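/- Let $n\ge 2$, $l\ge 1$, $m\ge 1$ be integers and let $\Omega\subset\mathbb R^n$ be a bounded Lipschitz domain, i.e. a bounded open set whose boundary has a finite open covering $\{\mathcal O_j\}$ such that each $\mathcal O_j\cap\Omega$ is the part of $\mathcal O_j$ lying above the graph of a Lipschitz function $\mathbb R^{n-1}\to\mathbb R$, in coordinates obtained by a rigid motion. Let $\sigma$ be the surface measure on $\partial\Omega$, $\rho(X)=\operatorname{dist}(X,\partial\Omega)$, and $D^\alpha=(-i\partial_1)^{\alpha_1}\cdots(-i\partial_n)^{\alpha_n}$. Let $1<p<\infty$, $-1/p<a<1-1/p$ and $s:=1-a-1/p\in(0,1)$. All functions are $\mathbb C^l$-valued. Let: * $W^{m,a}_p(\Omega)$ be the space of functions $\mathcal U$ on $\Omega$ with weak derivatives up to order $m$ and $\|\mathcal U\|_{W^{m,a}_p(\Omega)}=\bigl(\sum_{|\alpha|\le m}\int_\Omega|D^\alpha\mathcal U|^p\rho^{pa}\,dX\bigr)^{1/p}<\infty$; * $V^{m,a}_p(\Omega)$ be the space of functions $\mathcal U$ on $\Omega$ with weak derivatives up to order $m$ and $\sum_{|\beta|\le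 m}\int_\Omega|\rho^{|\beta|-m}D^\beta\mathcal U|^p\rho^{pa}\,dX<\infty$; * $\dot B^{m-1+s}_p(\partial\Omega)$ be the space of families $\dot f=\{f_\alpha\}_{|\alpha|\le m-1}$ of measurable functions on $\partial\Omega$ such that $$\|\dot f\|:=\sum_{|\alpha|\le m-1}\|f_\alpha\|_{L_p(\partial\Omega)}+\sum_{|\alpha|\le m-1}\Bigl(\int_{\partial\Omega}\int_{\partial\Omega}\frac{|R_\alpha(X,Y)|^p}{|X-Y|^{p(m-1+s-|\alpha|)+n-1}}\,d\sigma_Xd\sigma_Y\Bigr)^{1/p}<\infty,$$ where $R_\alpha(X,Y)=f_\alpha(X)-P_\alpha(X,Y)$ and $P_\alpha(X,Y)=\sum_{|\beta|\le m-1-|\alpha|}\frac1{\beta!}f_{\alpha+\beta}(Y)(X-Y)^\beta$; write $P=P_{(0,\dots,0)}$. For $u\in W^{1,a}_p(\Omega)$, a function $g\in L_p(\partial\Omega)$ is called a trace of $u$, $g=\operatorname{Tr}u$, if there are $\varphi_k\in C^\infty(\overline\Omega)$ with $\varphi_k\to u$ in $W^{1,a}_p(\Omega)$ and $\varphi_k|_{\partial\Omega}\to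 g$ in $L_p(\partial\Omega)$. Then, for every $\mathcal U\in W^{m,a}_p(\Omega)$ and $|\alpha|\le m-1$, the trace $\operatorname{Tr}[D^\alpha\mathcal U]$ exists and is unique, and $$\operatorname{tr}_{m-1}\mathcal U:=\bigl\{i^{|\alpha|}\operatorname{Tr}[D^\alpha\mathcal U]\bigr\}_{|\alpha|\le m-1}$$ defines a bounded linear operator from $W^{m,a}_p(\Omega)$ onto $\dot B^{m-1+s}_p(\partial\Omega)$, whose null-space is $V^{m,a}_p(\Omega)$. It has a bounded linear right inverse. More precisely, there exist kernels $\mathcal K:\Omega\times\partial\Omega\to\mathbb C$, smooth in $X\in\Omega$ and measurable in $Y\in\partial\Omega$, with * $\int_{\partial\Omega}\mathcal K(X,Y)\,d\sigma_Y=1$ for all $X\in\Omega$, * $|D^\alpha_X\mathcal K(X,Y)|\le c_\alpha\,\rho(X)^{1-n-|\alpha|}$ for all $\alpha$, $X\in\Omega$, $Y\in\partial\Omega$, * $\mathcal K(X,Y)=0$ whenever $|X-Y|\ge 2\rho(X)$, and for each such kernel the formula $$(\mathcal E\dot f)(X)=\int_{\partial\Omega}\mathcal K(X,Y)\,P(X,Y)\,d\sigma_Y,\qquad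 X\in\Omega,$$ defines a bounded linear operator $\mathcal E:\dot B^{m-1+s}_p(\partial\Omega)\to W^{m,a}_p(\Omega)$ with $\operatorname{tr}_{m-1}\mathcal E\dot f=\dot f$, i.e. $i^{|\alpha|}\operatorname{Tr}[D^\alpha(\mathcal E\dot f)]=f_\alpha$ for all $|\alpha|\le m-1$ and all $\dot f\in\dot B^{m-1+s}_p(\partial\Omega)$. -/

import Mathlib

open MeasureTheory Filter Topology Set
open scoped ENNReal NNReal ContDiff

noncomputable section

/-- Euclidean space `ℝⁿ`. -/
abbrev Rn (n : ℕ) : Type := EuclideanSpace ℝ (Fin n)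

/-- The Hermitian space `ℂˡ`, in which all functions take their values. -/
abbrev Cl (l : ℕ) : Type := EuclideanSpace ℂ (Fin l)

/-! ### Multi-indices and derivatives -/

/-- Multi-indices `α ∈ ℕ₀ⁿ` of length `|α| ≤ k`. -/
def MIdx (n k : ℕ) : Type := {α : Fin n → ℕ // ∑ i, α i ≤ k}

namespace MIdx

variable {n k : ℕ}

instance : Finite (MIdx n k) := by
  refine Finite.of_injective
    (fun (α : MIdx n k) (i : Fin n) => (⟨α.1 i, ?_⟩ : Fin (k + 1))) ?_
  · have h := Finset.single_le_sum (f := α.1) (fun j _ => Nat.zero_le _) (Finset.mem_univ i)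
    have h2 := α.2
    omega
  · intro α β h
    apply Subtype.ext
    funext i
    simpa using congrFun h i

instance : Fintype (MIdx n k) := Fintype.ofFinite _

/-- The length `|α|`. -/
def len (α : MIdx n k) : ℕ := ∑ i, α.1 i

/-- The factorial `α!`. -/
def fact (α : MIdx n k) : ℕ := ∏ i, (α.1 i).factorial

/-- The zero multi-index. -/
def zero (n k : ℕ) : MIdx n k := ⟨fun _ => 0, by simp⟩

/-- The sum `α + β`, where `|α| ≤ k` and `|β| ≤ k - |α|`. -/
def add (α : MIdx n k) (β : MIdx n (k - α.len)) : MIdx n k :=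
  ⟨fun i => α.1 i + β.1 i, by
    have h1 : α.len ≤ k := α.2
    have h2 := β.2
    have h3 : ∑ i, α.1 i = α.len := rfl
    rw [Finset.sum_add_distrib, h3]
    omega⟩

/-- A multi-index of length `≤ k`, seen as one of length `≤ k'`, where `k ≤ k'`. -/
def castLE {k' : ℕ} (h : k ≤ k') (α : MIdx n k) : MIdx n k' := ⟨α.1, α.2.trans h⟩

end MIdx

/-- The monomial `Z ^ β = Z₁ ^ β₁ ⋯ Zₙ ^ βₙ`. -/
def monom {n : ℕ} (β : Fin n → ℕ) (Z : Rn n) : ℝ := ∏ i, Z i ^ β i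

section Derivatives

variable {V : Type*} [NormedAddCommGroup V] [NormedSpace ℝ V] [NormedSpace ℂ V]

/-- The classical operator `D_j = -i ∂/∂x_j`. -/
def classD1 {n : ℕ} (j : Fin n) (g : Rn n → V) : Rn n → V :=
  fun X => (-Complex.I) • fderiv ℝ g X (EuclideanSpace.single j 1)

/-- The classical operator `D ^ α = D_1 ^ α₁ ⋯ D_n ^ αₙ`, with `D_j = -i ∂/∂x_j`. -/
def classD {n : ℕ} (α : Fin n → ℕ) (g : Rn n → V) : Rn n → V :=
  (List.finRange n).foldr (fun j h => (classD1 j)^[α j] h) g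

end Derivatives

/-- `v = D ^ α u` on the open set `Ω` in the weak (distributional) sense; `u` and `v` are locally
integrable on `Ω`, and the test functions are the complex-valued `φ ∈ C₀^∞(Ω)`. -/
def HasWeakD {n l : ℕ} (Ω : Set (Rn n)) (α : Fin n → ℕ) (u v : Rn n → Cl l) : Prop :=
  LocallyIntegrableOn u Ω volume ∧ LocallyIntegrableOn v Ω volume ∧
  ∀ φ : Rn n → ℂ, ContDiff ℝ ∞ φ → HasCompactSupport φ → tsupport φ ⊆ Ω →
    ∫ X in Ω, φ X • v X = (-1 : ℂ) ^ (∑ i, α i) • ∫ X in Ω, classD α φ X • u X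

/-! ### Bounded Lipschitz domains -/

/-- A bounded Lipschitz domain in `ℝⁿ`, `n ≥ 2`: a bounded open set whose boundary has a finite open
covering `O₁, …, O_N` such that `O_j ∩ Ω` is the part of `O_j` that lies above the graph of a
Lipschitz function `φ_j : ℝⁿ⁻¹ → ℝ`, in coordinates `ℝⁿ⁻¹ × ℝ` obtained through a rigid motion. -/
structure LipDomain (n : ℕ) where
  carrier : Set (Rn n)
  two_le : 2 ≤ n
  isOpen : IsOpen carrier
  isBounded : Bornology.IsBounded carrier
  charts : ∃ (N : ℕ) (O : Fin N → Set (Rn n))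
    (e : Fin N → (Rn n ≃ᵃⁱ[ℝ] WithLp 2 (Rn (n - 1) × ℝ))) (φ : Fin N → Rn (n - 1) → ℝ),
    (∀ j, IsOpen (O j)) ∧ frontier carrier ⊆ ⋃ j, O j ∧
    ∀ j, (∃ M : ℝ≥0, LipschitzWith M (φ j)) ∧
      O j ∩ carrier = {X ∈ O j | φ j (e j X).fst < (e j X).snd}

namespace LipDomain

variable {n : ℕ} (Ω : LipDomain n)

/-- The boundary `∂Ω`. -/
def bdry : Set (Rn n) := frontier Ω.carrier

/-- The distance `ρ(X)` to the boundary. -/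
def rho (X : Rn n) : ℝ := Metric.infDist X Ω.bdry

/-- The surface measure `σ` on `∂Ω`: the `(n-1)`-dimensional Hausdorff measure, normalized so
that it agrees with the Lebesgue measure on `ℝⁿ⁻¹`. -/
def surf : Measure (Rn n) := (μHE[n - 1] : Measure (Rn n)).restrict Ω.bdry

/-- The measure `ρ(X) ^ b dX` on `Ω`. -/
def wMeas (b : ℝ) : Measure (Rn n) :=
  (volume.restrict Ω.carrier).withDensity (fun X => ENNReal.ofReal (Ω.rho X ^ b))

theorem rho_pos {X : Rn n} (hX : X ∈ Ω.carrier) : 0 < Ω.rho X := by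
  have hne : (frontier Ω.carrier).Nonempty := by
    rw [Set.nonempty_iff_ne_empty]
    intro h
    have hcl : IsClopen Ω.carrier := isClopen_iff_frontier_eq_empty.2 h
    rcases isClopen_iff.1 hcl with h0 | h1
    · rw [h0] at hX
      exact hX
    · have hb := Ω.isBounded
      rw [h1] at hb
      have : Nontrivial (Fin n) := Fin.nontrivial_iff_two_le.2 Ω.two_le
      have : Nonempty (Fin n) := ⟨⟨0, by have := Ω.two_le; omega⟩⟩
      exact NormedSpace.unbounded_univ ℝ (Rn n) hb
  refine (isClosed_frontier.notMem_iff_infDist_pos hne).1 ?_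
  intro hXf
  rw [Ω.isOpen.frontier_eq] at hXf
  exact hXf.2 hX

theorem measurable_density (b : ℝ) :
    Measurable (fun X => ENNReal.ofReal (Ω.rho X ^ b)) := by
  have h : Measurable Ω.rho := (Metric.continuous_infDist_pt _).measurable
  exact (h.pow_const b).ennreal_ofReal

/-- The weighted measure has the same null sets as the Lebesgue measure on `Ω`. -/
theorem restrict_ac_wMeas (b : ℝ) : volume.restrict Ω.carrier ≪ Ω.wMeas b := by
  refine withDensity_absolutelyContinuous' (Ω.measurable_density b).aemeasurable ?_
  filter_upwards [ae_restrict_mem Ω.isOpen.measurableSet] with X hX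
  have : 0 < Ω.rho X ^ b := Real.rpow_pos_of_pos (Ω.rho_pos hX) b
  simpa using this

end LipDomain

/-! ### The weighted Sobolev space `W` -/

theorem HasWeakD.congr {n l : ℕ} {Ω : Set (Rn n)} {α : Fin n → ℕ}
    {u u' v v' : Rn n → Cl l}
    (h : HasWeakD Ω α u v) (hu : u =ᵐ[volume.restrict Ω] u') (hv : v =ᵐ[volume.restrict Ω] v') :
    HasWeakD Ω α u' v' := by
  have key : ∀ {w w' : Rn n → Cl l}, w =ᵐ[volume.restrict Ω] w' →
      LocallyIntegrableOn w Ω volume → LocallyIntegrableOn w' Ω volume := by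
    intro w w' hw h1 x hx
    obtain ⟨t, ht, hint⟩ := h1 x hx
    refine ⟨t ∩ Ω, inter_mem ht self_mem_nhdsWithin, ?_⟩
    have hint2 : IntegrableOn w (t ∩ Ω) volume := hint.mono_set inter_subset_left
    refine hint2.congr ?_
    exact ae_mono (Measure.restrict_mono_set _ inter_subset_right) hw
  refine ⟨key hu h.1, key hv h.2.1, fun φ h1 h2 h3 => ?_⟩
  have e1 : ∫ X in Ω, φ X • v' X = ∫ X in Ω, φ X • v X :=
    integral_congr_ae (by filter_upwards [hv] with X hX; rw [hX])
  have e2 : ∫ X in Ω, classD α φ X • u' X = ∫ X in Ω, classD α φ X • u X :=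
    integral_congr_ae (by filter_upwards [hu] with X hX; rw [hX])
  rw [e1, e2]
  exact h.2.2 φ h1 h2 h3

theorem classD_smooth {n : ℕ} (α : Fin n → ℕ) {φ : Rn n → ℂ} (h : ContDiff ℝ ∞ φ) :
    ContDiff ℝ ∞ (classD α φ) ∧ tsupport (classD α φ) ⊆ tsupport φ := by
  have step : ∀ (j : Fin n) (g : Rn n → ℂ), ContDiff ℝ ∞ g ∧ tsupport g ⊆ tsupport φ →
      ContDiff ℝ ∞ (classD1 j g) ∧ tsupport (classD1 j g) ⊆ tsupport φ := by
    intro j g hg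
    have hd : ContDiff ℝ ∞ (fun X => fderiv ℝ g X (EuclideanSpace.single j (1 : ℝ))) :=
      (hg.1.fderiv_right (m := ∞) (by simp)).clm_apply contDiff_const
    refine ⟨ContDiff.smul (f := fun _ : Rn n => -Complex.I) contDiff_const hd, ?_⟩
    refine (tsupport_smul_subset_right (fun _ : Rn n => -Complex.I) _).trans ?_
    exact (tsupport_fderiv_apply_subset ℝ _).trans hg.2
  have iter : ∀ (j : Fin n) (k : ℕ) (g : Rn n → ℂ), ContDiff ℝ ∞ g ∧ tsupport g ⊆ tsupport φ →
      ContDiff ℝ ∞ ((classD1 j)^[k] g) ∧ tsupport ((classD1 j)^[k] g) ⊆ tsupport φ := by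
    intro j k
    induction k with
    | zero => intro g hg; exact hg
    | succ k ih => intro g hg; exact ih _ (step j g hg)
  have main : ∀ L : List (Fin n),
      ContDiff ℝ ∞ (L.foldr (fun j h => (classD1 j)^[α j] h) φ) ∧
        tsupport (L.foldr (fun j h => (classD1 j)^[α j] h) φ) ⊆ tsupport φ := by
    intro L
    induction L with
    | nil => exact ⟨h, subset_rfl⟩
    | cons j L ih => exact iter j (α j) _ ih
  exact main _

theorem integrable_test_smul {n l : ℕ} {Ω : Set (Rn n)} {φ : Rn n → ℂ} {v : Rn n → Cl l}
    (hφ : Continuous φ) (hc : HasCompactSupport φ) (hs : tsupport φ ⊆ Ω)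
    (hv : LocallyIntegrableOn v Ω volume) :
    Integrable (fun X => φ X • v X) (volume.restrict Ω) := by
  have h1 : IntegrableOn v (tsupport φ) volume := hv.integrableOn_compact_subset hs hc
  have h2 : IntegrableOn (fun X => φ X • v X) (tsupport φ) volume :=
    h1.continuousOn_smul hφ.continuousOn hc
  refine Integrable.integrableOn ?_
  refine (integrableOn_iff_integrable_of_support_subset ?_).1 h2
  intro X hX
  apply subset_tsupport
  intro h0
  apply hX
  simp [h0]

theorem HasWeakD.add {n l : ℕ} {Ω : Set (Rn n)} {α : Fin n → ℕ} {u u' v v' : Rn n → Cl l}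
    (h : HasWeakD Ω α u v) (h' : HasWeakD Ω α u' v') : HasWeakD Ω α (u + u') (v + v') := by
  refine ⟨h.1.add h'.1, h.2.1.add h'.2.1, fun φ h1 h2 h3 => ?_⟩
  obtain ⟨d1, d2⟩ := classD_smooth α h1
  have dc : HasCompactSupport (classD α φ) := h2.mono' ((subset_tsupport _).trans d2)
  have e := h.2.2 φ h1 h2 h3
  have e' := h'.2.2 φ h1 h2 h3
  simp only [Pi.add_apply, smul_add]
  rw [integral_add (integrable_test_smul h1.continuous h2 h3 h.2.1)
      (integrable_test_smul h1.continuous h2 h3 h'.2.1),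
    integral_add (integrable_test_smul d1.continuous dc (d2.trans h3) h.1)
      (integrable_test_smul d1.continuous dc (d2.trans h3) h'.1), e, e', smul_add]

theorem HasWeakD.smul {n l : ℕ} {Ω : Set (Rn n)} {α : Fin n → ℕ} {u v : Rn n → Cl l}
    (c : ℂ) (h : HasWeakD Ω α u v) : HasWeakD Ω α (c • u) (c • v) := by
  refine ⟨h.1.smul c, h.2.1.smul c, fun φ h1 h2 h3 => ?_⟩
  have e := h.2.2 φ h1 h2 h3
  have c1 : ∫ X in Ω, φ X • (c • v) X = c • ∫ X in Ω, φ X • v X := by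
    rw [← integral_smul]
    exact integral_congr_ae (Eventually.of_forall fun X => smul_comm _ c _)
  have c2 : ∫ X in Ω, classD α φ X • (c • u) X = c • ∫ X in Ω, classD α φ X • u X := by
    rw [← integral_smul]
    exact integral_congr_ae (Eventually.of_forall fun X => smul_comm _ c _)
  rw [c1, c2, e, smul_comm]

theorem HasWeakD.zero {n l : ℕ} (Ω : Set (Rn n)) (α : Fin n → ℕ) :
    HasWeakD Ω α (0 : Rn n → Cl l) 0 :=
  ⟨locallyIntegrableOn_zero, locallyIntegrableOn_zero, fun φ _ _ _ => by simp⟩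

/-- The weighted Sobolev space `W = W_p^{m,a}(Ω)` of the `ℂˡ`-valued functions `U` on `Ω` with
`∑_{|α| ≤ m} ∫_Ω |D ^ α U(X)| ^ p ρ(X) ^ (p a) dX < ∞`. An element is recorded as the family
`(U_α)_{|α| ≤ m}` of its weak derivatives `U_α = D ^ α U`, where `U = U_0`; the norm of this
subspace of the `ℓ^p` sum of the spaces `L_p(Ω, ρ ^ (p a) dX)` is
`(∑_{|α| ≤ m} ∫_Ω |D ^ α U| ^ p ρ ^ (p a) dX) ^ (1 / p)`. -/
def sobolevW {n : ℕ} (Ω : LipDomain n) (m : ℕ) (p : ℝ≥0∞) [Fact (1 ≤ p)] (a : ℝ) (l : ℕ) :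
    Submodule ℂ (PiLp p fun _ : MIdx n m => Lp (Cl l) p (Ω.wMeas (p.toReal * a))) where
  carrier := {U | ∀ α : MIdx n m, HasWeakD Ω.carrier α.1 (U (MIdx.zero n m)) (U α)}
  add_mem' := by
    intro U U' h h' α
    have ac := Ω.restrict_ac_wMeas (p.toReal * a)
    exact ((h α).add (h' α)).congr
      (ac.ae_eq (Lp.coeFn_add (U (MIdx.zero n m)) (U' (MIdx.zero n m)))).symm
      (ac.ae_eq (Lp.coeFn_add (U α) (U' α))).symm
  zero_mem' := by
    intro α
    have ac := Ω.restrict_ac_wMeas (p.toReal * a)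
    exact (HasWeakD.zero Ω.carrier α.1).congr (ac.ae_eq (Lp.coeFn_zero _ _ _)).symm
      (ac.ae_eq (Lp.coeFn_zero _ _ _)).symm
  smul_mem' := by
    intro c U h α
    have ac := Ω.restrict_ac_wMeas (p.toReal * a)
    exact ((h α).smul c).congr (ac.ae_eq (Lp.coeFn_smul c (U (MIdx.zero n m)))).symm
      (ac.ae_eq (Lp.coeFn_smul c (U α))).symm

/-- The weak derivative `D ^ α U`, `|α| ≤ m`, of `U ∈ W`. -/
def sobolevW.D {n : ℕ} {Ω : LipDomain n} {m : ℕ} {p : ℝ≥0∞} [Fact (1 ≤ p)] {a : ℝ} {l : ℕ}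
    (U : sobolevW Ω m p a l) (α : MIdx n m) : Lp (Cl l) p (Ω.wMeas (p.toReal * a)) :=
  U.1 α

/-- The function underlying `U ∈ W`. -/
def sobolevW.toFun {n : ℕ} {Ω : LipDomain n} {m : ℕ} {p : ℝ≥0∞} [Fact (1 ≤ p)] {a : ℝ} {l : ℕ}
    (U : sobolevW Ω m p a l) : Rn n → Cl l :=
  sobolevW.D U (MIdx.zero n m)

/-- `u` belongs to the space `V = V_p^{m,a}(Ω)`: it has weak derivatives `v_β = D ^ β u`, `|β| ≤ m`,
with `∑_{|β| ≤ m} ∫_Ω |ρ(X) ^ (|β| - m) D ^ β u(X)| ^ p ρ(X) ^ (p a) dX < ∞`. -/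
def MemV {n l : ℕ} (Ω : LipDomain n) (m : ℕ) (p : ℝ≥0∞) (a : ℝ) (u : Rn n → Cl l) : Prop :=
  ∃ v : MIdx n m → Rn n → Cl l, ∀ β : MIdx n m,
    HasWeakD Ω.carrier β.1 u (v β) ∧
    MemLp (fun X => (Ω.rho X ^ ((β.len : ℝ) - m)) • v β X) p (Ω.wMeas (p.toReal * a))

/-- `g = Tr u` on `∂Ω`, for `u ∈ W_p^{1,a}(Ω)`: there are functions `φ_k ∈ C^∞` on the closure
of `Ω` which converge to `u` in `W_p^{1,a}(Ω)` and whose restrictions to `∂Ω` converge to `g`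
in `L_p(∂Ω)`. -/
def IsTrace {n l : ℕ} (Ω : LipDomain n) (p : ℝ≥0∞) (a : ℝ) (u g : Rn n → Cl l) : Prop :=
  ∃ v : Fin n → Rn n → Cl l,
    (∀ j, HasWeakD Ω.carrier (Pi.single j 1) u (v j)) ∧
    ∃ φ : ℕ → Rn n → Cl l, (∀ k, ContDiff ℝ ∞ (φ k)) ∧
      Tendsto (fun k => eLpNorm (φ k - u) p (Ω.wMeas (p.toReal * a))) atTop (𝓝 0) ∧
      (∀ j, Tendsto (fun k => eLpNorm (classD1 j (φ k) - v j) p (Ω.wMeas (p.toReal * a)))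
        atTop (𝓝 0)) ∧
      Tendsto (fun k => eLpNorm (φ k - g) p Ω.surf) atTop (𝓝 0)

/-! ### The Whitney–Besov space `B` -/

/-- The Taylor polynomial
`P_α(X, Y) = ∑_{|β| ≤ k - |α|} f_{α + β}(Y) (X - Y) ^ β / β!` of a family `(f_α)_{|α| ≤ k}`. -/
def taylorP {n l k : ℕ} (f : MIdx n k → Rn n → Cl l) (α : MIdx n k) (X Y : Rn n) : Cl l :=
  ∑ β : MIdx n (k - α.len), (monom β.1 (X - Y) / (β.fact : ℝ)) • f (α.add β) Y

/-- The remainder `R_α(X, Y) = f_α(X) - P_α(X, Y)`. -/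
def remR {n l k : ℕ} (f : MIdx n k → Rn n → Cl l) (α : MIdx n k) (X Y : Rn n) : Cl l :=
  f α X - taylorP f α X Y

/-- The quotient `R_α(X, Y) / |X - Y| ^ (k + s - |α| + (n - 1) / p)`. -/
def remQ {n l k : ℕ} (p : ℝ≥0∞) (s : ℝ) (f : MIdx n k → Rn n → Cl l) (α : MIdx n k)
    (Z : Rn n × Rn n) : Cl l :=
  (‖Z.1 - Z.2‖ ^ ((k : ℝ) + s - α.len + ((n : ℝ) - 1) / p.toReal))⁻¹ • remR f α Z.1 Z.2

theorem remQ_add {n l k : ℕ} (p : ℝ≥0∞) (s : ℝ) (f g : MIdx n k → Rn n → Cl l) (α : MIdx n k)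
    (Z : Rn n × Rn n) : remQ p s (f + g) α Z = remQ p s f α Z + remQ p s g α Z := by
  simp only [remQ, remR, taylorP, Pi.add_apply, smul_add, Finset.sum_add_distrib]
  rw [← smul_add]
  congr 1
  abel

theorem remQ_smul {n l k : ℕ} (p : ℝ≥0∞) (s : ℝ) (c : ℂ) (f : MIdx n k → Rn n → Cl l)
    (α : MIdx n k) (Z : Rn n × Rn n) : remQ p s (c • f) α Z = c • remQ p s f α Z := by
  have h : taylorP (c • f) α Z.1 Z.2 = c • taylorP f α Z.1 Z.2 := by
    simp only [taylorP, Pi.smul_apply]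
    rw [Finset.smul_sum]
    exact Finset.sum_congr rfl fun β _ => smul_comm _ c _
  simp only [remQ, remR, h, Pi.smul_apply]
  rw [← smul_sub, smul_comm]

theorem ae_prod_fst {X : Type*} [MeasurableSpace X] {μ : Measure X} {P : X → Prop}
    (h : ∀ᵐ x ∂μ, P x) : ∀ᵐ z ∂(μ.prod μ), P z.1 := by
  obtain ⟨t, hs, ht, h0⟩ := exists_measurable_superset_of_null (ae_iff.1 h)
  refine ae_iff.2 (measure_mono_null (t := Prod.fst ⁻¹' t) (fun z hz => hs hz) ?_)
  rw [Measure.prod]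
  refine le_antisymm ((Measure.bind_apply_le _ (measurable_fst ht)).trans ?_) bot_le
  refine le_of_eq (lintegral_eq_zero_of_ae_eq_zero ?_)
  have ht0 : ∀ᵐ x ∂μ, x ∉ t := by rw [ae_iff]; simpa using h0
  filter_upwards [ht0] with x hx
  rw [Measure.map_apply measurable_prodMk_left (measurable_fst ht)]
  have : Prod.mk x ⁻¹' (Prod.fst ⁻¹' t : Set (X × X)) = ∅ := by ext y; simpa using hx
  rw [this]
  simp

theorem ae_prod_snd {X : Type*} [MeasurableSpace X] {μ : Measure X} {P : X → Prop}
    (h : ∀ᵐ x ∂μ, P x) : ∀ᵐ z ∂(μ.prod μ), P z.2 := by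
  obtain ⟨t, hs, ht, h0⟩ := exists_measurable_superset_of_null (ae_iff.1 h)
  refine ae_iff.2 (measure_mono_null (t := Prod.snd ⁻¹' t) (fun z hz => hs hz) ?_)
  rw [Measure.prod]
  refine le_antisymm ((Measure.bind_apply_le _ (measurable_snd ht)).trans ?_) bot_le
  refine le_of_eq (lintegral_eq_zero_of_ae_eq_zero (Eventually.of_forall fun x => ?_))
  change Measure.map (Prod.mk x) μ (Prod.snd ⁻¹' t) = 0
  rw [Measure.map_apply measurable_prodMk_left (measurable_snd ht)]
  have : Prod.mk x ⁻¹' (Prod.snd ⁻¹' t : Set (X × X)) = t := by ext y; simp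
  rw [this]
  exact h0

theorem remQ_congr {n l k : ℕ} (p : ℝ≥0∞) (s : ℝ) {μ : Measure (Rn n)}
    {f g : MIdx n k → Rn n → Cl l} (h : ∀ α, f α =ᵐ[μ] g α) (α : MIdx n k) :
    remQ p s f α =ᵐ[μ.prod μ] remQ p s g α := by
  have h1 := ae_prod_fst (h α)
  have h2 : ∀ᵐ z ∂(μ.prod μ), ∀ β, f β z.2 = g β z.2 :=
    ae_all_iff.2 fun β => ae_prod_snd (h β)
  filter_upwards [h1, h2] with z hz1 hz2
  simp only [remQ, remR, taylorP, hz1, hz2]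

/-- The submodule of the families `(f_α)_{|α| ≤ k}` in `L_p(∂Ω)` for which all the integrals
`∫∫ |R_α(X, Y)| ^ p / |X - Y| ^ (p (k + s - |α|) + n - 1) dσ_X dσ_Y` are finite. -/
def besovSub {n : ℕ} (Ω : LipDomain n) (k : ℕ) (p : ℝ≥0∞) (s : ℝ) (l : ℕ) :
    Submodule ℂ (MIdx n k → Lp (Cl l) p Ω.surf) where
  carrier := {f | ∀ α, MemLp (remQ p s (fun β => ⇑(f β)) α) p (Ω.surf.prod Ω.surf)}
  add_mem' := by
    intro f g hf hg α
    refine ((hf α).add (hg α)).ae_eq ?_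
    have h := remQ_congr p s (fun β => Lp.coeFn_add (f β) (g β)) α
    filter_upwards [h] with z hz
    exact ((remQ_add p s (fun β => ⇑(f β)) (fun β => ⇑(g β)) α z).symm.trans hz.symm)
  zero_mem' := by
    intro α
    have h := remQ_congr p s (fun _ : MIdx n k => Lp.coeFn_zero (Cl l) p Ω.surf) α
    refine (MemLp.zero' (p := p) (μ := Ω.surf.prod Ω.surf)).ae_eq ?_
    filter_upwards [h] with z hz
    have h0 : remQ p s (fun _ : MIdx n k => (0 : Rn n → Cl l)) α z = 0 := by
      simp [remQ, remR, taylorP]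
    exact (hz.trans h0).symm
  smul_mem' := by
    intro c f hf α
    refine ((hf α).const_smul c).ae_eq ?_
    have h := remQ_congr p s (fun β => Lp.coeFn_smul c (f β)) α
    filter_upwards [h] with z hz
    exact ((remQ_smul p s c (fun β => ⇑(f β)) α z).symm.trans hz.symm)

/-- The Whitney–Besov space `B = Ḃ_p^{k+s}(∂Ω)` of `ℂˡ`-valued families `(f_α)_{|α| ≤ k}`. -/
def WBesov {n : ℕ} (Ω : LipDomain n) (k : ℕ) (p : ℝ≥0∞) (s : ℝ) (l : ℕ) : Type :=
  besovSub Ω k p s l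

namespace WBesov

variable {n : ℕ} {Ω : LipDomain n} {k : ℕ} {p : ℝ≥0∞} {s : ℝ} {l : ℕ}

instance : AddCommGroup (WBesov Ω k p s l) := inferInstanceAs (AddCommGroup (besovSub Ω k p s l))

instance : Module ℂ (WBesov Ω k p s l) := inferInstanceAs (Module ℂ (besovSub Ω k p s l))

/-- The component `f_α`. -/
def comp (f : WBesov Ω k p s l) (α : MIdx n k) : Lp (Cl l) p Ω.surf := f.1 α

/-- The components `f_α`, as functions on `∂Ω`. -/
def fn (f : WBesov Ω k p s l) : MIdx n k → Rn n → Cl l := fun α => ⇑(f.comp α)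

theorem memLp_rem (f : WBesov Ω k p s l) (α : MIdx n k) :
    MemLp (remQ p s f.fn α) p (Ω.surf.prod Ω.surf) := f.2 α

/-- The quotient `R_α(X, Y) / |X - Y| ^ (k + s - |α| + (n - 1) / p)`, in `L_p(∂Ω × ∂Ω)`. -/
def rem (f : WBesov Ω k p s l) (α : MIdx n k) : Lp (Cl l) p (Ω.surf.prod Ω.surf) :=
  MemLp.toLp (remQ p s f.fn α) (f.memLp_rem α)

/-- The Whitney–Besov norm
`∑_α ‖f_α‖_{L_p} + ∑_α (∫∫ |R_α(X, Y)| ^ p / |X - Y| ^ (p (k + s - |α|) + n - 1)) ^ (1 / p)`. -/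
instance : Norm (WBesov Ω k p s l) := ⟨fun f => ∑ α, ‖f.comp α‖ + ∑ α, ‖f.rem α‖⟩

theorem norm_def (f : WBesov Ω k p s l) : ‖f‖ = ∑ α, ‖f.comp α‖ + ∑ α, ‖f.rem α‖ := rfl

theorem comp_add (f g : WBesov Ω k p s l) (α : MIdx n k) :
    (f + g).comp α = f.comp α + g.comp α := rfl

theorem comp_smul (c : ℂ) (f : WBesov Ω k p s l) (α : MIdx n k) :
    (c • f).comp α = c • f.comp α := rfl

theorem rem_add (f g : WBesov Ω k p s l) (α : MIdx n k) :
    (f + g).rem α = f.rem α + g.rem α := by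
  have h := remQ_congr p s (fun β => Lp.coeFn_add (f.comp β) (g.comp β)) α
  refine Eq.trans ?_ (MemLp.toLp_add (f.memLp_rem α) (g.memLp_rem α))
  refine MemLp.toLp_congr _ _ ?_
  filter_upwards [h] with z hz
  exact hz.trans (remQ_add p s f.fn g.fn α z)

theorem rem_smul (c : ℂ) (f : WBesov Ω k p s l) (α : MIdx n k) :
    (c • f).rem α = c • f.rem α := by
  have h := remQ_congr p s (fun β => Lp.coeFn_smul c (f.comp β)) α
  refine Eq.trans ?_ (MemLp.toLp_const_smul c (f.memLp_rem α))
  refine MemLp.toLp_congr _ _ ?_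
  filter_upwards [h] with z hz
  exact hz.trans (remQ_smul p s c f.fn α z)

theorem core [Fact (1 ≤ p)] : NormedSpace.Core ℂ (WBesov Ω k p s l) where
  norm_nonneg f := by
    rw [norm_def]
    positivity
  norm_smul c f := by
    simp only [norm_def, comp_smul, rem_smul, norm_smul, mul_add, Finset.mul_sum]
  norm_triangle f g := by
    simp only [norm_def, comp_add, rem_add]
    have h1 : ∑ α, ‖f.comp α + g.comp α‖ ≤ ∑ α, ‖f.comp α‖ + ∑ α, ‖g.comp α‖ := by
      rw [← Finset.sum_add_distrib]
      exact Finset.sum_le_sum fun α _ => norm_add_le _ _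
    have h2 : ∑ α, ‖f.rem α + g.rem α‖ ≤ ∑ α, ‖f.rem α‖ + ∑ α, ‖g.rem α‖ := by
      rw [← Finset.sum_add_distrib]
      exact Finset.sum_le_sum fun α _ => norm_add_le _ _
    linarith
  norm_eq_zero_iff f := by
    constructor
    · intro h
      rw [norm_def] at h
      have h1 : 0 ≤ ∑ α, ‖f.comp α‖ := Finset.sum_nonneg fun α _ => norm_nonneg _
      have h2 : 0 ≤ ∑ α, ‖f.rem α‖ := Finset.sum_nonneg fun α _ => norm_nonneg _
      have h3 : ∑ α, ‖f.comp α‖ = 0 := by linarith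
      apply Subtype.ext
      funext α
      exact norm_eq_zero.1
        ((Finset.sum_eq_zero_iff_of_nonneg fun α _ => norm_nonneg _).1 h3 α (Finset.mem_univ α))
    · rintro rfl
      have h1 : ∀ α, (0 : WBesov Ω k p s l).comp α = 0 := fun α => rfl
      have h2 : ∀ α, (0 : WBesov Ω k p s l).rem α = 0 := by
        intro α
        have := rem_smul (0 : ℂ) (0 : WBesov Ω k p s l) α
        rwa [zero_smul, zero_smul] at this
      simp [norm_def, h1, h2]

instance [Fact (1 ≤ p)] : NormedAddCommGroup (WBesov Ω k p s l) := NormedAddCommGroup.ofCore core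

instance [Fact (1 ≤ p)] : NormedSpace ℂ (WBesov Ω k p s l) := NormedSpace.ofCore core

end WBesov

/-! ### The Whitney-type extension operator -/

/-- The kernels `K(X, Y)`, `X ∈ Ω`, `Y ∈ ∂Ω`, of the Whitney-type extension operators. -/
structure IsWhitneyKernel {n : ℕ} (Ω : LipDomain n) (K : Rn n → Rn n → ℂ) : Prop where
  smooth : ∀ Y ∈ Ω.bdry, ContDiffOn ℝ ∞ (fun X => K X Y) Ω.carrier
  measurable : ∀ X ∈ Ω.carrier, AEStronglyMeasurable (K X) Ω.surf
  integral_eq_one : ∀ X ∈ Ω.carrier, ∫ Y, K X Y ∂Ω.surf = 1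
  bound : ∀ α : Fin n → ℕ, ∃ c : ℝ, ∀ X ∈ Ω.carrier, ∀ Y ∈ Ω.bdry,
    ‖classD α (fun X' => K X' Y) X‖ ≤ c * Ω.rho X ^ (1 - (n : ℝ) - ∑ i, (α i : ℝ))
  support : ∀ X ∈ Ω.carrier, ∀ Y ∈ Ω.bdry, 2 * Ω.rho X ≤ ‖X - Y‖ → K X Y = 0

/-- The extension `X ↦ ∫_{∂Ω} K(X, Y) P(X, Y) dσ_Y`, where `P = P_{(0, …, 0)}` is the Taylor
polynomial of the family `f`. -/
def whitneyExt {n l k : ℕ} (Ω : LipDomain n) (K : Rn n → Rn n → ℂ)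
    (f : MIdx n k → Rn n → Cl l) (X : Rn n) : Cl l :=
  ∫ Y, K X Y • taylorP f (MIdx.zero n k) X Y ∂Ω.surf

end

noncomputable section

open ENNReal (ofReal ofReal_mul ofReal_ne_top ofReal_le_ofReal mul_ne_top rpow_le_rpow
  mul_rpow_of_nonneg ofReal_rpow_of_nonneg mul_lt_top rpow_ne_top_of_nonneg toReal_pos
  zero_rpow_of_pos ofReal_lt_top toReal_lt_toReal one_ne_top ofReal_toReal rpow_lt_top_of_nonneg
  toReal_nonneg add_ne_top sum_ne_top sum_lt_top ofReal_one rpow_sum_le_const_mul_sum_rpow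
  ofReal_sum_of_nonneg ofReal_rpow_of_pos rpow_add_le_mul_rpow_add_rpow)
open Metric (ball closedBall mem_ball ball_subset_ball measure_ball_pos mem_closedBall
  mem_ball_self ball_mem_nhds mem_ball')
open Real (norm_of_nonneg rpow_add rpow_natCast rpow_nonneg mul_rpow rpow_mul rpow_sub rpow_neg
  enorm_eq_ofReal_abs)
open Finset (sum_le_sum sum_congr single_le_sum sum_add_distrib mul_sum sum_nonneg sum_mul
  sum_le_card_nsmul sum_sub_distrib sum_smul smul_sum)

/-- Families of functions indexed by multi-indices. -/
abbrev Jet (n l : ℕ) : Type := (Fin n → ℕ) → Rn n → Cl l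

theorem one_lt_toReal {p : ℝ≥0∞} (hp : 1 < p) (hp' : p < ⊤) : 1 < p.toReal := by
  rw [← ENNReal.toReal_one]
  exact (toReal_lt_toReal one_ne_top hp'.ne).2 hp

theorem neg_one_lt_mul {P a : ℝ} (hP : 0 < P) (ha : -1 / P < a) : -1 < P * a := by
  rwa [div_lt_iff₀' hP] at ha

theorem tendsto_zero_of_le {ι : Type*} {L : Filter ι} {f g : ι → ℝ≥0∞}
    (hg : Tendsto g L (𝓝 0)) (h : ∀ k, f k ≤ g k) : Tendsto f L (𝓝 0) :=
  tendsto_of_tendsto_of_tendsto_of_le_of_le tendsto_const_nhds hg (fun _ => bot_le) h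

theorem lintegral_ofReal_mul {T : Type*} [MeasurableSpace T] {μ : Measure T} {c : ℝ}
    {f : T → ℝ≥0∞} : ∫⁻ x, ofReal c * f x ∂μ = ofReal c * ∫⁻ x, f x ∂μ :=
  lintegral_const_mul' _ _ ofReal_ne_top

theorem two_rpow_mul_ne_top {P : ℝ} (hP : 1 ≤ P) (N : ℕ) :
    (2 : ℝ≥0∞) ^ (P - 1) * ((N : ℝ≥0∞) ^ (P - 1) + 1) ≠ ⊤ :=
  mul_ne_top (rpow_ne_top_of_nonneg (by linarith) (by simp))
    (add_ne_top.2 ⟨rpow_ne_top_of_nonneg (by linarith) (by simp), by simp⟩)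

/-! ### Iterated partial derivatives -/

section Partial

variable {V : Type*} [NormedAddCommGroup V] [NormedSpace ℝ V] {n : ℕ}

/-- The partial derivative `∂_j`. -/
def pd (j : Fin n) (g : Rn n → V) : Rn n → V :=
  fun X => fderiv ℝ g X (EuclideanSpace.single j 1)

/-- The iterated partial derivative along a word. -/
def pdW : List (Fin n) → (Rn n → V) → Rn n → V
  | [], g => g
  | j :: J, g => pd j (pdW J g)

/-- The word `1 ⋯ 1 2 ⋯ 2 ⋯ n ⋯ n`, where `j` occurs `α j` times. -/
def wordOf (α : Fin n → ℕ) : List (Fin n) :=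
  (List.finRange n).flatMap fun j => List.replicate (α j) j

theorem wordOf_length (α : Fin n → ℕ) : (wordOf α).length = ∑ i, α i := by
  rw [wordOf, List.length_flatMap, ← List.ofFn_eq_map (f := fun j => (List.replicate (α j) j).length),
    List.sum_ofFn]
  simp

theorem count_wordOf (α : Fin n → ℕ) (i : Fin n) : (wordOf α).count i = α i := by
  rw [wordOf, List.count_flatMap,
    ← List.ofFn_eq_map (f := List.count i ∘ fun j => List.replicate (α j) j), List.sum_ofFn]
  simp [List.count_replicate]

theorem perm_wordOf (J : List (Fin n)) : J.Perm (wordOf fun j => J.count j) := by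
  rw [List.perm_iff_count]
  intro i; rw [count_wordOf]

theorem pdW_append (J J' : List (Fin n)) (g : Rn n → V) : pdW (J ++ J') g = pdW J (pdW J' g) := by
  induction J with
  | nil => rfl
  | cons j J ih => simp only [List.cons_append, pdW, ih]

variable {Ω : Set (Rn n)} {f g : Rn n → V}

theorem pd_congr (hΩ : IsOpen Ω) (h : EqOn f g Ω) (j : Fin n) : EqOn (pd j f) (pd j g) Ω := by
  intro X hX
  have : f =ᶠ[𝓝 X] g := by filter_upwards [hΩ.mem_nhds hX] with Z hZ using h hZ
  simp only [pd, this.fderiv_eq]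

theorem pdW_congr (hΩ : IsOpen Ω) (h : EqOn f g Ω) (J : List (Fin n)) :
    EqOn (pdW J f) (pdW J g) Ω := by
  induction J with
  | nil => exact h
  | cons j J ih => exact pd_congr hΩ ih j

theorem contDiffOn_pd (hΩ : IsOpen Ω) (hf : ContDiffOn ℝ ∞ f Ω) (j : Fin n) :
    ContDiffOn ℝ ∞ (pd j f) Ω :=
  (hf.fderiv_of_isOpen hΩ (m := ∞) (by simp)).clm_apply contDiffOn_const

theorem contDiffOn_pdW (hΩ : IsOpen Ω) (hf : ContDiffOn ℝ ∞ f Ω) (J : List (Fin n)) :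
    ContDiffOn ℝ ∞ (pdW J f) Ω := by
  induction J with
  | nil => exact hf
  | cons j J ih => exact contDiffOn_pd hΩ ih j

theorem contDiff_pd (hf : ContDiff ℝ ∞ f) (j : Fin n) : ContDiff ℝ ∞ (pd j f) :=
  contDiffOn_univ.1 (contDiffOn_pd isOpen_univ hf.contDiffOn j)

theorem contDiff_pdW (hf : ContDiff ℝ ∞ f) (J : List (Fin n)) : ContDiff ℝ ∞ (pdW J f) :=
  contDiffOn_univ.1 (contDiffOn_pdW isOpen_univ hf.contDiffOn J)

theorem differentiableAt_of_contDiffOn (hΩ : IsOpen Ω) (hf : ContDiffOn ℝ ∞ f Ω) {X : Rn n}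
    (hX : X ∈ Ω) : DifferentiableAt ℝ f X :=
  (hf.contDiffAt (hΩ.mem_nhds hX)).differentiableAt (by simp)

theorem pd_comm (hΩ : IsOpen Ω) (hf : ContDiffOn ℝ ∞ f Ω) (i j : Fin n) :
    EqOn (pd i (pd j f)) (pd j (pd i f)) Ω := by
  intro X hX
  have hc : ContDiffAt ℝ ∞ f X := hf.contDiffAt (hΩ.mem_nhds hX)
  have hd : DifferentiableAt ℝ (fderiv ℝ f) X :=
    (hc.fderiv_right (m := ∞) (by simp)).differentiableAt (by simp)
  have key : ∀ a b : Rn n, fderiv ℝ (fun Z => fderiv ℝ f Z b) X a = fderiv ℝ (fderiv ℝ f) X a b := by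
    intro a b; rw [fderiv_clm_apply hd (differentiableAt_const b)]; simp
  have hs : IsSymmSndFDerivAt ℝ f X :=
    hc.isSymmSndFDerivAt (by
      rw [minSmoothness_of_isRCLikeNormedField]
      exact WithTop.coe_le_coe.2 le_top)
  change fderiv ℝ (fun Z => fderiv ℝ f Z _) X _ = fderiv ℝ (fun Z => fderiv ℝ f Z _) X _
  rw [key, key]
  exact hs _ _

theorem pdW_perm (hΩ : IsOpen Ω) (hf : ContDiffOn ℝ ∞ f Ω) {J J' : List (Fin n)} (h : J.Perm J') :
    EqOn (pdW J f) (pdW J' f) Ω := by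
  induction h with
  | nil => exact fun _ _ => rfl
  | cons j _ ih => exact pd_congr hΩ ih j
  | swap i j J => exact pd_comm hΩ (contDiffOn_pdW hΩ hf J) _ _
  | trans _ _ ih ih' => exact ih.trans ih'

theorem pd_add (hΩ : IsOpen Ω) (hf : ContDiffOn ℝ ∞ f Ω) (hg : ContDiffOn ℝ ∞ g Ω) (j : Fin n) :
    EqOn (pd j (f + g)) (pd j f + pd j g) Ω := by
  intro X hX
  simp only [pd, Pi.add_apply]
  rw [fderiv_add (differentiableAt_of_contDiffOn hΩ hf hX)
    (differentiableAt_of_contDiffOn hΩ hg hX)]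
  rfl

theorem pdW_add (hΩ : IsOpen Ω) (hf : ContDiffOn ℝ ∞ f Ω) (hg : ContDiffOn ℝ ∞ g Ω)
    (J : List (Fin n)) : EqOn (pdW J (f + g)) (pdW J f + pdW J g) Ω := by
  induction J with
  | nil => exact fun _ _ => rfl
  | cons j J ih =>
    exact (pd_congr hΩ ih j).trans (pd_add hΩ (contDiffOn_pdW hΩ hf J) (contDiffOn_pdW hΩ hg J) j)

theorem pdW_sub (hΩ : IsOpen Ω) (hf : ContDiffOn ℝ ∞ f Ω) (hg : ContDiffOn ℝ ∞ g Ω)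
    (J : List (Fin n)) : EqOn (pdW J (f - g)) (pdW J f - pdW J g) Ω := by
  have h := pdW_add hΩ (f := f - g) (hf.sub hg) hg J
  intro X hX
  have h1 := h hX
  rw [sub_add_cancel] at h1; simp [h1]

theorem fderiv_apply_eq_sum (L : Rn n →L[ℝ] V) (y : Rn n) :
    L y = ∑ j, y j • L (EuclideanSpace.single j 1) := by
  have hy : y = ∑ j, y j • EuclideanSpace.single j (1 : ℝ) := by
    ext i; simp [Finset.sum_apply, Pi.single_apply]
  conv_lhs => rw [hy]
  simp [map_sum]

theorem norm_fderiv_le_sum_pd (X : Rn n) : ‖fderiv ℝ f X‖ ≤ ∑ j, ‖pd j f X‖ := by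
  refine ContinuousLinearMap.opNorm_le_bound _ (by positivity) fun y => ?_
  rw [fderiv_apply_eq_sum, sum_mul]
  refine (norm_sum_le _ _).trans (sum_le_sum fun j _ => ?_)
  rw [norm_smul, mul_comm]
  exact mul_le_mul_of_nonneg_left (PiLp.norm_apply_le y j) (norm_nonneg _)

theorem contDiffOn_of_pdW (hΩ : IsOpen Ω) (h : ∀ J, DifferentiableOn ℝ (pdW J f) Ω) :
    ContDiffOn ℝ ∞ f Ω := by
  rw [contDiffOn_infty]
  intro k
  induction k generalizing f with
  | zero => exact contDiffOn_zero.2 (h []).continuousOn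
  | succ k ih =>
    have := (contDiffOn_succ_iff_fderiv_of_isOpen (𝕜 := ℝ) (f := f) (n := (k : ℕ∞ω)) hΩ).2
      ⟨h [], by simp, ?_⟩
    · exact_mod_cast this
    rw [contDiffOn_clm_apply]
    intro y
    have e : (fun X => fderiv ℝ f X y) = fun X => ∑ j, y j • pd j f X := by
      funext X
      exact fderiv_apply_eq_sum _ y
    rw [e]
    refine ContDiffOn.sum fun j _ => ContDiffOn.smul contDiffOn_const (ih fun J => ?_)
    have := h (J ++ [j])
    rwa [pdW_append] at this

variable [NormedSpace ℂ V]

theorem pd_smul_const (c : ℂ) (hc : c ≠ 0) (j : Fin n) : pd j (c • f) = c • pd j f := by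
  funext X
  simp only [pd, Pi.smul_apply]
  by_cases h : DifferentiableAt ℝ f X
  · rw [fderiv_const_smul h]; rfl
  · have h' : ¬ DifferentiableAt ℝ (c • f) X := by
      intro h'
      apply h
      have := h'.const_smul c⁻¹
      simpa [smul_smul, inv_mul_cancel₀ hc] using this
    rw [fderiv_zero_of_not_differentiableAt h, fderiv_zero_of_not_differentiableAt h']; simp

theorem pdW_smul_const (c : ℂ) (hc : c ≠ 0) (J : List (Fin n)) : pdW J (c • f) = c • pdW J f := by
  induction J with
  | nil => rfl
  | cons j J ih => simp only [pdW, ih, pd_smul_const c hc]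

theorem classD1_eq (j : Fin n) : classD1 j f = (-Complex.I) • pd j f := rfl

theorem classD_eq (α : Fin n → ℕ) (f : Rn n → V) :
    classD α f = (-Complex.I) ^ (∑ i, α i) • pdW (wordOf α) f := by
  have hI : -Complex.I ≠ 0 := by simp
  have rep : ∀ (j : Fin n) (k : ℕ) (h : Rn n → V),
    (classD1 j)^[k] h = (-Complex.I) ^ k • pdW (List.replicate k j) h := by
    intro j k h
    induction k with
    | zero => simp [pdW]
    | succ k ih =>
      rw [Function.iterate_succ_apply', ih, classD1_eq, pd_smul_const _ (pow_ne_zero _ hI), smul_smul,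
        List.replicate_succ, pow_succ']
      rfl
  have main : ∀ L : List (Fin n), L.foldr (fun j h => (classD1 j)^[α j] h) f =
    (-Complex.I) ^ (L.map α).sum • pdW (L.flatMap fun j => List.replicate (α j) j) f := by
    intro L
    induction L with
    | nil => simp [pdW]
    | cons j L ih =>
      rw [List.foldr_cons, ih, rep, pdW_smul_const _ (pow_ne_zero _ hI), smul_smul,
        List.flatMap_cons, pdW_append, List.map_cons, List.sum_cons, pow_add]
  have := main (List.finRange n)
  rw [classD, this, ← List.ofFn_eq_map, List.sum_ofFn]; rfl

end Partial

section Products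

variable {V : Type*} [NormedAddCommGroup V] [NormedSpace ℝ V] [NormedSpace ℂ V] {n : ℕ}
  {Ω : Set (Rn n)}

theorem pd_smul (hΩ : IsOpen Ω) {f : Rn n → ℂ} {g : Rn n → V} (hf : ContDiffOn ℝ ∞ f Ω)
    (hg : ContDiffOn ℝ ∞ g Ω) (j : Fin n) :
    EqOn (pd j (f • g)) (pd j f • g + f • pd j g) Ω := by
  intro X hX
  have h := (differentiableAt_of_contDiffOn hΩ hf hX).hasFDerivAt.smul
    (differentiableAt_of_contDiffOn hΩ hg hX).hasFDerivAt
  have h' := h.fderiv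
  change fderiv ℝ (f • g) X _ = _
  rw [h']; simp [pd, add_comm]

theorem norm_pdW_pd_le {W : Type*} [NormedAddCommGroup W] [NormedSpace ℝ W] {N : ℕ} {A r : ℝ}
    {g : Rn n → W} {X : Rn n}
    (h : ∀ J : List (Fin n), J.length ≤ N + 1 → ‖pdW J g X‖ ≤ A * r ^ J.length) (j : Fin n)
    (J : List (Fin n)) (hJ : J.length ≤ N) : ‖pdW J (pd j g) X‖ ≤ (A * r) * r ^ J.length := by
  have := h (J ++ [j]) (by simpa using hJ)
  rw [pdW_append] at this
  refine this.trans (le_of_eq ?_)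
  simp only [List.length_append, List.length_singleton, pow_succ]; ring

/-- Leibniz estimate for the derivatives of a product at a point. -/
theorem norm_pdW_smul_le (hΩ : IsOpen Ω) {X : Rn n} (hX : X ∈ Ω) {r : ℝ} (N : ℕ) :
    ∀ {A B : ℝ} {f : Rn n → ℂ} {g : Rn n → V}, 0 ≤ r → ContDiffOn ℝ ∞ f Ω → ContDiffOn ℝ ∞ g Ω →
      (∀ J : List (Fin n), J.length ≤ N → ‖pdW J f X‖ ≤ A * r ^ J.length) →
      (∀ J : List (Fin n), J.length ≤ N → ‖pdW J g X‖ ≤ B * r ^ J.length) →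
      ∀ J : List (Fin n), J.length ≤ N →
        ‖pdW J (f • g) X‖ ≤ 2 ^ J.length * (A * B) * r ^ J.length := by
  induction N using Nat.strong_induction_on with | _ N ih =>
  intro A B f g hr hf hg h1 h2 J hJ
  rcases List.eq_nil_or_concat J with rfl | ⟨J', j, rfl⟩
  · have a1 := h1 [] (by simp)
    have a2 := h2 [] (by simp)
    simp only [pdW, List.length_nil, pow_zero, mul_one, one_mul] at a1 a2 ⊢
    rw [Pi.smul_apply', norm_smul]
    exact mul_le_mul a1 a2 (norm_nonneg _) ((norm_nonneg _).trans a1)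
  · obtain ⟨N, rfl⟩ : ∃ M, N = M + 1 := Nat.exists_eq_succ_of_ne_zero (by rintro rfl; simp at hJ)
    have hJ' : J'.length ≤ N := by simpa using hJ
    have e1 := pdW_congr hΩ (pd_smul hΩ hf hg j) J' hX
    have s1 := contDiffOn_pd hΩ hf j
    have s2 := contDiffOn_pd hΩ hg j
    have e2 := pdW_add hΩ (s1.smul hg) (hf.smul s2) J' hX
    have i1 := ih N (Nat.lt_succ_self N) hr s1 hg (norm_pdW_pd_le h1 j) (fun J hJ => h2 J (by omega)) J' hJ'
    have i2 := ih N (Nat.lt_succ_self N) hr hf s2 (fun J hJ => h1 J (by omega)) (norm_pdW_pd_le h2 j) J' hJ'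
    rw [List.concat_eq_append, pdW_append]
    change ‖pdW J' (pd j (f • g)) X‖ ≤ _
    rw [e1]
    have e3 : pdW J' (pd j f • g + f • pd j g) X =
      pdW J' (pd j f • g) X + pdW J' (f • pd j g) X := e2
    rw [e3]
    refine (norm_add_le _ _).trans ((add_le_add i1 i2).trans (le_of_eq ?_))
    simp only [List.length_append, List.length_singleton, pow_succ]; ring

/-- Estimate for the derivatives of a reciprocal at a point. -/
theorem exists_norm_pdW_inv_le (A c : ℝ) (hc : 0 < c) (N : ℕ) :
    ∃ C : ℝ, ∀ (n : ℕ) (Ω : Set (Rn n)), IsOpen Ω → ∀ X ∈ Ω, ∀ (r : ℝ) (f : Rn n → ℂ), 0 ≤ r →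
      ContDiffOn ℝ ∞ f Ω → (∀ Z ∈ Ω, f Z ≠ 0) → c ≤ ‖f X‖ →
      (∀ J : List (Fin n), J.length ≤ N → ‖pdW J f X‖ ≤ A * r ^ J.length) →
      ∀ J : List (Fin n), J.length ≤ N → ‖pdW J f⁻¹ X‖ ≤ C * r ^ J.length := by
  induction N with
  | zero =>
    refine ⟨c⁻¹, fun n Ω hΩ X hX r f hr hf h0 hcf h J hJ => ?_⟩
    obtain rfl : J = [] := by simpa using hJ
    simp only [pdW, Pi.inv_apply, norm_inv, List.length_nil, pow_zero, mul_one]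
    exact inv_anti₀ hc hcf
  | succ N ih =>
    obtain ⟨C, hC⟩ := ih
    refine ⟨max c⁻¹ (2 ^ N * ((2 ^ N * (C * C)) * A)),
      fun n Ω hΩ X hX r f hr hf h0 hcf h J hJ => ?_⟩
    rcases List.eq_nil_or_concat J with rfl | ⟨J', j, rfl⟩
    · simp only [pdW, Pi.inv_apply, norm_inv, List.length_nil, pow_zero, mul_one]
      exact (inv_anti₀ hc hcf).trans (le_max_left _ _)
    · have hJ' : J'.length ≤ N := by simpa using hJ
      have hA : 0 ≤ A := by
        have := h [] (by simp)
        simpa using (norm_nonneg _).trans this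
      have hi : ContDiffOn ℝ ∞ f⁻¹ Ω := hf.inv h0
      have bi := hC n Ω hΩ X hX r f hr hf h0 hcf (fun J hJ => h J (by omega))
      have hC0 : 0 ≤ C := by
        have := bi [] (by simp)
        simpa using (norm_nonneg _).trans this
      have e : EqOn (pd j f⁻¹) ((-1 : ℂ) • ((f⁻¹ • f⁻¹) • pd j f)) Ω := by
        intro Z hZ
        have h1 := pd_smul hΩ hf hi j hZ
        have h2 : EqOn (f • f⁻¹) (fun _ => (1 : ℂ)) Ω := fun W hW => by
          simp [mul_inv_cancel₀ (h0 W hW)]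
        have h3 := pd_congr hΩ h2 j hZ
        rw [h1] at h3
        have h4 : pd j (fun _ : Rn n => (1 : ℂ)) Z = 0 := by simp [pd]
        rw [h4] at h3
        have h5 : pd j f Z * (f Z)⁻¹ + f Z * pd j f⁻¹ Z = 0 := h3
        change pd j f⁻¹ Z = -1 * (((f Z)⁻¹ * (f Z)⁻¹) * pd j f Z)
        have h6 : (f Z)⁻¹ * f Z = 1 := inv_mul_cancel₀ (h0 Z hZ)
        linear_combination (f Z)⁻¹ * h5 - pd j f⁻¹ Z * h6
      have s1 := contDiffOn_pd hΩ hf j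
      have q1 := norm_pdW_pd_le h j
      have p1 : ∀ J : List (Fin n), J.length ≤ N →
        ‖pdW J (f⁻¹ • f⁻¹) X‖ ≤ (2 ^ N * (C * C)) * r ^ J.length := fun J hJ =>
        (norm_pdW_smul_le hΩ hX N hr hi hi bi bi J hJ).trans (by gcongr; norm_num)
      have p2 := norm_pdW_smul_le hΩ hX N hr (hi.smul hi) s1 p1 q1 J' hJ'
      rw [List.concat_eq_append, pdW_append]
      change ‖pdW J' (pd j f⁻¹) X‖ ≤ _
      rw [pdW_congr hΩ e J' hX, pdW_smul_const _ (by norm_num), Pi.smul_apply, norm_smul]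
      simp only [norm_neg, norm_one, one_mul, List.length_append, List.length_singleton]
      refine p2.trans ?_
      calc 2 ^ J'.length * (2 ^ N * (C * C) * (A * r)) * r ^ J'.length
          ≤ 2 ^ N * (2 ^ N * (C * C) * (A * r)) * r ^ J'.length := by gcongr; norm_num
        _ = 2 ^ N * ((2 ^ N * (C * C)) * A) * r ^ (J'.length + 1) := by ring
        _ ≤ _ := by gcongr; exact le_max_right _ _

end Products

section ParametricIntegral

variable {V : Type*} [NormedAddCommGroup V] [NormedSpace ℝ V] {n : ℕ}
  {Ω : Set (Rn n)} {T : Type*} [MeasurableSpace T] {μ : Measure T}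

theorem aestronglyMeasurable_pd (hΩ : IsOpen Ω) {H : Rn n → T → V}
    (hs : ∀ᵐ y ∂μ, ContDiffOn ℝ ∞ (fun X => H X y) Ω)
    (hm : ∀ X ∈ Ω, AEStronglyMeasurable (H X) μ) (j : Fin n) {X : Rn n} (hX : X ∈ Ω) :
    AEStronglyMeasurable (fun y => pd j (fun X => H X y) X) μ := by
  set e : Rn n := EuclideanSpace.single j 1
  have hlim : Tendsto (fun k : ℕ => X + ((k : ℝ) + 1)⁻¹ • e) atTop (𝓝 X) := by
    have h1 : Tendsto (fun k : ℕ => ((k : ℝ) + 1)⁻¹) atTop (𝓝 0) := by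
      simpa using tendsto_one_div_add_atTop_nhds_zero_nat (𝕜 := ℝ)
    simpa using (h1.smul_const e).const_add X
  obtain ⟨K, hK⟩ := (hlim.eventually (hΩ.mem_nhds hX)).exists_forall_of_atTop
  refine aestronglyMeasurable_of_tendsto_ae (u := atTop)
    (f := fun (k : ℕ) y => (((k + K : ℕ) : ℝ) + 1) •
      (H (X + (((k + K : ℕ) : ℝ) + 1)⁻¹ • e) y - H X y)) (fun k => ?_) ?_
  · exact ((hm _ (hK _ (by omega))).sub (hm X hX)).const_smul _
  · filter_upwards [hs] with y hy
    have hd := (differentiableAt_of_contDiffOn hΩ hy hX).hasFDerivAt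
    have hc : Tendsto (fun k : ℕ => ‖(((k + K : ℕ) : ℝ) + 1)‖) atTop atTop := by
      have h1 : Tendsto (fun k : ℕ => ((k + K : ℕ) : ℝ) + 1) atTop atTop :=
        tendsto_atTop_add_const_right _ _
          (tendsto_natCast_atTop_atTop.comp (tendsto_add_atTop_nat K))
      exact tendsto_norm_atTop_atTop.comp h1
    have := hd.lim (v := e) hc
    refine this.congr fun k => ?_
    rfl

/-- Differentiation under the integral sign, for all partial derivatives. -/
theorem pdW_integral [CompleteSpace V] (hΩ : IsOpen Ω) {H : Rn n → T → V}
    (hs : ∀ᵐ y ∂μ, ContDiffOn ℝ ∞ (fun X => H X y) Ω)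
    (hm : ∀ X ∈ Ω, AEStronglyMeasurable (H X) μ)
    (hb : ∀ J : List (Fin n), ∀ X₀ ∈ Ω, ∃ δ > 0, ∃ b : T → ℝ, Integrable b μ ∧
      ∀ᵐ y ∂μ, ∀ X ∈ ball X₀ δ, X ∈ Ω → ‖pdW J (fun X => H X y) X‖ ≤ b y) :
    ContDiffOn ℝ ∞ (fun X => ∫ y, H X y ∂μ) Ω ∧
    (∀ J, ∀ X ∈ Ω, AEStronglyMeasurable (fun y => pdW J (fun X => H X y) X) μ) ∧
    ∀ J, ∀ X ∈ Ω, pdW J (fun X => ∫ y, H X y ∂μ) X = ∫ y, pdW J (fun X => H X y) X ∂μ := by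
  have hs' : ∀ J, ∀ᵐ y ∂μ, ContDiffOn ℝ ∞ (fun X => pdW J (fun X => H X y) X) Ω := fun J => by
    filter_upwards [hs] with y hy using contDiffOn_pdW hΩ hy J
  have hm' : ∀ J, ∀ X ∈ Ω, AEStronglyMeasurable (fun y => pdW J (fun X => H X y) X) μ := by
    intro J
    induction J with
    | nil => exact hm
    | cons j J ih =>
      intro X hX
      exact aestronglyMeasurable_pd (H := fun X y => pdW J (fun X => H X y) X) hΩ (hs' J) ih j hX
  have step : ∀ J, ∀ X ∈ Ω, DifferentiableAt ℝ (fun X => ∫ y, pdW J (fun X => H X y) X ∂μ) X ∧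
    ∀ j, pd j (fun X => ∫ y, pdW J (fun X => H X y) X ∂μ) X
      = ∫ y, pdW (j :: J) (fun X => H X y) X ∂μ := by
    intro J X₀ hX₀
    choose δ hδ b hbi hbb using fun j => hb (j :: J) X₀ hX₀
    have hnhd : (⋂ j, ball X₀ (δ j)) ∩ Ω ∈ 𝓝 X₀ :=
      inter_mem (Filter.iInter_mem.2 fun j => ball_mem_nhds _ (hδ j)) (hΩ.mem_nhds hX₀)
    obtain ⟨δ0, hδ0, b0, hbi0, hbb0⟩ := hb J X₀ hX₀
    have hF' : AEStronglyMeasurable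
      (fun y => fderiv ℝ (fun X => pdW J (fun X => H X y) X) X₀) μ := by
      have e : (fun y => fderiv ℝ (fun X => pdW J (fun X => H X y) X) X₀) = fun y =>
        ∑ j, (ContinuousLinearMap.smulRightL ℝ (Rn n) V (EuclideanSpace.proj j))
          (pdW (j :: J) (fun X => H X y) X₀) := by
        funext y
        ext x; rw [fderiv_apply_eq_sum]; simp
        rfl
      rw [e]
      have := Finset.aestronglyMeasurable_sum (μ := μ) Finset.univ
        (f := fun j y => (ContinuousLinearMap.smulRightL ℝ (Rn n) V (EuclideanSpace.proj j))
          (pdW (j :: J) (fun X => H X y) X₀))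
        fun j _ => (ContinuousLinearMap.continuous _).comp_aestronglyMeasurable (hm' (j :: J) X₀ hX₀)
      convert this using 1
      funext y; simp
    have main := hasFDerivAt_integral_of_dominated_of_fderiv_le (𝕜 := ℝ) (μ := μ)
      (F := fun X y => pdW J (fun X => H X y) X)
      (F' := fun X y => fderiv ℝ (fun X => pdW J (fun X => H X y) X) X)
      (bound := fun y => ∑ j, b j y) hnhd
      (by filter_upwards [hΩ.mem_nhds hX₀] with X hX using hm' J X hX)
      (hbi0.mono' (hm' J X₀ hX₀) (by
        filter_upwards [hbb0] with y hy using hy X₀ (mem_ball_self hδ0) hX₀))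
      hF'
      (by
        filter_upwards [ae_all_iff.2 hbb] with y hy X hX
        refine (norm_fderiv_le_sum_pd X).trans (sum_le_sum fun j _ => ?_)
        exact hy j X (mem_iInter.1 hX.1 j) hX.2)
      (integrable_finsetSum _ fun j _ => hbi j)
      (by
        filter_upwards [hs' J] with y hy X hX
        exact (differentiableAt_of_contDiffOn hΩ hy hX.2).hasFDerivAt)
    refine ⟨main.differentiableAt, fun j => ?_⟩
    change fderiv ℝ _ X₀ _ = _
    rw [main.fderiv, ContinuousLinearMap.integral_apply]
    · rfl
    · refine Integrable.mono' (integrable_finsetSum Finset.univ fun j _ => hbi j) hF' ?_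
      filter_upwards [ae_all_iff.2 hbb] with y hy
      refine (norm_fderiv_le_sum_pd X₀).trans (sum_le_sum fun j _ => ?_)
      exact hy j X₀ (mem_ball_self (hδ j)) hX₀
  have key : ∀ J, ∀ X ∈ Ω, pdW J (fun X => ∫ y, H X y ∂μ) X = ∫ y, pdW J (fun X => H X y) X ∂μ := by
    intro J
    induction J with
    | nil => exact fun _ _ => rfl
    | cons j J ih =>
      intro X hX
      exact (pd_congr hΩ ih j hX).trans ((step J X hX).2 j)
  refine ⟨contDiffOn_of_pdW hΩ fun J X hX => ?_, hm', key⟩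
  refine DifferentiableAt.differentiableWithinAt ?_
  refine (step J X hX).1.congr_of_eventuallyEq ?_
  filter_upwards [hΩ.mem_nhds hX] with Z hZ using key J Z hZ

end ParametricIntegral

section WeakDerivatives

variable {n l : ℕ} {Ω : Set (Rn n)}

theorem classD_add_single {α : Fin n → ℕ} {j : Fin n} {φ : Rn n → ℂ} (h : ContDiff ℝ ∞ φ) :
    classD (α + Pi.single j 1) φ = classD α (classD1 j φ) := by
  have hI : -Complex.I ≠ 0 := by simp
  rw [classD_eq, classD_eq, classD1_eq, pdW_smul_const _ hI, smul_smul]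
  have e1 : ∑ i, (α + Pi.single j 1 : Fin n → ℕ) i = (∑ i, α i) + 1 := by simp [sum_add_distrib]
  have e2 : pdW (wordOf (α + Pi.single j 1)) φ = pdW (wordOf α) (pd j φ) := by
    have hp : (wordOf (α + Pi.single j 1)).Perm (wordOf α ++ [j]) := by
      rw [List.perm_iff_count]
      intro i; rw [List.count_append, count_wordOf, count_wordOf]
      by_cases hij : i = j
      · subst hij; simp
      · have : List.count i [j] = 0 := List.count_eq_zero.2 (by simpa using hij)
        simp [this, hij]
    funext X; rw [pdW_perm isOpen_univ h.contDiffOn hp (mem_univ X), pdW_append]; rfl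
  rw [e1, e2, pow_succ]

theorem classD_single {j : Fin n} {φ : Rn n → ℂ} (h : ContDiff ℝ ∞ φ) :
    classD (Pi.single j 1) φ = classD1 j φ := by
  have := classD_add_single (α := 0) (j := j) h
  rw [zero_add] at this; rw [this, classD_eq]
  have : wordOf (0 : Fin n → ℕ) = [] := by
    apply List.eq_nil_of_length_eq_zero
    rw [wordOf_length]; simp
  simp [this, pdW]

/-- If `v = D ^ α u` and `w = D_j D ^ α u`, then `w = D_j v`. -/
theorem HasWeakD.single {α : Fin n → ℕ} {j : Fin n} {u v w : Rn n → Cl l}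
    (h : HasWeakD Ω α u v) (h' : HasWeakD Ω (α + Pi.single j 1) u w) :
    HasWeakD Ω (Pi.single j 1) v w := by
  refine ⟨h.2.1, h'.2.1, fun φ h1 h2 h3 => ?_⟩
  obtain ⟨d1, d2⟩ := classD_smooth (Pi.single j 1) h1
  have dc : HasCompactSupport (classD (Pi.single j 1) φ) := h2.mono' ((subset_tsupport _).trans d2)
  rw [h.2.2 _ d1 dc (d2.trans h3), h'.2.2 φ h1 h2 h3, classD_add_single h1, classD_single h1,
    smul_smul]
  congr 1; simp [sum_add_distrib, pow_add, mul_comm]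

theorem HasWeakD.integral_pd {j : Fin n} {u v : Rn n → Cl l} (h : HasWeakD Ω (Pi.single j 1) u v)
    {φ : Rn n → ℂ} (h1 : ContDiff ℝ ∞ φ) (h2 : HasCompactSupport φ) (h3 : tsupport φ ⊆ Ω) :
    ∫ X in Ω, pd j φ X • u X = -∫ X in Ω, φ X • (Complex.I • v X) := by
  have := h.2.2 φ h1 h2 h3
  rw [classD_single h1, classD1_eq] at this
  have e1 : ∫ X in Ω, φ X • (Complex.I • v X) = Complex.I • ∫ X in Ω, φ X • v X := by
    rw [← integral_smul]
    exact integral_congr_ae (.of_forall fun X => smul_comm _ _ _)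
  have e2 : ∫ X in Ω, (-Complex.I • pd j φ) X • u X = -Complex.I • ∫ X in Ω, pd j φ X • u X := by
    rw [← integral_smul]
    exact integral_congr_ae (.of_forall fun X => by simp [smul_smul])
  rw [e1, this, e2]; simp [smul_smul]

/-- Uniqueness of weak derivatives. -/
theorem HasWeakD.unique (hΩ : IsOpen Ω) {α : Fin n → ℕ} {u v v' : Rn n → Cl l}
    (h : HasWeakD Ω α u v) (h' : HasWeakD Ω α u v') : v =ᵐ[volume.restrict Ω] v' := by
  have hli : LocallyIntegrableOn (v - v') Ω volume := h.2.1.sub h'.2.1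
  have := hΩ.ae_eq_zero_of_integral_contDiff_smul_eq_zero hli (fun g g1 g2 g3 => ?_)
  · rw [Filter.EventuallyEq, ae_restrict_iff' hΩ.measurableSet]
    filter_upwards [this] with X hX hXΩ
    exact sub_eq_zero.1 (hX hXΩ)
  · set φ : Rn n → ℂ := fun X => (g X : ℂ)
    have hφ : ContDiff ℝ ∞ φ := Complex.ofRealCLM.contDiff.comp g1
    have ht : tsupport φ = tsupport g := by simp [φ, tsupport, Function.support]
    have hc : HasCompactSupport φ := by
      rw [HasCompactSupport, ht]
      exact g2
    have e1 := h.2.2 φ hφ hc (ht ▸ g3)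
    have e2 := h'.2.2 φ hφ hc (ht ▸ g3)
    have e3 : ∫ X in Ω, φ X • (v - v') X = 0 := by
      simp only [Pi.sub_apply, smul_sub]
      rw [integral_sub (integrable_test_smul hφ.continuous hc (ht ▸ g3) h.2.1)
        (integrable_test_smul hφ.continuous hc (ht ▸ g3) h'.2.1), e1, e2, sub_self]
    rw [setIntegral_eq_integral_of_forall_compl_eq_zero] at e3
    · exact e3
    · intro X hX
      have : g X = 0 := by
        by_contra h0
        exact hX (g3 (subset_tsupport _ h0))
      simp [φ, this]

theorem integral_smul_pd (hΩ : IsOpen Ω) {u : Rn n → Cl l} (hu : ContDiffOn ℝ ∞ u Ω) {φ : Rn n → ℂ}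
    (h1 : ContDiff ℝ ∞ φ) (h2 : HasCompactSupport φ) (h3 : tsupport φ ⊆ Ω) (j : Fin n) :
    ∫ X in Ω, φ X • pd j u X = -∫ X in Ω, pd j φ X • u X := by
  have hs : tsupport (pd j φ) ⊆ tsupport φ := tsupport_fderiv_apply_subset ℝ _
  have hsub : ∀ (ψ : Rn n → ℂ) (w : Rn n → Cl l), tsupport ψ ⊆ Ω →
    Integrable (fun X => ψ X • w X) (volume.restrict Ω) → Integrable (fun X => ψ X • w X) := by
    intro ψ w hψ hi
    refine (integrableOn_iff_integrable_of_support_subset ?_).1 hi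
    intro X hX
    apply hψ
    apply subset_tsupport
    intro h0
    apply hX
    simp [h0]
  have hsub' : ∀ (ψ : Rn n → ℂ) (w : Rn n → Cl l), tsupport ψ ⊆ Ω →
    ∫ X in Ω, ψ X • w X = ∫ X, ψ X • w X := by
    intro ψ w hψ
    refine setIntegral_eq_integral_of_forall_compl_eq_zero fun X hX => ?_
    have : ψ X = 0 := by
      by_contra h0
      exact hX (hψ (subset_tsupport _ h0))
    simp [this]
  have hli : ∀ w : Rn n → Cl l, ContDiffOn ℝ ∞ w Ω → LocallyIntegrableOn w Ω volume := fun w hw =>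
    hw.continuousOn.locallyIntegrableOn hΩ.measurableSet
  have hcd : HasCompactSupport (pd j φ) := h2.mono' ((subset_tsupport _).trans hs)
  rw [hsub' _ _ h3, hsub' _ _ (hs.trans h3)]
  have := integral_smul_fderiv_eq_neg_fderiv_smul_of_integrable (μ := volume) (f := φ) (g := u)
    (v := EuclideanSpace.single j (1 : ℝ))
    (hsub _ _ (hs.trans h3) (integrable_test_smul (contDiff_pd h1 j).continuous hcd (hs.trans h3)
      (hli u hu)))
    (hsub _ _ h3 (integrable_test_smul h1.continuous h2 h3 (hli _ (contDiffOn_pd hΩ hu j))))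
    (hsub _ _ h3 (integrable_test_smul h1.continuous h2 h3 (hli u hu)))
    (fun X _ => h1.differentiable (by simp) X)
    (fun X hX => differentiableAt_of_contDiffOn hΩ hu (h3 hX))
  exact this

/-- The classical derivatives of a smooth function are weak derivatives. -/
theorem hasWeakD_of_contDiffOn (hΩ : IsOpen Ω) {u : Rn n → Cl l} (hu : ContDiffOn ℝ ∞ u Ω)
    (α : Fin n → ℕ) : HasWeakD Ω α u (classD α u) := by
  have hli : ∀ w : Rn n → Cl l, ContDiffOn ℝ ∞ w Ω → LocallyIntegrableOn w Ω volume := fun w hw =>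
    hw.continuousOn.locallyIntegrableOn hΩ.measurableSet
  have hw : ∀ J, ContDiffOn ℝ ∞ (pdW J u) Ω := contDiffOn_pdW hΩ hu
  refine ⟨hli u hu, ?_, fun φ h1 h2 h3 => ?_⟩
  · rw [classD_eq]
    exact (hli _ (hw _)).smul _
  have key : ∀ (J : List (Fin n)) (φ : Rn n → ℂ), ContDiff ℝ ∞ φ → HasCompactSupport φ →
    tsupport φ ⊆ Ω →
    ∫ X in Ω, φ X • pdW J u X = (-1 : ℂ) ^ J.length • ∫ X in Ω, pdW J φ X • u X := by
    intro J
    induction J with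
    | nil => intro φ _ _ _; simp [pdW]
    | cons j J ih =>
      intro φ h1 h2 h3
      have hs : tsupport (pd j φ) ⊆ tsupport φ := tsupport_fderiv_apply_subset ℝ _
      have hcd : HasCompactSupport (pd j φ) := h2.mono' ((subset_tsupport _).trans hs)
      have e1 := integral_smul_pd hΩ (hw J) h1 h2 h3 j
      have e2 := ih (pd j φ) (contDiff_pd h1 j) hcd (hs.trans h3)
      have e3 : pdW J (pd j φ) = pdW (j :: J) φ := by
        funext X
        have := pdW_perm isOpen_univ h1.contDiffOn (List.perm_append_singleton j J) (mem_univ X)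
        rwa [pdW_append] at this
      change ∫ X in Ω, φ X • pd j (pdW J u) X = _
      rw [e1, e2, e3, List.length_cons, pow_succ]; simp
  have := key (wordOf α) φ h1 h2 h3
  rw [classD_eq, classD_eq, wordOf_length] at *
  have e1 : ∀ (c : ℂ) (w : Rn n → Cl l), ∫ X in Ω, φ X • (c • w) X = c • ∫ X in Ω, φ X • w X := by
    intro c w; rw [← integral_smul]
    exact integral_congr_ae (.of_forall fun X => smul_comm (φ X) c (w X))
  have e2 : ∀ (c : ℂ) (ψ : Rn n → ℂ), ∫ X in Ω, (c • ψ) X • u X = c • ∫ X in Ω, ψ X • u X := by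
    intro c ψ; rw [← integral_smul]
    exact integral_congr_ae (.of_forall fun X => by simp [smul_smul])
  rw [e1, e2, this, smul_comm]

end WeakDerivatives

/-! ### Taylor polynomials of jets -/

section Taylor

variable {n l : ℕ}

/-- The divided power `Z ^ β / β!`. -/
def dpow (β : Fin n → ℕ) (Z : Rn n) : ℝ := ∏ i, Z i ^ β i / (β i).factorial

/-- The multi-indices of length `< m`. -/
def mlt (n m : ℕ) : Finset (Fin n → ℕ) :=
  (Fintype.piFinset fun _ : Fin n => Finset.range m).filter fun β => ∑ i, β i < m

theorem mem_mlt {m : ℕ} {β : Fin n → ℕ} : β ∈ mlt n m ↔ ∑ i, β i < m := by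
  simp only [mlt, Finset.mem_filter, Fintype.mem_piFinset, Finset.mem_range, and_iff_right_iff_imp]
  intro h i
  exact (single_le_sum (f := β) (fun _ _ => Nat.zero_le _) (Finset.mem_univ i)).trans_lt h

theorem sum_mIdx {M : Type*} [AddCommMonoid M] (k : ℕ) (F : (Fin n → ℕ) → M) :
    ∑ β : MIdx n k, F β.1 = ∑ β ∈ mlt n (k + 1), F β := by
  refine Finset.sum_bij' (fun β _ => β.1)
    (fun β hβ => ⟨β, Nat.lt_succ_iff.1 (mem_mlt.1 hβ)⟩) ?_ ?_ ?_ ?_ ?_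
  · intro β _
    exact mem_mlt.2 (Nat.lt_succ_iff.2 β.2)
  · intro β _
    exact Finset.mem_univ _
  · intro β _; rfl
  · intro β _; rfl
  · intro β _; rfl

theorem dpow_zero (Z : Rn n) : dpow 0 Z = 1 := by simp [dpow]

theorem monom_div_fact {k : ℕ} (β : MIdx n k) (Z : Rn n) :
    monom β.1 Z / (β.fact : ℝ) = dpow β.1 Z := by
  simp [monom, MIdx.fact, dpow, Finset.prod_div_distrib]

theorem abs_dpow_le (β : Fin n → ℕ) (Z : Rn n) : |dpow β Z| ≤ ‖Z‖ ^ ∑ i, β i := by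
  rw [dpow, Finset.abs_prod, ← Finset.prod_pow_eq_pow_sum]
  refine Finset.prod_le_prod (fun _ _ => abs_nonneg _) fun i _ => ?_
  rw [abs_div, abs_pow]
  have h1 : |Z i| ≤ ‖Z‖ := PiLp.norm_apply_le Z i
  have h2 : (1 : ℝ) ≤ |((β i).factorial : ℝ)| := by
    rw [abs_of_nonneg (by positivity)]
    exact_mod_cast Nat.factorial_pos _
  calc |Z i| ^ β i / |((β i).factorial : ℝ)| ≤ |Z i| ^ β i := div_le_self (by positivity) h2
    _ ≤ _ := by gcongr

theorem contDiff_dpow (β : Fin n → ℕ) : ContDiff ℝ ∞ (dpow β : Rn n → ℝ) := by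
  refine contDiff_prod fun i _ => ContDiff.div_const (ContDiff.pow ?_ _) _
  exact (EuclideanSpace.proj (𝕜 := ℝ) i).contDiff

theorem hasFDerivAt_dpow (β : Fin n → ℕ) (Z : Rn n) :
    HasFDerivAt (dpow β : Rn n → ℝ) (∑ j, (if β j = 0 then 0 else dpow (β - Pi.single j 1) Z) •
      (EuclideanSpace.proj (𝕜 := ℝ) j : Rn n →L[ℝ] ℝ)) Z := by
  have h : ∀ i ∈ (Finset.univ : Finset (Fin n)), HasFDerivAt (fun Z : Rn n => Z i ^ β i / ((β i).factorial : ℝ))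
    ((if β i = 0 then 0 else Z i ^ (β i - 1) / ((β i - 1).factorial : ℝ)) •
      (EuclideanSpace.proj (𝕜 := ℝ) i : Rn n →L[ℝ] ℝ)) Z := by
    intro i _
    have h0 : HasFDerivAt (fun Z : Rn n => Z i) (EuclideanSpace.proj (𝕜 := ℝ) i : Rn n →L[ℝ] ℝ) Z :=
      (EuclideanSpace.proj (𝕜 := ℝ) i : Rn n →L[ℝ] ℝ).hasFDerivAt
    have h1 := (h0.pow (β i)).mul_const (((β i).factorial : ℝ)⁻¹)
    refine h1.congr_fderiv ?_
    ext w
    rcases Nat.eq_zero_or_pos (β i) with hb | hb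
    · simp [hb]
    · obtain ⟨b, hb'⟩ : ∃ b, β i = b + 1 := ⟨β i - 1, by omega⟩
      have : (b.factorial : ℝ) ≠ 0 := by positivity
      simp [hb', Nat.factorial_succ]
      field_simp
  have := HasFDerivAt.finsetProd h
  refine this.congr_fderiv ?_
  refine sum_congr rfl fun i _ => ?_
  rw [smul_smul]; congr 1
  split_ifs with h0
  · simp
  · simp only [dpow]
    rw [← Finset.mul_prod_erase (a := i) Finset.univ _ (Finset.mem_univ i), mul_comm]; congr 1
    · simp
    · refine Finset.prod_congr rfl fun j hj => ?_
      have : j ≠ i := Finset.ne_of_mem_erase hj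
      simp [this]

theorem dpow_add (β : Fin n → ℕ) (Z Z' : Rn n) :
    dpow β (Z + Z') = ∑ δ ∈ Finset.Iic β, dpow δ Z * dpow (β - δ) Z' := by
  have h1 : ∀ i, (Z + Z') i ^ β i / ((β i).factorial : ℝ) = ∑ d ∈ Finset.Iic (β i),
    (Z i ^ d / (d.factorial : ℝ)) * (Z' i ^ (β i - d) / ((β i - d).factorial : ℝ)) := by
    intro i; rw [← Nat.range_succ_eq_Iic, PiLp.add_apply, add_pow, Finset.sum_div]
    refine sum_congr rfl fun d hd => ?_
    have hd' : d ≤ β i := by simpa [Nat.lt_succ_iff] using hd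
    rw [Nat.cast_choose ℝ hd']
    have a1 : ((β i).factorial : ℝ) ≠ 0 := by positivity
    have a2 : (d.factorial : ℝ) ≠ 0 := by positivity
    have a3 : ((β i - d).factorial : ℝ) ≠ 0 := by positivity
    field_simp
  simp only [dpow]; rw [Finset.prod_congr rfl fun i _ => h1 i, Finset.prod_univ_sum]
  have : Fintype.piFinset (fun i => Finset.Iic (β i)) = Finset.Iic β := by ext δ; simp [Pi.le_def]
  rw [this]
  refine sum_congr rfl fun δ _ => ?_
  rw [← Finset.prod_mul_distrib]; rfl

/-- The Taylor polynomial `∑_{|β| < m} (A - W) ^ β / β! g_{γ + β}(W)` of a family `g`. -/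
def taylor (m : ℕ) (g : Jet n l) (γ : Fin n → ℕ) (A W : Rn n) : Cl l :=
  ∑ β ∈ mlt n m, dpow β (A - W) • g (γ + β) W

variable {m : ℕ} {g : Jet n l}

/-- Re-expansion of a Taylor polynomial about another point. -/
theorem taylor_eq_sum (hg : ∀ α, m ≤ ∑ i, α i → g α = 0) (γ : Fin n → ℕ) (A B W : Rn n) :
    taylor m g γ A W = ∑ β ∈ mlt n m, dpow β (A - B) • taylor m g (γ + β) B W := by
  simp only [taylor, smul_sum, smul_smul]; rw [Finset.sum_sigma']
  have e1 : ∀ β ∈ mlt n m, dpow β (A - W) • g (γ + β) W =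
    ∑ δ ∈ Finset.Iic β, (dpow δ (A - B) * dpow (β - δ) (B - W)) • g (γ + β) W := by
    intro β _; rw [← sum_smul, ← dpow_add]
    congr 2
    abel
  rw [sum_congr rfl e1, Finset.sum_sigma']
  have e2 : ∀ x ∈ ((mlt n m).sigma fun _ => mlt n m),
    x ∉ (((mlt n m).sigma fun _ => mlt n m).filter fun x => ∑ i, (x.1 + x.2) i < m) →
    (dpow x.1 (A - B) * dpow x.2 (B - W)) • g (γ + x.1 + x.2) W = 0 := by
    intro x hx hx'; rw [hg, Pi.zero_apply, smul_zero]
    simp only [Finset.mem_filter, not_and, not_lt] at hx'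
    refine (hx' hx).trans (sum_le_sum fun i _ => ?_)
    simp only [Pi.add_apply]; omega
  rw [← Finset.sum_subset (Finset.filter_subset _ _) e2]
  refine Finset.sum_bij' (fun x _ => ⟨x.2, x.1 - x.2⟩) (fun x _ => ⟨x.1 + x.2, x.1⟩) ?_ ?_ ?_ ?_ ?_
  · rintro ⟨β, δ⟩ h
    simp only [Finset.mem_sigma, mem_mlt, Finset.mem_Iic, Finset.mem_filter] at h ⊢
    obtain ⟨h1, h2⟩ := h
    have h3 : δ + (β - δ) = β := by
      funext i
      have : δ i ≤ β i := h2 i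
      simp
      omega
    refine ⟨⟨?_, ?_⟩, by rwa [h3]⟩
    · exact lt_of_le_of_lt (sum_le_sum fun i _ => h2 i) h1
    · exact lt_of_le_of_lt (sum_le_sum fun i _ => by simp) h1
  · rintro ⟨δ, ε⟩ h
    simp only [Finset.mem_sigma, mem_mlt, Finset.mem_Iic, Finset.mem_filter] at h ⊢
    exact ⟨h.2, fun i => by simp⟩
  · rintro ⟨β, δ⟩ h
    simp only [Finset.mem_sigma, mem_mlt, Finset.mem_Iic] at h
    have h3 : δ + (β - δ) = β := by
      funext i
      have : δ i ≤ β i := h.2 i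
      simp
      omega
    simp [h3]
  · rintro ⟨δ, ε⟩ _
    have : δ + ε - δ = ε := by funext i; simp
    simp [this]
  · rintro ⟨β, δ⟩ h
    simp only [Finset.mem_sigma, mem_mlt, Finset.mem_Iic] at h
    have h3 : γ + δ + (β - δ) = γ + β := by
      funext i
      have : δ i ≤ β i := h.2 i
      simp
      omega
    simp [h3]

theorem sum_mlt_single {M : Type*} [AddCommMonoid M] (j : Fin n) (F : (Fin n → ℕ) → M) :
    ∑ β ∈ mlt n (m + 1), (if β j = 0 then 0 else F (β - Pi.single j 1)) = ∑ β ∈ mlt n m, F β := by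
  have : ∀ β ∈ mlt n (m + 1), (if β j = 0 then 0 else F (β - Pi.single j 1)) =
    if ¬ β j = 0 then F (β - Pi.single j 1) else 0 := fun β _ => by split_ifs <;> simp_all
  rw [sum_congr rfl this, ← Finset.sum_filter]
  have hs : ∀ β : Fin n → ℕ, ∑ i, (β + Pi.single j 1 : Fin n → ℕ) i = (∑ i, β i) + 1 := fun β => by
    simp [sum_add_distrib]
  have hb : ∀ β : Fin n → ℕ, β j ≠ 0 → β - Pi.single j 1 + Pi.single j 1 = β := fun β hβ => by
    funext i
    by_cases hij : i = j
    · subst hij; simp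
      omega
    · simp [hij]
  refine Finset.sum_bij' (fun β _ => β - Pi.single j 1) (fun β _ => β + Pi.single j 1) ?_ ?_ ?_ ?_ ?_
  · intro β h
    simp only [Finset.mem_filter, mem_mlt] at h ⊢
    have h1 := hs (β - Pi.single j 1)
    rw [hb β h.2] at h1; omega
  · intro β h
    simp only [Finset.mem_filter, mem_mlt] at h ⊢
    refine ⟨by rw [hs]; omega, by simp⟩
  · intro β h
    exact hb β (Finset.mem_filter.1 h).2
  · intro β _
    funext i; simp
  · intro β _; rfl

theorem hasFDerivAt_taylor_left (γ : Fin n → ℕ) (A W : Rn n) :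
    HasFDerivAt (fun A => taylor m g γ A W) (∑ β ∈ mlt n m, (∑ j, (if β j = 0 then 0 else
      dpow (β - Pi.single j 1) (A - W)) • (EuclideanSpace.proj (𝕜 := ℝ) j : Rn n →L[ℝ] ℝ)).smulRight
        (g (γ + β) W)) A := by
  refine HasFDerivAt.fun_sum fun β _ => ?_
  have h1 := (hasFDerivAt_dpow β (A - W)).comp A ((hasFDerivAt_id A).sub_const W)
  exact h1.smul_const (g (γ + β) W)

theorem contDiff_taylor (γ : Fin n → ℕ) (W : Rn n) : ContDiff ℝ ∞ (fun A => taylor m g γ A W) := by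
  refine ContDiff.sum fun β _ => ?_
  have h : ContDiff ℝ ∞ fun A : Rn n => dpow β (A - W) :=
    (contDiff_dpow β).comp (contDiff_id.sub contDiff_const)
  exact h.smul contDiff_const

theorem pd_taylor (hg : ∀ α, m ≤ ∑ i, α i → g α = 0) (γ : Fin n → ℕ) (j : Fin n) (W : Rn n) :
    pd j (fun A => taylor m g γ A W) = fun A => taylor m g (γ + Pi.single j 1) A W := by
  funext A; rw [pd, (hasFDerivAt_taylor_left γ A W).fderiv]
  simp only [FunLike.coe_sum, Finset.sum_apply, ContinuousLinearMap.smulRight_apply, smul_apply]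
  have e1 : ∀ β : Fin n → ℕ, (∑ i, (if β i = 0 then 0 else dpow (β - Pi.single i 1) (A - W)) •
    (EuclideanSpace.proj (𝕜 := ℝ) i : Rn n →L[ℝ] ℝ) (EuclideanSpace.single j 1)) =
    if β j = 0 then 0 else dpow (β - Pi.single j 1) (A - W) := by
    intro β; simp
  rcases m with _ | m
  · simp [taylor, mlt]
  · obtain ⟨F, hF⟩ : ∃ F : (Fin n → ℕ) → Cl l, F = fun β => dpow β (A - W) •
      g (γ + Pi.single j 1 + β) W := ⟨_, rfl⟩
    have e2 : ∀ β ∈ mlt n (m + 1), (∑ i, (if β i = 0 then 0 else dpow (β - Pi.single i 1) (A - W)) •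
      (EuclideanSpace.proj (𝕜 := ℝ) i : Rn n →L[ℝ] ℝ) (EuclideanSpace.single j 1)) • g (γ + β) W =
      if β j = 0 then 0 else F (β - Pi.single j 1) := by
      intro β _; rw [e1, hF]
      split_ifs with h
      · simp
      · congr 2
        funext i
        by_cases hij : i = j
        · subst hij; simp
          omega
        · simp [hij]
    rw [sum_congr rfl e2]
    refine (sum_mlt_single (m := m) j F).trans ?_
    rw [taylor, hF]
    refine Finset.sum_subset (fun β hβ => mem_mlt.2 ((mem_mlt.1 hβ).trans (Nat.lt_succ_self m))) ?_
    intro β h h'; rw [hg, Pi.zero_apply, smul_zero]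
    simp only [mem_mlt] at h'
    simp only [Pi.add_apply, sum_add_distrib]; simp
    omega

theorem taylor_self (hm : 0 < m) (γ : Fin n → ℕ) (W : Rn n) : taylor m g γ W W = g γ W := by
  rw [taylor, Finset.sum_eq_single 0]
  · simp [dpow_zero]
  · intro β _ hβ
    obtain ⟨i, hi⟩ : ∃ i, β i ≠ 0 := by
      by_contra h
      push Not at h
      exact hβ (funext h)
    have : dpow β (W - W) = 0 := by
      refine Finset.prod_eq_zero (Finset.mem_univ i) ?_
      simp [hi]
    rw [this, zero_smul]
  · intro h
    exact absurd (mem_mlt.2 (by simpa using hm)) h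

attribute [irreducible] dpow

end Taylor

section Jets

variable {n l : ℕ}

/-- The truncation of a family to the multi-indices of length `< m`. -/
def truncJet (m : ℕ) (h : Jet n l) : Jet n l :=
  fun α => if ∑ i, α i < m then h α else 0

theorem truncJet_eq_zero (m : ℕ) (h : Jet n l) (α : Fin n → ℕ)
    (hα : m ≤ ∑ i, α i) : truncJet m h α = 0 := by
  simp [truncJet, not_lt.2 hα]

theorem truncJet_eq {m : ℕ} (h : Jet n l) {α : Fin n → ℕ}
    (hα : ∑ i, α i < m) : truncJet m h α = h α := by
  simp [truncJet, hα]

/-- `∑_{|δ| = m} |h_δ|`. -/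
def topSum (m : ℕ) (h : Jet n l) (X : Rn n) : ℝ≥0∞ :=
  ∑ δ ∈ (mlt n (m + 1)).filter (fun δ => ∑ i, δ i = m), ‖h δ X‖ₑ

theorem enorm_le_topSum {m : ℕ} {h : Jet n l} {δ : Fin n → ℕ}
    (hδ : ∑ i, δ i = m) (X : Rn n) : ‖h δ X‖ₑ ≤ topSum m h X := by
  refine single_le_sum (f := fun δ => ‖h δ X‖ₑ) (fun _ _ => bot_le) ?_
  simp [mem_mlt, hδ]

theorem taylor_truncJet {m : ℕ} (h : Jet n l) (γ : Fin n → ℕ) (A W : Rn n) :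
    taylor m (truncJet m h) γ A W = ∑ β ∈ mlt n (m - ∑ i, γ i), dpow β (A - W) • h (γ + β) W := by
  rw [taylor]
  have hs : ∀ β : Fin n → ℕ, ∑ i, (γ + β) i = ∑ i, γ i + ∑ i, β i := fun β => by
    simp [sum_add_distrib]
  rw [← Finset.sum_subset (s₁ := mlt n (m - ∑ i, γ i))]
  · refine sum_congr rfl fun β hβ => ?_
    rw [mem_mlt] at hβ; rw [truncJet_eq]; rw [hs]
    omega
  · intro β hβ
    rw [mem_mlt] at hβ ⊢; omega
  · intro β _ hβ
    rw [mem_mlt] at hβ; rw [truncJet_eq_zero]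
    · simp
    · rw [hs]; omega

theorem hasDerivAt_taylor_segment {m : ℕ} {h : Jet n l}
    (hd : ∀ α, Differentiable ℝ (h α)) {γ : Fin n → ℕ} (A W w : Rn n) (τ : ℝ)
    (hj : ∀ α, ∑ i, α i < m → ∀ j, pd j (h α) (W + τ • w) = h (α + Pi.single j 1) (W + τ • w)) :
    HasDerivAt (fun τ : ℝ => taylor m (truncJet m h) γ A (W + τ • w))
      (∑ β ∈ mlt n (m - ∑ i, γ i), ∑ j, w j •
        (dpow β (A - (W + τ • w)) • h (γ + Pi.single j 1 + β) (W + τ • w)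
          - (if β j = 0 then 0 else dpow (β - Pi.single j 1) (A - (W + τ • w))) •
            h (γ + β) (W + τ • w))) τ := by
  simp only [taylor_truncJet]
  refine HasDerivAt.fun_sum fun β hβ => ?_
  have hl : HasDerivAt (fun τ : ℝ => W + τ • w) w τ := by
    simpa using ((hasDerivAt_id τ).smul_const w).const_add W
  have h1 : HasDerivAt (fun τ : ℝ => h (γ + β) (W + τ • w)) _ τ :=
    (hd (γ + β) (W + τ • w)).hasFDerivAt.comp_hasDerivAt τ hl
  have h2 : HasDerivAt (fun τ : ℝ => dpow β (A - (W + τ • w))) _ τ :=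
    (hasFDerivAt_dpow β (A - (W + τ • w))).comp_hasDerivAt τ (hl.const_sub A)
  refine (h2.fun_smul h1).congr_deriv ?_
  have hγβ : ∑ i, (γ + β) i < m := by
    rw [mem_mlt] at hβ
    simp only [Pi.add_apply, sum_add_distrib]; omega
  have e1 : fderiv ℝ (h (γ + β)) (W + τ • w) w =
    ∑ j, w j • h (γ + Pi.single j 1 + β) (W + τ • w) := by
    rw [fderiv_apply_eq_sum]
    refine sum_congr rfl fun j _ => ?_
    have := hj _ hγβ j
    rw [pd] at this; rw [this, add_right_comm]
  rw [e1]
  simp only [FunLike.coe_sum, Finset.sum_apply, smul_apply, PiLp.proj_apply, PiLp.neg_apply,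
    smul_sub, sum_sub_distrib, smul_sum, sum_smul]
  refine (congrArg₂ (· + ·) ?_ ?_).trans (sub_eq_add_neg _ _).symm
  · exact sum_congr rfl fun j _ => smul_comm _ _ _
  · rw [← Finset.sum_neg_distrib]
    refine sum_congr rfl fun j _ => ?_
    rw [smul_smul, ← neg_smul]; congr 1
    simp only [smul_eq_mul]; ring

theorem enorm_taylor_deriv_le {m : ℕ} {h : Jet n l} {γ : Fin n → ℕ}
    (hγ : ∑ i, γ i < m) {A W w : Rn n} {L M : ℝ} (hL : ‖A - W‖ ≤ L) (hw : ‖w‖ ≤ M) :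
    ‖∑ β ∈ mlt n (m - ∑ i, γ i), ∑ j, w j • (dpow β (A - W) • h (γ + Pi.single j 1 + β) W
      - (if β j = 0 then 0 else dpow (β - Pi.single j 1) (A - W)) • h (γ + β) W)‖ₑ
      ≤ ofReal (n * (mlt n m).card * M * L ^ (m - 1 - ∑ i, γ i)) * topSum m h W := by
  obtain ⟨r, hr⟩ : ∃ r, m - ∑ i, γ i = r + 1 := ⟨m - 1 - ∑ i, γ i, by omega⟩
  have hr' : m - 1 - ∑ i, γ i = r := by omega
  have hL0 : 0 ≤ L := (norm_nonneg _).trans hL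
  have hM0 : 0 ≤ M := (norm_nonneg _).trans hw
  rw [hr, hr', Finset.sum_comm]
  have e1 : ∀ j, ∑ β ∈ mlt n (r + 1), w j • (dpow β (A - W) • h (γ + Pi.single j 1 + β) W
    - (if β j = 0 then 0 else dpow (β - Pi.single j 1) (A - W)) • h (γ + β) W) =
    w j • ∑ β ∈ mlt n (r + 1) \ mlt n r, dpow β (A - W) • h (γ + Pi.single j 1 + β) W := by
    intro j; rw [← smul_sum, sum_sub_distrib]; congr 1
    obtain ⟨F, hF⟩ : ∃ F : (Fin n → ℕ) → Cl l, F = fun β => dpow β (A - W) •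
      h (γ + Pi.single j 1 + β) W := ⟨_, rfl⟩
    have e2 : ∀ β ∈ mlt n (r + 1), (if β j = 0 then 0 else dpow (β - Pi.single j 1) (A - W)) •
      h (γ + β) W = if β j = 0 then 0 else F (β - Pi.single j 1) := by
      intro β _; rw [hF]
      split_ifs with h0
      · simp
      · simp only
        congr 2
        funext i
        by_cases hij : i = j
        · subst hij; simp
          omega
        · simp [hij]
    rw [sum_congr rfl e2, sum_mlt_single (m := r) j F]
    have e3 : ∑ β ∈ mlt n (r + 1), dpow β (A - W) • h (γ + Pi.single j 1 + β) W =
      ∑ β ∈ mlt n (r + 1), F β := by rw [hF]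
    have e4 : ∑ β ∈ mlt n (r + 1) \ mlt n r, dpow β (A - W) • h (γ + Pi.single j 1 + β) W =
      ∑ β ∈ mlt n (r + 1) \ mlt n r, F β := by rw [hF]
    rw [e3, e4, ← Finset.sum_sdiff (s₁ := mlt n r) (s₂ := mlt n (r + 1))]
    · simp
    · exact fun β hβ => mem_mlt.2 ((mem_mlt.1 hβ).trans (Nat.lt_succ_self r))
  rw [sum_congr rfl fun j _ => e1 j]
  refine (enorm_sum_le _ _).trans ?_
  have e5 : ∀ j ∈ (Finset.univ : Finset (Fin n)),
    ‖w j • ∑ β ∈ mlt n (r + 1) \ mlt n r, dpow β (A - W) • h (γ + Pi.single j 1 + β) W‖ₑ ≤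
    ofReal M * ((mlt n m).card * (ofReal (L ^ r) * topSum m h W)) := by
    intro j _; rw [enorm_smul]
    refine mul_le_mul' ?_ ?_
    · rw [enorm_eq_ofReal_abs]
      exact ofReal_le_ofReal ((PiLp.norm_apply_le w j).trans hw)
    · refine (enorm_sum_le _ _).trans ?_
      refine (sum_le_card_nsmul _ _ (ofReal (L ^ r) * topSum m h W) ?_).trans ?_
      · intro β hβ
        simp only [Finset.mem_sdiff, mem_mlt] at hβ
        have hβr : ∑ i, β i = r := by omega
        rw [enorm_smul]
        refine mul_le_mul' ?_ (enorm_le_topSum ?_ W)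
        · rw [enorm_eq_ofReal_abs]
          refine ofReal_le_ofReal ((abs_dpow_le β _).trans ?_)
          rw [hβr]; gcongr
        · simp only [Pi.add_apply, sum_add_distrib]; simp
          omega
      · rw [nsmul_eq_mul]; gcongr
        intro β hβ
        simp only [Finset.mem_sdiff, mem_mlt] at hβ ⊢
        omega
  refine (sum_le_sum e5).trans (le_of_eq ?_)
  rw [Finset.sum_const, nsmul_eq_mul, Finset.card_univ, Fintype.card_fin,
    ofReal_mul (by positivity), ofReal_mul (by positivity),
    ofReal_mul (by positivity)]
  simp only [ENNReal.ofReal_natCast]; ring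

/-- Variation of the Taylor polynomial of a jet along a segment. -/
theorem enorm_taylor_sub_le {m : ℕ} {h : Jet n l}
    (hd : ∀ α, ContDiff ℝ ∞ (h α)) {γ : Fin n → ℕ} (hγ : ∑ i, γ i < m) {A W w : Rn n} {t L M : ℝ}
    (ht : 0 ≤ t) (hj : ∀ τ ∈ Icc 0 t, ∀ α, ∑ i, α i < m → ∀ j,
      pd j (h α) (W + τ • w) = h (α + Pi.single j 1) (W + τ • w))
    (hL : ∀ τ ∈ Icc 0 t, ‖A - (W + τ • w)‖ ≤ L) (hw : ‖w‖ ≤ M) :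
    ‖taylor m (truncJet m h) γ A (W + t • w) - taylor m (truncJet m h) γ A W‖ₑ
      ≤ ofReal (n * (mlt n m).card * M * L ^ (m - 1 - ∑ i, γ i)) *
        ∫⁻ τ in Ioo 0 t, topSum m h (W + τ • w) := by
  have hder := fun τ (hτ : τ ∈ Icc 0 t) => hasDerivAt_taylor_segment (γ := γ)
    (fun α => (hd α).differentiable (by simp)) A W w τ (hj τ hτ)
  have hc : Continuous fun τ : ℝ => W + τ • w := by fun_prop
  have hdc : ∀ β, Continuous (dpow β : Rn n → ℝ) := fun β => (contDiff_dpow β).continuous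
  have hhc : ∀ α, Continuous fun τ : ℝ => h α (W + τ • w) := fun α => (hd α).continuous.comp hc
  have hpc : ∀ β, Continuous fun τ : ℝ => dpow β (A - (W + τ • w)) := fun β =>
    (hdc β).comp (continuous_const.sub hc)
  have gen : ∀ (c : ℝ) (a b : ℝ → ℝ) (u v : ℝ → Cl l), Continuous a → Continuous u →
    Continuous b → Continuous v → Continuous fun τ => c • (a τ • u τ - b τ • v τ) := by
    intros
    fun_prop
  have hcont : Continuous fun τ : ℝ => (∑ β ∈ mlt n (m - ∑ i, γ i), ∑ j, w j •
    (dpow β (A - (W + τ • w)) • h (γ + Pi.single j 1 + β) (W + τ • w)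
      - (if β j = 0 then 0 else dpow (β - Pi.single j 1) (A - (W + τ • w))) •
        h (γ + β) (W + τ • w))) := by
    refine continuous_finsetSum _ fun β _ => continuous_finsetSum _ fun j _ => ?_
    have q : Continuous fun τ : ℝ =>
      if β j = 0 then (0 : ℝ) else dpow (β - Pi.single j 1) (A - (W + τ • w)) := by
      split_ifs with h0
      · exact continuous_const
      · exact hpc _
    exact gen _ _ _ _ _ (hpc β) (hhc _) q (hhc _)
  have hi := intervalIntegral.integral_eq_sub_of_hasDerivAt (a := 0) (b := t)
    (fun τ hτ => hder τ (by rwa [uIcc_of_le ht] at hτ)) (hcont.intervalIntegrable 0 t)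
  simp only [zero_smul, add_zero] at hi
  rw [← hi, intervalIntegral.integral_of_le ht, integral_Ioc_eq_integral_Ioo]
  refine (enorm_integral_le_lintegral_enorm _).trans ?_
  rw [← lintegral_const_mul']
  · refine setLIntegral_mono' measurableSet_Ioo fun τ hτ => ?_
    exact enorm_taylor_deriv_le hγ (hL τ ⟨hτ.1.le, hτ.2.le⟩) hw
  · exact ofReal_ne_top

end Jets

/-! ### Geometry of Lipschitz domains -/

/-- Cone condition near `c`: from the points of the closure of `Ω` near `c`, the truncated cone
with axis `v` leads into `Ω`, away from the boundary. -/
structure LipDomain.IsCone {n : ℕ} (Ω : LipDomain n) (c v : Rn n) (κ r : ℝ) : Prop where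
  κ_pos : 0 < κ
  κ_le : κ ≤ 1
  r_pos : 0 < r
  norm_le : ‖v‖ ≤ 1
  cone : ∀ X ∈ closure Ω.carrier, dist X c < 4 * r → ∀ t, 0 < t → t < r → ∀ z, ‖z‖ ≤ κ →
    X + t • (v + z) ∈ Ω.carrier ∧ κ * (Ω.rho X + t) ≤ Ω.rho (X + t • (v + z))

/-- The points of `Ω` near `c` and near the boundary lie above a boundary point. -/
def LipDomain.HasFoot {n : ℕ} (Ω : LipDomain n) (c v : Rn n) (κ r : ℝ) : Prop :=
  ∀ X ∈ Ω.carrier, dist X c < 2 * r → Ω.rho X < κ * r →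
    ∃ Y ∈ Ω.bdry, ∃ t, X = Y + t • v ∧ Ω.rho X ≤ t ∧ κ * t ≤ Ω.rho X

theorem euclideanHausdorff_image_le {X Y : Type*} [EMetricSpace X] [EMetricSpace Y]
    [MeasurableSpace X] [BorelSpace X] [MeasurableSpace Y] [BorelSpace Y] {K : ℝ≥0} {f : X → Y}
    (h : LipschitzWith K f) (d : ℕ) (s : Set X) :
    (μHE[d] : Measure Y) (f '' s) ≤ (K : ℝ≥0∞) ^ d * (μHE[d] : Measure X) s := by
  rw [Measure.euclideanHausdorffMeasure_def, Measure.euclideanHausdorffMeasure_def,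
    Measure.smul_apply, Measure.smul_apply]
  have := h.hausdorffMeasure_image_le (d := d) (by positivity) s
  rw [ENNReal.rpow_natCast] at this
  simp only [ENNReal.smul_def, smul_eq_mul]
  calc _ ≤ _ := mul_le_mul_right this _
    _ = _ := by ring

namespace LipDomain

variable {n : ℕ} (Ω : LipDomain n)

theorem bdry_compact : IsCompact Ω.bdry :=
  Metric.isCompact_of_isClosed_isBounded isClosed_frontier
    ((Ω.isBounded.closure).subset frontier_subset_closure)

theorem rho_nonneg (X : Rn n) : 0 ≤ Ω.rho X := Metric.infDist_nonneg

theorem rho_le_dist (X : Rn n) {Y : Rn n} (hY : Y ∈ Ω.bdry) : Ω.rho X ≤ dist X Y :=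
  Metric.infDist_le_dist_of_mem hY

theorem rho_le_add (X Y : Rn n) : Ω.rho X ≤ Ω.rho Y + dist X Y :=
  Metric.infDist_le_infDist_add_dist

theorem continuous_rho : Continuous Ω.rho := Metric.continuous_infDist_pt _

theorem exists_rho_le : ∃ D > 0, ∀ X ∈ closure Ω.carrier, Ω.rho X ≤ D := by
  have hc : IsCompact (closure Ω.carrier) := Ω.isBounded.isCompact_closure
  obtain ⟨D, hD⟩ := (hc.image Ω.continuous_rho).isBounded.subset_closedBall 0
  refine ⟨max D 1, by positivity, fun X hX => ?_⟩
  have := hD (mem_image_of_mem _ hX)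
  rw [mem_closedBall_zero_iff, Real.norm_eq_abs] at this
  exact (le_abs_self _).trans (this.trans (le_max_left _ _))

theorem bdry_nonempty_of_mem {X : Rn n} (hX : X ∈ Ω.carrier) : Ω.bdry.Nonempty := by
  rw [Set.nonempty_iff_ne_empty]
  intro h
  have := Ω.rho_pos hX
  simp [rho, h] at this

theorem notMem_of_bdry {Y : Rn n} (hY : Y ∈ Ω.bdry) : Y ∉ Ω.carrier := by
  rw [bdry, Ω.isOpen.frontier_eq] at hY
  exact hY.2

theorem exists_isCone_of_mem {c : Rn n} (hc : c ∈ Ω.carrier) : ∃ κ r, Ω.IsCone c 0 κ r := by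
  obtain ⟨R, hR, hball⟩ := Metric.isOpen_iff.1 Ω.isOpen c hc
  have hρ := Ω.rho_pos hc
  set r := min (R / 8) (Ω.rho c / 8)
  have hr : 0 < r := by positivity
  have hr1 : r ≤ R / 8 := min_le_left _ _
  have hr2 : r ≤ Ω.rho c / 8 := min_le_right _ _
  refine ⟨1 / 4, r, by norm_num, by norm_num, hr, by simp, fun X _ hXc t ht htr z hz => ?_⟩
  have hd : dist (X + t • ((0 : Rn n) + z)) X ≤ t / 4 := by
    rw [dist_eq_norm, zero_add, add_sub_cancel_left, norm_smul, norm_of_nonneg ht.le]; nlinarith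
  constructor
  · apply hball
    have := dist_triangle (X + t • ((0 : Rn n) + z)) X c
    rw [mem_ball]; linarith
  · have h1 := Ω.rho_le_add X (X + t • ((0 : Rn n) + z))
    rw [dist_comm] at h1
    have h2 := Ω.rho_le_add c X
    rw [dist_comm] at h2; linarith

/-- Local geometry near a boundary point. -/
theorem exists_isCone_of_bdry {c : Rn n} (hc : c ∈ Ω.bdry) : ∃ v κ r, Ω.IsCone c v κ r ∧
    Ω.HasFoot c v κ r ∧
    (∃ C : ℝ, 0 < C ∧ ∀ Y, dist Y c < 2 * r → ∀ τ, 0 < τ → τ < r →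
      Ω.surf (ball Y τ) ≤ ofReal (C * τ ^ (n - 1))) ∧
    ∃ C : ℝ, 0 < C ∧ ∀ Y ∈ Ω.bdry, dist Y c < 2 * r → ∀ τ, 0 < τ → τ < r →
      ofReal (C * τ ^ (n - 1)) ≤ Ω.surf (ball Y τ) := by
  obtain ⟨N, O, e, φ, hO, hcov, hch⟩ := Ω.charts
  obtain ⟨j, hj⟩ := mem_iUnion.1 (hcov hc)
  obtain ⟨⟨M, hM⟩, hset⟩ := hch j
  have hOj := hO j
  generalize O j = O at *
  generalize e j = e at *
  generalize φ j = φ at *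
  obtain ⟨R, hR, hball⟩ := Metric.isOpen_iff.1 hOj c hj
  obtain ⟨D, hD, hρD⟩ := Ω.exists_rho_le
  set H : Rn n → ℝ := fun X => (e X).snd - φ (e X).fst with hH
  set v : Rn n := e.linearIsometryEquiv.symm (WithLp.toLp 2 (0, 1)) with hv
  have hnv : ‖v‖ = 1 := by rw [hv, LinearIsometryEquiv.norm_map]; simp
  have hM0 : (0 : ℝ) ≤ M := M.2
  have hdist : ∀ X Z : Rn n, dist (e X).fst (e Z).fst ≤ dist X Z ∧
    |(e X).snd - (e Z).snd| ≤ dist X Z := by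
    intro X Z
    have h1 := e.dist_map X Z
    rw [dist_eq_norm (e X)] at h1; rw [← h1, dist_eq_norm]
    exact ⟨WithLp.norm_fst_le _ (e X - e Z), WithLp.norm_snd_le _ (e X - e Z)⟩
  have hHlip : ∀ X Z, H X ≤ H Z + (1 + M) * dist X Z := by
    intro X Z
    obtain ⟨h1, h2⟩ := hdist X Z
    have h3 := hM.dist_le_mul (e X).fst (e Z).fst
    rw [Real.dist_eq] at h3
    have h4 : (M : ℝ) * dist (e X).fst (e Z).fst ≤ M * dist X Z := by gcongr
    have h5 := (abs_le.1 h2).2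
    have h6 := (abs_le.1 h3).1
    simp only [hH]; linarith
  have hHcont : Continuous H := by
    have h1 : Continuous fun X => (e X).snd := (WithLp.continuous_snd _ _ _).comp e.continuous
    have h2 : Continuous fun X => (e X).fst := (WithLp.continuous_fst _ _ _).comp e.continuous
    exact h1.sub (hM.continuous.comp h2)
  have hHv : ∀ X (t : ℝ), H (X + t • v) = H X + t := by
    intro X t
    have h1 : e (X + t • v) = e X + t • WithLp.toLp 2 ((0 : Rn (n - 1)), (1 : ℝ)) := by
      have := e.map_vadd X (t • v)
      simp only [vadd_eq_add] at this
      rw [add_comm X, this, add_comm, map_smul, hv]; simp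
    simp only [hH, h1]; simp
    ring
  have hmem : ∀ X ∈ O, (X ∈ Ω.carrier ↔ 0 < H X) := by
    intro X hX
    have : X ∈ O ∩ Ω.carrier ↔ X ∈ {X ∈ O | φ (e X).fst < (e X).snd} := by rw [hset]
    simp only [mem_inter_iff, hX, true_and, mem_ofPred_eq] at this
    rw [this, hH, sub_pos]
  have hcl : ∀ X ∈ O, X ∈ closure Ω.carrier → 0 ≤ H X := by
    intro X hX hXc
    by_contra hneg
    push Not at hneg
    have hopen : IsOpen (O ∩ {X | H X < 0}) := hOj.inter (isOpen_lt hHcont continuous_const)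
    obtain ⟨Z, hZ, hZΩ⟩ := mem_closure_iff.1 hXc _ hopen ⟨hX, hneg⟩
    have := (hmem Z hZ.1).1 hZΩ
    exact absurd hZ.2 (not_lt.2 this.le)
  have hb0 : ∀ X ∈ O, X ∈ Ω.bdry → H X = 0 := by
    intro X hX hXb
    refine le_antisymm ?_ (hcl X hX (frontier_subset_closure hXb))
    by_contra h
    push Not at h
    exact Ω.notMem_of_bdry hXb ((hmem X hX).2 h)
  have hb1 : ∀ X ∈ O, H X = 0 → X ∈ Ω.bdry := by
    intro X hX hX0; rw [bdry, Ω.isOpen.frontier_eq]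
    refine ⟨?_, fun h => absurd ((hmem X hX).1 h) (by simp [hX0])⟩
    have hlim : Tendsto (fun t : ℝ => X + t • v) (𝓝[>] 0) (𝓝 X) := by
      have : Continuous fun t : ℝ => X + t • v := by fun_prop
      have h := this.tendsto 0
      simp only [zero_smul, add_zero] at h
      exact h.mono_left nhdsWithin_le_nhds
    refine mem_closure_of_tendsto hlim ?_
    filter_upwards [hlim.eventually (hOj.mem_nhds hX), self_mem_nhdsWithin] with t ht ht0
    refine (hmem _ ht).2 ?_
    rw [hHv, hX0, zero_add]
    exact ht0
  set r := R / 16 with hr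
  have hr0 : 0 < r := by positivity
  have hOb : ∀ X, dist X c < 16 * r → X ∈ O := fun X hX => hball (by
    rw [mem_ball]
    linarith)
  have h1M : 0 < 1 + (M : ℝ) := by positivity
  set κ : ℝ := min (1 / (2 * (1 + M))) (2 * r / ((1 + M) * (D + r))) with hκ
  have hκ0 : 0 < κ := by positivity
  have hκ1 : κ * (1 + M) ≤ 1 / 2 := by
    have : κ ≤ 1 / (2 * (1 + M)) := min_le_left _ _
    rw [le_div_iff₀ (by positivity)] at this; linarith
  have hκ2 : κ * (1 + M) * (D + r) ≤ 2 * r := by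
    have : κ ≤ 2 * r / ((1 + M) * (D + r)) := min_le_right _ _
    rw [le_div_iff₀ (by positivity)] at this; linarith
  have hκle : κ ≤ 1 := by nlinarith
  have hκ3 : κ * (D + r) ≤ 2 * r := by
    have : κ * (D + r) * 1 ≤ κ * (D + r) * (1 + M) := by gcongr; linarith
    nlinarith
  have hne : Ω.bdry.Nonempty := ⟨c, hc⟩
  have hρlow : ∀ W, dist W c < 8 * r → 2 * r ≤ Ω.rho W ∨ H W ≤ (1 + M) * Ω.rho W := by
    intro W hW
    by_contra hcon
    push Not at hcon
    obtain ⟨h1, h2⟩ := hcon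
    obtain ⟨Y, hY, hYd⟩ := Ω.bdry_compact.exists_infDist_eq_dist hne W
    have hYd' : Ω.rho W = dist W Y := hYd
    have hYO : Y ∈ O := hOb Y (by
      have := dist_triangle Y W c
      rw [dist_comm Y W] at this
      linarith)
    have := hHlip W Y
    rw [hb0 Y hYO hY, ← hYd'] at this; linarith
  have hfoot : ∀ X, dist X c < 4 * r → 0 ≤ H X → H X < 2 * r →
    X - H X • v ∈ Ω.bdry ∧ Ω.rho X ≤ H X := by
    intro X hX h0 h1
    have hd : dist X (X - H X • v) = H X := by
      rw [dist_eq_norm, sub_sub_cancel, norm_smul, hnv, mul_one, norm_of_nonneg h0]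
    have hb : X - H X • v ∈ Ω.bdry := by
      apply hb1
      · apply hOb
        have := dist_triangle (X - H X • v) X c
        rw [dist_comm _ X, hd] at this; linarith
      · have := hHv X (-H X)
        rw [neg_smul, ← sub_eq_add_neg] at this; rw [this]; ring
    exact ⟨hb, (Ω.rho_le_dist X hb).trans hd.le⟩
  refine ⟨v, κ, r, ⟨hκ0, hκle, hr0, hnv.le, ?_⟩, ?_, ?_, ?_⟩
  · intro X hX hXc t ht htr z hz
    have hHX : 0 ≤ H X := hcl X (hOb X (by linarith)) hX
    have hvz : ‖v + z‖ ≤ 2 := by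
      have := norm_add_le v z
      linarith
    have hWX : dist (X + t • (v + z)) X ≤ 2 * t := by
      rw [dist_eq_norm, add_sub_cancel_left, norm_smul, norm_of_nonneg ht.le]; nlinarith
    have hWc : dist (X + t • (v + z)) c < 8 * r := by
      have := dist_triangle (X + t • (v + z)) X c
      linarith
    have hHW : H X + t / 2 ≤ H (X + t • (v + z)) := by
      have h1 := hHlip (X + t • v) (X + t • (v + z))
      rw [hHv] at h1
      have h2 : dist (X + t • v) (X + t • (v + z)) ≤ t * κ := by
        rw [dist_eq_norm]
        have : X + t • v - (X + t • (v + z)) = -(t • z) := by rw [smul_add]; abel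
        rw [this, norm_neg, norm_smul, norm_of_nonneg ht.le]; gcongr
      have h3 : (1 + (M : ℝ)) * dist (X + t • v) (X + t • (v + z)) ≤ t / 2 := by
        calc _ ≤ (1 + (M : ℝ)) * (t * κ) := by gcongr
          _ = t * (κ * (1 + M)) := by ring
          _ ≤ t * (1 / 2) := by gcongr
          _ = _ := by ring
      linarith
    have hWΩ : X + t • (v + z) ∈ Ω.carrier := (hmem _ (hOb _ (by linarith))).2 (by linarith)
    refine ⟨hWΩ, ?_⟩
    have hρX := hρD X hX
    have hρX0 := Ω.rho_nonneg X
    have hup : κ * (Ω.rho X + t) ≤ κ * (D + r) := by gcongr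
    rcases hρlow _ hWc with h | h
    · linarith
    · by_cases hHr : H X < 2 * r
      · have h1 := (hfoot X hXc hHX hHr).2
        have h2 : (1 + (M : ℝ)) * (κ * (Ω.rho X + t)) ≤ (1 + M) * Ω.rho (X + t • (v + z)) := by
          calc (1 + (M : ℝ)) * (κ * (Ω.rho X + t)) = (κ * (1 + M)) * (Ω.rho X + t) := by ring
            _ ≤ 1 / 2 * (Ω.rho X + t) := by gcongr
            _ ≤ _ := by linarith
        exact le_of_mul_le_mul_left h2 h1M
      · have h2 : (1 + (M : ℝ)) * (κ * (Ω.rho X + t)) ≤ (1 + M) * Ω.rho (X + t • (v + z)) := by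
          calc (1 + (M : ℝ)) * (κ * (Ω.rho X + t)) ≤ (1 + M) * (κ * (D + r)) := by gcongr
            _ = κ * (1 + M) * (D + r) := by ring
            _ ≤ _ := by linarith
        exact le_of_mul_le_mul_left h2 h1M
  · intro X hX hXc hXρ
    have hXρ' : Ω.rho X < r := hXρ.trans_le (by nlinarith)
    have hH0 : 0 < H X := (hmem X (hOb X (by linarith))).1 hX
    have hHρ : H X ≤ (1 + M) * Ω.rho X := by
      rcases hρlow X (by linarith) with h | h
      · linarith
      · exact h
    have hρ0 := Ω.rho_nonneg X
    have hHr : H X < 2 * r := by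
      have : (1 + (M : ℝ)) * Ω.rho X ≤ (1 + M) * (κ * r) := by gcongr
      have h2 : (1 + (M : ℝ)) * (κ * r) = κ * (1 + M) * r := by ring
      nlinarith
    obtain ⟨h1, h2⟩ := hfoot X (by linarith) hH0.le hHr
    refine ⟨_, h1, H X, by simp, h2, ?_⟩
    calc κ * H X ≤ κ * ((1 + M) * Ω.rho X) := by gcongr
      _ = κ * (1 + M) * Ω.rho X := by ring
      _ ≤ 1 / 2 * Ω.rho X := by gcongr
      _ ≤ _ := by linarith
  all_goals
    have hvol : ∀ (x : Rn (n - 1)) (τ : ℝ), 0 < τ → (μHE[n - 1] : Measure (Rn (n - 1))) (ball x τ) =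
      ofReal (τ ^ (n - 1)) * volume (ball (0 : Rn (n - 1)) 1) := by
      intro x τ hτ
      rw [EuclideanSpace.euclideanHausdorffMeasure_eq_volume, Measure.addHaar_ball_of_pos _ _ hτ]
      simp
    have hb1pos : 0 < volume (ball (0 : Rn (n - 1)) 1) := measure_ball_pos _ _ one_pos
    have hb1fin : volume (ball (0 : Rn (n - 1)) 1) < ⊤ := measure_ball_lt_top
    set V := volume (ball (0 : Rn (n - 1)) 1) with hV
    have hVreal : V = ofReal V.toReal := (ofReal_toReal hb1fin.ne).symm
    have hVpos : 0 < V.toReal := toReal_pos hb1pos.ne' hb1fin.ne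
    set Φ : Rn (n - 1) → Rn n := fun x => e.symm (WithLp.toLp 2 (x, φ x)) with hΦ
    have heΦ : ∀ x, e (Φ x) = WithLp.toLp 2 (x, φ x) := fun x => e.apply_symm_apply _
    have hHΦ : ∀ x, H (Φ x) = 0 := fun x => by simp [hH, heΦ]
    have hΦe : ∀ X, H X = 0 → X = Φ (e X).fst := by
      intro X hX
      apply e.injective
      rw [heΦ]
      have : (e X).snd = φ (e X).fst := by
        simp only [hH] at hX
        linarith
      rw [← this]; rfl
    have hΦlip : LipschitzWith (1 + M) Φ := by
      refine LipschitzWith.of_dist_le_mul fun x y => ?_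
      simp only [hΦ]; rw [e.symm.dist_map, dist_eq_norm]
      have h1 : ∀ (a : Rn (n - 1)) (b : ℝ), ‖WithLp.toLp 2 (a, b)‖ ≤ ‖a‖ + |b| := by
        intro a b; rw [WithLp.prod_norm_eq_of_L2, Real.sqrt_le_left (by positivity)]
        change ‖a‖ ^ 2 + |b| ^ 2 ≤ (‖a‖ + |b|) ^ 2
        nlinarith [norm_nonneg a, abs_nonneg b]
      have h2 := hM.dist_le_mul x y
      rw [Real.dist_eq] at h2
      have h3 := h1 (x - y) (φ x - φ y)
      rw [← dist_eq_norm] at h3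
      refine h3.trans ?_
      push_cast; linarith
  · refine ⟨(1 + (M : ℝ)) ^ (n - 1) * V.toReal, by positivity, fun Y hY τ hτ hτr => ?_⟩
    rw [surf, Measure.restrict_apply measurableSet_ball]
    have hsub : ball Y τ ∩ Ω.bdry ⊆ Φ '' ball (e Y).fst τ := by
      rintro X ⟨hX1, hX2⟩
      rw [mem_ball] at hX1
      have hXO : X ∈ O := hOb X (by
        have := dist_triangle X Y c
        linarith)
      refine ⟨(e X).fst, ?_, (hΦe X (hb0 X hXO hX2)).symm⟩
      rw [mem_ball]
      exact ((hdist X Y).1).trans_lt hX1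
    refine (measure_mono hsub).trans ((euclideanHausdorff_image_le hΦlip (n - 1) _).trans ?_)
    rw [hvol _ _ hτ, hVreal, ← ofReal_mul (by positivity)]
    have : (((1 + M : ℝ≥0)) : ℝ≥0∞) ^ (n - 1) = ofReal ((1 + M) ^ (n - 1)) := by
      rw [ENNReal.ofReal_pow (by positivity)]; congr 1
      rw [← NNReal.coe_one, ← NNReal.coe_add, ENNReal.ofReal_coe_nnreal]
    rw [this, ← ofReal_mul (by positivity)]
    refine ofReal_le_ofReal (le_of_eq ?_)
    rw [ENNReal.toReal_ofReal toReal_nonneg]; ring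
  · refine ⟨V.toReal * ((1 + (M : ℝ)) ^ (n - 1))⁻¹, by positivity, fun Y hYb hY τ hτ hτr => ?_⟩
    rw [surf, Measure.restrict_apply measurableSet_ball]
    have hY0 : H Y = 0 := hb0 Y (hOb Y (by linarith)) hYb
    have hproj : LipschitzWith 1 fun X : Rn n => (e X).fst := by
      refine LipschitzWith.of_dist_le_mul fun X Z => ?_
      simpa using (hdist X Z).1
    have hsub : ball (e Y).fst (τ / (1 + M)) ⊆
      (fun X : Rn n => (e X).fst) '' (ball Y τ ∩ Ω.bdry) := by
      intro x hx
      have h1 : dist (Φ x) Y < τ := by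
        rw [mem_ball, lt_div_iff₀ h1M] at hx
        have := hΦlip.dist_le_mul x (e Y).fst
        rw [← hΦe Y hY0] at this
        push_cast at this
        linarith
      refine ⟨Φ x, ⟨h1, hb1 _ (hOb _ ?_) (hHΦ x)⟩, by simp [heΦ]⟩
      have := dist_triangle (Φ x) Y c
      linarith
    have h1 := (measure_mono hsub).trans (euclideanHausdorff_image_le hproj (n - 1) _)
    rw [hvol _ _ (by positivity), hVreal, ← ofReal_mul (by positivity)] at h1
    simp only [ENNReal.coe_one, one_pow, one_mul] at h1
    refine le_trans (le_of_eq ?_) h1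
    congr 1; rw [div_pow]; field_simp

end LipDomain

/-! ### Integral estimates -/

section Real

theorem rpow_le_of_comparable {x y K : ℝ} (e : ℝ) (hx : 0 < x) (hy : 0 < y) (h1 : y ≤ K * x)
    (h2 : x ≤ K * y) : y ^ e ≤ K ^ |e| * x ^ e := by
  have hK : 0 < K := by
    by_contra h
    push Not at h
    nlinarith
  rcases le_total 0 e with he | he
  · rw [abs_of_nonneg he, ← mul_rpow hK.le hx.le]
    exact Real.rpow_le_rpow hy.le h1 he
  · rw [abs_of_nonpos he]
    have h3 : x / K ≤ y := by rw [div_le_iff₀ hK]; linarith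
    calc y ^ e ≤ (x / K) ^ e := Real.rpow_le_rpow_of_nonpos (by positivity) h3 he
      _ = _ := by rw [Real.div_rpow hx.le hK.le, rpow_neg hK.le]; ring

theorem lintegral_rpow_Ioo {b R : ℝ} (hb : -1 < b) (hR : 0 ≤ R) :
    ∫⁻ u in Ioo 0 R, ofReal (u ^ b) = ofReal (R ^ (b + 1) / (b + 1)) := by
  have hi : IntervalIntegrable (fun u : ℝ => u ^ b) volume 0 R :=
    intervalIntegral.intervalIntegrable_rpow' hb
  have h := integral_rpow (a := 0) (b := R) (r := b) (Or.inl hb)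
  rw [intervalIntegral.integral_of_le hR, integral_Ioc_eq_integral_Ioo,
    Real.zero_rpow (by linarith), sub_zero] at h
  rw [← h, ofReal_integral_eq_lintegral_ofReal]
  · exact ((intervalIntegrable_iff_integrableOn_Ioo_of_le hR).1 hi)
  · filter_upwards [ae_restrict_mem measurableSet_Ioo] with u hu
    exact rpow_nonneg hu.1.le _

theorem lintegral_rpow_Ioo_le {b x R : ℝ} (hb : b < -1) (hx : 0 < x) :
    ∫⁻ u in Ioo x R, ofReal (u ^ b) ≤ ofReal (x ^ (b + 1) / (-(b + 1))) := by
  rcases le_or_gt x R with hR | hR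
  · have h0 : (0 : ℝ) ∉ uIcc x R := by
      rw [uIcc_of_le hR]
      exact fun h => absurd h.1 (not_le.2 hx)
    have hi : IntervalIntegrable (fun u : ℝ => u ^ b) volume x R :=
      intervalIntegral.intervalIntegrable_rpow (Or.inr h0)
    have h := integral_rpow (a := x) (b := R) (r := b) (Or.inr ⟨by linarith, h0⟩)
    rw [intervalIntegral.integral_of_le hR, integral_Ioc_eq_integral_Ioo] at h
    have h2 : R ^ (b + 1) ≥ 0 := rpow_nonneg (hx.le.trans hR) _
    rw [← ofReal_integral_eq_lintegral_ofReal, h]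
    · refine ofReal_le_ofReal ?_
      rw [div_neg, ← neg_div]
      exact (div_le_div_right_of_neg (by linarith)).2 (by linarith)
    · exact ((intervalIntegrable_iff_integrableOn_Ioo_of_le hR).1 hi)
    · filter_upwards [ae_restrict_mem measurableSet_Ioo] with u hu
      exact rpow_nonneg (hx.le.trans hu.1.le) _
  · rw [Ioo_eq_empty (by linarith)]; simp

theorem measurable_ofReal_rpow (b : ℝ) : Measurable fun t : ℝ => ofReal (t ^ b) :=
  (measurable_id.pow_const b).ennreal_ofReal

/-- A weighted Hardy inequality. -/
theorem exists_hardy {P a : ℝ} (hP : 1 < P) (ha : a < 1 - 1 / P) :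
    ∃ C : ℝ, 0 ≤ C ∧ ∀ (G : ℝ → ℝ≥0∞), Measurable G → ∀ δ : ℝ,
      ∫⁻ t in Ioo 0 δ, ofReal (t ^ (P * a - P)) * (∫⁻ τ in Ioo 0 t, G τ) ^ P ≤
        ofReal C * ∫⁻ t in Ioo 0 δ, ofReal (t ^ (P * a)) * G t ^ P := by
  have hP0 : 0 < P := by linarith
  obtain ⟨q, hpq⟩ : ∃ q, P.HolderConjugate q := ⟨_, Real.HolderConjugate.conjExponent hP⟩
  have hq0 : 0 < q := hpq.symm.pos
  have hinv : 1 / q = 1 - 1 / P := by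
    have := hpq.inv_add_inv_eq_one
    rw [one_div, one_div]; linarith
  obtain ⟨d, hda, hdq⟩ : ∃ d, a < d ∧ d < 1 / q := exists_between (by rw [hinv]; exact ha)
  have hdq' : d * q < 1 := by rwa [lt_div_iff₀ hq0] at hdq
  set K := (1 / (1 - d * q)) ^ (P / q)
  have hK : 0 ≤ K := rpow_nonneg (by apply one_div_nonneg.2; linarith) _
  set e := P * a - 1 - d * P
  have he : e < -1 := by
    have : P * (a - d) < 0 := mul_neg_of_pos_of_neg hP0 (by linarith)
    simp only [e]; linarith
  have hPq : P / q = P - 1 := by rw [div_eq_mul_one_div, hinv]; field_simp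
  refine ⟨K * (1 / (-(e + 1))), mul_nonneg hK (one_div_nonneg.2 (by linarith)), fun G hG δ => ?_⟩
  have hhol : ∀ t : ℝ, 0 < t → (∫⁻ τ in Ioo 0 t, G τ) ^ P ≤
    ofReal (K * t ^ ((1 - d * q) * (P / q))) * ∫⁻ τ in Ioo 0 t, ofReal (τ ^ (d * P)) * G τ ^ P := by
    intro t ht
    have h1 : ∫⁻ τ in Ioo 0 t, G τ = ∫⁻ τ in Ioo 0 t,
      ((fun τ => ofReal (τ ^ d) * G τ) * fun τ => ofReal (τ ^ (-d))) τ := by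
      refine setLIntegral_congr_fun measurableSet_Ioo fun τ hτ => ?_
      simp only [Pi.mul_apply]
      rw [mul_right_comm, ← ofReal_mul (rpow_nonneg hτ.1.le _), ← rpow_add hτ.1]; simp
    have h2 := ENNReal.lintegral_mul_le_Lp_mul_Lq (volume.restrict (Ioo 0 t)) hpq
      (f := fun τ => ofReal (τ ^ d) * G τ) (g := fun τ => ofReal (τ ^ (-d)))
      (((measurable_ofReal_rpow d).mul hG).aemeasurable) (measurable_ofReal_rpow _).aemeasurable
    rw [← h1] at h2
    have h3 : ∫⁻ τ in Ioo 0 t, ofReal (τ ^ (-d)) ^ q = ofReal (t ^ (1 - d * q) / (1 - d * q)) := by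
      rw [← show -(d * q) + 1 = 1 - d * q by ring, ← lintegral_rpow_Ioo (by linarith) ht.le]
      refine setLIntegral_congr_fun measurableSet_Ioo fun τ hτ => ?_
      rw [ofReal_rpow_of_pos (Real.rpow_pos_of_pos hτ.1 _), ← rpow_mul hτ.1.le]; ring_nf
    have h4 : ∀ τ ∈ Ioo 0 t, (ofReal (τ ^ d) * G τ) ^ P = ofReal (τ ^ (d * P)) * G τ ^ P := by
      intro τ hτ
      rw [mul_rpow_of_nonneg _ _ hP0.le,
        ofReal_rpow_of_pos (Real.rpow_pos_of_pos hτ.1 _), ← rpow_mul hτ.1.le]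
    rw [h3, setLIntegral_congr_fun measurableSet_Ioo h4] at h2
    have h5 := rpow_le_rpow h2 hP0.le
    refine h5.trans (le_of_eq ?_)
    rw [mul_rpow_of_nonneg _ _ hP0.le, ← ENNReal.rpow_mul, ← ENNReal.rpow_mul,
      one_div_mul_cancel hP0.ne', ENNReal.rpow_one, mul_comm]
    congr 1
    have hpos : 0 < 1 - d * q := by linarith
    rw [ofReal_rpow_of_pos (by positivity)]; congr 1
    rw [div_eq_mul_one_div, mul_rpow (by positivity) (by positivity), mul_comm, ← rpow_mul ht.le]
    have : 1 / q * P = P / q := by ring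
    rw [this]
  have hexp : P * a - P + (1 - d * q) * (P / q) = e := by
    have : (1 - d * q) * (P / q) = P / q - d * P := by field_simp
    rw [this, hPq]
    simp only [e]; ring
  calc ∫⁻ t in Ioo 0 δ, ofReal (t ^ (P * a - P)) * (∫⁻ τ in Ioo 0 t, G τ) ^ P
      ≤ ∫⁻ t in Ioo 0 δ, ofReal K * (∫⁻ τ in Ioo 0 δ, (Iio t).indicator 1 τ *
        (ofReal (t ^ e) * (ofReal (τ ^ (d * P)) * G τ ^ P))) := by
        refine setLIntegral_mono' measurableSet_Ioo fun t ht => ?_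
        refine (mul_le_mul_right (hhol t ht.1) _).trans (le_of_eq ?_)
        rw [← mul_assoc, ← ofReal_mul (rpow_nonneg ht.1.le _), mul_left_comm,
          ← rpow_add ht.1, hexp, ofReal_mul hK, mul_assoc]
        congr 1
        rw [← lintegral_ofReal_mul, ← lintegral_indicator measurableSet_Ioo,
          ← lintegral_indicator measurableSet_Ioo]
        congr 1
        funext τ
        by_cases h1 : τ ∈ Ioo 0 t
        · have h2 : τ ∈ Ioo 0 δ := ⟨h1.1, h1.2.trans ht.2⟩
          rw [indicator_of_mem h1, indicator_of_mem h2, indicator_of_mem (show τ ∈ Iio t from h1.2)]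
          simp
        · rw [indicator_of_notMem h1]
          by_cases h2 : τ ∈ Ioo 0 δ
          · have h3 : τ ∉ Iio t := fun h => h1 ⟨h2.1, h⟩
            rw [indicator_of_mem h2, indicator_of_notMem h3, zero_mul]
          · rw [indicator_of_notMem h2]
    _ = ofReal K * ∫⁻ τ in Ioo 0 δ, ∫⁻ t in Ioo 0 δ, (Iio t).indicator 1 τ *
      (ofReal (t ^ e) * (ofReal (τ ^ (d * P)) * G τ ^ P)) := by
      rw [lintegral_ofReal_mul, lintegral_lintegral_swap]
      have hs : MeasurableSet {x : ℝ × ℝ | x.2 < x.1} := measurableSet_lt measurable_snd measurable_fst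
      have : Measurable fun x : ℝ × ℝ => ({x : ℝ × ℝ | x.2 < x.1}.indicator 1 x : ℝ≥0∞) *
        (ofReal (x.1 ^ e) * (ofReal (x.2 ^ (d * P)) * G x.2 ^ P)) :=
        (measurable_one.indicator hs).mul (by fun_prop)
      exact this.aemeasurable
    _ ≤ ofReal K * ∫⁻ τ in Ioo 0 δ, ofReal (1 / (-(e + 1))) * (ofReal (τ ^ (P * a)) * G τ ^ P) := by
      gcongr ofReal K * ?_
      refine setLIntegral_mono' measurableSet_Ioo fun τ hτ => ?_
      have h1 : ∫⁻ t in Ioo 0 δ, (Iio t).indicator 1 τ *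
        (ofReal (t ^ e) * (ofReal (τ ^ (d * P)) * G τ ^ P)) =
        ∫⁻ t in Ioo τ δ, ofReal (t ^ e) * (ofReal (τ ^ (d * P)) * G τ ^ P) := by
        rw [← lintegral_indicator measurableSet_Ioo, ← lintegral_indicator measurableSet_Ioo]
        congr 1
        funext t
        by_cases h1 : t ∈ Ioo τ δ
        · have h2 : t ∈ Ioo 0 δ := ⟨hτ.1.trans h1.1, h1.2⟩
          have h3 : τ ∈ Iio t := h1.1
          rw [indicator_of_mem h1, indicator_of_mem h2, indicator_of_mem h3]; simp
        · rw [indicator_of_notMem h1]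
          by_cases h2 : t ∈ Ioo 0 δ
          · have h3 : τ ∉ Iio t := fun h => h1 ⟨h, h2.2⟩
            rw [indicator_of_mem h2, indicator_of_notMem h3, zero_mul]
          · rw [indicator_of_notMem h2]
      rw [h1, lintegral_mul_const _ (measurable_ofReal_rpow e)]
      refine (mul_le_mul_left (lintegral_rpow_Ioo_le he hτ.1) _).trans (le_of_eq ?_)
      rw [← mul_assoc, ← mul_assoc, ← ofReal_mul, ← ofReal_mul]
      · congr 2
        have : P * a = e + 1 + d * P := by simp only [e]; ring
        rw [this, rpow_add hτ.1 (e + 1)]; ring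
      · exact one_div_nonneg.2 (by linarith)
      · exact div_nonneg (rpow_nonneg hτ.1.le _) (by linarith)
    _ = _ := by rw [lintegral_ofReal_mul, ← mul_assoc, ← ofReal_mul hK]

end Real

namespace LipDomain

variable {n : ℕ} (Ω : LipDomain n)

/-- A boundary chart: a cone direction, an opening and a size. -/
structure Chart where
  c : Rn n
  v : Rn n
  κ : ℝ
  r : ℝ
  cone : Ω.IsCone c v κ r
  foot : Ω.HasFoot c v κ r
  upper : ∃ C : ℝ, 0 < C ∧ ∀ Y, dist Y c < 2 * r → ∀ τ, 0 < τ → τ < r →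
    Ω.surf (ball Y τ) ≤ ofReal (C * τ ^ (n - 1))
  lower : ∃ C : ℝ, 0 < C ∧ ∀ Y ∈ Ω.bdry, dist Y c < 2 * r → ∀ τ, 0 < τ → τ < r →
    ofReal (C * τ ^ (n - 1)) ≤ Ω.surf (ball Y τ)

theorem exists_chart {c : Rn n} (hc : c ∈ Ω.bdry) : ∃ χ : Ω.Chart, χ.c = c := by
  obtain ⟨v, κ, r, h1, h2, h3, h4⟩ := Ω.exists_isCone_of_bdry hc
  exact ⟨⟨c, v, κ, r, h1, h2, h3, h4⟩, rfl⟩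

theorem exists_atlas : ∃ T : Finset Ω.Chart, Ω.bdry ⊆ ⋃ χ ∈ T, ball χ.c (χ.r / 4) := by
  classical
  choose χ hχ using fun c : Ω.bdry => Ω.exists_chart c.2
  obtain ⟨t, ht⟩ := Ω.bdry_compact.elim_nhds_subcover' (fun x hx => ball x ((χ ⟨x, hx⟩).r / 4))
    (fun x hx => ball_mem_nhds x (by have := (χ ⟨x, hx⟩).cone.r_pos; positivity))
  refine ⟨t.image χ, fun Y hY => ?_⟩
  obtain ⟨x, hx, hYx⟩ := mem_iUnion₂.1 (ht hY)
  exact mem_iUnion₂.2 ⟨χ x, Finset.mem_image_of_mem _ hx, by rw [hχ]; exact hYx⟩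

theorem exists_surf_ball_le : ∃ C : ℝ, 0 < C ∧ ∀ Y τ, 0 < τ →
    Ω.surf (ball Y τ) ≤ ofReal (C * τ ^ (n - 1)) := by
  obtain ⟨T, hT⟩ := Ω.exists_atlas
  choose C hC0 hC using fun χ : Ω.Chart => χ.upper
  refine ⟨∑ χ ∈ T, C χ + 1, by
    have := sum_nonneg fun χ (_ : χ ∈ T) => (hC0 χ).le
    linarith, fun Y τ hτ => ?_⟩
  have h1 : ∀ χ : Ω.Chart, Ω.surf (ball Y τ ∩ ball χ.c (χ.r / 4)) ≤ ofReal (C χ * τ ^ (n - 1)) := by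
    intro χ
    have hr := χ.cone.r_pos
    rcases lt_or_ge τ (χ.r / 4) with h | h
    · rcases (ball Y τ ∩ ball χ.c (χ.r / 4)).eq_empty_or_nonempty with h0 | ⟨Z, hZ⟩
      · rw [h0]; simp
      · refine (measure_mono inter_subset_left).trans (hC χ Y ?_ τ hτ (by linarith))
        have e1 := mem_ball.1 hZ.1
        have e2 := mem_ball.1 hZ.2
        rw [dist_comm] at e1; linarith [dist_triangle Y Z χ.c]
    · refine (measure_mono inter_subset_right).trans
        ((hC χ χ.c (by simp; linarith) (χ.r / 4) (by positivity) (by linarith)).trans ?_)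
      exact ofReal_le_ofReal (by have := (hC0 χ).le; gcongr)
  calc Ω.surf (ball Y τ) = Ω.surf (ball Y τ ∩ Ω.bdry) := by
        rw [surf, Measure.restrict_apply measurableSet_ball,
          Measure.restrict_apply (measurableSet_ball.inter
            Ω.bdry_compact.isClosed.measurableSet), inter_assoc, inter_self]
    _ ≤ Ω.surf (⋃ χ ∈ T, ball Y τ ∩ ball χ.c (χ.r / 4)) := by
      refine measure_mono fun Z hZ => ?_
      obtain ⟨χ, hχ, h⟩ := mem_iUnion₂.1 (hT hZ.2)
      exact mem_iUnion₂.2 ⟨χ, hχ, hZ.1, h⟩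
    _ ≤ ∑ χ ∈ T, Ω.surf (ball Y τ ∩ ball χ.c (χ.r / 4)) := measure_biUnion_finset_le _ _
    _ ≤ ∑ χ ∈ T, ofReal (C χ * τ ^ (n - 1)) := sum_le_sum fun χ _ => h1 χ
    _ = ofReal ((∑ χ ∈ T, C χ) * τ ^ (n - 1)) := by
      rw [sum_mul, ofReal_sum_of_nonneg]
      intro χ _
      have := (hC0 χ).le
      positivity
    _ ≤ _ := ofReal_le_ofReal (by gcongr; linarith)

theorem ae_surf_mem : ∀ᵐ Y ∂Ω.surf, Y ∈ Ω.bdry :=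
  ae_restrict_mem Ω.bdry_compact.isClosed.measurableSet

instance : IsFiniteMeasure Ω.surf := by
  obtain ⟨C, hC0, hC⟩ := Ω.exists_surf_ball_le
  obtain ⟨R, hR⟩ := Ω.bdry_compact.isBounded.subset_ball 0
  refine ⟨?_⟩
  have h : Ω.surf univ ≤ Ω.surf (ball 0 (max R 1)) := by
    refine measure_mono_ae ?_
    filter_upwards [Ω.ae_surf_mem] with Y hY _
    exact ball_subset_ball (le_max_left _ _) (hR hY)
  exact h.trans_lt ((hC 0 (max R 1) (by positivity)).trans_lt ofReal_lt_top)

theorem lintegral_wMeas (b : ℝ) {F : Rn n → ℝ≥0∞} (hF : Measurable F) {s : Set (Rn n)}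
    (hs : MeasurableSet s) : ∫⁻ X in s, F X ∂Ω.wMeas b =
      ∫⁻ X in s ∩ Ω.carrier, ofReal (Ω.rho X ^ b) * F X := by
  rw [wMeas, restrict_withDensity hs, lintegral_withDensity_eq_lintegral_mul _
    (Ω.measurable_density b) hF, Measure.restrict_restrict hs]
  rfl

theorem lintegral_ball_comp {t : ℝ} (ht : 0 < t) {F : Rn n → ℝ≥0∞} (hF : Measurable F)
    (A : Rn n) (κ : ℝ) : ∫⁻ z in ball 0 κ, F (A + t • z) =
      ofReal (t ^ n)⁻¹ * ∫⁻ W, (ball A (κ * t)).indicator F W := by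
  have e1 : ∀ z : Rn n, (ball (0 : Rn n) κ).indicator (fun z => F (A + t • z)) z =
    (ball A (κ * t)).indicator F (A + t • z) := by
    intro z
    have : z ∈ ball (0 : Rn n) κ ↔ A + t • z ∈ ball A (κ * t) := by
      rw [mem_ball_zero_iff, mem_ball, dist_eq_norm, add_sub_cancel_left, norm_smul,
        norm_of_nonneg ht.le, mul_comm κ, mul_lt_mul_iff_right₀ ht]
    by_cases h : z ∈ ball (0 : Rn n) κ
    · rw [indicator_of_mem h, indicator_of_mem (this.1 h)]
    · rw [indicator_of_notMem h, indicator_of_notMem (fun h' => h (this.2 h'))]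
  have hm : Measurable ((ball A (κ * t)).indicator F) := hF.indicator measurableSet_ball
  rw [← lintegral_indicator measurableSet_ball]
  simp_rw [e1]
  have e2 := lintegral_map (μ := (volume : Measure (Rn n)))
    (f := fun z' => (ball A (κ * t)).indicator F (A + z')) (g := fun z : Rn n => t • z)
    (hm.comp (measurable_const_add A)) (measurable_const_smul t)
  rw [← e2, Measure.map_addHaar_smul _ ht.ne', lintegral_smul_measure,
    lintegral_add_left_eq_self (fun z => (ball A (κ * t)).indicator F z)]
  rw [finrank_euclideanSpace_fin, abs_of_pos (by positivity), smul_eq_mul]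

namespace Chart

variable {Ω} (χ : Ω.Chart)

/-- The measure `dσ_Y dt dz` on the parameters of the truncated cones of a chart. -/
def coneM : Measure (Rn n × ℝ × Rn n) :=
  (Ω.surf.restrict (ball χ.c χ.r)).prod
    ((volume.restrict (Ioo 0 χ.r)).prod (volume.restrict (ball 0 χ.κ)))

/-- The point `Y + t (v + z)` with parameters `(Y, t, z)`. -/
def map (q : Rn n × ℝ × Rn n) : Rn n := q.1 + q.2.1 • (χ.v + q.2.2)

theorem continuous_map : Continuous χ.map := by
  unfold map
  fun_prop

/-- The density of the image of `t ^ b dσ_Y dt dz`. -/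
def coneK (b : ℝ) (W : Rn n) : ℝ≥0∞ :=
  ∫⁻ Y in ball χ.c χ.r, (∫⁻ t in Ioo 0 χ.r, ofReal (t ^ (b - n)) *
    (ball (Y + t • χ.v) (χ.κ * t)).indicator 1 W) ∂Ω.surf

theorem lintegral_coneM {F : Rn n × ℝ × Rn n → ℝ≥0∞} (hF : Measurable F) :
    ∫⁻ q, F q ∂χ.coneM = ∫⁻ Y in ball χ.c χ.r,
      (∫⁻ t in Ioo 0 χ.r, (∫⁻ z in ball 0 χ.κ, F (Y, t, z))) ∂Ω.surf := by
  rw [coneM, lintegral_prod _ hF.aemeasurable]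
  refine lintegral_congr fun Y => ?_
  rw [lintegral_prod (fun q => F (Y, q)) (hF.comp measurable_prodMk_left).aemeasurable]

theorem measurable_coneKer (b : ℝ) : Measurable fun q : Rn n × ℝ × Rn n =>
    ofReal (q.2.1 ^ b) * (ball (q.1 + q.2.1 • χ.v) (χ.κ * q.2.1)).indicator
      (1 : Rn n → ℝ≥0∞) q.2.2 := by
  have hset : MeasurableSet {q : Rn n × ℝ × Rn n | q.2.2 ∈ ball (q.1 + q.2.1 • χ.v)
    (χ.κ * q.2.1)} := by
    simp only [mem_ball]
    exact measurableSet_lt (by fun_prop) (by fun_prop)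
  refine ((measurable_ofReal_rpow _).comp (by fun_prop)).mul ?_
  have : (fun q : Rn n × ℝ × Rn n =>
    (ball (q.1 + q.2.1 • χ.v) (χ.κ * q.2.1)).indicator (1 : Rn n → ℝ≥0∞) q.2.2) =
    {q : Rn n × ℝ × Rn n | q.2.2 ∈ ball (q.1 + q.2.1 • χ.v) (χ.κ * q.2.1)}.indicator 1 := by
    funext q
    simp only [indicator, mem_ofPred_eq, Pi.one_apply]
  rw [this]
  exact measurable_const.indicator hset

theorem lintegral_map (b : ℝ) {F : Rn n → ℝ≥0∞} (hF : Measurable F) :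
    ∫⁻ q, ofReal (q.2.1 ^ b) * F (χ.map q) ∂χ.coneM = ∫⁻ W, F W * χ.coneK b W := by
  have hmap := χ.continuous_map.measurable
  have hker := χ.measurable_coneKer (b - n)
  have hG : Measurable fun q : Rn n × ℝ × Rn n => F q.2.2 * (ofReal (q.2.1 ^ (b - n)) *
    (ball (q.1 + q.2.1 • χ.v) (χ.κ * q.2.1)).indicator 1 q.2.2) :=
    (hF.comp (by fun_prop)).mul hker
  rw [χ.lintegral_coneM (F := fun q => ofReal (q.2.1 ^ b) * F (χ.map q)) (by fun_prop)]
  calc _ = ∫⁻ Y in ball χ.c χ.r, (∫⁻ t in Ioo 0 χ.r, (∫⁻ W, F W *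
        (ofReal (t ^ (b - n)) * (ball (Y + t • χ.v) (χ.κ * t)).indicator 1 W))) ∂Ω.surf := by
        refine lintegral_congr fun Y => setLIntegral_congr_fun measurableSet_Ioo fun t ht => ?_
        have h1 : ∀ z, χ.map (Y, t, z) = (Y + t • χ.v) + t • z := by
          intro z
          simp only [map, smul_add, add_assoc]
        simp only [h1]
        rw [lintegral_const_mul (f := fun z => F (Y + t • χ.v + t • z)) _ (hF.comp (by fun_prop)),
          lintegral_ball_comp ht.1 hF,
          ← mul_assoc, ← ofReal_mul (rpow_nonneg ht.1.le _), Real.rpow_sub_natCast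
          ht.1.ne', ← div_eq_mul_inv, ← lintegral_const_mul _
          (hF.indicator measurableSet_ball)]
        refine lintegral_congr fun W => ?_
        by_cases h : W ∈ ball (Y + t • χ.v) (χ.κ * t)
        · rw [indicator_of_mem h, indicator_of_mem h, Pi.one_apply, mul_one, mul_comm]
        · rw [indicator_of_notMem h, indicator_of_notMem h, mul_zero, mul_zero]
    _ = ∫⁻ Y in ball χ.c χ.r, (∫⁻ W, (∫⁻ t in Ioo 0 χ.r, F W * (ofReal (t ^ (b - n)) *
      (ball (Y + t • χ.v) (χ.κ * t)).indicator 1 W))) ∂Ω.surf := by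
      refine lintegral_congr fun Y => ?_
      exact lintegral_lintegral_swap (hG.comp (measurable_prodMk_left (x := Y))).aemeasurable
    _ = ∫⁻ W, (∫⁻ Y in ball χ.c χ.r, (∫⁻ t in Ioo 0 χ.r, F W * (ofReal (t ^ (b - n)) *
      (ball (Y + t • χ.v) (χ.κ * t)).indicator 1 W)) ∂Ω.surf) := by
      refine lintegral_lintegral_swap (Measurable.aemeasurable ?_)
      refine Measurable.lintegral_prod_right' (f := fun q : (Rn n × Rn n) × ℝ => F q.1.2 *
        (ofReal (q.2 ^ (b - n)) *
        (ball (q.1.1 + q.2 • χ.v) (χ.κ * q.2)).indicator 1 q.1.2)) ?_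
      exact hG.comp (g := fun q : Rn n × ℝ × Rn n => _)
        (f := fun q : (Rn n × Rn n) × ℝ => (q.1.1, q.2, q.1.2)) (by fun_prop)
    _ = _ := by
      refine lintegral_congr fun W => ?_
      rw [coneK, ← lintegral_const_mul]
      · refine lintegral_congr fun Y => ?_
        rw [← lintegral_const_mul]
        exact hker.comp (g := fun q : Rn n × ℝ × Rn n => _)
          (f := fun t : ℝ => (Y, t, W)) (by fun_prop)
      · exact Measurable.lintegral_prod_right' (f := fun q : Rn n × ℝ =>
          ofReal (q.2 ^ (b - n)) *
          (ball (q.1 + q.2 • χ.v) (χ.κ * q.2)).indicator (1 : Rn n → ℝ≥0∞) W)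
          (hker.comp (g := fun q : Rn n × ℝ × Rn n => _)
            (f := fun q : Rn n × ℝ => (q.1, q.2, W)) (by fun_prop))

theorem mem_ball_map {Y : Rn n} (hY : Y ∈ Ω.bdry) (hc : dist Y χ.c < χ.r) {t : ℝ} (ht : 0 < t)
    (htr : t < χ.r) {z : Rn n} (hz : ‖z‖ ≤ χ.κ) : Y + t • (χ.v + z) ∈ Ω.carrier ∧
      dist (Y + t • (χ.v + z)) χ.c < 4 * χ.r ∧ dist (Y + t • (χ.v + z)) Y ≤ 2 * t ∧
      χ.κ * t ≤ Ω.rho (Y + t • (χ.v + z)) ∧ Ω.rho (Y + t • (χ.v + z)) ≤ 2 * t := by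
  have hr := χ.cone.r_pos
  obtain ⟨h1, h2⟩ := χ.cone.cone Y (frontier_subset_closure hY) (by linarith) t ht htr z hz
  have h3 : dist (Y + t • (χ.v + z)) Y ≤ 2 * t := by
    rw [dist_eq_norm, add_sub_cancel_left, norm_smul, norm_of_nonneg ht.le, mul_comm]
    have := norm_add_le χ.v z
    have := χ.cone.norm_le
    have := χ.cone.κ_le
    gcongr; linarith
  have h4 := dist_triangle (Y + t • (χ.v + z)) Y χ.c
  refine ⟨h1, by linarith, h3, ?_, (Ω.rho_le_dist _ hY).trans h3⟩
  have := Ω.rho_nonneg Y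
  have := χ.cone.κ_pos
  nlinarith

theorem of_mem_ball {W Y : Rn n} (hY : Y ∈ Ω.bdry) (hc : dist Y χ.c < χ.r) {t : ℝ}
    (ht : t ∈ Ioo 0 χ.r) (hW : W ∈ ball (Y + t • χ.v) (χ.κ * t)) : W ∈ Ω.carrier ∧
      dist W χ.c < 4 * χ.r ∧ dist W Y ≤ 2 * t ∧ χ.κ * t ≤ Ω.rho W ∧ Ω.rho W ≤ 2 * t := by
  have e : Y + t • (χ.v + t⁻¹ • (W - (Y + t • χ.v))) = W := by
    rw [smul_add, smul_inv_smul₀ ht.1.ne']; abel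
  rw [← e]
  refine χ.mem_ball_map hY hc ht.1 ht.2 ?_
  rw [norm_smul, norm_inv, norm_of_nonneg ht.1.le, ← dist_eq_norm, inv_mul_le_iff₀ ht.1, mul_comm]
  exact (mem_ball.1 hW).le

theorem ae_surf_ball : ∀ᵐ Y ∂Ω.surf.restrict (ball χ.c χ.r), Y ∈ Ω.bdry ∧ dist Y χ.c < χ.r := by
  filter_upwards [ae_restrict_of_ae Ω.ae_surf_mem,
    ae_restrict_mem measurableSet_ball] with Y h1 h2 using ⟨h1, h2⟩

theorem exists_coneK_le (b : ℝ) : ∃ C : ℝ, 0 ≤ C ∧ ∀ W, χ.coneK b W ≤ ofReal C *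
    (Ω.carrier ∩ ball χ.c (4 * χ.r)).indicator (fun W => ofReal (Ω.rho W ^ b)) W := by
  obtain ⟨A, hA0, hA⟩ := Ω.exists_surf_ball_le
  have hκ := χ.cone.κ_pos
  have hn := Ω.two_le
  set M := 2 / χ.κ with hM
  refine ⟨A * (3 / χ.κ) ^ (n - 1) * (M ^ |b - n| / χ.κ), by positivity, fun W => ?_⟩
  set S := Ω.carrier ∩ ball χ.c (4 * χ.r) with hS
  by_cases hW : W ∈ S
  · rw [indicator_of_mem hW]
    have hρ := Ω.rho_pos hW.1
    set ρ := Ω.rho W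
    calc χ.coneK b W ≤ ∫⁻ Y in ball χ.c χ.r, (ball W (3 / χ.κ * ρ)).indicator
          (fun _ => ofReal (M ^ |b - n| * ρ ^ (b - n)) * ofReal (ρ / χ.κ)) Y
          ∂Ω.surf := by
          refine lintegral_mono_ae ?_
          filter_upwards [χ.ae_surf_ball] with Y ⟨hY, hYc⟩
          have key : ∀ t ∈ Ioo 0 χ.r, W ∈ ball (Y + t • χ.v) (χ.κ * t) →
            Y ∈ ball W (3 / χ.κ * ρ) ∧ t ∈ Ioc 0 (ρ / χ.κ) ∧ ρ ≤ 2 * t := by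
            intro t ht hWt
            obtain ⟨-, -, h3, h4, h5⟩ := χ.of_mem_ball hY hYc ht hWt
            have h6 : t ≤ ρ / χ.κ := by rwa [le_div_iff₀ hκ, mul_comm]
            refine ⟨?_, ⟨ht.1, h6⟩, h5⟩
            rw [mem_ball, dist_comm]
            have : 3 / χ.κ * ρ = 3 * (ρ / χ.κ) := by ring
            have : 0 < ρ / χ.κ := by positivity
            linarith
          by_cases hYW : Y ∈ ball W (3 / χ.κ * ρ)
          · rw [indicator_of_mem hYW]
            calc _ ≤ ∫⁻ t in Ioo 0 χ.r, (Ioc 0 (ρ / χ.κ)).indicator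
                  (fun _ => ofReal (M ^ |b - n| * ρ ^ (b - n))) t := by
                  refine setLIntegral_mono' measurableSet_Ioo fun t ht => ?_
                  by_cases hWt : W ∈ ball (Y + t • χ.v) (χ.κ * t)
                  · obtain ⟨-, h2, h3⟩ := key t ht hWt
                    rw [indicator_of_mem hWt, indicator_of_mem h2, Pi.one_apply, mul_one]
                    refine ofReal_le_ofReal (rpow_le_of_comparable _ hρ ht.1 ?_ (h3.trans ?_))
                    · refine h2.2.trans ?_
                      rw [hM, div_mul_eq_mul_div]; gcongr; linarith
                    · have : 1 ≤ 1 / χ.κ := by rw [le_div_iff₀ hκ, one_mul]; exact χ.cone.κ_le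
                      have ht1 := ht.1
                      have e : M * t = 1 / χ.κ * (2 * t) := by rw [hM]; ring
                      rw [e]; nlinarith
                  · rw [indicator_of_notMem hWt, mul_zero]; exact bot_le
              _ ≤ ∫⁻ t, (Ioc 0 (ρ / χ.κ)).indicator
                (fun _ => ofReal (M ^ |b - n| * ρ ^ (b - n))) t :=
                setLIntegral_le_lintegral _ _
              _ = _ := by
                rw [lintegral_indicator measurableSet_Ioc, setLIntegral_const, Real.volume_Ioc,
                  sub_zero]
          · rw [indicator_of_notMem hYW]
            refine le_of_eq (setLIntegral_eq_zero measurableSet_Ioo fun t ht => ?_)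
            have : W ∉ ball (Y + t • χ.v) (χ.κ * t) := fun h => hYW (key t ht h).1
            rw [indicator_of_notMem this, mul_zero]; rfl
      _ ≤ ∫⁻ Y, (ball W (3 / χ.κ * ρ)).indicator
        (fun _ => ofReal (M ^ |b - n| * ρ ^ (b - n)) * ofReal (ρ / χ.κ)) Y
        ∂Ω.surf := setLIntegral_le_lintegral _ _
      _ ≤ ofReal (M ^ |b - n| * ρ ^ (b - n)) * ofReal (ρ / χ.κ) *
        ofReal (A * (3 / χ.κ * ρ) ^ (n - 1)) := by
        rw [lintegral_indicator measurableSet_ball, setLIntegral_const]; gcongr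
        exact hA _ _ (by positivity)
      _ = _ := by
        rw [← ofReal_mul (by positivity), ← ofReal_mul (by positivity),
          ← ofReal_mul (by positivity), Real.rpow_sub_natCast hρ.ne']
        congr 1
        have : ρ ^ n = ρ ^ (n - 1) * ρ := by rw [← pow_succ]; congr 1; omega
        rw [this, mul_pow]; field_simp
  · rw [indicator_of_notMem hW, mul_zero]
    refine le_of_eq (lintegral_eq_zero_of_ae_eq_zero ?_)
    filter_upwards [χ.ae_surf_ball] with Y ⟨hY, hYc⟩
    refine setLIntegral_eq_zero measurableSet_Ioo fun t ht => ?_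
    have : W ∉ ball (Y + t • χ.v) (χ.κ * t) := fun hWt =>
      let h := χ.of_mem_ball hY hYc ht hWt
      hW ⟨h.1, h.2.1⟩
    rw [indicator_of_notMem this, mul_zero]; rfl

/-- Integrals over the truncated cones are bounded by weighted volume integrals. -/
theorem exists_lintegral_map_le (b : ℝ) : ∃ C : ℝ, 0 ≤ C ∧ ∀ F : Rn n → ℝ≥0∞, Measurable F →
    ∫⁻ q, ofReal (q.2.1 ^ b) * F (χ.map q) ∂χ.coneM ≤
      ofReal C * ∫⁻ X in ball χ.c (4 * χ.r), F X ∂Ω.wMeas b := by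
  obtain ⟨C, hC0, hC⟩ := χ.exists_coneK_le b
  refine ⟨C, hC0, fun F hF => ?_⟩
  rw [χ.lintegral_map b hF, Ω.lintegral_wMeas b hF measurableSet_ball, ← lintegral_ofReal_mul,
    ← lintegral_indicator (measurableSet_ball.inter Ω.isOpen.measurableSet)]
  refine lintegral_mono fun W => ?_
  refine (mul_le_mul_right (hC W) _).trans (le_of_eq ?_)
  rw [inter_comm]
  by_cases h : W ∈ ball χ.c (4 * χ.r) ∩ Ω.carrier
  · rw [indicator_of_mem h, indicator_of_mem h]; ring
  · rw [indicator_of_notMem h, indicator_of_notMem h]; ring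

/-- The part of `Ω` covered by the cones of a chart. -/
def inner : Set (Rn n) := ball χ.c (χ.r / 2) ∩ {X | Ω.rho X < χ.κ * χ.r / 8}

theorem measurableSet_inner : MeasurableSet χ.inner :=
  measurableSet_ball.inter (measurableSet_lt Ω.continuous_rho.measurable measurable_const)

theorem exists_le_coneK (b : ℝ) : ∃ c : ℝ, 0 < c ∧ ∀ W ∈ χ.inner ∩ Ω.carrier,
    ofReal (c * Ω.rho W ^ b) ≤ χ.coneK b W := by
  obtain ⟨A, hA0, hA⟩ := χ.lower
  have hκ := χ.cone.κ_pos
  have hκ1 := χ.cone.κ_le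
  have hr := χ.cone.r_pos
  have hn := Ω.two_le
  set M := 2 / χ.κ with hM
  refine ⟨(M ^ |b - n|)⁻¹ * (χ.κ / 4) * (A * (χ.κ / 4) ^ (n - 1)), by positivity, fun W hW => ?_⟩
  have hρ := Ω.rho_pos hW.2
  have hWc := mem_ball.1 hW.1.1
  have hWρ : Ω.rho W < χ.κ * χ.r / 8 := hW.1.2
  obtain ⟨Y₀, hY₀, t₀, hW₀, h1, h2⟩ := χ.foot W hW.2 (by linarith) (by nlinarith)
  set ρ := Ω.rho W
  have ht₀ : 0 < t₀ := hρ.trans_le h1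
  have ht₀r : t₀ < χ.r / 8 := by
    by_contra! h
    nlinarith
  have hYW : dist Y₀ W ≤ t₀ := by
    rw [hW₀, dist_eq_norm, sub_add_cancel_left, norm_neg, norm_smul, norm_of_nonneg ht₀.le]
    have := χ.cone.norm_le
    nlinarith
  have hY₀c := dist_triangle Y₀ W χ.c
  have hκt : χ.κ * t₀ ≤ t₀ := by nlinarith
  have hmem : ∀ Y ∈ ball Y₀ (χ.κ * t₀ / 4), ∀ t ∈ Ioo t₀ (t₀ + χ.κ * t₀ / 4),
    W ∈ ball (Y + t • χ.v) (χ.κ * t) := by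
    intro Y hY t ht
    have e : W - (Y + t • χ.v) = (Y₀ - Y) + (t₀ - t) • χ.v := by rw [hW₀, sub_smul]; abel
    have e1 : ‖Y₀ - Y‖ < χ.κ * t₀ / 4 := by rw [← dist_eq_norm, dist_comm]; exact hY
    have e2 : ‖(t₀ - t) • χ.v‖ ≤ χ.κ * t₀ / 4 := by
      rw [norm_smul, Real.norm_of_nonpos (by linarith [ht.1])]
      have := χ.cone.norm_le
      have := norm_nonneg χ.v
      nlinarith [ht.1, ht.2]
    rw [mem_ball, dist_eq_norm, e]
    have := norm_add_le (Y₀ - Y) ((t₀ - t) • χ.v)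
    nlinarith [ht.1]
  have hlow : ∀ t ∈ Ioo t₀ (t₀ + χ.κ * t₀ / 4), (M ^ |b - n|)⁻¹ * ρ ^ (b - n) ≤ t ^ (b - n) := by
    intro t ht
    have ht0 := ht₀.trans ht.1
    rw [inv_mul_le_iff₀ (by positivity)]
    refine rpow_le_of_comparable _ ht0 hρ ?_ ?_
    · have : 1 ≤ M := by rw [hM, le_div_iff₀ hκ]; linarith
      nlinarith [ht.1]
    · have : t₀ ≤ ρ / χ.κ := by rwa [le_div_iff₀ hκ, mul_comm]
      have e : M * ρ = 2 * (ρ / χ.κ) := by rw [hM]; ring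
      rw [e]; linarith [ht.2]
  have hsub : ball Y₀ (χ.κ * t₀ / 4) ⊆ ball χ.c χ.r := by
    refine Metric.ball_subset_ball' ?_
    linarith
  have hsubt : Ioo t₀ (t₀ + χ.κ * t₀ / 4) ⊆ Ioo 0 χ.r := fun t ht =>
    ⟨ht₀.trans ht.1, by linarith [ht.2]⟩
  calc ofReal ((M ^ |b - n|)⁻¹ * (χ.κ / 4) * (A * (χ.κ / 4) ^ (n - 1)) * ρ ^ b)
      = ofReal ((M ^ |b - n|)⁻¹ * ρ ^ (b - n)) * ofReal (χ.κ * ρ / 4) *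
        ofReal (A * (χ.κ * ρ / 4) ^ (n - 1)) := by
        rw [← ofReal_mul (by positivity), ← ofReal_mul (by positivity),
          Real.rpow_sub_natCast hρ.ne']
        congr 1
        have e : ρ ^ n = ρ ^ (n - 1) * ρ := by rw [← pow_succ]; congr 1; omega
        have e1 : χ.κ * ρ / 4 = χ.κ / 4 * ρ := by ring
        rw [e, e1, mul_pow]; field_simp
    _ ≤ ofReal ((M ^ |b - n|)⁻¹ * ρ ^ (b - n)) * ofReal (χ.κ * t₀ / 4) *
      Ω.surf (ball Y₀ (χ.κ * t₀ / 4)) := by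
      gcongr
      refine le_trans (ofReal_le_ofReal ?_) (hA Y₀ hY₀ (by linarith) _ (by positivity)
        (by nlinarith))
      gcongr
    _ = ∫⁻ Y in ball Y₀ (χ.κ * t₀ / 4), (∫⁻ t in Ioo t₀ (t₀ + χ.κ * t₀ / 4),
      ofReal ((M ^ |b - n|)⁻¹ * ρ ^ (b - n))) ∂Ω.surf := by
      rw [setLIntegral_const, setLIntegral_const, Real.volume_Ioo, add_sub_cancel_left]
    _ ≤ ∫⁻ Y in ball Y₀ (χ.κ * t₀ / 4), (∫⁻ t in Ioo 0 χ.r, ofReal (t ^ (b - n)) *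
      (ball (Y + t • χ.v) (χ.κ * t)).indicator 1 W) ∂Ω.surf := by
      refine setLIntegral_mono' measurableSet_ball fun Y hY => ?_
      refine (setLIntegral_mono' measurableSet_Ioo fun t ht => ?_).trans (lintegral_mono_set hsubt)
      rw [indicator_of_mem (hmem Y hY t ht), Pi.one_apply, mul_one]
      exact ofReal_le_ofReal (hlow t ht)
    _ ≤ _ := lintegral_mono_set hsub

/-- Near the boundary, weighted volume integrals are bounded by integrals over truncated cones. -/
theorem exists_le_lintegral_map (b : ℝ) : ∃ C : ℝ, 0 ≤ C ∧ ∀ F : Rn n → ℝ≥0∞, Measurable F →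
    ∫⁻ X in χ.inner, F X ∂Ω.wMeas b ≤
      ofReal C * ∫⁻ q, ofReal (q.2.1 ^ b) * F (χ.map q) ∂χ.coneM := by
  obtain ⟨c, hc0, hc⟩ := χ.exists_le_coneK b
  refine ⟨c⁻¹, by positivity, fun F hF => ?_⟩
  rw [χ.lintegral_map b hF, Ω.lintegral_wMeas b hF χ.measurableSet_inner, ← lintegral_ofReal_mul]
  refine (setLIntegral_mono' (χ.measurableSet_inner.inter Ω.isOpen.measurableSet)
    fun W hW => ?_).trans (setLIntegral_le_lintegral _ _)
  have := hc W hW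
  calc ofReal (Ω.rho W ^ b) * F W
      = ofReal c⁻¹ * (F W * ofReal (c * Ω.rho W ^ b)) := by
        rw [ofReal_mul hc0.le]
        have e : ofReal c⁻¹ * ofReal c = 1 := by
          rw [← ofReal_mul (by positivity), inv_mul_cancel₀ hc0.ne', ofReal_one]
        calc _ = (ofReal c⁻¹ * ofReal c) * (ofReal (Ω.rho W ^ b) * F W) := by
              rw [e, one_mul]
          _ = _ := by ring
    _ ≤ _ := by gcongr

end Chart

end LipDomain

theorem exists_pos_forall_le {ι : Type*} (T : Finset ι) {f : ι → ℝ} (hf : ∀ i, 0 < f i) :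
    ∃ δ > 0, ∀ i ∈ T, δ ≤ f i := by
  classical
  induction T using Finset.induction_on with
  | empty => exact ⟨1, one_pos, by simp⟩
  | insert i T _ ih =>
    obtain ⟨δ, h0, h⟩ := ih
    refine ⟨min δ (f i), lt_min h0 (hf i), fun j hj => ?_⟩
    rcases Finset.mem_insert.1 hj with rfl | hj
    · exact min_le_right _ _
    · exact (min_le_left _ _).trans (h j hj)

namespace LipDomain

variable {n : ℕ} (Ω : LipDomain n)

theorem Chart.exists_wMeas_inner_le {Ω : LipDomain n} (χ : Ω.Chart) {b : ℝ} (hb : -1 < b) :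
    ∃ C : ℝ, 0 ≤ C ∧ ∀ W τ, 0 < τ → Ω.wMeas b (χ.inner ∩ (ball W τ ∩ {X | Ω.rho X < τ})) ≤
      ofReal (C * τ ^ (b + n)) := by
  obtain ⟨C, hC0, hC⟩ := χ.exists_le_lintegral_map b
  obtain ⟨A, hA0, hA⟩ := Ω.exists_surf_ball_le
  have hκ := χ.cone.κ_pos
  have hκ1 := χ.cone.κ_le
  have hn := Ω.two_le
  have hb1 : 0 < b + 1 := by linarith
  set v := (volume (ball (0 : Rn n) χ.κ)).toReal with hv
  have hv' : volume (ball (0 : Rn n) χ.κ) = ofReal v := (ofReal_toReal measure_ball_lt_top.ne).symm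
  refine ⟨C * ((χ.κ⁻¹) ^ (b + 1) / (b + 1) * v * (A * (3 / χ.κ) ^ (n - 1))), by positivity,
    fun W τ hτ => ?_⟩
  have hms : MeasurableSet (ball W τ ∩ {X | Ω.rho X < τ}) :=
    measurableSet_ball.inter (measurableSet_lt Ω.continuous_rho.measurable measurable_const)
  set s := ball W τ ∩ {X | Ω.rho X < τ} with hs
  have h1 := hC (s.indicator 1) (measurable_const.indicator hms)
  rw [lintegral_indicator_one hms, Measure.restrict_apply hms, inter_comm s] at h1
  refine h1.trans ?_
  rw [χ.lintegral_coneM (F := fun q => ofReal (q.2.1 ^ b) * s.indicator 1 (χ.map q))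
    (((measurable_ofReal_rpow b).comp (by fun_prop)).mul
      ((measurable_one.indicator hms).comp χ.continuous_map.measurable)),
    mul_assoc C, ofReal_mul hC0]
  refine mul_le_mul_right ?_ _
  calc _ ≤ ∫⁻ Y in ball χ.c χ.r, (ball W (3 / χ.κ * τ)).indicator
        (fun _ => ofReal ((τ / χ.κ) ^ (b + 1) / (b + 1)) * ofReal v) Y ∂Ω.surf := by
        refine lintegral_mono_ae ?_
        filter_upwards [χ.ae_surf_ball] with Y ⟨hY, hYc⟩
        have key : ∀ t ∈ Ioo 0 χ.r, ∀ z ∈ ball (0 : Rn n) χ.κ, χ.map (Y, t, z) ∈ s →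
          Y ∈ ball W (3 / χ.κ * τ) ∧ t ∈ Ioo 0 (τ / χ.κ) := by
          intro t ht z hz h
          obtain ⟨-, -, h3, h4, -⟩ := χ.mem_ball_map hY hYc ht.1 ht.2 (mem_ball_zero_iff.1 hz).le
          have e1 := mem_ball.1 h.1
          have e2 : Ω.rho (χ.map (Y, t, z)) < τ := h.2
          simp only [map] at e1 e2
          have h5 : t < τ / χ.κ := by rw [lt_div_iff₀ hκ]; linarith
          refine ⟨?_, ht.1, h5⟩
          have e3 := dist_triangle_left Y W (Y + t • (χ.v + z))
          have e4 : 3 / χ.κ * τ = 3 * (τ / χ.κ) := by ring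
          have : τ ≤ τ / χ.κ := by rw [le_div_iff₀ hκ]; nlinarith
          rw [mem_ball]; linarith
        by_cases hYW : Y ∈ ball W (3 / χ.κ * τ)
        · rw [indicator_of_mem hYW]
          calc _ ≤ ∫⁻ t in Ioo 0 χ.r, (Ioo 0 (τ / χ.κ)).indicator
                (fun t => ofReal (t ^ b)) t * ofReal v := by
                refine setLIntegral_mono' measurableSet_Ioo fun t ht => ?_
                rw [← hv', ← setLIntegral_const]
                refine setLIntegral_mono' measurableSet_ball fun z hz => ?_
                by_cases h : χ.map (Y, t, z) ∈ s
                · rw [indicator_of_mem h, indicator_of_mem (key t ht z hz h).2, Pi.one_apply,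
                    mul_one]
                · rw [indicator_of_notMem h, mul_zero]; exact bot_le
            _ ≤ ∫⁻ t, (Ioo 0 (τ / χ.κ)).indicator (fun t => ofReal (t ^ b)) t * ofReal v :=
              setLIntegral_le_lintegral _ _
            _ = _ := by
              rw [lintegral_mul_const' _ _ ofReal_ne_top,
                lintegral_indicator measurableSet_Ioo, lintegral_rpow_Ioo hb (by positivity)]
        · rw [indicator_of_notMem hYW]
          refine le_of_eq (setLIntegral_eq_zero measurableSet_Ioo fun t ht => ?_)
          refine setLIntegral_eq_zero measurableSet_ball fun z hz => ?_
          have : χ.map (Y, t, z) ∉ s := fun h => hYW (key t ht z hz h).1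
          rw [indicator_of_notMem this, mul_zero]; rfl
    _ ≤ ∫⁻ Y, (ball W (3 / χ.κ * τ)).indicator
      (fun _ => ofReal ((τ / χ.κ) ^ (b + 1) / (b + 1)) * ofReal v) Y ∂Ω.surf :=
      setLIntegral_le_lintegral _ _
    _ ≤ ofReal ((τ / χ.κ) ^ (b + 1) / (b + 1)) * ofReal v *
      ofReal (A * (3 / χ.κ * τ) ^ (n - 1)) := by
      rw [lintegral_indicator measurableSet_ball, setLIntegral_const]; gcongr
      exact hA _ _ (by positivity)
    _ = _ := by
      rw [← ofReal_mul (by positivity), ← ofReal_mul (by positivity)]; congr 1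
      have e : b + n = b + 1 + ((n - 1 : ℕ) : ℝ) := by rw [Nat.cast_sub (by omega)]; push_cast; ring
      rw [e, Real.rpow_add_natCast hτ.ne', div_eq_mul_inv τ, mul_rpow hτ.le (by positivity),
        mul_pow]
      ring

theorem exists_inner_cover : ∃ (T : Finset Ω.Chart) (δ : ℝ), 0 < δ ∧
    ∀ X ∈ Ω.carrier, Ω.rho X < δ → ∃ χ ∈ T, X ∈ χ.inner := by
  obtain ⟨T, hT⟩ := Ω.exists_atlas
  obtain ⟨δ, hδ0, hδ⟩ := exists_pos_forall_le T (f := fun χ : Ω.Chart => χ.κ * χ.r / 8) fun χ => by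
    have := χ.cone.κ_pos
    have := χ.cone.r_pos
    positivity
  refine ⟨T, δ, hδ0, fun X hX hρ => ?_⟩
  obtain ⟨Y, hY, hXY⟩ := Ω.bdry_compact.exists_infDist_eq_dist (Ω.bdry_nonempty_of_mem hX) X
  obtain ⟨χ, hχ, hYχ⟩ := mem_iUnion₂.1 (hT hY)
  have h1 := hδ χ hχ
  have hκ := χ.cone.κ_pos
  have hκ1 := χ.cone.κ_le
  have hr := χ.cone.r_pos
  refine ⟨χ, hχ, ?_, hρ.trans_le h1⟩
  have h2 := dist_triangle X Y χ.c
  have h3 := mem_ball.1 hYχ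
  have h4 : dist X Y < χ.κ * χ.r / 8 := by rw [← hXY]; exact hρ.trans_le h1
  rw [mem_ball]; nlinarith

theorem exists_wMeas_ball_le {b : ℝ} (hb : -1 < b) : ∃ C : ℝ, 0 ≤ C ∧ ∃ δ > 0, ∀ W τ, 0 < τ →
    τ < δ → Ω.wMeas b (ball W τ ∩ {X | Ω.rho X < τ}) ≤ ofReal (C * τ ^ (b + n)) := by
  obtain ⟨T, δ, hδ0, hδ⟩ := Ω.exists_inner_cover
  choose C hC0 hC using fun χ : Ω.Chart => χ.exists_wMeas_inner_le hb
  refine ⟨∑ χ ∈ T, C χ, sum_nonneg fun χ _ => hC0 χ, δ, hδ0, fun W τ hτ hτδ => ?_⟩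
  calc _ ≤ Ω.wMeas b (⋃ χ ∈ T, χ.inner ∩ (ball W τ ∩ {X | Ω.rho X < τ})) := by
        refine measure_mono_ae ?_
        filter_upwards [(withDensity_absolutelyContinuous _ _).ae_le
          (ae_restrict_mem Ω.isOpen.measurableSet)] with X hX hXs
        obtain ⟨χ, hχ, h⟩ := hδ X hX (lt_trans hXs.2 hτδ)
        exact mem_iUnion₂.2 ⟨χ, hχ, h, hXs⟩
    _ ≤ ∑ χ ∈ T, Ω.wMeas b (χ.inner ∩ (ball W τ ∩ {X | Ω.rho X < τ})) :=
      measure_biUnion_finset_le _ _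
    _ ≤ ∑ χ ∈ T, ofReal (C χ * τ ^ (b + n)) := sum_le_sum fun χ _ => hC χ W τ hτ
    _ = _ := by
      rw [sum_mul, ofReal_sum_of_nonneg]
      intro χ _
      have := hC0 χ
      positivity

theorem isFiniteMeasure_wMeas {b : ℝ} (hb : -1 < b) : IsFiniteMeasure (Ω.wMeas b) := by
  obtain ⟨T, δ, hδ0, hδ⟩ := Ω.exists_inner_cover
  obtain ⟨D, hD0, hD⟩ := Ω.exists_rho_le
  have h1 : ∀ χ : Ω.Chart, Ω.wMeas b χ.inner < ⊤ := by
    intro χ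
    obtain ⟨C, hC0, hC⟩ := χ.exists_wMeas_inner_le hb
    have hκ1 := χ.cone.κ_le
    have hr := χ.cone.r_pos
    refine (measure_mono (t := χ.inner ∩ (ball χ.c χ.r ∩ {X | Ω.rho X < χ.r}))
      fun X hX => ⟨hX, ?_, ?_⟩).trans_lt
      ((hC χ.c χ.r hr).trans_lt ofReal_lt_top)
    · exact ball_subset_ball (by linarith) hX.1
    · have : Ω.rho X < χ.κ * χ.r / 8 := hX.2
      change Ω.rho X < χ.r
      nlinarith
  have h2 : Ω.wMeas b {X | δ ≤ Ω.rho X} < ⊤ := by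
    have hms : MeasurableSet {X | δ ≤ Ω.rho X} :=
      measurableSet_le measurable_const Ω.continuous_rho.measurable
    have e := Ω.lintegral_wMeas b (F := fun _ => 1) measurable_const hms
    rw [setLIntegral_one] at e; rw [e]
    have hfin : volume ({X | δ ≤ Ω.rho X} ∩ Ω.carrier) < ⊤ :=
      (measure_mono inter_subset_right).trans_lt Ω.isBounded.measure_lt_top
    refine (setLIntegral_mono' (hms.inter Ω.isOpen.measurableSet)
      (g := fun _ => ofReal ((max (D / δ) 1) ^ |b| * δ ^ b)) fun X hX => ?_).trans_lt ?_
    · rw [mul_one]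
      have hX1 : δ ≤ Ω.rho X := hX.1
      refine ofReal_le_ofReal (rpow_le_of_comparable b hδ0 (hδ0.trans_le hX1) ?_ ?_)
      · calc Ω.rho X ≤ D := hD X (subset_closure hX.2)
          _ = D / δ * δ := by field_simp
          _ ≤ _ := by gcongr; exact le_max_left _ _
      · have := le_max_right (D / δ) 1
        nlinarith
    · rw [setLIntegral_const]
      exact mul_lt_top ofReal_lt_top hfin
  refine ⟨?_⟩
  calc Ω.wMeas b univ ≤ Ω.wMeas b ((⋃ χ ∈ T, χ.inner) ∪ {X | δ ≤ Ω.rho X}) := by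
        refine measure_mono_ae ?_
        filter_upwards [(withDensity_absolutelyContinuous _ _).ae_le
          (ae_restrict_mem Ω.isOpen.measurableSet)] with X hX _
        rcases lt_or_ge (Ω.rho X) δ with h | h
        · obtain ⟨χ, hχ, h⟩ := hδ X hX h
          exact Or.inl (mem_iUnion₂.2 ⟨χ, hχ, h⟩)
        · exact Or.inr h
    _ ≤ ∑ χ ∈ T, Ω.wMeas b χ.inner + Ω.wMeas b {X | δ ≤ Ω.rho X} :=
      (measure_union_le _ _).trans (by gcongr; exact measure_biUnion_finset_le _ _)
    _ < ⊤ := ENNReal.add_lt_top.2 ⟨sum_lt_top.2 fun χ _ => h1 χ, h2⟩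

end LipDomain

theorem exists_subseq_tendsto_ae {X ι E : Type*} [MeasurableSpace X] [NormedAddCommGroup E]
    {μ : Measure X} {p : ℝ≥0∞} (hp : p ≠ 0) (S : Finset ι) {F : ℕ → ι → X → E} {G : ι → X → E}
    (hF : ∀ i ∈ S, ∀ k, AEStronglyMeasurable (F k i) μ) (hG : ∀ i ∈ S, AEStronglyMeasurable (G i) μ)
    (h : ∀ i ∈ S, Tendsto (fun k => eLpNorm (F k i - G i) p μ) atTop (𝓝 0)) :
    ∃ ns : ℕ → ℕ, StrictMono ns ∧
      ∀ᵐ x ∂μ, ∀ i ∈ S, Tendsto (fun k => F (ns k) i x) atTop (𝓝 (G i x)) := by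
  classical
  induction S using Finset.induction_on with
  | empty => exact ⟨id, strictMono_id, by simp⟩
  | insert i S _ ih =>
    obtain ⟨ns, h1, h2⟩ := ih (fun j hj => hF j (Finset.mem_insert_of_mem hj))
      (fun j hj => hG j (Finset.mem_insert_of_mem hj))
      (fun j hj => h j (Finset.mem_insert_of_mem hj))
    have h3 := tendstoInMeasure_of_tendsto_eLpNorm (f := fun k => F (ns k) i) hp
      (fun k => hF i (Finset.mem_insert_self _ _) (ns k)) (hG i (Finset.mem_insert_self _ _))
      ((h i (Finset.mem_insert_self _ _)).comp h1.tendsto_atTop)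
    obtain ⟨ms, h4, h5⟩ := h3.exists_seq_tendsto_ae
    refine ⟨ns ∘ ms, h1.comp h4, ?_⟩
    filter_upwards [h2, h5] with x hx hx' j hj
    rcases Finset.mem_insert.1 hj with rfl | hj
    · exact hx'
    · exact (hx j hj).comp h4.tendsto_atTop

theorem lintegral_enorm_rpow {X E : Type*} [MeasurableSpace X] [NormedAddCommGroup E]
    {μ : Measure X} {p : ℝ≥0∞} (hp : p ≠ 0) (hp' : p ≠ ⊤) (f : X → E) :
    ∫⁻ x, ‖f x‖ₑ ^ p.toReal ∂μ = eLpNorm f p μ ^ p.toReal := by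
  rw [eLpNorm_eq_lintegral_rpow_enorm_toReal hp hp', ← ENNReal.rpow_mul,
    one_div_mul_cancel (toReal_pos hp hp').ne', ENNReal.rpow_one]

namespace LipDomain.Chart

variable {n : ℕ} {Ω : LipDomain n} (χ : Ω.Chart)

theorem lintegral_coneM' {F : Rn n × ℝ × Rn n → ℝ≥0∞} (hF : Measurable F) :
    ∫⁻ q, F q ∂χ.coneM = ∫⁻ Y in ball χ.c χ.r,
      (∫⁻ z in ball 0 χ.κ, (∫⁻ t in Ioo 0 χ.r, F (Y, t, z))) ∂Ω.surf := by
  rw [χ.lintegral_coneM hF]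
  refine lintegral_congr fun Y => ?_
  exact lintegral_lintegral_swap (hF.comp (measurable_prodMk_left (x := Y))).aemeasurable

theorem measurable_lintegral_segment {F : Rn n → ℝ≥0∞} (hF : Measurable F) :
    Measurable fun q : Rn n × ℝ × Rn n => ∫⁻ τ in Ioo 0 q.2.1, F (χ.map (q.1, τ, q.2.2)) := by
  have h : Measurable fun w : (Rn n × ℝ × Rn n) × ℝ =>
    {w : (Rn n × ℝ × Rn n) × ℝ | 0 < w.2 ∧ w.2 < w.1.2.1}.indicator
      (fun w => F (χ.map (w.1.1, w.2, w.1.2.2))) w := by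
    refine Measurable.indicator (hF.comp (χ.continuous_map.measurable.comp (by fun_prop))) ?_
    exact (measurableSet_lt measurable_const measurable_snd).inter
      (measurableSet_lt measurable_snd measurable_fst.snd.fst)
  convert! h.lintegral_prod_right' (ν := volume) using 2 with q
  rw [← lintegral_indicator measurableSet_Ioo]; rfl

theorem ae_coneM : ∀ᵐ q ∂χ.coneM, q.1 ∈ Ω.bdry ∧ dist q.1 χ.c < χ.r ∧ 0 < q.2.1 ∧ q.2.1 < χ.r ∧
    ‖q.2.2‖ < χ.κ := by
  have h1 := χ.ae_surf_ball
  have h2 : ∀ᵐ t ∂(volume.restrict (Ioo 0 χ.r)), 0 < t ∧ t < χ.r := by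
    filter_upwards [ae_restrict_mem measurableSet_Ioo] with t ht using ht
  have h3 : ∀ᵐ z ∂(volume.restrict (ball (0 : Rn n) χ.κ)), ‖z‖ < χ.κ := by
    filter_upwards [ae_restrict_mem measurableSet_ball] with t ht
    simpa using ht
  have g1 := (Measure.quasiMeasurePreserving_fst (μ := Ω.surf.restrict (ball χ.c χ.r))
    (ν := (volume.restrict (Ioo 0 χ.r)).prod (volume.restrict (ball (0 : Rn n) χ.κ)))).ae h1
  have g2 := (Measure.quasiMeasurePreserving_snd (μ := Ω.surf.restrict (ball χ.c χ.r))
    (ν := (volume.restrict (Ioo 0 χ.r)).prod (volume.restrict (ball (0 : Rn n) χ.κ)))).ae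
    (Measure.quasiMeasurePreserving_fst.ae h2)
  have g3 := (Measure.quasiMeasurePreserving_snd (μ := Ω.surf.restrict (ball χ.c χ.r))
    (ν := (volume.restrict (Ioo 0 χ.r)).prod (volume.restrict (ball (0 : Rn n) χ.κ)))).ae
    (Measure.quasiMeasurePreserving_snd.ae h3)
  unfold coneM
  filter_upwards [g1, g2, g3] with q h1 h2 h3 using ⟨h1.1, h1.2, h2.1, h2.2, h3⟩

theorem ae_fst {p : Rn n → Prop} (h : ∀ᵐ Y ∂Ω.surf.restrict (ball χ.c χ.r), p Y) :
    ∀ᵐ q ∂χ.coneM, p q.1 :=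
  Measure.quasiMeasurePreserving_fst.ae h

theorem ae_map (b : ℝ) {p : Rn n → Prop}
    (h : ∀ᵐ X ∂(Ω.wMeas b).restrict (ball χ.c (4 * χ.r)), p X) :
    ∀ᵐ q ∂χ.coneM, p (χ.map q) := by
  obtain ⟨C, -, hC⟩ := χ.exists_lintegral_map_le b
  obtain ⟨N, hN, hNm, h0⟩ := exists_measurable_superset_of_null (ae_iff.1 h)
  have h1 := hC (N.indicator 1) (measurable_one.indicator hNm)
  rw [lintegral_indicator_one hNm, h0, mul_zero] at h1
  have h2 := (lintegral_eq_zero_iff (((measurable_ofReal_rpow b).comp (by fun_prop)).mul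
    ((measurable_one.indicator hNm).comp χ.continuous_map.measurable))).1 (le_antisymm h1 bot_le)
  filter_upwards [h2, χ.ae_coneM] with q hq hq'
  by_contra hn
  have h3 : χ.map q ∈ N := hN hn
  simp only [Pi.zero_apply, mul_eq_zero, ENNReal.ofReal_eq_zero, not_le.2 (Real.rpow_pos_of_pos hq'.2.2.1 b),
    Function.comp_apply, indicator_of_mem h3, Pi.one_apply, one_ne_zero, or_self, Pi.mul_apply] at hq

theorem exists_hardy {P a : ℝ} (hP : 1 < P) (ha : a < 1 - 1 / P) :
    ∃ C : ℝ, 0 ≤ C ∧ ∀ F : Rn n → ℝ≥0∞, Measurable F → ∫⁻ q, ofReal (q.2.1 ^ (P * a - P)) *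
      (∫⁻ τ in Ioo 0 q.2.1, F (χ.map (q.1, τ, q.2.2))) ^ P ∂χ.coneM ≤
      ofReal C * ∫⁻ X in ball χ.c (4 * χ.r), F X ^ P ∂Ω.wMeas (P * a) := by
  obtain ⟨C, hC0, hC⟩ := _root_.exists_hardy hP ha
  obtain ⟨C', hC0', hC'⟩ := χ.exists_lintegral_map_le (P * a)
  refine ⟨C * C', by positivity, fun F hF => ?_⟩
  have hFP : Measurable fun X => F X ^ P := hF.pow_const P
  have hm1 : Measurable fun q : Rn n × ℝ × Rn n => ofReal (q.2.1 ^ (P * a - P)) *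
    (∫⁻ τ in Ioo 0 q.2.1, F (χ.map (q.1, τ, q.2.2))) ^ P :=
    ((measurable_ofReal_rpow _).comp (by fun_prop)).mul
      ((χ.measurable_lintegral_segment hF).pow_const P)
  have hm2 : Measurable fun q : Rn n × ℝ × Rn n => ofReal (q.2.1 ^ (P * a)) * F (χ.map q) ^ P :=
    ((measurable_ofReal_rpow _).comp (by fun_prop)).mul (hFP.comp χ.continuous_map.measurable)
  calc _ ≤ ofReal C * ∫⁻ q, ofReal (q.2.1 ^ (P * a)) * F (χ.map q) ^ P ∂χ.coneM := by
        rw [χ.lintegral_coneM' hm1, χ.lintegral_coneM' hm2, ← lintegral_ofReal_mul]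
        refine lintegral_mono fun Y => ?_
        rw [← lintegral_ofReal_mul]
        refine lintegral_mono fun z => ?_
        exact hC (fun τ => F (χ.map (Y, τ, z)))
          (hF.comp (χ.continuous_map.measurable.comp (by fun_prop))) χ.r
    _ ≤ _ := by
      rw [ofReal_mul hC0, mul_assoc]
      exact mul_le_mul_right (hC' _ hFP) _

end LipDomain.Chart

/-- The exponent of `t` in the estimates of Taylor remainders of order `γ` over cones. -/
def jetExp {n : ℕ} (P a : ℝ) (m : ℕ) (γ : Fin n → ℕ) : ℝ :=
  P * a - P - P * ((m - 1 - ∑ i, γ i : ℕ) : ℝ)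

/-- The multi-indices of length `m`. -/
def topIdx (n m : ℕ) : Finset (Fin n → ℕ) := (mlt n (m + 1)).filter (fun δ => ∑ i, δ i = m)

theorem mem_topIdx {n m : ℕ} {δ : Fin n → ℕ} : δ ∈ topIdx n m ↔ ∑ i, δ i = m := by
  simp only [topIdx, Finset.mem_filter, mem_mlt]; omega

namespace LipDomain.Chart

variable {n l : ℕ} {Ω : LipDomain n} (χ : Ω.Chart)

theorem exists_smooth_jet_bound {P a : ℝ} (hP : 1 < P) (ha : a < 1 - 1 / P) (m : ℕ) :
    ∃ C : ℝ, 0 ≤ C ∧ ∀ h : Jet n l, (∀ α, ContDiff ℝ ∞ (h α)) →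
      (∀ α, ∑ i, α i < m → ∀ j, ∀ X ∈ closure Ω.carrier, dist X χ.c < 4 * χ.r →
        pd j (h α) X = h (α + Pi.single j 1) X) →
      ∀ γ, ∑ i, γ i < m →
      ∫⁻ q, ofReal (q.2.1 ^ jetExp P a m γ) *
        ‖h γ q.1 - taylor m (truncJet m h) γ q.1 (χ.map q)‖ₑ ^ P ∂χ.coneM ≤
      ofReal C * ∫⁻ X in ball χ.c (4 * χ.r), topSum m h X ^ P ∂Ω.wMeas (P * a) := by
  obtain ⟨C, hC0, hC⟩ := χ.exists_hardy hP ha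
  set K : ℝ := n * (mlt n m).card * 2 * 2 ^ m with hK
  refine ⟨K ^ P * C, by positivity, fun h hd hj γ hγ => ?_⟩
  have hT : Measurable (topSum m h) :=
    Finset.measurable_sum _ fun δ _ => (hd δ).continuous.measurable.enorm
  rw [ofReal_mul (by positivity), mul_assoc]
  refine le_trans ?_ (mul_le_mul_right (hC _ hT) _)
  rw [← lintegral_ofReal_mul]
  refine lintegral_mono_ae ?_
  filter_upwards [χ.ae_coneM] with ⟨Y, t, z⟩ ⟨hY, hYc, ht0, htr, hz⟩
  simp only at hY hYc ht0 htr hz ⊢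
  have hr := χ.cone.r_pos
  have hv : ‖χ.v + z‖ ≤ 2 := by
    have := norm_add_le χ.v z
    have := χ.cone.norm_le
    have := χ.cone.κ_le
    linarith
  have h1 := enorm_taylor_sub_le (m := m) hd hγ (A := Y) (W := Y) (w := χ.v + z) (t := t) (L := 2 * t)
    (M := 2) ht0.le (fun τ hτ α hα j => by
      rcases hτ.1.eq_or_lt with h0 | h0
      · rw [← h0, zero_smul, add_zero]
        exact hj α hα j Y (frontier_subset_closure hY) (by linarith)
      · obtain ⟨g1, g2, -⟩ := χ.mem_ball_map hY hYc h0 (hτ.2.trans_lt htr) hz.le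
        exact hj α hα j _ (subset_closure g1) g2) (fun τ hτ => by
      rw [sub_add_cancel_left, norm_neg, norm_smul, norm_of_nonneg hτ.1, mul_comm]
      exact mul_le_mul hv hτ.2 hτ.1 (by norm_num)) hv
  rw [taylor_self (by omega), truncJet_eq _ hγ, ← enorm_neg, neg_sub] at h1
  set j := m - 1 - ∑ i, γ i with hjdef
  set I := ∫⁻ τ in Ioo 0 t, topSum m h (Y + τ • (χ.v + z)) with hI
  have h2 : ‖h γ Y - taylor m (truncJet m h) γ Y (Y + t • (χ.v + z))‖ₑ ≤
    ofReal K * ofReal (t ^ j) * I := by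
    refine h1.trans (mul_le_mul_left ?_ _)
    rw [← ofReal_mul (by positivity)]
    refine ofReal_le_ofReal ?_
    rw [hK, mul_pow, ← mul_assoc]; gcongr
    · norm_num
    · omega
  have hP0 : 0 ≤ P := by linarith
  have h3 : ofReal (t ^ jetExp P a m γ) * ofReal (t ^ j) ^ P = ofReal (t ^ (P * a - P)) := by
    rw [ofReal_rpow_of_nonneg (by positivity) hP0, ← rpow_natCast, ← rpow_mul ht0.le,
      ← ofReal_mul (by positivity), ← rpow_add ht0, jetExp, ← hjdef]
    congr 2
    ring
  calc _ ≤ ofReal (t ^ jetExp P a m γ) *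
        (ofReal K * ofReal (t ^ j) * I) ^ P := by
        gcongr
        exact h2
    _ = ofReal (K ^ P) * ((ofReal (t ^ jetExp P a m γ) * ofReal (t ^ j) ^ P) * I ^ P) := by
      rw [mul_rpow_of_nonneg _ _ hP0, mul_rpow_of_nonneg _ _ hP0,
        ofReal_rpow_of_nonneg (by positivity) hP0]
      ring
    _ = _ := by rw [h3]; rfl

theorem exists_jet_bound {p : ℝ≥0∞} (hp : 1 < p) (hp' : p < ⊤) {a : ℝ}
    (ha : a < 1 - 1 / p.toReal) (m : ℕ) :
    ∃ C : ℝ, 0 ≤ C ∧ ∀ (h : ℕ → Jet n l) (u f : Jet n l), (∀ k α, ContDiff ℝ ∞ (h k α)) →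
      (∀ k α, ∑ i, α i < m → ∀ j, ∀ X ∈ closure Ω.carrier, dist X χ.c < 4 * χ.r →
        pd j (h k α) X = h k (α + Pi.single j 1) X) →
      (∀ α, ∑ i, α i ≤ m → AEStronglyMeasurable (u α)
        ((Ω.wMeas (p.toReal * a)).restrict (ball χ.c (4 * χ.r)))) →
      (∀ α, ∑ i, α i < m → AEStronglyMeasurable (f α) (Ω.surf.restrict (ball χ.c χ.r))) →
      (∀ α, ∑ i, α i ≤ m → Tendsto (fun k => eLpNorm (h k α - u α) p
        ((Ω.wMeas (p.toReal * a)).restrict (ball χ.c (4 * χ.r)))) atTop (𝓝 0)) →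
      (∀ α, ∑ i, α i < m → Tendsto (fun k => eLpNorm (h k α - f α) p
        (Ω.surf.restrict (ball χ.c χ.r))) atTop (𝓝 0)) →
      ∀ γ, ∑ i, γ i < m →
      ∫⁻ q, ofReal (q.2.1 ^ jetExp p.toReal a m γ) *
        ‖f γ q.1 - taylor m (truncJet m u) γ q.1 (χ.map q)‖ₑ ^ p.toReal ∂χ.coneM ≤
      ofReal C * ∑ δ ∈ topIdx n m, eLpNorm (u δ) p
        ((Ω.wMeas (p.toReal * a)).restrict (ball χ.c (4 * χ.r))) ^ p.toReal := by
  have hp0 : p ≠ 0 := hp.ne_bot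
  have hP : 1 < p.toReal := one_lt_toReal hp hp'
  set P := p.toReal with hPdef
  obtain ⟨C, hC0, hC⟩ := χ.exists_smooth_jet_bound (l := l) hP ha m
  refine ⟨C * ((topIdx n m).card : ℝ) ^ (P - 1), by positivity,
    fun h u f hd hj hum hfm hu hf γ hγ => ?_⟩
  set μ := (Ω.wMeas (P * a)).restrict (ball χ.c (4 * χ.r)) with hμ
  set ν := Ω.surf.restrict (ball χ.c χ.r) with hν
  obtain ⟨ns, hns, hae⟩ := exists_subseq_tendsto_ae hp0 (mlt n (m + 1)) (F := h) (G := u) (μ := μ)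
    (fun α _ k => (hd k α).continuous.aestronglyMeasurable)
    (fun α hα => hum α (Nat.lt_succ_iff.1 (mem_mlt.1 hα)))
    (fun α hα => hu α (Nat.lt_succ_iff.1 (mem_mlt.1 hα)))
  obtain ⟨ms, hms, hae'⟩ := exists_subseq_tendsto_ae hp0 {γ} (F := fun k => h (ns k)) (G := f) (μ := ν)
    (fun α _ k => (hd _ α).continuous.aestronglyMeasurable)
    (fun α hα => by rw [Finset.mem_singleton.1 hα]; exact hfm γ hγ)
    (fun α hα => by rw [Finset.mem_singleton.1 hα]; exact (hf γ hγ).comp hns.tendsto_atTop)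
  set h' := fun k => h (ns (ms k)) with hh'
  have hsub : Tendsto (fun k => ns (ms k)) atTop atTop := hns.tendsto_atTop.comp hms.tendsto_atTop
  have hlim : ∀ᵐ q ∂χ.coneM, Tendsto (fun k => ofReal (q.2.1 ^ jetExp P a m γ) *
    ‖h' k γ q.1 - taylor m (truncJet m (h' k)) γ q.1 (χ.map q)‖ₑ ^ P) atTop
    (𝓝 (ofReal (q.2.1 ^ jetExp P a m γ) *
      ‖f γ q.1 - taylor m (truncJet m u) γ q.1 (χ.map q)‖ₑ ^ P)) := by
    filter_upwards [χ.ae_map (P * a) hae, χ.ae_fst hae'] with q hq hq'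
    refine ENNReal.Tendsto.const_mul ?_ (Or.inr ofReal_ne_top)
    refine ((ENNReal.continuous_rpow_const.tendsto _).comp
      ((continuous_enorm.tendsto _).comp (Tendsto.sub (hq' γ (by simp)) ?_)))
    refine tendsto_finsetSum _ fun β _ => Tendsto.const_smul ?_ _
    simp only [truncJet]
    split_ifs with hlt
    · exact (hq _ (mem_mlt.2 (hlt.trans (Nat.lt_succ_self m)))).comp hms.tendsto_atTop
    · exact tendsto_const_nhds
  have hmeas : ∀ k, Measurable fun q : Rn n × ℝ × Rn n => ofReal (q.2.1 ^ jetExp P a m γ) *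
    ‖h' k γ q.1 - taylor m (truncJet m (h' k)) γ q.1 (χ.map q)‖ₑ ^ P := by
    intro k
    refine ((measurable_ofReal_rpow _).comp (by fun_prop)).mul (Measurable.pow_const ?_ P)
    refine Continuous.enorm (Continuous.sub ?_ ?_) |>.measurable
    · exact (hd _ γ).continuous.comp continuous_fst
    · refine continuous_finsetSum _ fun β _ => Continuous.fun_smul ?_ ?_
      · exact (contDiff_dpow β).continuous.comp (continuous_fst.sub χ.continuous_map)
      · simp only [truncJet]
        split_ifs
        · exact (hd _ _).continuous.comp χ.continuous_map
        · exact continuous_const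
  have hbound : ∀ k, ∫⁻ q, ofReal (q.2.1 ^ jetExp P a m γ) *
    ‖h' k γ q.1 - taylor m (truncJet m (h' k)) γ q.1 (χ.map q)‖ₑ ^ P ∂χ.coneM ≤
    ofReal (C * ((topIdx n m).card : ℝ) ^ (P - 1)) * ∑ δ ∈ topIdx n m,
      (eLpNorm (u δ) p μ + eLpNorm (h' k δ - u δ) p μ) ^ P := by
    intro k
    refine (hC (h' k) (hd _) (hj _) γ hγ).trans ?_
    rw [ofReal_mul hC0, mul_assoc]
    refine mul_le_mul_right ?_ _
    have e1 : ∀ X, topSum m (h' k) X ^ P ≤ ofReal (((topIdx n m).card : ℝ) ^ (P - 1)) *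
      ∑ δ ∈ topIdx n m, ‖h' k δ X‖ₑ ^ P := by
      intro X
      refine (rpow_sum_le_const_mul_sum_rpow _ _ hP.le).trans (le_of_eq ?_)
      rw [← ofReal_rpow_of_nonneg (by positivity) (by linarith), ENNReal.ofReal_natCast]; rfl
    refine (lintegral_mono e1).trans ?_
    rw [lintegral_ofReal_mul, lintegral_finsetSum _
      (fun δ _ => (hd _ δ).continuous.measurable.enorm.pow_const P)]
    gcongr with δ hδ
    rw [lintegral_enorm_rpow hp0 hp'.ne]; gcongr
    have e2 : h' k δ = u δ + (h' k δ - u δ) := by abel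
    have hδ' : ∑ i, δ i ≤ m := (mem_topIdx.1 hδ).le
    calc eLpNorm (h' k δ) p μ = eLpNorm (u δ + (h' k δ - u δ)) p μ := by rw [← e2]
      _ ≤ _ := eLpNorm_add_le (hum δ hδ')
        ((hd _ δ).continuous.aestronglyMeasurable.sub (hum δ hδ')) hp.le
  have hR : Tendsto (fun k => ofReal (C * ((topIdx n m).card : ℝ) ^ (P - 1)) *
    ∑ δ ∈ topIdx n m, (eLpNorm (u δ) p μ + eLpNorm (h' k δ - u δ) p μ) ^ P) atTop
    (𝓝 (ofReal (C * ((topIdx n m).card : ℝ) ^ (P - 1)) *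
      ∑ δ ∈ topIdx n m, eLpNorm (u δ) p μ ^ P)) := by
    refine ENNReal.Tendsto.const_mul ?_ (Or.inr ofReal_ne_top)
    refine tendsto_finsetSum _ fun δ hδ => (ENNReal.continuous_rpow_const.tendsto _).comp ?_
    have := tendsto_const_nhds (x := eLpNorm (u δ) p μ) (f := atTop (α := ℕ)) |>.add
      ((hu δ (mem_topIdx.1 hδ).le).comp hsub)
    rwa [add_zero] at this
  calc _ = ∫⁻ q, liminf (fun k => ofReal (q.2.1 ^ jetExp P a m γ) *
        ‖h' k γ q.1 - taylor m (truncJet m (h' k)) γ q.1 (χ.map q)‖ₑ ^ P) atTop ∂χ.coneM := by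
        refine lintegral_congr_ae ?_
        filter_upwards [hlim] with q hq using hq.liminf_eq.symm
    _ ≤ liminf (fun k => ∫⁻ q, ofReal (q.2.1 ^ jetExp P a m γ) *
      ‖h' k γ q.1 - taylor m (truncJet m (h' k)) γ q.1 (χ.map q)‖ₑ ^ P ∂χ.coneM) atTop :=
      lintegral_liminf_le hmeas
    _ ≤ liminf (fun k => ofReal (C * ((topIdx n m).card : ℝ) ^ (P - 1)) *
      ∑ δ ∈ topIdx n m, (eLpNorm (u δ) p μ + eLpNorm (h' k δ - u δ) p μ) ^ P) atTop :=
      liminf_le_liminf (.of_forall hbound)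
    _ = _ := hR.liminf_eq

end LipDomain.Chart

theorem perm_cons_wordOf {n : ℕ} (j : Fin n) (α : Fin n → ℕ) :
    (j :: wordOf α).Perm (wordOf (α + Pi.single j 1)) := by
  refine (perm_wordOf _).trans (List.Perm.of_eq ?_)
  congr 1
  funext i; rw [List.count_cons, count_wordOf, Pi.add_apply]
  by_cases h : i = j
  · subst h; simp
  · rw [Pi.single_eq_of_ne h, if_neg (by simpa using Ne.symm h)]

theorem wordOf_zero {n : ℕ} : wordOf (0 : Fin n → ℕ) = [] :=
  List.length_eq_zero_iff.1 (by rw [wordOf_length]; simp)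

theorem wordOf_single {n : ℕ} (j : Fin n) : wordOf (Pi.single j 1 : Fin n → ℕ) = [j] := by
  have := perm_cons_wordOf j 0
  rw [wordOf_zero, zero_add] at this
  exact (List.singleton_perm.1 this).symm

theorem sum_topIdx_one {n : ℕ} {M : Type*} [AddCommMonoid M] (F : (Fin n → ℕ) → M) :
    ∑ δ ∈ topIdx n 1, F δ = ∑ j, F (Pi.single j 1) := by
  have h : topIdx n 1 = Finset.univ.image (fun j : Fin n => (Pi.single j 1 : Fin n → ℕ)) := by
    ext δ; rw [mem_topIdx, Finset.mem_image]
    constructor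
    · intro h
      obtain ⟨j, hj⟩ : ∃ j, δ j ≠ 0 := by
        by_contra! h0
        simp [h0] at h
      refine ⟨j, Finset.mem_univ _, ?_⟩
      have h1 := Finset.add_sum_erase Finset.univ δ (Finset.mem_univ j)
      have h2 : ∀ i ∈ Finset.univ.erase j, δ i = 0 := Finset.sum_eq_zero_iff.1 (by omega)
      have h3 : ∑ i ∈ Finset.univ.erase j, δ i = 0 := Finset.sum_eq_zero h2
      funext i
      by_cases hi : i = j
      · subst hi; rw [Pi.single_eq_same]; omega
      · rw [Pi.single_eq_of_ne hi]
        exact (h2 i (by simp [hi])).symm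
    · rintro ⟨j, -, rfl⟩
      simp
  rw [h, Finset.sum_image]
  intro i _ j _ hij
  by_contra hne
  have := congrFun hij i
  simp [Pi.single_eq_of_ne hne] at this

theorem lintegral_rpow_Ioo_eq_top {b R : ℝ} (hb : b ≤ -1) (hR : 0 < R) :
    ∫⁻ u in Ioo 0 R, ofReal (u ^ b) = ⊤ := by
  by_contra h
  have h1 : IntegrableOn (fun u : ℝ => u ^ b) (Ioo 0 R) := by
    refine ⟨(measurable_id.pow_const b).aestronglyMeasurable, ?_⟩
    rw [hasFiniteIntegral_iff_ofReal]
    · exact lt_top_iff_ne_top.2 h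
    · filter_upwards [ae_restrict_mem measurableSet_Ioo] with u hu
      exact rpow_nonneg hu.1.le b
  have := (intervalIntegral.integrableOn_Ioo_rpow_iff hR).1 h1
  linarith

namespace LipDomain

variable {n l : ℕ} {Ω : LipDomain n}

theorem ae_surf_of_chart {q : Rn n → Prop}
    (h : ∀ χ : Ω.Chart, ∀ᵐ Y ∂Ω.surf.restrict (ball χ.c χ.r), q Y) : ∀ᵐ Y ∂Ω.surf, q Y := by
  obtain ⟨T, hT⟩ := Ω.exists_atlas
  have h1 : ∀ χ ∈ T, ∀ᵐ Y ∂Ω.surf, Y ∈ ball χ.c χ.r → q Y := fun χ _ =>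
    (ae_restrict_iff' measurableSet_ball).1 (h χ)
  filter_upwards [(Finset.eventually_all T).2 h1, Ω.ae_surf_mem] with Y hY hYb
  obtain ⟨χ, hχ, hm⟩ := mem_iUnion₂.1 (hT hYb)
  have := χ.cone.r_pos
  exact hY χ hχ (ball_subset_ball (by linarith) hm)

theorem wMeas_ac (b : ℝ) : Ω.wMeas b ≪ volume.restrict Ω.carrier :=
  withDensity_absolutelyContinuous _ _

namespace Chart

variable (χ : Ω.Chart)

theorem quasiMeasurePreserving_map (b : ℝ) : Measure.QuasiMeasurePreserving χ.map χ.coneM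
    ((Ω.wMeas b).restrict (ball χ.c (4 * χ.r))) := by
  refine ⟨χ.continuous_map.measurable, Measure.AbsolutelyContinuous.mk fun s hs h0 => ?_⟩
  rw [Measure.map_apply χ.continuous_map.measurable hs]
  have h1 : ∀ᵐ X ∂(Ω.wMeas b).restrict (ball χ.c (4 * χ.r)), X ∉ s :=
    measure_eq_zero_iff_ae_notMem.1 h0
  exact measure_eq_zero_iff_ae_notMem.2 (χ.ae_map b h1)

theorem aestronglyMeasurable_fst {E : Type*} [TopologicalSpace E] {f : Rn n → E}
    (hf : AEStronglyMeasurable f (Ω.surf.restrict (ball χ.c χ.r))) :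
    AEStronglyMeasurable (fun q : Rn n × ℝ × Rn n => f q.1) χ.coneM :=
  hf.comp_quasiMeasurePreserving Measure.quasiMeasurePreserving_fst

theorem lintegral_fst_mul {F : Rn n → ℝ≥0∞} {G : ℝ → ℝ≥0∞}
    (hF : AEMeasurable F (Ω.surf.restrict (ball χ.c χ.r))) (hG : Measurable G) :
    ∫⁻ q, G q.2.1 * F q.1 ∂χ.coneM = (∫⁻ t in Ioo 0 χ.r, G t) * volume (ball (0 : Rn n) χ.κ) *
      ∫⁻ Y in ball χ.c χ.r, F Y ∂Ω.surf := by
  have h1 := lintegral_prod_mul (μ := volume.restrict (Ioo 0 χ.r))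
    (ν := volume.restrict (ball (0 : Rn n) χ.κ)) (f := G) (g := fun _ => 1)
    hG.aemeasurable aemeasurable_const
  simp only [mul_one, lintegral_const, Measure.restrict_apply_univ, one_mul] at h1
  rw [← h1, mul_comm (lintegral _ _), coneM, ← lintegral_prod_mul (g := fun q : ℝ × Rn n => G q.1) hF
    (hG.comp measurable_fst).aemeasurable]
  exact lintegral_congr fun q => mul_comm _ _

theorem ae_eq_of_lintegral_lt_top {P a : ℝ} (hP : 1 < P) (ha : a < 1 - 1 / P)
    {f g : Rn n → Cl l} {w : Rn n × ℝ × Rn n → Cl l}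
    (hf : AEStronglyMeasurable f (Ω.surf.restrict (ball χ.c χ.r)))
    (hg : AEStronglyMeasurable g (Ω.surf.restrict (ball χ.c χ.r)))
    (hw : AEStronglyMeasurable w χ.coneM)
    (h1 : ∫⁻ q, ofReal (q.2.1 ^ (P * a - P)) * ‖f q.1 - w q‖ₑ ^ P ∂χ.coneM < ⊤)
    (h2 : ∫⁻ q, ofReal (q.2.1 ^ (P * a - P)) * ‖g q.1 - w q‖ₑ ^ P ∂χ.coneM < ⊤) :
    f =ᵐ[Ω.surf.restrict (ball χ.c χ.r)] g := by
  have hP0 : 0 < P := by linarith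
  have hw' : Measurable fun q : Rn n × ℝ × Rn n => ofReal (q.2.1 ^ (P * a - P)) := by fun_prop
  have h3 : ∫⁻ q, ofReal (q.2.1 ^ (P * a - P)) * ‖f q.1 - g q.1‖ₑ ^ P ∂χ.coneM < ⊤ := by
    calc _ ≤ ∫⁻ q, (2 : ℝ≥0∞) ^ (P - 1) * (ofReal (q.2.1 ^ (P * a - P)) *
          ‖f q.1 - w q‖ₑ ^ P + ofReal (q.2.1 ^ (P * a - P)) * ‖g q.1 - w q‖ₑ ^ P) ∂χ.coneM := by
          refine lintegral_mono fun q => ?_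
          have e : ‖f q.1 - g q.1‖ₑ ≤ ‖f q.1 - w q‖ₑ + ‖g q.1 - w q‖ₑ := by
            rw [← enorm_neg (g q.1 - w q)]
            refine le_trans (le_of_eq ?_) (enorm_add_le _ _)
            congr 1; abel
          have e2 := (rpow_le_rpow e hP0.le).trans (rpow_add_le_mul_rpow_add_rpow _ _ hP.le)
          refine (mul_le_mul_right e2 _).trans (le_of_eq ?_)
          ring
      _ < ⊤ := by
        rw [lintegral_const_mul' _ _ (by finiteness), lintegral_add_left']
        · exact mul_lt_top (by finiteness) (ENNReal.add_lt_top.2 ⟨h1, h2⟩)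
        · exact hw'.aemeasurable.mul (((χ.aestronglyMeasurable_fst hf).sub hw).enorm.pow_const P)
  have hm : AEMeasurable (fun Y => ‖f Y - g Y‖ₑ ^ P) (Ω.surf.restrict (ball χ.c χ.r)) :=
    (hf.sub hg).enorm.pow_const P
  rw [χ.lintegral_fst_mul hm (measurable_ofReal_rpow _), lintegral_rpow_Ioo_eq_top (by
    have : P * a < P * (1 - 1 / P) := by gcongr
    have e : P * (1 - 1 / P) = P - 1 := by field_simp
    linarith) χ.cone.r_pos,
    ENNReal.top_mul (measure_ball_pos _ _ χ.cone.κ_pos).ne'] at h3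
  have h4 : ∫⁻ Y in ball χ.c χ.r, ‖f Y - g Y‖ₑ ^ P ∂Ω.surf = 0 := by
    by_contra h
    rw [ENNReal.top_mul h] at h3
    exact h3.ne rfl
  filter_upwards [(lintegral_eq_zero_iff' hm).1 h4] with Y hY
  simpa [hP0, sub_eq_zero, hP0.le, not_lt.2 hP0.le] using hY

/-- A trace is bounded by its distance to the values inside the cones. -/
theorem exists_lintegral_bdry_le {P a : ℝ} (hP : 1 < P) (ha : -1 / P < a) :
    ∃ C : ℝ, 0 ≤ C ∧ ∀ g w : Rn n → Cl l, AEStronglyMeasurable g (Ω.surf.restrict (ball χ.c χ.r)) →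
      AEStronglyMeasurable w ((Ω.wMeas (P * a)).restrict (ball χ.c (4 * χ.r))) →
      ∫⁻ Y in ball χ.c χ.r, ‖g Y‖ₑ ^ P ∂Ω.surf ≤ ofReal C *
        (∫⁻ q, ofReal (q.2.1 ^ (P * a - P)) * ‖g q.1 - w (χ.map q)‖ₑ ^ P ∂χ.coneM +
          ∫⁻ X in ball χ.c (4 * χ.r), ‖w X‖ₑ ^ P ∂Ω.wMeas (P * a)) := by
  have hP0 : 0 < P := by linarith
  have hr := χ.cone.r_pos
  have hPa : -1 < P * a := neg_one_lt_mul (by positivity) ha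
  obtain ⟨C, hC0, hC⟩ := χ.exists_lintegral_map_le (P * a)
  set v := (volume (ball (0 : Rn n) χ.κ)).toReal with hv
  have hv' : volume (ball (0 : Rn n) χ.κ) = ofReal v := (ofReal_toReal measure_ball_lt_top.ne).symm
  have hv0 : 0 < v := toReal_pos (measure_ball_pos _ _ χ.cone.κ_pos).ne' measure_ball_lt_top.ne
  set I := χ.r ^ (P * a + 1) / (P * a + 1) * v with hI
  have hI0 : 0 < I := by
    have : 0 < P * a + 1 := by linarith
    positivity
  refine ⟨I⁻¹ * (2 ^ (P - 1) * (χ.r ^ P + C)), by positivity, fun g w hg hw => ?_⟩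
  have hm : AEMeasurable (fun Y => ‖g Y‖ₑ ^ P) (Ω.surf.restrict (ball χ.c χ.r)) :=
    hg.enorm.pow_const P
  have h1 := χ.lintegral_fst_mul hm (measurable_ofReal_rpow (P * a))
  rw [lintegral_rpow_Ioo hPa hr.le, hv', ← ofReal_mul (by
    have : 0 < P * a + 1 := by linarith
    positivity)] at h1
  set A := ∫⁻ q, ofReal (q.2.1 ^ (P * a - P)) * ‖g q.1 - w (χ.map q)‖ₑ ^ P ∂χ.coneM with hA
  set B := ∫⁻ X in ball χ.c (4 * χ.r), ‖w X‖ₑ ^ P ∂Ω.wMeas (P * a) with hB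
  have hwm : AEStronglyMeasurable (fun q => w (χ.map q)) χ.coneM :=
    hw.comp_quasiMeasurePreserving (χ.quasiMeasurePreserving_map _)
  have h2 : ∫⁻ q, ofReal (q.2.1 ^ (P * a)) * ‖w (χ.map q)‖ₑ ^ P ∂χ.coneM ≤ ofReal C * B := by
    have hwk := hw.ae_eq_mk
    have e1 : B = ∫⁻ X in ball χ.c (4 * χ.r), ‖hw.mk w X‖ₑ ^ P ∂Ω.wMeas (P * a) := by
      refine lintegral_congr_ae ?_
      filter_upwards [hwk] with X hX
      rw [hX]
    rw [e1]
    refine le_trans (le_of_eq (lintegral_congr_ae ?_))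
      (hC (fun X => ‖hw.mk w X‖ₑ ^ P) (hw.stronglyMeasurable_mk.enorm.pow_const P))
    filter_upwards [χ.ae_map (P * a) hwk] with q hq
    rw [hq]
  have h3 : ∫⁻ q, ofReal (q.2.1 ^ (P * a)) * ‖g q.1‖ₑ ^ P ∂χ.coneM ≤
    ofReal (2 ^ (P - 1)) * (ofReal (χ.r ^ P) * A + ofReal C * B) := by
    have e2 : (2 : ℝ≥0∞) ^ (P - 1) = ofReal (2 ^ (P - 1)) := by
      rw [← ofReal_rpow_of_pos (by norm_num)]; simp
    calc _ ≤ ∫⁻ q, ofReal (2 ^ (P - 1)) * (ofReal (χ.r ^ P) *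
          (ofReal (q.2.1 ^ (P * a - P)) * ‖g q.1 - w (χ.map q)‖ₑ ^ P) +
          ofReal (q.2.1 ^ (P * a)) * ‖w (χ.map q)‖ₑ ^ P) ∂χ.coneM := by
          refine lintegral_mono_ae ?_
          filter_upwards [χ.ae_coneM] with q hq
          obtain ⟨-, -, ht0, htr, -⟩ := hq
          have e : ‖g q.1‖ₑ ≤ ‖g q.1 - w (χ.map q)‖ₑ + ‖w (χ.map q)‖ₑ := by
            refine le_trans (le_of_eq ?_) (enorm_add_le _ _)
            rw [sub_add_cancel]
          have e3 := (rpow_le_rpow e hP0.le).trans (rpow_add_le_mul_rpow_add_rpow _ _ hP.le)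
          have e4 : ofReal (q.2.1 ^ (P * a)) ≤ ofReal (χ.r ^ P) * ofReal (q.2.1 ^ (P * a - P)) := by
            rw [← ofReal_mul (by positivity)]
            refine ofReal_le_ofReal ?_
            calc q.2.1 ^ (P * a) = q.2.1 ^ P * q.2.1 ^ (P * a - P) := by
                  rw [← rpow_add ht0]; congr 1; ring
              _ ≤ _ := by gcongr
          rw [e2] at e3
          calc _ ≤ ofReal (q.2.1 ^ (P * a)) * _ := mul_le_mul_right e3 _
            _ = ofReal (2 ^ (P - 1)) * (ofReal (q.2.1 ^ (P * a)) *
              ‖g q.1 - w (χ.map q)‖ₑ ^ P + ofReal (q.2.1 ^ (P * a)) * ‖w (χ.map q)‖ₑ ^ P) := by ring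
            _ ≤ _ := by rw [← mul_assoc (ofReal (χ.r ^ P))]; gcongr
      _ ≤ _ := by
        rw [lintegral_ofReal_mul, lintegral_add_right', lintegral_ofReal_mul]
        · gcongr
        · exact ((measurable_ofReal_rpow (P * a)).comp
            (measurable_snd.fst)).aemeasurable.mul (hwm.enorm.pow_const P)
  rw [h1] at h3
  have e5 : ofReal I⁻¹ * ofReal I = 1 := by
    rw [← ofReal_mul (by positivity), inv_mul_cancel₀ hI0.ne', ofReal_one]
  calc _ = ofReal I⁻¹ * (ofReal I * ∫⁻ Y in ball χ.c χ.r, ‖g Y‖ₑ ^ P ∂Ω.surf) := by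
        rw [← mul_assoc, e5, one_mul]
    _ ≤ ofReal I⁻¹ * _ := mul_le_mul_right h3 _
    _ ≤ ofReal I⁻¹ * (ofReal (2 ^ (P - 1)) * (ofReal (χ.r ^ P + C) * (A + B))) := by
      gcongr; rw [mul_add]; gcongr
      · linarith
      · have : 0 ≤ χ.r ^ P := by positivity
        linarith
    _ = _ := by rw [ofReal_mul (by positivity), ofReal_mul (by positivity)]; ring

theorem exists_trace_bound {p : ℝ≥0∞} (hp : 1 < p) (hp' : p < ⊤) {a : ℝ}
    (ha : a < 1 - 1 / p.toReal) :
    ∃ C : ℝ, 0 ≤ C ∧ ∀ μ, μ = (Ω.wMeas (p.toReal * a)).restrict (ball χ.c (4 * χ.r)) →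
      ∀ (φ : ℕ → Rn n → Cl l) (w g : Rn n → Cl l) (v : Fin n → Rn n → Cl l),
      (∀ k, ContDiff ℝ ∞ (φ k)) →
      AEStronglyMeasurable w μ →
      (∀ j, AEStronglyMeasurable (v j) μ) →
      AEStronglyMeasurable g (Ω.surf.restrict (ball χ.c χ.r)) →
      Tendsto (fun k => eLpNorm (φ k - w) p μ) atTop (𝓝 0) →
      (∀ j, Tendsto (fun k => eLpNorm (pd j (φ k) - v j) p μ) atTop (𝓝 0)) →
      Tendsto (fun k => eLpNorm (φ k - g) p (Ω.surf.restrict (ball χ.c χ.r))) atTop (𝓝 0) →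
      ∫⁻ q, ofReal (q.2.1 ^ (p.toReal * a - p.toReal)) *
        ‖g q.1 - w (χ.map q)‖ₑ ^ p.toReal ∂χ.coneM ≤
      ofReal C * ∑ j, eLpNorm (v j) p μ ^ p.toReal := by
  obtain ⟨C, hC0, hC⟩ := χ.exists_jet_bound (l := l) hp hp' ha 1
  refine ⟨C, hC0, fun _ hμ φ w g v hd hw hv hg h1 h2 h3 => ?_⟩
  subst hμ
  classical
  have hz : ∀ α : Fin n → ℕ, ∑ i, α i < 1 → α = 0 := by
    intro α hα
    funext i
    have := Finset.sum_eq_zero_iff.1 (Nat.lt_one_iff.1 hα) i (Finset.mem_univ i)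
    simpa using this
  have hs : ∀ α : Fin n → ℕ, ∑ i, α i = 1 → ∃ j, α = Pi.single j 1 := by
    intro α hα
    by_contra! hne
    have := sum_topIdx_one (fun δ => if δ = α then 1 else 0)
    rw [Finset.sum_ite_eq' _ α, if_pos (mem_topIdx.2 hα),
      Finset.sum_eq_zero fun j _ => if_neg (hne j).symm] at this
    exact one_ne_zero this
  have hne : ∀ j : Fin n, (Pi.single j 1 : Fin n → ℕ) ≠ 0 := by
    intro j h
    have := congrFun h j
    simp at this
  set u : Jet n l := fun α => if α = 0 then w else ∑ j, if α = Pi.single j 1 then v j else 0 with hu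
  have hu0 : u 0 = w := if_pos rfl
  have hu1 : ∀ j, u (Pi.single j 1) = v j := by
    intro j
    simp only [hu]; rw [if_neg (hne j), Finset.sum_eq_single j, if_pos rfl]
    · intro i _ hij; rw [if_neg]
      intro h
      have := congrFun h j
      simp [Pi.single_eq_of_ne hij.symm] at this
    · simp
  have hw0 : ∀ k, pdW (wordOf (0 : Fin n → ℕ)) (φ k) = φ k := fun k => by rw [wordOf_zero]; rfl
  have hw1 : ∀ k j, pdW (wordOf (Pi.single j 1 : Fin n → ℕ)) (φ k) = pd j (φ k) := fun k j => by
    rw [wordOf_single]; rfl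
  have key := hC (fun k α => pdW (wordOf α) (φ k)) u (fun _ => g) (fun k α => contDiff_pdW (hd k) _)
    (fun k α hα j X _ _ => by
      rw [hz α hα, zero_add]
      simp only [hw1, hw0])
    (fun α hα => by
      rcases Nat.le_one_iff_eq_zero_or_eq_one.1 hα with h | h
      · rw [hz α (by omega), hu0]; exact hw
      · obtain ⟨j, rfl⟩ := hs α h
        rw [hu1]; exact hv j)
    (fun _ _ => hg)
    (fun α hα => by
      rcases Nat.le_one_iff_eq_zero_or_eq_one.1 hα with h | h
      · rw [hz α (by omega), hu0]; simp only [hw0]; exact h1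
      · obtain ⟨j, rfl⟩ := hs α h
        rw [hu1]; simp only [hw1]; exact h2 j)
    (fun α hα => by rw [hz α hα]; simp only [hw0]; exact h3) 0 (by simp)
  rw [sum_topIdx_one] at key
  simp only [hu1] at key
  have e1 : ∀ Y W : Rn n, taylor 1 (truncJet 1 u) 0 Y W = w W := by
    intro Y W; rw [taylor_truncJet]
    have : mlt n (1 - ∑ i, (0 : Fin n → ℕ) i) = {0} := by
      ext β; rw [mem_mlt, Finset.mem_singleton]
      constructor
      · intro h; exact hz β (by simpa using h)
      · rintro rfl; simp
    rw [this, Finset.sum_singleton, dpow_zero, one_smul, zero_add, hu0]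
  have e2 : jetExp p.toReal a 1 (0 : Fin n → ℕ) = p.toReal * a - p.toReal := by simp [jetExp]
  simp only [e1, e2] at key
  exact key

end Chart

theorem _root_.HasWeakD.aestronglyMeasurable {α : Fin n → ℕ} {u v : Rn n → Cl l}
    (h : HasWeakD Ω.carrier α u v) (b : ℝ) : AEStronglyMeasurable v (Ω.wMeas b) :=
  (h.2.1.aestronglyMeasurable).mono_ac (wMeas_ac _)

theorem enorm_classD1_sub {j : Fin n} {φ v : Rn n → Cl l} (X : Rn n) :
    ‖(classD1 j φ - v) X‖ₑ = ‖(pd j φ - Complex.I • v) X‖ₑ := by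
  have : (pd j φ - Complex.I • v) X = Complex.I • (classD1 j φ - v) X := by
    rw [classD1_eq]
    simp only [Pi.smul_apply, Pi.sub_apply, smul_sub, smul_smul]
    rw [mul_neg, Complex.I_mul_I, neg_neg, one_smul]
  rw [this, enorm_smul]; simp [enorm_eq_nnnorm]

theorem Chart.exists_isTrace_bound (χ : Ω.Chart) {p : ℝ≥0∞} (hp : 1 < p) (hp' : p < ⊤) {a : ℝ}
    (ha : a < 1 - 1 / p.toReal) :
    ∃ C : ℝ, 0 ≤ C ∧ ∀ (w g : Rn n → Cl l) (v : Fin n → Rn n → Cl l),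
      (∀ j, HasWeakD Ω.carrier (Pi.single j 1) w (v j)) →
      AEStronglyMeasurable g Ω.surf → IsTrace Ω p a w g →
      ∫⁻ q, ofReal (q.2.1 ^ (p.toReal * a - p.toReal)) *
        ‖g q.1 - w (χ.map q)‖ₑ ^ p.toReal ∂χ.coneM ≤
      ofReal C * ∑ j, eLpNorm (v j) p (Ω.wMeas (p.toReal * a)) ^ p.toReal := by
  obtain ⟨C, hC0, hC⟩ := χ.exists_trace_bound (l := l) hp hp' ha
  refine ⟨C, hC0, fun w g v hv hg ⟨v', hv', φ, hφ, h1, h2, h3⟩ => ?_⟩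
  have hj : 0 < n := by linarith [Ω.two_le]
  have hw := ((hv ⟨0, hj⟩).1.aestronglyMeasurable).mono_ac (wMeas_ac (p.toReal * a))
  have hvv : ∀ j, v' j =ᵐ[Ω.wMeas (p.toReal * a)] v j := fun j =>
    (wMeas_ac _).ae_eq (HasWeakD.unique Ω.isOpen (hv' j) (hv j))
  refine (hC _ rfl φ w g (fun j => Complex.I • v j) hφ hw.restrict
    (fun j => (((hv j).aestronglyMeasurable _).restrict).const_smul _) hg.restrict ?_ ?_ ?_).trans ?_
  · exact tendsto_zero_of_le h1 fun k => eLpNorm_restrict_le _ _ _ _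
  · intro j
    refine tendsto_zero_of_le (h2 j) fun k => ?_
    refine (eLpNorm_restrict_le _ _ _ _).trans (le_of_eq ?_)
    refine eLpNorm_congr_enorm_ae ?_
    filter_upwards [hvv j] with X hX
    rw [enorm_classD1_sub, Pi.sub_apply, Pi.sub_apply, Pi.smul_apply, Pi.smul_apply, hX]
  · exact tendsto_zero_of_le h3 fun k => eLpNorm_restrict_le _ _ _ _
  · gcongr with j
    refine (eLpNorm_restrict_le _ _ _ _).trans (le_of_eq ?_)
    rw [eLpNorm_const_smul]; simp [enorm_eq_nnnorm]

/-- A function on the boundary that is close to `w` inside the cones is the trace of `w`. -/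
theorem _root_.IsTrace.ae_eq {p : ℝ≥0∞} (hp : 1 < p) (hp' : p < ⊤) {a : ℝ}
    (ha : a < 1 - 1 / p.toReal) {w f g : Rn n → Cl l} {v : Fin n → Rn n → Cl l}
    (hv : ∀ j, HasWeakD Ω.carrier (Pi.single j 1) w (v j))
    (hvp : ∀ j, MemLp (v j) p (Ω.wMeas (p.toReal * a)))
    (hf : AEStronglyMeasurable f Ω.surf) (hg : AEStronglyMeasurable g Ω.surf)
    (h : IsTrace Ω p a w g)
    (h' : ∀ χ : Ω.Chart, ∫⁻ q, ofReal (q.2.1 ^ (p.toReal * a - p.toReal)) *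
      ‖f q.1 - w (χ.map q)‖ₑ ^ p.toReal ∂χ.coneM < ⊤) : f =ᵐ[Ω.surf] g := by
  have hP : 1 < p.toReal := one_lt_toReal hp hp'
  have hj : 0 < n := by linarith [Ω.two_le]
  have hw := ((hv ⟨0, hj⟩).1.aestronglyMeasurable).mono_ac (wMeas_ac (p.toReal * a))
  refine ae_surf_of_chart fun χ => ?_
  obtain ⟨C, hC0, hC⟩ := χ.exists_isTrace_bound (l := l) hp hp' ha
  refine χ.ae_eq_of_lintegral_lt_top hP ha hf.restrict hg.restrict
    (hw.restrict.comp_quasiMeasurePreserving (χ.quasiMeasurePreserving_map _)) (h' χ)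
    ((hC w g v hv hg h).trans_lt ?_)
  refine mul_lt_top ofReal_lt_top (sum_lt_top.2 fun j _ => ?_)
  exact rpow_lt_top_of_nonneg (by linarith) (hvp j).2.ne

theorem _root_.IsTrace.unique {p : ℝ≥0∞} (hp : 1 < p) (hp' : p < ⊤) {a : ℝ}
    (ha : a < 1 - 1 / p.toReal) {w f g : Rn n → Cl l} {v : Fin n → Rn n → Cl l}
    (hv : ∀ j, HasWeakD Ω.carrier (Pi.single j 1) w (v j))
    (hvp : ∀ j, MemLp (v j) p (Ω.wMeas (p.toReal * a)))
    (hf : AEStronglyMeasurable f Ω.surf) (hg : AEStronglyMeasurable g Ω.surf)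
    (h : IsTrace Ω p a w g) (h' : IsTrace Ω p a w f) : f =ᵐ[Ω.surf] g := by
  refine IsTrace.ae_eq hp hp' ha hv hvp hf hg h fun χ => ?_
  obtain ⟨C, hC0, hC⟩ := χ.exists_isTrace_bound (l := l) hp hp' ha
  refine (hC w f v hv hf h').trans_lt (mul_lt_top ofReal_lt_top (sum_lt_top.2 fun j _ => ?_))
  exact rpow_lt_top_of_nonneg toReal_nonneg (hvp j).2.ne

end LipDomain

open scoped Convolution

theorem lintegral_rpow_le {X : Type*} [MeasurableSpace X] {μ : Measure X} {P : ℝ} (hP : 1 < P)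
    {F : X → ℝ≥0∞} (hF : AEMeasurable F μ) :
    (∫⁻ x, F x ∂μ) ^ P ≤ μ univ ^ (P - 1) * ∫⁻ x, F x ^ P ∂μ := by
  have hP0 : 0 < P := by linarith
  have hpq := Real.HolderConjugate.conjExponent hP
  have h := ENNReal.lintegral_mul_le_Lp_mul_Lq μ hpq hF (g := fun _ => 1) aemeasurable_const
  have h' := rpow_le_rpow h hP0.le
  have e : 1 / P.conjExponent * P = P - 1 := by
    rw [Real.conjExponent]
    have : P - 1 ≠ 0 := by linarith
    field_simp
  rw [mul_rpow_of_nonneg _ _ hP0.le, ← ENNReal.rpow_mul, ← ENNReal.rpow_mul,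
    one_div_mul_cancel hP0.ne', ENNReal.rpow_one, e] at h'
  simp only [Pi.mul_apply, mul_one, ENNReal.one_rpow, lintegral_const, one_mul] at h'
  rwa [mul_comm]

namespace LipDomain

variable {n l : ℕ} {Ω : LipDomain n}

/-- The points of `Ω` at distance at least `δ` from the boundary. -/
def core (Ω : LipDomain n) (δ : ℝ) : Set (Rn n) := {X ∈ Ω.carrier | δ ≤ Ω.rho X}

theorem isCompact_core {δ : ℝ} (hδ : 0 < δ) : IsCompact (Ω.core δ) := by
  have h : Ω.core δ = closure Ω.carrier ∩ {X | δ ≤ Ω.rho X} := by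
    ext X
    refine ⟨fun h => ⟨subset_closure h.1, h.2⟩, fun h => ⟨?_, h.2⟩⟩
    by_contra hX
    have hb : X ∈ Ω.bdry := by
      rw [bdry, Ω.isOpen.frontier_eq]
      exact ⟨h.1, hX⟩
    have h1 := Ω.rho_le_dist X hb
    have h2 : δ ≤ Ω.rho X := h.2
    rw [dist_self] at h1; linarith
  rw [h]
  exact (Ω.isBounded.isCompact_closure).inter_right (isClosed_le continuous_const Ω.continuous_rho)

theorem integrable_core {δ : ℝ} (hδ : 0 < δ) {u : Rn n → Cl l}
    (hu : LocallyIntegrableOn u Ω.carrier volume) : Integrable ((Ω.core δ).indicator u) :=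
  (integrable_indicator_iff (isCompact_core hδ).measurableSet).2
    (hu.integrableOn_compact_subset (fun _ h => h.1) (isCompact_core hδ))

namespace IsCone

variable {c v : Rn n} {κ r ε : ℝ} (h : Ω.IsCone c v κ r)

/-- A bump function supported in the ball of radius `κ`. -/
def bump : ContDiffBump (0 : Rn n) :=
  ⟨κ / 2, κ, by have := h.κ_pos; positivity, by linarith [h.κ_pos]⟩

/-- A mollifier supported in the cone with axis `v`. -/
def ker (ε : ℝ) (ξ : Rn n) : ℝ := (ε ^ n)⁻¹ * h.bump.normed volume (ε⁻¹ • ξ - v)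

/-- Mollification in the direction of the cone. -/
def moll (ε : ℝ) (u : Rn n → Cl l) (X : Rn n) : Cl l :=
  ∫ W, h.ker ε (W - X) • (Ω.core (κ * ε)).indicator u W

theorem ker_nonneg (hε : 0 < ε) (ξ : Rn n) : 0 ≤ h.ker ε ξ :=
  mul_nonneg (by positivity) (h.bump.nonneg_normed _)

theorem contDiff_ker (ε : ℝ) : ContDiff ℝ ∞ (h.ker ε) := by
  refine contDiff_const.mul ((h.bump.contDiff_normed (μ := volume)).comp ?_)
  exact (contDiff_const_smul _).sub contDiff_const

theorem ker_eq_zero {ξ : Rn n} (hξ : κ ≤ ‖ε⁻¹ • ξ - v‖) : h.ker ε ξ = 0 := by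
  have : ε⁻¹ • ξ - v ∉ Function.support (h.bump.normed volume) := by
    rw [h.bump.support_normed_eq, mem_ball_zero_iff]
    exact not_lt.2 hξ
  rw [ker, Function.notMem_support.1 this, mul_zero]

theorem norm_le_of_ker_ne_zero (hε : 0 < ε) {ξ : Rn n} (hξ : h.ker ε ξ ≠ 0) : ‖ξ‖ ≤ 2 * ε := by
  have h1 : ‖ε⁻¹ • ξ - v‖ < κ := by
    by_contra! hc
    exact hξ (h.ker_eq_zero hc)
  have h2 : ‖ε⁻¹ • ξ‖ ≤ 2 := by
    have := norm_le_norm_sub_add (ε⁻¹ • ξ) v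
    have := h.κ_le
    have := h.norm_le
    linarith
  rw [norm_smul, norm_inv, norm_of_nonneg hε.le, inv_mul_le_iff₀ hε] at h2; linarith

theorem hasCompactSupport_ker (hε : 0 < ε) : HasCompactSupport (h.ker ε) :=
  HasCompactSupport.intro (isCompact_closedBall (0 : Rn n) (2 * ε)) fun ξ hξ => by
    by_contra hc
    exact hξ (mem_closedBall_zero_iff.2 (h.norm_le_of_ker_ne_zero hε hc))

theorem integral_ker (hε : 0 < ε) (X : Rn n) : ∫ W, h.ker ε (W - X) = 1 := by
  rw [integral_sub_right_eq_self (fun W => h.ker ε W)]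
  simp only [ker]
  rw [integral_const_mul, Measure.integral_comp_inv_smul_of_nonneg volume
    (fun ξ => h.bump.normed volume (ξ - v)) hε.le,
    integral_sub_right_eq_self (fun ξ => h.bump.normed volume ξ), h.bump.integral_normed,
    finrank_euclideanSpace_fin]
  simp [hε.ne']

theorem exists_ker_le : ∃ M : ℝ, 0 ≤ M ∧ ∀ ε, 0 < ε → ∀ ξ, h.ker ε ξ ≤ M * (ε ^ n)⁻¹ := by
  refine ⟨1 / volume.real (closedBall (0 : Rn n) h.bump.rIn), by positivity, fun ε hε ξ => ?_⟩
  rw [ker, mul_comm]; gcongr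
  exact h.bump.normed_le_div_measure_closedBall_rIn _ _

/-- Near `c`, the mollifier stays in the part of `Ω` away from the boundary. -/
theorem mem_core (h : Ω.IsCone c v κ r) (hε : 0 < ε) (hεr : ε < r) {X W : Rn n} (hX : X ∈ closure Ω.carrier)
    (hXc : dist X c < 4 * r) (hW : ‖ε⁻¹ • (W - X) - v‖ ≤ κ) : W ∈ Ω.core (κ * ε) := by
  obtain ⟨h1, h2⟩ := h.cone X hX hXc ε hε hεr _ hW
  have e : X + ε • (v + (ε⁻¹ • (W - X) - v)) = W := by
    rw [add_sub_cancel, smul_inv_smul₀ hε.ne', add_sub_cancel]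
  rw [e] at h1 h2
  refine ⟨h1, le_trans ?_ h2⟩
  have := Ω.rho_nonneg X
  have := h.κ_pos
  gcongr; linarith

theorem moll_eq_convolution (ε : ℝ) (u : Rn n → Cl l) : h.moll ε u =
    ((Ω.core (κ * ε)).indicator u) ⋆[(ContinuousLinearMap.lsmul ℝ ℝ).flip, volume]
      (fun ξ => h.ker ε (-ξ)) := by
  funext X; rw [convolution_def]
  simp only [ContinuousLinearMap.flip_apply, ContinuousLinearMap.lsmul_apply, neg_sub]; rfl

theorem contDiff_moll (hε : 0 < ε) {u : Rn n → Cl l}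
    (hu : LocallyIntegrableOn u Ω.carrier volume) : ContDiff ℝ ∞ (h.moll ε u) := by
  rw [h.moll_eq_convolution]
  exact HasCompactSupport.contDiff_convolution_right _
    ((h.hasCompactSupport_ker hε).comp_homeomorph (Homeomorph.neg _))
    (integrable_core (mul_pos h.κ_pos hε) hu).locallyIntegrable
    ((h.contDiff_ker ε).comp contDiff_neg)

theorem integrable_moll (hε : 0 < ε) {u : Rn n → Cl l}
    (hu : LocallyIntegrableOn u Ω.carrier volume) (X : Rn n) :
    Integrable fun W => h.ker ε (W - X) • (Ω.core (κ * ε)).indicator u W := by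
  obtain ⟨M, hM0, hM⟩ := h.exists_ker_le
  refine Integrable.bdd_smul (φ := fun W => h.ker ε (W - X))
    (integrable_core (mul_pos h.κ_pos hε) hu) (M * (ε ^ n)⁻¹) ?_ ?_
  · exact ((h.contDiff_ker ε).continuous.comp (by fun_prop)).aestronglyMeasurable
  · refine .of_forall fun W => ?_
    rw [norm_of_nonneg (h.ker_nonneg hε _)]
    exact hM ε hε _

theorem moll_sub (hε : 0 < ε) {u w : Rn n → Cl l} (hu : LocallyIntegrableOn u Ω.carrier volume)
    (hw : LocallyIntegrableOn w Ω.carrier volume) (X : Rn n) :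
    h.moll ε (u - w) X = h.moll ε u X - h.moll ε w X := by
  rw [moll, moll, moll, ← integral_sub (h.integrable_moll hε hu X) (h.integrable_moll hε hw X)]
  refine integral_congr_ae (.of_forall fun W => ?_)
  by_cases hW : W ∈ Ω.core (κ * ε)
  · simp only [indicator_of_mem hW, Pi.sub_apply, smul_sub]
  · simp only [indicator_of_notMem hW, smul_zero, sub_zero]

theorem pd_moll (hε : 0 < ε) (hεr : ε < r) {u w : Rn n → Cl l} {j : Fin n}
    (hu : HasWeakD Ω.carrier (Pi.single j 1) u w) {X : Rn n} (hX : X ∈ closure Ω.carrier)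
    (hXc : dist X c < 4 * r) : pd j (h.moll ε u) X = h.moll ε (Complex.I • w) X := by
  have hκε := mul_pos h.κ_pos hε
  set g : Rn n → ℝ := fun ξ => h.ker ε (-ξ) with hg
  have hgc : HasCompactSupport g := (h.hasCompactSupport_ker hε).comp_homeomorph (Homeomorph.neg _)
  have hgd : ContDiff ℝ ∞ g := (h.contDiff_ker ε).comp contDiff_neg
  have hui := (integrable_core hκε hu.1).locallyIntegrable
  have h1 := (HasCompactSupport.hasFDerivAt_convolution_right
    ((ContinuousLinearMap.lsmul ℝ ℝ).flip : Cl l →L[ℝ] ℝ →L[ℝ] Cl l) hgc hui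
    (hgd.of_le (by simp)) X).fderiv
  set φ : Rn n → ℂ := fun W => ((h.ker ε (W - X) : ℝ) : ℂ) with hφ
  have hφd : ContDiff ℝ ∞ φ := Complex.ofRealCLM.contDiff.comp
    ((h.contDiff_ker ε).comp (contDiff_id.sub contDiff_const))
  have hsupp : tsupport φ ⊆ {W | ‖ε⁻¹ • (W - X) - v‖ ≤ κ} := by
    refine closure_minimal (fun W hW => ?_) (isClosed_le (by fun_prop) continuous_const)
    by_contra hc
    refine hW ?_
    rw [hφ]
    simp only
    rw [h.ker_eq_zero (not_le.1 hc).le, Complex.ofReal_zero]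
  have hcore : tsupport φ ⊆ Ω.core (κ * ε) := fun W hW => h.mem_core hε hεr hX hXc (hsupp hW)
  have hφc : HasCompactSupport φ :=
    (isCompact_core hκε).of_isClosed_subset (isClosed_tsupport _) hcore
  have h2 := hu.integral_pd hφd hφc (hcore.trans fun _ hW => hW.1)
  have hpd : ∀ W, pd j φ W = ((-(fderiv ℝ g (X - W) (EuclideanSpace.single j 1)) : ℝ) : ℂ) := by
    intro W
    have e1 : φ = fun W => Complex.ofRealCLM (g (X - W)) := by funext W; simp [hφ, hg]
    have e2 : HasFDerivAt (fun W => g (X - W)) (-(fderiv ℝ g (X - W))) W := by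
      have e3 : HasFDerivAt (fun W : Rn n => X - W) (-(ContinuousLinearMap.id ℝ (Rn n))) W :=
        (hasFDerivAt_id W).const_sub X
      have := ((hgd.differentiable (by simp)) (X - W)).hasFDerivAt.comp W e3
      convert! this using 1
      ext y; simp
    rw [pd, e1, HasFDerivAt.fderiv (f := fun W => Complex.ofRealCLM (g (X - W)))
      ((Complex.ofRealCLM.hasFDerivAt).comp W e2)]
    simp
  have hpd0 : ∀ W, W ∉ Ω.core (κ * ε) → pd j φ W = 0 := by
    intro W hW
    have : W ∉ tsupport (fderiv ℝ φ) := fun hc => hW (hcore (tsupport_fderiv_subset ℝ hc))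
    rw [pd, image_eq_zero_of_notMem_tsupport this, zero_apply]
  have hφ0 : ∀ W, W ∉ Ω.core (κ * ε) → φ W = 0 := fun W hW =>
    image_eq_zero_of_notMem_tsupport fun hc => hW (hcore hc)
  have e3 : pd j (h.moll ε u) X = -∫ W in Ω.carrier, pd j φ W • u W := by
    rw [pd, h.moll_eq_convolution, h1, convolution_precompR_apply _ hui (hgc.fderiv (𝕜 := ℝ))
      ((hgd.continuous_fderiv (by simp))), convolution_def, ← integral_neg,
      ← integral_indicator Ω.isOpen.measurableSet]
    refine integral_congr_ae (.of_forall fun W => ?_)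
    simp only [ContinuousLinearMap.flip_apply, ContinuousLinearMap.lsmul_apply]
    by_cases hW : W ∈ Ω.core (κ * ε)
    · rw [indicator_of_mem hW, indicator_of_mem hW.1, hpd, Complex.coe_smul, neg_smul, neg_neg]
    · rw [indicator_of_notMem hW, smul_zero]
      by_cases hW' : W ∈ Ω.carrier
      · rw [indicator_of_mem hW', hpd0 W hW, zero_smul, neg_zero]
      · rw [indicator_of_notMem hW']
  rw [e3, h2, neg_neg, moll, ← integral_indicator Ω.isOpen.measurableSet]
  refine integral_congr_ae (.of_forall fun W => ?_)
  simp only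
  by_cases hW : W ∈ Ω.core (κ * ε)
  · rw [indicator_of_mem hW, indicator_of_mem hW.1, hφ]
    simp only [Complex.coe_smul, Pi.smul_apply]
  · rw [indicator_of_notMem hW, smul_zero]
    by_cases hW' : W ∈ Ω.carrier
    · rw [indicator_of_mem hW', hφ0 W hW, zero_smul]
    · rw [indicator_of_notMem hW']

end IsCone

end LipDomain

namespace LipDomain

variable {n l : ℕ} {Ω : LipDomain n}

namespace IsCone

variable {c v : Rn n} {κ r : ℝ} (h : Ω.IsCone c v κ r)

theorem exists_wMeas_shadow_le (h : Ω.IsCone c v κ r) {b : ℝ} (hb : -1 < b) :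
    ∃ C : ℝ, 0 ≤ C ∧ ∃ ε₀ > 0, ∀ ε, 0 < ε → ε < ε₀ → ε < r ∧ ∀ W ∈ Ω.carrier,
      Ω.wMeas b {X | dist X c < 4 * r ∧ dist W (X + ε • v) < κ * ε} ≤
        ofReal (C * ε ^ n * Ω.rho W ^ b) := by
  obtain ⟨C, hC0, δ, hδ, hC⟩ := Ω.exists_wMeas_ball_le hb
  have hκ := h.κ_pos
  have hκ1 := h.κ_le
  set M := 3 / κ with hM
  set β := (volume (ball (0 : Rn n) 1)).toReal with hβ
  have hβ' : volume (ball (0 : Rn n) 1) = ofReal β := (ofReal_toReal measure_ball_lt_top.ne).symm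
  refine ⟨M ^ |b| * β + C * M ^ |b|, by positivity, min δ r, lt_min hδ h.r_pos,
    fun ε hε hε₀ => ⟨hε₀.trans_le (min_le_right _ _), fun W hW => ?_⟩⟩
  have hεr : ε < r := hε₀.trans_le (min_le_right _ _)
  have hρW := Ω.rho_pos hW
  have key : ∀ X ∈ Ω.carrier, dist X c < 4 * r → dist W (X + ε • v) < κ * ε →
    κ * (Ω.rho X + ε) ≤ Ω.rho W ∧ Ω.rho W ≤ Ω.rho X + 2 * ε ∧ dist X (W - ε • v) < ε := by
    intro X hX hXc hXW
    have hz : ‖ε⁻¹ • (W - (X + ε • v))‖ ≤ κ := by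
      rw [norm_smul, norm_inv, norm_of_nonneg hε.le, ← dist_eq_norm, inv_mul_le_iff₀ hε, mul_comm]
      exact hXW.le
    have e : X + ε • (v + ε⁻¹ • (W - (X + ε • v))) = W := by
      rw [smul_add, smul_inv_smul₀ hε.ne']; abel
    have h1 := (h.cone X (subset_closure hX) hXc ε hε hεr _ hz).2
    rw [e] at h1
    have h2 : dist W X ≤ 2 * ε := by
      have h3 := dist_triangle W (X + ε • v) X
      have h4 : dist (X + ε • v) X ≤ ε := by
        rw [dist_eq_norm, add_sub_cancel_left, norm_smul, norm_of_nonneg hε.le]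
        nlinarith [h.norm_le]
      nlinarith
    refine ⟨h1, ?_, ?_⟩
    · linarith [Ω.rho_le_add W X]
    · have e2 : dist X (W - ε • v) = dist W (X + ε • v) := by
        rw [dist_comm, dist_eq_norm, dist_eq_norm]; congr 1; abel
      rw [e2]; nlinarith
  set s₁ := ball (W - ε • v) ε ∩ {X | ε ≤ Ω.rho X ∧ κ * Ω.rho X ≤ Ω.rho W ∧
    Ω.rho W ≤ 3 * Ω.rho X} with hs₁
  set s₂ := {X | X ∈ ball (W - ε • v) ε ∩ {X | Ω.rho X < ε} ∧ κ * ε ≤ Ω.rho W ∧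
    Ω.rho W ≤ 3 * ε} with hs₂
  have hm : MeasurableSet s₁ := by
    have := Ω.continuous_rho
    refine measurableSet_ball.inter ?_
    exact ((isClosed_le continuous_const this).inter ((isClosed_le (continuous_const.mul this) continuous_const).inter
      (isClosed_le continuous_const (continuous_const.mul this)))).measurableSet
  have hsub : Ω.wMeas b {X | dist X c < 4 * r ∧ dist W (X + ε • v) < κ * ε} ≤
    Ω.wMeas b (s₁ ∪ s₂) := by
    refine measure_mono_ae ?_
    filter_upwards [(wMeas_ac b).ae_le (ae_restrict_mem Ω.isOpen.measurableSet)] with X hX hX'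
    obtain ⟨h1, h2, h3⟩ := key X hX hX'.1 hX'.2
    have := Ω.rho_pos hX
    rcases le_or_gt ε (Ω.rho X) with h4 | h4
    · exact Or.inl ⟨h3, h4, by nlinarith, by linarith⟩
    · exact Or.inr ⟨⟨h3, h4⟩, by nlinarith, by linarith⟩
  have hb₁ : Ω.wMeas b s₁ ≤ ofReal (M ^ |b| * β * ε ^ n * Ω.rho W ^ b) := by
    have e := Ω.lintegral_wMeas b (F := fun _ => 1) measurable_const hm
    rw [setLIntegral_one] at e; rw [e]
    calc _ ≤ ∫⁻ _ in s₁ ∩ Ω.carrier, ofReal (M ^ |b| * Ω.rho W ^ b) := by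
          refine setLIntegral_mono' (hm.inter Ω.isOpen.measurableSet) fun X hX => ?_
          obtain ⟨-, h1, h2, h3⟩ := hX.1
          rw [mul_one]
          have h4 : Ω.rho X ≤ Ω.rho W / κ := by rwa [le_div_iff₀ hκ, mul_comm]
          have e1 : M * Ω.rho W = 3 * (Ω.rho W / κ) := by rw [hM]; ring
          have e2 : 3 ≤ M := by rw [hM, le_div_iff₀ hκ]; linarith
          have h5 := Ω.rho_pos hX.2
          refine ofReal_le_ofReal (rpow_le_of_comparable b hρW h5 ?_ ?_)
          · rw [e1]
            have : 0 < Ω.rho W / κ := by positivity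
            linarith
          · nlinarith
      _ ≤ ofReal (M ^ |b| * Ω.rho W ^ b) * volume (ball (W - ε • v) (ε * 1)) := by
        rw [setLIntegral_const, mul_one]; gcongr
        exact fun X hX => hX.1.1
      _ = _ := by
        rw [Measure.addHaar_ball_mul_of_pos _ _ hε, finrank_euclideanSpace_fin, hβ',
          ← ofReal_mul (by positivity), ← ofReal_mul (by positivity)]
        congr 1; ring
  have hb₂ : Ω.wMeas b s₂ ≤ ofReal (C * M ^ |b| * ε ^ n * Ω.rho W ^ b) := by
    rcases s₂.eq_empty_or_nonempty with h0 | ⟨X, -, h1, h2⟩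
    · rw [h0, measure_empty]; exact bot_le
    · refine (measure_mono fun X hX => hX.1).trans ((hC _ ε hε
        (hε₀.trans_le (min_le_left _ _))).trans (ofReal_le_ofReal ?_))
      rw [Real.rpow_add_natCast hε.ne']
      have h3 : ε ^ b ≤ M ^ |b| * Ω.rho W ^ b := by
        have h4 : ε ≤ Ω.rho W / κ := by rwa [le_div_iff₀ hκ, mul_comm]
        have e1 : M * Ω.rho W = 3 * (Ω.rho W / κ) := by rw [hM]; ring
        have e2 : 3 ≤ M := by rw [hM, le_div_iff₀ hκ]; linarith
        refine rpow_le_of_comparable b hρW hε ?_ ?_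
        · rw [e1]
          have : 0 < Ω.rho W / κ := by positivity
          linarith
        · nlinarith
      calc C * (ε ^ b * ε ^ n) ≤ C * ((M ^ |b| * Ω.rho W ^ b) * ε ^ n) := by gcongr
        _ = _ := by ring
  refine hsub.trans ((measure_union_le _ _).trans ((add_le_add hb₁ hb₂).trans (le_of_eq ?_)))
  rw [← ENNReal.ofReal_add (by positivity) (by positivity)]; congr 1; ring

theorem exists_lintegral_moll_le {P : ℝ} (hP : 1 < P) {b : ℝ} (hb : -1 < b) :
    ∃ C : ℝ, 0 ≤ C ∧ ∃ ε₀ > 0, ∀ ε, 0 < ε → ε < ε₀ → ∀ u : Rn n → Cl l, StronglyMeasurable u →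
      ∫⁻ X in ball c (4 * r), ‖h.moll ε u X‖ₑ ^ P ∂Ω.wMeas b ≤
        ofReal C * ∫⁻ X, ‖u X‖ₑ ^ P ∂Ω.wMeas b := by
  obtain ⟨C, hC0, ε₀, hε₀, hC⟩ := h.exists_wMeas_shadow_le hb
  obtain ⟨M, hM0, hM⟩ := h.exists_ker_le
  have hκ := h.κ_pos
  have hP0 : 0 < P := by linarith
  set β := (volume (ball (0 : Rn n) κ)).toReal with hβ
  have hβ' : volume (ball (0 : Rn n) κ) = ofReal β := (ofReal_toReal measure_ball_lt_top.ne).symm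
  refine ⟨M ^ P * β ^ (P - 1) * C, by positivity, ε₀, hε₀, fun ε hε hεε u hu => ?_⟩
  obtain ⟨hεr, hsh⟩ := hC ε hε hεε
  have hcm : MeasurableSet (Ω.core (κ * ε)) := (isCompact_core (mul_pos hκ hε)).measurableSet
  set U : Rn n → ℝ≥0∞ := fun W => ‖(Ω.core (κ * ε)).indicator u W‖ₑ ^ P with hU
  have hUm0 : Measurable fun W => ‖(Ω.core (κ * ε)).indicator u W‖ₑ := (hu.indicator hcm).enorm
  have hUm : Measurable U := hUm0.pow_const P
  set K := M ^ P * β ^ (P - 1) * (ε ^ n)⁻¹ with hK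
  have hpt : ∀ X, ‖h.moll ε u X‖ₑ ^ P ≤ ofReal K *
    ∫⁻ W, (ball (X + ε • v) (κ * ε)).indicator U W := by
    intro X
    have h1 : ‖h.moll ε u X‖ₑ ≤ ofReal (M * (ε ^ n)⁻¹) *
      ∫⁻ W in ball (X + ε • v) (κ * ε), ‖(Ω.core (κ * ε)).indicator u W‖ₑ := by
      refine (enorm_integral_le_lintegral_enorm _).trans ?_
      rw [← lintegral_const_mul _ hUm0, ← lintegral_indicator measurableSet_ball]
      refine lintegral_mono fun W => ?_
      by_cases hW : W ∈ ball (X + ε • v) (κ * ε)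
      · rw [indicator_of_mem hW, enorm_smul]; gcongr; rw [Real.enorm_of_nonneg (h.ker_nonneg hε _)]
        exact ofReal_le_ofReal (hM ε hε _)
      · rw [indicator_of_notMem hW, h.ker_eq_zero, zero_smul, enorm_zero]
        have e : ε⁻¹ • (W - X) - v = ε⁻¹ • (W - (X + ε • v)) := by
          rw [← sub_sub, smul_sub _ (W - X), inv_smul_smul₀ hε.ne']
        rw [e, norm_smul, norm_inv, norm_of_nonneg hε.le, ← dist_eq_norm,
          le_inv_mul_iff₀ hε, mul_comm]
        exact not_lt.1 hW
    have h2 := (rpow_le_rpow h1 hP0.le)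
    rw [mul_rpow_of_nonneg _ _ hP0.le] at h2
    refine h2.trans ((mul_le_mul_right (lintegral_rpow_le hP hUm0.aemeasurable) _).trans ?_)
    have hvol : volume (ball (X + ε • v) (κ * ε)) = ofReal (ε ^ n * β) := by
      rw [mul_comm κ, Measure.addHaar_ball_mul_of_pos _ _ hε, finrank_euclideanSpace_fin, hβ',
        ofReal_mul (by positivity)]
    rw [Measure.restrict_apply_univ, lintegral_indicator measurableSet_ball, ← mul_assoc,
      hvol, ofReal_rpow_of_nonneg (by positivity) hP0.le,
      ofReal_rpow_of_nonneg (by positivity) (by linarith), ← ofReal_mul (by positivity)]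
    refine mul_le_mul_left (ofReal_le_ofReal (le_of_eq ?_)) _
    have hεn : 0 < ε ^ n := by positivity
    rw [hK, mul_rpow hM0 (by positivity), mul_rpow hεn.le (by positivity),
      Real.inv_rpow hεn.le, Real.rpow_sub_one hεn.ne']
    have : (ε ^ n) ^ P ≠ 0 := by positivity
    field_simp
  have hjm : Measurable fun q : Rn n × Rn n =>
    (ball (q.1 + ε • v) (κ * ε)).indicator U q.2 := by
    have e : (fun q : Rn n × Rn n => (ball (q.1 + ε • v) (κ * ε)).indicator U q.2) =
      {q : Rn n × Rn n | dist q.2 (q.1 + ε • v) < κ * ε}.indicator (fun q => U q.2) := by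
      funext q
      simp only [indicator, mem_ball, mem_ofPred_eq]
    rw [e]
    exact (hUm.comp measurable_snd).indicator (measurableSet_lt (by fun_prop) (by fun_prop))
  calc _ ≤ ∫⁻ X in ball c (4 * r), ofReal K *
        (∫⁻ W, (ball (X + ε • v) (κ * ε)).indicator U W) ∂Ω.wMeas b := lintegral_mono hpt
    _ = ofReal K * ∫⁻ W, (∫⁻ X in ball c (4 * r),
      (ball (X + ε • v) (κ * ε)).indicator U W ∂Ω.wMeas b) := by
      have : IsFiniteMeasure (Ω.wMeas b) := Ω.isFiniteMeasure_wMeas hb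
      rw [lintegral_ofReal_mul, lintegral_lintegral_swap hjm.aemeasurable]
    _ ≤ ofReal K * ∫⁻ W in Ω.carrier, ofReal (C * ε ^ n) * (ofReal (Ω.rho W ^ b) * ‖u W‖ₑ ^ P) := by
      refine mul_le_mul_right ?_ _
      rw [← lintegral_indicator Ω.isOpen.measurableSet]
      refine lintegral_mono fun W => ?_
      by_cases hW : W ∈ Ω.core (κ * ε)
      · rw [indicator_of_mem hW.1]
        have e1 : ∀ X, (ball (X + ε • v) (κ * ε)).indicator U W =
          {X | dist W (X + ε • v) < κ * ε}.indicator (fun _ => ‖u W‖ₑ ^ P) X := by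
          intro X
          simp only [indicator, mem_ball, mem_ofPred_eq, hU]; rw [if_pos hW]
        have hms : MeasurableSet {X : Rn n | dist W (X + ε • v) < κ * ε} :=
          measurableSet_lt (by fun_prop) (by fun_prop)
        simp only [e1]
        rw [lintegral_indicator hms, setLIntegral_const, Measure.restrict_apply hms, mul_comm,
          ← mul_assoc, ← ofReal_mul (by positivity)]
        gcongr
        refine le_trans (measure_mono fun X hX => ?_) (hsh W hW.1)
        exact ⟨hX.2, hX.1⟩
      · have hU0 : U W = 0 := by
          rw [hU]
          simp only
          rw [indicator_of_notMem hW, enorm_zero, zero_rpow_of_pos hP0]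
        have e1 : ∀ X, (ball (X + ε • v) (κ * ε)).indicator U W = 0 := by
          intro X
          simp only [indicator, hU0, ite_self]
        simp only [e1, lintegral_zero]; exact bot_le
    _ = _ := by
      rw [lintegral_ofReal_mul, ← mul_assoc, ← ofReal_mul (by positivity)]
      have e := Ω.lintegral_wMeas b (F := fun X => ‖u X‖ₑ ^ P) (hu.enorm.pow_const P)
        MeasurableSet.univ
      rw [Measure.restrict_univ, univ_inter] at e; rw [e]
      congr 2
      rw [hK]
      have : ε ^ n ≠ 0 := by positivity
      field_simp

theorem norm_moll_sub_le {ε : ℝ} (hε : 0 < ε) (hεr : ε < r) {w : Rn n → Cl l} (hw : Continuous w)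
    {X : Rn n} (hX : X ∈ closure Ω.carrier) (hXc : dist X c < 4 * r) {δ : ℝ}
    (hδ : ∀ W, dist W X ≤ 2 * ε → ‖w W - w X‖ ≤ δ) : ‖h.moll ε w X - w X‖ ≤ δ := by
  have hwl : LocallyIntegrableOn w Ω.carrier volume := hw.locallyIntegrable.locallyIntegrableOn _
  have hki : Integrable fun W => h.ker ε (W - X) := by
    by_contra hc
    have := h.integral_ker hε X
    rw [integral_undef hc] at this
    exact zero_ne_one this
  have e1 : w X = ∫ W, h.ker ε (W - X) • w X := by
    rw [integral_smul_const, h.integral_ker hε, one_smul]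
  have e2 : δ = ∫ W, h.ker ε (W - X) * δ := by rw [integral_mul_const, h.integral_ker hε, one_mul]
  conv_lhs => rw [e1]
  rw [moll, ← integral_sub (h.integrable_moll hε hwl X) (hki.smul_const _)]
  conv_rhs => rw [e2]
  refine norm_integral_le_of_norm_le (hki.mul_const δ) (.of_forall fun W => ?_)
  by_cases h0 : h.ker ε (W - X) = 0
  · simp [h0]
  · have h1 : ‖ε⁻¹ • (W - X) - v‖ ≤ κ := by
      by_contra! hc
      exact h0 (h.ker_eq_zero hc.le)
    rw [indicator_of_mem (h.mem_core hε hεr hX hXc h1), ← smul_sub, norm_smul,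
      norm_of_nonneg (h.ker_nonneg hε _)]
    refine mul_le_mul_of_nonneg_left (hδ W ?_) (h.ker_nonneg hε _)
    rw [dist_eq_norm]
    exact h.norm_le_of_ker_ne_zero hε h0

/-- Mollification converges in weighted `L_p`-spaces. -/
theorem tendsto_moll {p : ℝ≥0∞} (hp : 1 < p) (hp' : p < ⊤) {b : ℝ} (hb : -1 < b)
    {u : Rn n → Cl l} (hum : StronglyMeasurable u) (hul : LocallyIntegrableOn u Ω.carrier volume)
    (hu : MemLp u p (Ω.wMeas b)) :
    Tendsto (fun ε => eLpNorm (h.moll ε u - u) p ((Ω.wMeas b).restrict (ball c (4 * r))))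
      (𝓝[>] 0) (𝓝 0) := by
  have hp0 : p ≠ 0 := hp.ne_bot
  have hP : 1 < p.toReal := one_lt_toReal hp hp'
  obtain ⟨C, hC0, ε₀, hε₀, hC⟩ := h.exists_lintegral_moll_le (l := l) hP hb
  have : IsFiniteMeasure (Ω.wMeas b) := Ω.isFiniteMeasure_wMeas hb
  set μ := (Ω.wMeas b).restrict (ball c (4 * r)) with hμ
  set C₁ : ℝ≥0∞ := ofReal C ^ (1 / p.toReal) with hC₁
  have hC₁t : C₁ ≠ ⊤ := rpow_ne_top_of_nonneg (by positivity) ofReal_ne_top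
  have hC' : ∀ ε, 0 < ε → ε < ε₀ → ∀ u : Rn n → Cl l, StronglyMeasurable u →
    eLpNorm (h.moll ε u) p μ ≤ C₁ * eLpNorm u p (Ω.wMeas b) := by
    intro ε h1 h2 u hu
    rw [eLpNorm_eq_lintegral_rpow_enorm_toReal hp0 hp'.ne,
      eLpNorm_eq_lintegral_rpow_enorm_toReal hp0 hp'.ne, hC₁,
      ← mul_rpow_of_nonneg _ _ (by positivity)]
    exact rpow_le_rpow (hC ε h1 h2 u hu) (by positivity)
  rw [ENNReal.tendsto_nhds_zero]
  intro η hη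
  rcases eq_or_ne η ⊤ with rfl | hηt
  · exact .of_forall fun _ => le_top
  set η' := η / (C₁ + 2) with hη'
  have hden : C₁ + 2 ≠ ⊤ := by finiteness
  have hη'0 : η' ≠ 0 := (ENNReal.div_pos hη.ne' hden).ne'
  have hη't : η' ≠ ⊤ := ENNReal.div_ne_top hηt (by simp)
  obtain ⟨w, hwc, hw1, hw2, hw3⟩ := hu.exists_hasCompactSupport_eLpNorm_sub_le hp'.ne hη'0
  have hwm : StronglyMeasurable w := hw2.stronglyMeasurable
  have hwl : LocallyIntegrableOn w Ω.carrier volume := hw2.locallyIntegrable.locallyIntegrableOn _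
  set K := μ univ ^ p.toReal⁻¹ with hK
  have hKt : K ≠ ⊤ := rpow_ne_top_of_nonneg (by positivity) (measure_ne_top _ _)
  set δ := (η' / (K + 1)).toReal with hδ
  have hδ' : ofReal δ = η' / (K + 1) := ofReal_toReal (ENNReal.div_ne_top hη't (by simp))
  have hδ0 : 0 < δ := toReal_pos (ENNReal.div_pos hη'0 (by finiteness)).ne'
    (ENNReal.div_ne_top hη't (by simp))
  obtain ⟨θ, hθ0, hθ⟩ := Metric.uniformContinuous_iff.1
    (hw2.uniformContinuous_of_tendsto_cocompact hwc.is_zero_at_infty) δ hδ0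
  have hev : Ioo (0 : ℝ) (min ε₀ (min r (θ / 2))) ∈ 𝓝[>] (0 : ℝ) :=
    Ioo_mem_nhdsGT (lt_min hε₀ (lt_min h.r_pos (by positivity)))
  filter_upwards [hev] with ε ⟨hε, hε'⟩
  have h1 : ε < ε₀ := hε'.trans_le (min_le_left _ _)
  have h2 : ε < r := hε'.trans_le ((min_le_right _ _).trans (min_le_left _ _))
  have h3 : ε < θ / 2 := hε'.trans_le ((min_le_right _ _).trans (min_le_right _ _))
  have e : h.moll ε u - u = h.moll ε (u - w) + (h.moll ε w - w) - (u - w) := by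
    funext X
    simp only [Pi.sub_apply, Pi.add_apply, h.moll_sub hε hul hwl]; abel
  have hm1 : AEStronglyMeasurable (h.moll ε (u - w)) μ :=
    (h.contDiff_moll hε (hul.sub hwl)).continuous.aestronglyMeasurable
  have hm2 : AEStronglyMeasurable (h.moll ε w - w) μ :=
    ((h.contDiff_moll hε hwl).continuous.sub hw2).aestronglyMeasurable
  have b1 : eLpNorm (h.moll ε (u - w)) p μ ≤ C₁ * η' :=
    (hC' ε hε h1 _ (hum.sub hwm)).trans (mul_le_mul_right hw1 _)
  have b2 : eLpNorm (h.moll ε w - w) p μ ≤ η' := by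
    refine (eLpNorm_le_of_ae_bound (C := δ) ?_).trans ?_
    · have hX1 : ∀ᵐ X ∂μ, X ∈ Ω.carrier :=
        ae_restrict_of_ae ((wMeas_ac b).ae_le (ae_restrict_mem Ω.isOpen.measurableSet))
      filter_upwards [hX1, ae_restrict_mem measurableSet_ball] with X hX hXc
      refine h.norm_moll_sub_le hε h2 hw2 (subset_closure hX) hXc fun W hW => ?_
      rw [← dist_eq_norm]
      exact (hθ (by linarith)).le
    · rw [hδ']
      calc K * (η' / (K + 1)) ≤ (K + 1) * (η' / (K + 1)) := by gcongr; exact le_self_add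
        _ ≤ η' := ENNReal.mul_div_le
  have b3 : eLpNorm (u - w) p μ ≤ η' := (eLpNorm_restrict_le _ _ _ _).trans hw1
  calc eLpNorm (h.moll ε u - u) p μ
      ≤ eLpNorm (h.moll ε (u - w)) p μ + eLpNorm (h.moll ε w - w) p μ + eLpNorm (u - w) p μ := by
        rw [e]
        exact (eLpNorm_sub_le (hm1.add hm2) (hum.sub hwm).aestronglyMeasurable hp.le).trans
          (add_le_add_left (eLpNorm_add_le hm1 hm2 hp.le) _)
    _ ≤ C₁ * η' + η' + η' := add_le_add (add_le_add b1 b2) b3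
    _ = (C₁ + 2) * η' := by ring
    _ ≤ η := ENNReal.mul_div_le

end IsCone

end LipDomain

open scoped Manifold

/-- `w` and its first weak derivatives `v_j = D_j w` belong to a weighted `L_p`-space. -/
structure IsW1 {n l : ℕ} (Ω : LipDomain n) (p : ℝ≥0∞) (a : ℝ) (w : Rn n → Cl l)
    (v : Fin n → Rn n → Cl l) : Prop where
  meas : StronglyMeasurable w
  memLp : MemLp w p (Ω.wMeas (p.toReal * a))
  meas_d : ∀ j, StronglyMeasurable (v j)
  memLp_d : ∀ j, MemLp (v j) p (Ω.wMeas (p.toReal * a))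
  hasWeakD : ∀ j, HasWeakD Ω.carrier (Pi.single j 1) w (v j)

theorem tendsto_zero_of_rpow_le {ι κ : Type*} [Fintype κ] {L : Filter ι} {P C : ℝ} (hP : 0 < P)
    {x y : ι → ℝ≥0∞} {z : κ → ι → ℝ≥0∞}
    (h : ∀ i, x i ^ P ≤ ofReal C * (y i ^ P + ∑ j, z j i ^ P))
    (hy : Tendsto y L (𝓝 0)) (hz : ∀ j, Tendsto (z j) L (𝓝 0)) : Tendsto x L (𝓝 0) := by
  have e0 : (0 : ℝ≥0∞) ^ P = 0 := zero_rpow_of_pos hP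
  have key : ∀ {f : ι → ℝ≥0∞}, Tendsto f L (𝓝 0) → Tendsto (fun i => f i ^ P) L (𝓝 0) := by
    intro f hf
    have := (ENNReal.continuous_rpow_const (y := P)).tendsto 0 |>.comp hf
    rwa [e0] at this
  have h1 : Tendsto (fun i => ofReal C * (y i ^ P + ∑ j, z j i ^ P)) L (𝓝 0) := by
    have := ENNReal.Tendsto.const_mul (a := ofReal C)
      ((key hy).add (tendsto_finsetSum Finset.univ fun j _ => key (hz j)))
      (Or.inr ofReal_ne_top)
    simpa using this
  have h2 : Tendsto (fun i => x i ^ P) L (𝓝 0) := tendsto_zero_of_le h1 h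
  have h3 := (ENNReal.continuous_rpow_const (y := 1 / P)).tendsto 0 |>.comp h2
  rw [zero_rpow_of_pos (by positivity)] at h3
  refine h3.congr fun i => ?_
  rw [Function.comp_apply, ← ENNReal.rpow_mul, mul_one_div_cancel hP.ne', ENNReal.rpow_one]

theorem eLpNorm_smul_le_restrict {X E : Type*} [MeasurableSpace X] [NormedAddCommGroup E]
    [NormedSpace ℝ E] {μ : Measure X} {p : ℝ≥0∞} {θ : X → ℝ} {F : X → E} {s : Set X}
    (hs : MeasurableSet s) {B : ℝ} (h1 : ∀ᵐ x ∂μ, |θ x| ≤ B) (h0 : ∀ x, x ∉ s → θ x = 0) :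
    eLpNorm (fun x => θ x • F x) p μ ≤ ofReal B * eLpNorm F p (μ.restrict s) := by
  rw [← eLpNorm_indicator_eq_eLpNorm_restrict hs]
  refine eLpNorm_le_mul_eLpNorm_of_ae_le_mul ?_ p
  filter_upwards [h1] with x hx
  by_cases hxs : x ∈ s
  · rw [indicator_of_mem hxs, norm_smul, Real.norm_eq_abs]; gcongr
  · rw [indicator_of_notMem hxs, h0 x hxs, zero_smul, norm_zero, mul_zero]

namespace LipDomain

variable {n l : ℕ} {Ω : LipDomain n}

theorem exists_isCone {c : Rn n} (hc : c ∈ closure Ω.carrier) : ∃ v κ r, Ω.IsCone c v κ r := by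
  by_cases h : c ∈ Ω.carrier
  · obtain ⟨κ, r, h⟩ := Ω.exists_isCone_of_mem h
    exact ⟨0, κ, r, h⟩
  · obtain ⟨χ, rfl⟩ := Ω.exists_chart (c := c) (by
      rw [bdry, Ω.isOpen.frontier_eq]
      exact ⟨hc, h⟩)
    exact ⟨_, _, _, χ.cone⟩

theorem exists_partition : ∃ (N : ℕ) (c v : Fin N → Rn n) (κ r : Fin N → ℝ) (θ : Fin N → Rn n → ℝ),
    (∀ i, Ω.IsCone (c i) (v i) (κ i) (r i)) ∧ (∀ i, ContDiff ℝ ∞ (θ i)) ∧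
    (∀ i X, |θ i X| ≤ 1) ∧ (∀ i, tsupport (θ i) ⊆ ball (c i) (r i)) ∧
    ∀ X ∈ closure Ω.carrier, ∑ i, θ i X = 1 := by
  choose v κ r h using fun c : closure Ω.carrier => Ω.exists_isCone c.2
  obtain ⟨t, ht⟩ := Ω.isBounded.isCompact_closure.elim_nhds_subcover'
    (fun x hx => ball x (r ⟨x, hx⟩))
    (fun x hx => ball_mem_nhds x (h ⟨x, hx⟩).r_pos)
  obtain ⟨f, hf⟩ := SmoothPartitionOfUnity.exists_isSubordinate (𝓘(ℝ, Rn n)) (s := closure Ω.carrier)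
    isClosed_closure (fun i : Fin t.card => ball (t.equivFin.symm i : closure Ω.carrier).1
      (r (t.equivFin.symm i))) (fun _ => Metric.isOpen_ball) (fun X hX => by
        obtain ⟨x, hx, hXx⟩ := mem_iUnion₂.1 (ht hX)
        exact mem_iUnion.2 ⟨t.equivFin ⟨x, hx⟩, by simpa using hXx⟩)
  refine ⟨t.card, fun i => (t.equivFin.symm i : closure Ω.carrier).1, fun i => v (t.equivFin.symm i),
    fun i => κ (t.equivFin.symm i), fun i => r (t.equivFin.symm i), fun i => f i, fun i => h _,
    fun i => contMDiff_iff_contDiff.1 (f i).contMDiff, fun i X => ?_, hf, fun X hX => ?_⟩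
  · rw [abs_of_nonneg (f.nonneg i X)]
    exact f.le_one i X
  · rw [← finsum_eq_sum_of_fintype]
    exact f.sum_eq_one hX

theorem memLp_surf {E : Type*} [NormedAddCommGroup E] {φ : Rn n → E} (hφ : Continuous φ)
    (p : ℝ≥0∞) : MemLp φ p Ω.surf := by
  obtain ⟨B, hB⟩ := Ω.bdry_compact.exists_bound_of_continuousOn hφ.continuousOn
  exact MemLp.of_bound hφ.aestronglyMeasurable B (Ω.ae_surf_mem.mono hB)

theorem ae_wMeas_mem (b : ℝ) : ∀ᵐ X ∂Ω.wMeas b, X ∈ Ω.carrier :=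
  (wMeas_ac b).ae_le (ae_restrict_mem Ω.isOpen.measurableSet)

theorem lintegral_biUnion_finset_le {ι X : Type*} [MeasurableSpace X] {μ : Measure X}
    (T : Finset ι) (s : ι → Set X) (f : X → ℝ≥0∞) :
    ∫⁻ x in ⋃ i ∈ T, s i, f x ∂μ ≤ ∑ i ∈ T, ∫⁻ x in s i, f x ∂μ := by
  classical
  induction T using Finset.induction_on with
  | empty => simp
  | insert i T hi ih =>
    rw [Finset.set_biUnion_insert, Finset.sum_insert hi]
    exact (lintegral_union_le f _ _).trans (add_le_add le_rfl ih)

theorem lintegral_surf_le_sum (Ω : LipDomain n) {T : Finset Ω.Chart}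
    (hT : Ω.bdry ⊆ ⋃ χ ∈ T, ball χ.c (χ.r / 4))
    (F : Rn n → ℝ≥0∞) : ∫⁻ Y, F Y ∂Ω.surf ≤ ∑ χ ∈ T, ∫⁻ Y in ball χ.c χ.r, F Y ∂Ω.surf := by
  refine le_trans ?_ (lintegral_biUnion_finset_le T (fun χ => ball χ.c χ.r) _)
  conv_lhs => rw [← Measure.restrict_univ (μ := Ω.surf)]
  refine lintegral_mono_set' ?_
  filter_upwards [Ω.ae_surf_mem] with Y hY _
  obtain ⟨χ, hχ, h⟩ := mem_iUnion₂.1 (hT hY)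
  have := χ.cone.r_pos
  exact mem_iUnion₂.2 ⟨χ, hχ, ball_subset_ball (by linarith) h⟩

theorem exists_lintegral_wMeas_le (Ω : LipDomain n) : ∃ (T : Finset Ω.Chart) (δ : ℝ), 0 < δ ∧
    ∀ (b : ℝ) (F : Rn n → ℝ≥0∞), ∫⁻ X, F X ∂Ω.wMeas b ≤
      ∑ χ ∈ T, (∫⁻ X in χ.inner, F X ∂Ω.wMeas b) + ∫⁻ X in {X | δ ≤ Ω.rho X}, F X ∂Ω.wMeas b := by
  obtain ⟨T, δ, hδ, hT⟩ := Ω.exists_inner_cover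
  refine ⟨T, δ, hδ, fun b F => le_trans ?_ ((lintegral_union_le F _ _).trans
    (add_le_add (lintegral_biUnion_finset_le T (fun χ => χ.inner) F) le_rfl))⟩
  conv_lhs => rw [← Measure.restrict_univ (μ := Ω.wMeas b)]
  refine lintegral_mono_set' ?_
  filter_upwards [Ω.ae_wMeas_mem b] with X hX _
  rcases lt_or_ge (Ω.rho X) δ with h | h
  · obtain ⟨χ, hχ, hX⟩ := hT X hX h
    exact Or.inl (mem_iUnion₂.2 ⟨χ, hχ, hX⟩)
  · exact Or.inr h

/-- The trace inequality for smooth functions in a chart. -/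
theorem Chart.exists_smooth_trace_le (χ : Ω.Chart) {p : ℝ≥0∞} (hp : 1 < p) (hp' : p < ⊤) {a : ℝ}
    (ha : -1 / p.toReal < a) (ha' : a < 1 - 1 / p.toReal) :
    ∃ C : ℝ, 0 ≤ C ∧ ∀ φ : Rn n → Cl l, ContDiff ℝ ∞ φ →
      eLpNorm φ p (Ω.surf.restrict (ball χ.c χ.r)) ^ p.toReal ≤ ofReal C *
        (eLpNorm φ p ((Ω.wMeas (p.toReal * a)).restrict (ball χ.c (4 * χ.r))) ^ p.toReal +
          ∑ j, eLpNorm (pd j φ) p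
            ((Ω.wMeas (p.toReal * a)).restrict (ball χ.c (4 * χ.r))) ^ p.toReal) := by
  have hp0 : p ≠ 0 := hp.ne_bot
  have hP : 1 < p.toReal := one_lt_toReal hp hp'
  obtain ⟨C₁, hC₁, h1⟩ := χ.exists_trace_bound (l := l) hp hp' ha'
  obtain ⟨C₂, hC₂, h2⟩ := χ.exists_lintegral_bdry_le (l := l) hP ha
  refine ⟨C₂ * (C₁ + 1), by positivity, fun φ hφ => ?_⟩
  have hc := hφ.continuous
  have e1 := h1 _ rfl (fun _ => φ) φ φ (fun j => pd j φ) (fun _ => hφ) hc.aestronglyMeasurable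
    (fun j => (contDiff_pd hφ j).continuous.aestronglyMeasurable) hc.aestronglyMeasurable
    (by simp) (by simp) (by simp)
  have e2 := h2 φ φ hc.aestronglyMeasurable hc.aestronglyMeasurable
  rw [lintegral_enorm_rpow hp0 hp'.ne, lintegral_enorm_rpow hp0 hp'.ne] at e2
  refine e2.trans ?_
  rw [ofReal_mul hC₂, mul_assoc]
  refine mul_le_mul_right ?_ _
  refine (add_le_add_left e1 _).trans ?_
  rw [mul_add, add_comm]
  refine add_le_add ?_ (by gcongr; linarith)
  calc _ = ofReal 1 * _ := by rw [ofReal_one, one_mul]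
    _ ≤ _ := by gcongr; linarith

/-- The trace inequality for smooth functions. -/
theorem exists_smooth_trace_le {p : ℝ≥0∞} (hp : 1 < p) (hp' : p < ⊤) {a : ℝ}
    (ha : -1 / p.toReal < a) (ha' : a < 1 - 1 / p.toReal) :
    ∃ C : ℝ, 0 ≤ C ∧ ∀ φ : Rn n → Cl l, ContDiff ℝ ∞ φ → eLpNorm φ p Ω.surf ^ p.toReal ≤ ofReal C *
      (eLpNorm φ p (Ω.wMeas (p.toReal * a)) ^ p.toReal +
        ∑ j, eLpNorm (pd j φ) p (Ω.wMeas (p.toReal * a)) ^ p.toReal) := by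
  have hp0 : p ≠ 0 := hp.ne_bot
  obtain ⟨T, hT⟩ := Ω.exists_atlas
  choose C hC0 hC using fun χ : Ω.Chart => χ.exists_smooth_trace_le (l := l) hp hp' ha ha'
  refine ⟨∑ χ ∈ T, C χ, sum_nonneg fun χ _ => hC0 χ, fun φ hφ => ?_⟩
  rw [ofReal_sum_of_nonneg fun χ _ => hC0 χ, sum_mul]
  calc eLpNorm φ p Ω.surf ^ p.toReal = ∫⁻ Y, ‖φ Y‖ₑ ^ p.toReal ∂Ω.surf :=
        (lintegral_enorm_rpow hp0 hp'.ne _).symm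
    _ ≤ ∑ χ ∈ T, ∫⁻ Y in ball χ.c χ.r, ‖φ Y‖ₑ ^ p.toReal ∂Ω.surf := Ω.lintegral_surf_le_sum hT _
    _ ≤ _ := by
      refine sum_le_sum fun χ _ => ?_
      rw [lintegral_enorm_rpow hp0 hp'.ne]
      refine (hC χ φ hφ).trans ?_
      gcongr
      · exact Measure.restrict_le_self
      · exact Measure.restrict_le_self

namespace IsCone

variable {c v : Rn n} {κ r : ℝ} (h : Ω.IsCone c v κ r)

theorem tendsto_pd_moll {p : ℝ≥0∞} (hp : 1 < p) (hp' : p < ⊤) {a : ℝ}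
    (ha : -1 < p.toReal * a) {w : Rn n → Cl l} {v' : Fin n → Rn n → Cl l}
    (hw : IsW1 Ω p a w v') (j : Fin n) :
    Tendsto (fun ε => eLpNorm (pd j (h.moll ε w) - Complex.I • v' j) p
      ((Ω.wMeas (p.toReal * a)).restrict (ball c (4 * r)))) (𝓝[>] 0) (𝓝 0) := by
  refine (h.tendsto_moll hp hp' ha ((hw.meas_d j).const_smul Complex.I)
    ((hw.hasWeakD j).2.1.smul _) ((hw.memLp_d j).const_smul _)).congr' ?_
  filter_upwards [Ioo_mem_nhdsGT h.r_pos] with ε hε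
  refine eLpNorm_congr_ae ?_
  filter_upwards [ae_restrict_of_ae (Ω.ae_wMeas_mem _),
    ae_restrict_mem measurableSet_ball] with X hX hXc
  rw [Pi.sub_apply, Pi.sub_apply, h.pd_moll hε.1 hε.2 (hw.hasWeakD j) (subset_closure hX) hXc]

end IsCone

theorem pd_sum_smul {N : ℕ} {θ : Fin N → Rn n → ℝ} {F : Fin N → Rn n → Cl l}
    (hθ : ∀ i, ContDiff ℝ ∞ (θ i)) (hF : ∀ i, ContDiff ℝ ∞ (F i)) (j : Fin n) (X : Rn n) :
    pd j (fun X => ∑ i, θ i X • F i X) X = ∑ i, (θ i X • pd j (F i) X + pd j (θ i) X • F i X) := by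
  have hd : ∀ i, DifferentiableAt ℝ (θ i) X := fun i => (hθ i).differentiable (by simp) X
  have hd' : ∀ i, DifferentiableAt ℝ (F i) X := fun i => (hF i).differentiable (by simp) X
  rw [pd, fderiv_fun_sum fun i _ => (hd i).fun_smul (hd' i), FunLike.coe_sum, Finset.sum_apply]
  refine sum_congr rfl fun i _ => ?_
  rw [fderiv_fun_smul (hd i) (hd' i)]; simp [pd]

/-- Functions of the weighted Sobolev space of order one are limits of smooth functions. -/
theorem exists_smooth_approx {p : ℝ≥0∞} (hp : 1 < p) (hp' : p < ⊤) {a : ℝ}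
    (ha : -1 < p.toReal * a) {w : Rn n → Cl l} {v : Fin n → Rn n → Cl l} (hw : IsW1 Ω p a w v) :
    ∃ φ : ℕ → Rn n → Cl l, (∀ k, ContDiff ℝ ∞ (φ k)) ∧
      Tendsto (fun k => eLpNorm (φ k - w) p (Ω.wMeas (p.toReal * a))) atTop (𝓝 0) ∧
      ∀ j, Tendsto (fun k => eLpNorm (pd j (φ k) - Complex.I • v j) p (Ω.wMeas (p.toReal * a)))
        atTop (𝓝 0) := by
  obtain ⟨N, c, v', κ, r, θ, hcone, hθd, hθ1, hθs, hθsum⟩ := Ω.exists_partition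
  obtain ⟨ε, -, hε0, hε⟩ := exists_seq_strictAnti_tendsto (0 : ℝ)
  have hε' : Tendsto ε atTop (𝓝[>] 0) := tendsto_nhdsWithin_iff.2 ⟨hε, .of_forall fun k => hε0 k⟩
  set μ := Ω.wMeas (p.toReal * a) with hμ
  have hn0 : 0 < n := by linarith [Ω.two_le]
  have hwl : LocallyIntegrableOn w Ω.carrier volume := (hw.hasWeakD ⟨0, hn0⟩).1
  set F : ℕ → Fin N → Rn n → Cl l := fun k i => (hcone i).moll (ε k) w with hF
  have hFd : ∀ k i, ContDiff ℝ ∞ (F k i) := fun k i => (hcone i).contDiff_moll (hε0 k) hwl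
  have hms : ∀ i, MeasurableSet (ball (c i) (4 * r i)) := fun i => measurableSet_ball
  have hsub : ∀ i, ball (c i) (r i) ⊆ ball (c i) (4 * r i) := fun i =>
    ball_subset_ball (by linarith [(hcone i).r_pos])
  have hθ0 : ∀ i X, X ∉ ball (c i) (4 * r i) → θ i X = 0 := fun i X hX =>
    image_eq_zero_of_notMem_tsupport fun h => hX (hsub i (hθs i h))
  have hθ0' : ∀ i j X, X ∉ ball (c i) (4 * r i) → pd j (θ i) X = 0 := by
    intro i j X hX
    have : X ∉ tsupport (fderiv ℝ (θ i)) := fun h =>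
      hX (hsub i (hθs i (tsupport_fderiv_subset ℝ h)))
    rw [pd, image_eq_zero_of_notMem_tsupport this, zero_apply]
  have hB : ∀ i j, ∃ B : ℝ, ∀ X ∈ closure Ω.carrier, ‖pd j (θ i) X‖ ≤ B := fun i j =>
    Ω.isBounded.isCompact_closure.exists_bound_of_continuousOn
      (contDiff_pd (hθd i) j).continuous.continuousOn
  choose B hB using hB
  have hsum0 : ∀ X ∈ Ω.carrier, ∀ j, ∑ i, pd j (θ i) X = 0 := by
    intro X hX j
    have h1 : pd j (fun X => ∑ i, θ i X) X = ∑ i, pd j (θ i) X := by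
      rw [pd, fderiv_fun_sum fun i _ => (hθd i).differentiable (by simp) X]; simp [pd]
    have h2 : (fun X => ∑ i, θ i X) =ᶠ[𝓝 X] fun _ => (1 : ℝ) := by
      filter_upwards [Ω.isOpen.mem_nhds hX] with Z hZ using hθsum Z (subset_closure hZ)
    rw [← h1, pd, h2.fderiv_eq]; simp
  have t1 : ∀ i, Tendsto (fun k => eLpNorm (F k i - w) p (μ.restrict (ball (c i) (4 * r i))))
    atTop (𝓝 0) := fun i => ((hcone i).tendsto_moll hp hp' ha hw.meas hwl hw.memLp).comp hε'
  have t2 : ∀ i j, Tendsto (fun k => eLpNorm (pd j (F k i) - Complex.I • v j) p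
    (μ.restrict (ball (c i) (4 * r i)))) atTop (𝓝 0) := fun i j =>
    ((hcone i).tendsto_pd_moll hp hp' ha hw j).comp hε'
  refine ⟨fun k X => ∑ i, θ i X • F k i X, fun k => ContDiff.sum fun i _ => (hθd i).smul (hFd k i),
    ?_, fun j => ?_⟩
  · have hb : ∀ k, eLpNorm ((fun X => ∑ i, θ i X • F k i X) - w) p μ ≤
      ∑ i, ofReal 1 * eLpNorm (F k i - w) p (μ.restrict (ball (c i) (4 * r i))) := by
      intro k
      have e : ((fun X => ∑ i, θ i X • F k i X) - w) =ᵐ[μ] ∑ i, fun X => θ i X • (F k i - w) X := by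
        filter_upwards [Ω.ae_wMeas_mem _] with X hX
        simp only [Pi.sub_apply, Finset.sum_apply, smul_sub, sum_sub_distrib]
        rw [← sum_smul, hθsum X (subset_closure hX), one_smul]
      rw [eLpNorm_congr_ae e]
      refine (eLpNorm_sum_le (fun i _ => ?_) hp.le).trans (sum_le_sum fun i _ => ?_)
      · exact (hθd i).continuous.aestronglyMeasurable.smul
          ((hFd k i).continuous.aestronglyMeasurable.sub hw.meas.aestronglyMeasurable)
      · exact eLpNorm_smul_le_restrict (hms i) (.of_forall (hθ1 i)) (hθ0 i)
    refine tendsto_zero_of_le ?_ hb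
    have := tendsto_finsetSum Finset.univ fun i _ =>
      ENNReal.Tendsto.const_mul (a := ofReal 1) (t1 i) (Or.inr ofReal_ne_top)
    simpa using this
  · have hb : ∀ k, eLpNorm (pd j (fun X => ∑ i, θ i X • F k i X) - Complex.I • v j) p μ ≤
      ∑ i, (ofReal 1 * eLpNorm (pd j (F k i) - Complex.I • v j) p
        (μ.restrict (ball (c i) (4 * r i))) +
        ofReal (B i j) * eLpNorm (F k i - w) p (μ.restrict (ball (c i) (4 * r i)))) := by
      intro k
      have e : (pd j (fun X => ∑ i, θ i X • F k i X) - Complex.I • v j) =ᵐ[μ]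
        ∑ i, ((fun X => θ i X • (pd j (F k i) - Complex.I • v j) X) +
          fun X => pd j (θ i) X • (F k i - w) X) := by
        filter_upwards [Ω.ae_wMeas_mem _] with X hX
        rw [Pi.sub_apply, pd_sum_smul hθd (hFd k)]
        simp only [Pi.sub_apply, Pi.add_apply, Finset.sum_apply, smul_sub, sum_sub_distrib,
          sum_add_distrib]
        rw [← sum_smul, ← sum_smul, hθsum X (subset_closure hX), hsum0 X hX j, one_smul,
          zero_smul, sub_zero]
        abel
      have m1 : ∀ i, AEStronglyMeasurable (fun X => θ i X • (pd j (F k i) - Complex.I • v j) X) μ :=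
        fun i => (hθd i).continuous.aestronglyMeasurable.smul
          ((contDiff_pd (hFd k i) j).continuous.aestronglyMeasurable.sub
            ((hw.meas_d j).const_smul Complex.I).aestronglyMeasurable)
      have m2 : ∀ i, AEStronglyMeasurable (fun X => pd j (θ i) X • (F k i - w) X) μ :=
        fun i => (contDiff_pd (hθd i) j).continuous.aestronglyMeasurable.smul
          ((hFd k i).continuous.aestronglyMeasurable.sub hw.meas.aestronglyMeasurable)
      rw [eLpNorm_congr_ae e]
      refine (eLpNorm_sum_le (fun i _ => (m1 i).add (m2 i)) hp.le).trans (sum_le_sum fun i _ => ?_)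
      refine (eLpNorm_add_le (m1 i) (m2 i) hp.le).trans (add_le_add ?_ ?_)
      · exact eLpNorm_smul_le_restrict (hms i) (.of_forall (hθ1 i)) (hθ0 i)
      · refine eLpNorm_smul_le_restrict (hms i) ?_ (hθ0' i j)
        filter_upwards [Ω.ae_wMeas_mem _] with X hX using hB i j X (subset_closure hX)
    refine tendsto_zero_of_le ?_ hb
    have := tendsto_finsetSum Finset.univ fun i _ =>
      (ENNReal.Tendsto.const_mul (a := ofReal 1) (t2 i j) (Or.inr ofReal_ne_top)).add
      (ENNReal.Tendsto.const_mul (a := ofReal (B i j)) (t1 i) (Or.inr ofReal_ne_top))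
    simpa using this

theorem pd_sub {f g : Rn n → Cl l} (hf : ContDiff ℝ ∞ f) (hg : ContDiff ℝ ∞ g) {j : Fin n} :
    pd j (f - g) = pd j f - pd j g := by
  funext X
  rw [pd, fderiv_sub (hf.differentiable (by simp) X) (hg.differentiable (by simp) X)]; rfl

theorem eLpNorm_sub_le_add {μ : Measure (Rn n)} {p : ℝ≥0∞} (hp : 1 ≤ p) {f g w : Rn n → Cl l}
    (hf : ContDiff ℝ ∞ f) (hg : ContDiff ℝ ∞ g) (hw : Measurable w) :
    eLpNorm (f - g) p μ ≤ eLpNorm (f - w) p μ + eLpNorm (g - w) p μ := by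
  rw [← sub_sub_sub_cancel_right f g w]
  exact eLpNorm_sub_le (hf.continuous.aestronglyMeasurable.sub hw.aestronglyMeasurable)
    (hg.continuous.aestronglyMeasurable.sub hw.aestronglyMeasurable) hp

/-- Existence of traces. -/
theorem exists_isTrace {p : ℝ≥0∞} [Fact (1 ≤ p)] (hp : 1 < p) (hp' : p < ⊤) {a : ℝ}
    (ha : -1 / p.toReal < a) (ha' : a < 1 - 1 / p.toReal) {w : Rn n → Cl l}
    {v : Fin n → Rn n → Cl l} (hw : IsW1 Ω p a w v) :
    ∃ g : Lp (Cl l) p Ω.surf, IsTrace Ω p a w g := by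
  have hP : 0 < p.toReal := by linarith [one_lt_toReal hp hp']
  have hPa : -1 < p.toReal * a := neg_one_lt_mul hP ha
  obtain ⟨φ, hφd, hφ1, hφ2⟩ := Ω.exists_smooth_approx hp hp' hPa hw
  obtain ⟨C, hC0, hC⟩ := Ω.exists_smooth_trace_le (l := l) hp hp' ha ha'
  set μ := Ω.wMeas (p.toReal * a) with hμ
  have hm : ∀ k, MemLp (φ k) p Ω.surf := fun k => memLp_surf (hφd k).continuous p
  have hw1 := hw.meas.measurable
  have hw2 := fun j => ((hw.meas_d j).const_smul Complex.I).measurable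
  have hadd : ∀ {f : ℕ → ℝ≥0∞}, Tendsto f atTop (𝓝 0) →
    Tendsto (fun q : ℕ × ℕ => f q.1 + f q.2) atTop (𝓝 0) := by
    intro f hf; rw [← prod_atTop_atTop_eq]
    have := (hf.comp tendsto_fst).add (hf.comp (tendsto_snd (f := (atTop : Filter ℕ))))
    simpa using this
  have hpair : Tendsto (fun q : ℕ × ℕ => eLpNorm (φ q.1 - φ q.2) p Ω.surf) atTop (𝓝 0) := by
    refine tendsto_zero_of_rpow_le (P := p.toReal) (C := C) hP (fun q => hC _ ((hφd _).sub (hφd _)))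
      ?_ fun j => ?_
    · refine tendsto_zero_of_le (hadd hφ1) fun q => ?_
      exact eLpNorm_sub_le_add hp.le (hφd _) (hφd _) hw1
    · refine tendsto_zero_of_le (hadd (hφ2 j)) fun q => ?_
      rw [pd_sub (hφd _) (hφd _)]
      exact eLpNorm_sub_le_add hp.le (contDiff_pd (hφd _) j) (contDiff_pd (hφd _) j) (hw2 j)
  have hcau : CauchySeq fun k => (hm k).toLp (φ k) := by
    rw [EMetric.cauchySeq_iff]
    intro η hη
    obtain ⟨N, hN⟩ := eventually_atTop_prod_self'.1 (hpair.eventually (gt_mem_nhds hη))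
    refine ⟨N, fun i hi j hj => ?_⟩
    rw [Lp.edist_toLp_toLp]
    exact hN i hi j hj
  obtain ⟨g, hg⟩ := cauchySeq_tendsto_of_complete hcau
  refine ⟨g, v, hw.hasWeakD, φ, hφd, hφ1, fun j => (hφ2 j).congr fun k => ?_, ?_⟩
  · exact eLpNorm_congr_enorm_ae (.of_forall fun X => (enorm_classD1_sub X).symm)
  · have h1 := (tendsto_iff_edist_tendsto_0.1 hg)
    refine h1.congr fun k => ?_
    rw [Lp.edist_def]
    refine eLpNorm_congr_ae ?_
    filter_upwards [(hm k).coeFn_toLp] with X hX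
    simp [hX]

/-- The boundary values of the mollifications converge to the trace. -/
theorem Chart.tendsto_moll_trace (χ : Ω.Chart) {p : ℝ≥0∞} (hp : 1 < p) (hp' : p < ⊤) {a : ℝ}
    (ha : -1 / p.toReal < a) (ha' : a < 1 - 1 / p.toReal) {w g : Rn n → Cl l}
    {v : Fin n → Rn n → Cl l} (hw : IsW1 Ω p a w v) (hg : AEStronglyMeasurable g Ω.surf)
    (htr : IsTrace Ω p a w g) {ε : ℕ → ℝ} (hε0 : ∀ k, 0 < ε k) (hε : Tendsto ε atTop (𝓝[>] 0)) :
    Tendsto (fun k => eLpNorm (χ.cone.moll (ε k) w - g) p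
      (Ω.surf.restrict (ball χ.c χ.r))) atTop (𝓝 0) := by
  have hP : 0 < p.toReal := by linarith [one_lt_toReal hp hp']
  have hPa : -1 < p.toReal * a := neg_one_lt_mul hP ha
  obtain ⟨v', hv', φ, hφd, hφ1, hφ2, hφ3⟩ := htr
  obtain ⟨C, hC0, hC⟩ := χ.exists_smooth_trace_le (l := l) hp hp' ha ha'
  set μ := (Ω.wMeas (p.toReal * a)).restrict (ball χ.c (4 * χ.r)) with hμ
  have hn0 : 0 < n := by linarith [Ω.two_le]
  have hwl : LocallyIntegrableOn w Ω.carrier volume := (hw.hasWeakD ⟨0, hn0⟩).1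
  have hMd : ∀ k, ContDiff ℝ ∞ (χ.cone.moll (ε k) w) := fun k => χ.cone.contDiff_moll (hε0 k) hwl
  have hw1 := hw.meas.measurable
  have hw2 := fun j => ((hw.meas_d j).const_smul Complex.I).measurable
  have hdiff : Tendsto (fun k => eLpNorm (χ.cone.moll (ε k) w - φ k) p
    (Ω.surf.restrict (ball χ.c χ.r))) atTop (𝓝 0) := by
    refine tendsto_zero_of_rpow_le (P := p.toReal) (C := C) hP (fun k => hC _ ((hMd _).sub (hφd _)))
      ?_ fun j => ?_
    · have h1 := ((χ.cone.tendsto_moll hp hp' hPa hw.meas hwl hw.memLp).comp hε).add hφ1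
      rw [add_zero] at h1
      refine tendsto_zero_of_le h1 fun k => ?_
      exact (eLpNorm_sub_le_add hp.le (hMd _) (hφd _) hw1).trans
        (add_le_add le_rfl (eLpNorm_restrict_le _ _ _ _))
    · have h1 := ((χ.cone.tendsto_pd_moll hp hp' hPa hw j).comp hε).add (hφ2 j)
      rw [add_zero] at h1
      refine tendsto_zero_of_le h1 fun k => ?_
      rw [pd_sub (hMd _) (hφd _)]
      refine (eLpNorm_sub_le_add hp.le (contDiff_pd (hMd _) j) (contDiff_pd (hφd _) j) (hw2 j)).trans
        (add_le_add le_rfl ?_)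
      refine (eLpNorm_restrict_le _ _ _ _).trans (le_of_eq ?_)
      refine eLpNorm_congr_enorm_ae ?_
      filter_upwards [(wMeas_ac _).ae_eq (HasWeakD.unique Ω.isOpen (hv' j) (hw.hasWeakD j))] with X hX
      rw [enorm_classD1_sub, Pi.sub_apply, Pi.sub_apply, Pi.smul_apply, Pi.smul_apply, hX]
  have h1 := hdiff.add hφ3
  rw [add_zero] at h1
  refine tendsto_zero_of_le h1 fun k => ?_
  have e : χ.cone.moll (ε k) w - g = (χ.cone.moll (ε k) w - φ k) + (φ k - g) := by abel
  calc _ ≤ _ := by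
        rw [e]
        exact eLpNorm_add_le ((hMd _).continuous.sub (hφd _).continuous).aestronglyMeasurable
          ((hφd _).continuous.aestronglyMeasurable.sub hg.restrict) hp.le
    _ ≤ _ := add_le_add le_rfl (eLpNorm_restrict_le _ _ _ _)

end LipDomain

/-- The Taylor remainder `R_γ(X, Y)` of order `m - 1` of a family `f`. -/
def remJ {n l : ℕ} (m : ℕ) (f : Jet n l) (γ : Fin n → ℕ) (X Y : Rn n) : Cl l :=
  truncJet m f γ X - taylor m (truncJet m f) γ X Y

/-- The difference of `f_γ(Y)` and the Taylor expansion of the family `u` about `W`. -/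
def jetDiff {n l : ℕ} (m : ℕ) (f u : Jet n l) (γ : Fin n → ℕ) (Y W : Rn n) : Cl l :=
  truncJet m f γ Y - taylor m (truncJet m u) γ Y W

section

variable {n l m : ℕ} {f u : Jet n l}

theorem jetDiff_eq_zero {γ : Fin n → ℕ} (hγ : m ≤ ∑ i, γ i) (Y W : Rn n) :
    jetDiff m f u γ Y W = 0 := by
  rw [jetDiff, truncJet_eq_zero _ _ _ hγ, taylor_truncJet, Nat.sub_eq_zero_of_le hγ]
  have : mlt n 0 = ∅ := by ext; simp [mem_mlt]
  simp [this]

theorem remJ_eq (γ : Fin n → ℕ) (X Y W : Rn n) : remJ m f γ X Y =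
    jetDiff m f u γ X W - ∑ β ∈ mlt n m, dpow β (X - Y) • jetDiff m f u (γ + β) Y W := by
  simp only [remJ, jetDiff, smul_sub, sum_sub_distrib]
  rw [taylor_eq_sum (truncJet_eq_zero m u) γ X Y W, taylor]; abel

theorem enorm_sub_sum_rpow_le {P : ℝ} (hP : 1 ≤ P) (A : Cl l) (Q : (Fin n → ℕ) → Cl l) (Z : Rn n) :
    ‖A - ∑ β ∈ mlt n m, dpow β Z • Q β‖ₑ ^ P ≤ 2 ^ (P - 1) * (((mlt n m).card : ℝ≥0∞) ^ (P - 1) + 1) *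
      (‖A‖ₑ ^ P + ∑ β ∈ mlt n m, ofReal (‖Z‖ ^ (P * (∑ i, β i : ℕ))) * ‖Q β‖ₑ ^ P) := by
  have hP0 : 0 ≤ P := by linarith
  have h1 : ‖A - ∑ β ∈ mlt n m, dpow β Z • Q β‖ₑ ≤ ‖A‖ₑ + ∑ β ∈ mlt n m, ‖dpow β Z • Q β‖ₑ :=
    enorm_sub_le.trans (add_le_add le_rfl (enorm_sum_le _ _))
  have h2 : ∀ β : Fin n → ℕ, ‖dpow β Z • Q β‖ₑ ^ P ≤
    ofReal (‖Z‖ ^ (P * (∑ i, β i : ℕ))) * ‖Q β‖ₑ ^ P := by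
    intro β; rw [enorm_smul, mul_rpow_of_nonneg _ _ hP0]; gcongr
    rw [enorm_eq_ofReal_abs, ofReal_rpow_of_nonneg (abs_nonneg _) hP0]
    refine ofReal_le_ofReal ?_
    rw [mul_comm P, rpow_mul (norm_nonneg _), rpow_natCast]
    exact Real.rpow_le_rpow (abs_nonneg _) (abs_dpow_le β Z) hP0
  refine (rpow_le_rpow h1 hP0).trans ((rpow_add_le_mul_rpow_add_rpow _ _ hP).trans ?_)
  rw [mul_assoc]
  refine mul_le_mul_right ?_ _
  rw [mul_add]
  refine add_le_add ?_ ?_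
  · calc _ = 1 * ‖A‖ₑ ^ P := (one_mul _).symm
      _ ≤ _ := by gcongr; exact le_add_self
  · refine (rpow_sum_le_const_mul_sum_rpow _ _ hP).trans ?_
    gcongr with β _
    · exact le_self_add
    · exact h2 β

theorem measurable_truncJet (hf : ∀ γ, Measurable (f γ)) (γ : Fin n → ℕ) :
    Measurable (truncJet m f γ) := by
  rw [truncJet]
  split_ifs
  · exact hf γ
  · exact measurable_zero

theorem measurable_taylor (hu : ∀ γ, Measurable (u γ)) (γ : Fin n → ℕ) :
    Measurable fun q : Rn n × Rn n => taylor m u γ q.1 q.2 := by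
  simp only [taylor]
  refine Finset.measurable_fun_sum _ fun β _ => ?_
  exact ((contDiff_dpow β).continuous.measurable.comp (measurable_fst.sub measurable_snd)).smul
    ((hu _).comp measurable_snd)

theorem measurable_jetDiff (hf : ∀ γ, Measurable (f γ)) (hu : ∀ γ, Measurable (u γ))
    (γ : Fin n → ℕ) : Measurable fun q : Rn n × Rn n => jetDiff m f u γ q.1 q.2 :=
  ((measurable_truncJet hf γ).comp measurable_fst).sub (measurable_taylor (measurable_truncJet hu) γ)

theorem measurable_remJ (hf : ∀ γ, Measurable (f γ)) (γ : Fin n → ℕ) :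
    Measurable fun q : Rn n × Rn n => remJ m f γ q.1 q.2 := measurable_jetDiff hf hf γ

end

namespace LipDomain.Chart

variable {n l : ℕ} {Ω : LipDomain n} (χ : Ω.Chart)

theorem exists_lintegral_shadow_le (e : ℝ) : ∃ C : ℝ≥0∞, C ≠ ⊤ ∧ ∀ (X : Rn n) (G : ℝ → ℝ≥0∞),
    Measurable G → ∫⁻ Y in ball χ.c χ.r, (if 0 < dist X Y ∧ dist X Y < χ.κ * χ.r / 4 then
      ofReal (dist X Y ^ e) * ∫⁻ t in Ioo (2 * dist X Y / χ.κ) (4 * dist X Y / χ.κ), G t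
      else 0) ∂Ω.surf ≤ C * ∫⁻ t in Ioo 0 χ.r, ofReal (t ^ (e + n - 1)) * G t := by
  obtain ⟨A, hA0, hA⟩ := Ω.exists_surf_ball_le
  have hκ := χ.cone.κ_pos
  have hκ1 := χ.cone.κ_le
  have hn := Ω.two_le
  refine ⟨ofReal ((4 / χ.κ) ^ |e| * (A * (χ.κ / 2) ^ (n - 1))), ofReal_ne_top, fun X G hG => ?_⟩
  obtain ⟨S, hSd⟩ : ∃ S : Set (Rn n × ℝ), S = {q : Rn n × ℝ | (0 < q.2 ∧ q.2 < χ.r) ∧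
    dist X q.1 < χ.κ / 2 * q.2} := ⟨_, rfl⟩
  have hS : MeasurableSet S := by
    rw [hSd]
    exact ((measurableSet_lt measurable_const measurable_snd).inter
      (measurableSet_lt measurable_snd measurable_const)).inter
      (measurableSet_lt (measurable_const.dist measurable_fst) (measurable_snd.const_mul _))
  have hSm : ∀ Y t, (Y, t) ∈ S ↔ (0 < t ∧ t < χ.r) ∧ dist X Y < χ.κ / 2 * t := fun Y t => by
    rw [hSd]; rfl
  calc _ ≤ ∫⁻ Y in ball χ.c χ.r, (∫⁻ t, S.indicator (fun q => ofReal ((4 / χ.κ) ^ |e|) *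
          (ofReal (q.2 ^ e) * G q.2)) (Y, t)) ∂Ω.surf := by
        refine lintegral_mono fun Y => ?_
        dsimp only
        split_ifs with h
        · rw [← lintegral_ofReal_mul, ← lintegral_indicator measurableSet_Ioo]
          refine lintegral_mono fun t => ?_
          by_cases ht : t ∈ Ioo (2 * dist X Y / χ.κ) (4 * dist X Y / χ.κ)
          · have t1 : 2 * dist X Y < t * χ.κ := (div_lt_iff₀ hκ).1 ht.1
            have t2 : t * χ.κ < 4 * dist X Y := (lt_div_iff₀ hκ).1 ht.2
            have t0 : 0 < t := pos_of_mul_pos_left (by linarith [h.1]) hκ.le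
            have t3 : t < χ.r := by
              by_contra hc
              have := mul_le_mul_of_nonneg_right (not_lt.1 hc) hκ.le
              linarith [h.2, mul_comm χ.r χ.κ]
            rw [indicator_of_mem ht, indicator_of_mem ((hSm Y t).2 ⟨⟨t0, t3⟩, by linarith⟩), ← mul_assoc,
              ← ofReal_mul (by positivity)]
            refine mul_le_mul_left (ofReal_le_ofReal ?_) _
            refine rpow_le_of_comparable e t0 h.1 ?_ ?_
            · have : dist X Y ≤ t := by nlinarith
              refine this.trans (le_mul_of_one_le_left t0.le ?_)
              rw [le_div_iff₀ hκ]; linarith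
            · rw [div_mul_eq_mul_div, le_div_iff₀ hκ]; linarith
          · rw [indicator_of_notMem ht]; exact bot_le
        · exact bot_le
    _ = ∫⁻ t, (∫⁻ Y in ball χ.c χ.r, S.indicator (fun q => ofReal ((4 / χ.κ) ^ |e|) *
      (ofReal (q.2 ^ e) * G q.2)) (Y, t) ∂Ω.surf) := by
      refine lintegral_lintegral_swap ?_
      exact ((((measurable_ofReal_rpow e).comp measurable_snd).mul
        (hG.comp measurable_snd)).const_mul _ |>.indicator hS).aemeasurable
    _ ≤ ∫⁻ t, (Ioo 0 χ.r).indicator (fun t => ofReal ((4 / χ.κ) ^ |e| *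
      (A * (χ.κ / 2) ^ (n - 1))) * (ofReal (t ^ (e + n - 1)) * G t)) t := by
      refine lintegral_mono fun t => ?_
      by_cases ht : t ∈ Ioo 0 χ.r
      · rw [indicator_of_mem ht]
        calc _ ≤ ∫⁻ Y in ball χ.c χ.r, (ball X (χ.κ / 2 * t)).indicator (fun _ =>
              ofReal ((4 / χ.κ) ^ |e|) * (ofReal (t ^ e) * G t)) Y ∂Ω.surf := by
              refine lintegral_mono fun Y => ?_
              by_cases h : (Y, t) ∈ S
              · rw [indicator_of_mem h, indicator_of_mem]; rw [mem_ball, dist_comm]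
                exact ((hSm Y t).1 h).2
              · rw [indicator_of_notMem h]; exact bot_le
          _ ≤ ofReal ((4 / χ.κ) ^ |e|) * (ofReal (t ^ e) * G t) *
            ofReal (A * (χ.κ / 2 * t) ^ (n - 1)) := by
            rw [lintegral_indicator_const measurableSet_ball]
            refine mul_le_mul_right ((Measure.restrict_apply_le _ _).trans (hA X _ ?_)) _
            have := ht.1
            positivity
          _ = _ := by
            have t0 := ht.1
            have e1 : t ^ (e + n - 1) = t ^ e * t ^ (n - 1) := by
              rw [← rpow_natCast t (n - 1), ← rpow_add t0, Nat.cast_sub (by omega)]; congr 1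
              push_cast; ring
            rw [e1, mul_pow, ← mul_assoc A, ofReal_mul (p := A * _) (by positivity),
              ofReal_mul (p := t ^ e) (by positivity),
              ofReal_mul (p := (4 / χ.κ) ^ |e|) (by positivity)]
            ring
      · rw [indicator_of_notMem ht]
        refine le_of_eq (lintegral_eq_zero_of_ae_eq_zero (.of_forall fun Y => ?_))
        exact indicator_of_notMem (fun h => ht ((hSm Y t).1 h).1) _
    _ = _ := by rw [lintegral_indicator measurableSet_Ioo, lintegral_ofReal_mul]

theorem measurable_lintegral_assoc {H : Rn n × ℝ × Rn n → ℝ≥0∞} (hH : Measurable H)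
    {s : Set (Rn n)} : Measurable fun q : Rn n × ℝ => ∫⁻ z in s, H (q.1, q.2, z) := by
  have h : Measurable fun w : (Rn n × ℝ) × Rn n => H (w.1.1, w.1.2, w.2) := hH.comp (by fun_prop)
  exact h.lintegral_prod_right'

/-- The `P`-th power of the jet difference, integrated over a ball transversal to the cone. -/
def jetG (P : ℝ) (m : ℕ) (f u : Jet n l) (δ : Fin n → ℕ) (Y : Rn n) (t : ℝ) :
    ℝ≥0∞ := ∫⁻ z in ball 0 χ.κ, ‖jetDiff m f u δ Y (χ.map (Y, t, z))‖ₑ ^ P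

variable {χ} in
theorem measurable_jetDiff_map {P : ℝ} {m : ℕ} {f u : Jet n l}
    (hf : ∀ γ, Measurable (f γ)) (hu : ∀ γ, Measurable (u γ)) (δ : Fin n → ℕ) :
    Measurable fun q : Rn n × ℝ × Rn n => ‖jetDiff m f u δ q.1 (χ.map q)‖ₑ ^ P :=
  ((measurable_jetDiff hf hu δ).comp
    (measurable_fst.prodMk χ.continuous_map.measurable)).enorm.pow_const P

theorem measurable_jetG {P : ℝ} {m : ℕ} {f u : Jet n l}
    (hf : ∀ γ, Measurable (f γ)) (hu : ∀ γ, Measurable (u γ)) (δ : Fin n → ℕ) :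
    Measurable fun q : Rn n × ℝ => χ.jetG P m f u δ q.1 q.2 := by
  unfold jetG
  exact measurable_lintegral_assoc (measurable_jetDiff_map (χ := χ) (P := P) hf hu δ)

theorem measurable_jetG_right {P : ℝ} {m : ℕ} {f u : Jet n l}
    (hf : ∀ γ, Measurable (f γ)) (hu : ∀ γ, Measurable (u γ)) (δ : Fin n → ℕ) (Y : Rn n) :
    Measurable fun t => χ.jetG P m f u δ Y t := by
  have h1 : Measurable fun t : ℝ => (Y, t) := measurable_prodMk_left
  have h2 := (χ.measurable_jetG (P := P) (m := m) hf hu δ).comp h1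
  exact h2

theorem lintegral_jetG {P : ℝ} {m : ℕ} {f u : Jet n l}
    (hf : ∀ γ, Measurable (f γ)) (hu : ∀ γ, Measurable (u γ)) (δ : Fin n → ℕ) (e : ℝ) :
    ∫⁻ Y in ball χ.c χ.r, (∫⁻ t in Ioo 0 χ.r, ofReal (t ^ e) * χ.jetG P m f u δ Y t) ∂Ω.surf =
    ∫⁻ q, ofReal (q.2.1 ^ e) * ‖jetDiff m f u δ q.1 (χ.map q)‖ₑ ^ P ∂χ.coneM := by
  rw [χ.lintegral_coneM (F := fun q => ofReal (q.2.1 ^ e) *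
    ‖jetDiff m f u δ q.1 (χ.map q)‖ₑ ^ P) (((measurable_ofReal_rpow e).comp (by fun_prop)).mul
      (measurable_jetDiff_map hf hu δ))]
  refine lintegral_congr fun Y => lintegral_congr fun t => ?_
  rw [jetG, ← lintegral_ofReal_mul]

theorem measurable_jetDiff_segment {P : ℝ} {m : ℕ} {f u : Jet n l}
    (hf : ∀ γ, Measurable (f γ)) (hu : ∀ γ, Measurable (u γ)) (δ : Fin n → ℕ) (Y : Rn n) (t : ℝ) :
    Measurable fun z => ‖jetDiff m f u δ Y (χ.map (Y, t, z))‖ₑ ^ P := by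
  have h1 : Measurable fun z : Rn n => (Y, t, z) := by fun_prop
  have h2 := (measurable_jetDiff_map (χ := χ) (P := P) (m := m) hf hu δ).comp h1
  exact h2

theorem lintegral_jetDiff_le_jetG {P : ℝ} {m : ℕ} {f u : Jet n l}
    (δ : Fin n → ℕ) (Y : Rn n) (t : ℝ) {w : Rn n} (hw : ‖w‖ < χ.κ / 2) :
    ∫⁻ z in ball (0 : Rn n) (χ.κ / 2), ‖jetDiff m f u δ Y (χ.map (Y, t, z + w))‖ₑ ^ P ≤
      χ.jetG P m f u δ Y t := by
  rw [jetG, ← lintegral_indicator measurableSet_ball, ← lintegral_indicator measurableSet_ball,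
    ← lintegral_add_right_eq_self ((ball (0 : Rn n) χ.κ).indicator _) w]
  refine lintegral_mono fun z => ?_
  by_cases hz : z ∈ ball (0 : Rn n) (χ.κ / 2)
  · rw [indicator_of_mem hz, indicator_of_mem]
    rw [mem_ball_zero_iff] at hz ⊢; linarith [norm_add_le z w]
  · rw [indicator_of_notMem hz]; exact bot_le

theorem enorm_remJ_rpow_le_jetG {P : ℝ} (hP : 1 ≤ P) {m : ℕ} {f u : Jet n l}
    (hf : ∀ γ, Measurable (f γ)) (hu : ∀ γ, Measurable (u γ)) (γ : Fin n → ℕ) {X Y : Rn n} {t : ℝ}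
    (ht0 : 0 < t) (ht : 2 * dist X Y < t * χ.κ) {K : ℝ≥0∞} (hK : K ≠ ⊤)
    (hKd : K = 2 ^ (P - 1) * (((mlt n m).card : ℝ≥0∞) ^ (P - 1) + 1)) :
    ‖remJ m f γ X Y‖ₑ ^ P * volume (ball (0 : Rn n) (χ.κ / 2)) ≤ K *
      (χ.jetG P m f u γ X t + ∑ β ∈ mlt n m, ofReal (dist X Y ^ (P * (∑ i, β i : ℕ))) *
        χ.jetG P m f u (γ + β) Y t) := by
  have hw : ‖t⁻¹ • (X - Y)‖ < χ.κ / 2 := by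
    rw [norm_smul, norm_inv, norm_of_nonneg ht0.le, ← dist_eq_norm, inv_mul_lt_iff₀ ht0]; linarith
  have e2 : ∀ z, χ.map (X, t, z) = χ.map (Y, t, z + t⁻¹ • (X - Y)) := fun z => by
    simp only [map, smul_add, smul_smul, mul_inv_cancel₀ ht0.ne', one_smul]; abel
  have hm := fun δ Y => χ.measurable_jetDiff_segment (P := P) (m := m) hf hu δ Y t
  obtain ⟨w, hwd⟩ : ∃ w, w = t⁻¹ • (X - Y) := ⟨_, rfl⟩
  rw [← hwd] at hw e2
  have hm' : ∀ δ, Measurable fun z => ‖jetDiff m f u δ Y (χ.map (Y, t, z + w))‖ₑ ^ P :=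
    fun δ => (hm δ Y).comp (measurable_id.add_const w)
  rw [← setLIntegral_const]
  calc _ ≤ ∫⁻ z in ball (0 : Rn n) (χ.κ / 2), K *
        (‖jetDiff m f u γ X (χ.map (X, t, z))‖ₑ ^ P +
          ∑ β ∈ mlt n m, ofReal (dist X Y ^ (P * (∑ i, β i : ℕ))) *
            ‖jetDiff m f u (γ + β) Y (χ.map (Y, t, z + w))‖ₑ ^ P) := by
        refine lintegral_mono fun z => ?_
        dsimp only
        rw [remJ_eq (u := u) γ X Y (χ.map (X, t, z)), dist_eq_norm, ← e2, hKd]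
        exact enorm_sub_sum_rpow_le hP _ _ _
    _ = K * ((∫⁻ z in ball (0 : Rn n) (χ.κ / 2), ‖jetDiff m f u γ X (χ.map (X, t, z))‖ₑ ^ P) +
      ∑ β ∈ mlt n m, ofReal (dist X Y ^ (P * (∑ i, β i : ℕ))) * ∫⁻ z in ball (0 : Rn n) (χ.κ / 2),
        ‖jetDiff m f u (γ + β) Y (χ.map (Y, t, z + w))‖ₑ ^ P) := by
      rw [lintegral_const_mul' _ _ hK, lintegral_add_left (hm _ _),
        lintegral_finsetSum _ fun β _ => (hm' (γ + β)).const_mul _]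
      congr 2
      exact sum_congr rfl fun β _ => lintegral_ofReal_mul
    _ ≤ _ := by
      refine mul_le_mul_right (add_le_add ?_ (sum_le_sum fun β _ =>
        mul_le_mul_right (χ.lintegral_jetDiff_le_jetG _ _ _ hw) _)) _
      exact lintegral_mono_set (ball_subset_ball (by linarith [χ.cone.κ_pos]))

theorem enorm_remJ_rpow_le {P : ℝ} (hP : 1 ≤ P) {m : ℕ} {f u : Jet n l}
    (hf : ∀ γ, Measurable (f γ)) (hu : ∀ γ, Measurable (u γ)) (γ : Fin n → ℕ) {X Y : Rn n}
    (hXY : 0 < dist X Y) {K : ℝ≥0∞} (hK : K ≠ ⊤)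
    (hKd : K = 2 ^ (P - 1) * (((mlt n m).card : ℝ≥0∞) ^ (P - 1) + 1)) :
    volume (ball (0 : Rn n) (χ.κ / 2)) * ofReal (2 / χ.κ) *
      (ofReal (dist X Y) * ‖remJ m f γ X Y‖ₑ ^ P) ≤ K *
      ((∫⁻ t in Ioo (2 * dist X Y / χ.κ) (4 * dist X Y / χ.κ), χ.jetG P m f u γ X t) +
        ∑ β ∈ mlt n m, ofReal (dist X Y ^ (P * (∑ i, β i : ℕ))) *
          ∫⁻ t in Ioo (2 * dist X Y / χ.κ) (4 * dist X Y / χ.κ), χ.jetG P m f u (γ + β) Y t) := by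
  have hκ := χ.cone.κ_pos
  have hm1 : ∀ δ Y, Measurable fun t => χ.jetG P m f u δ Y t := fun δ Y =>
    χ.measurable_jetG_right hf hu δ Y
  calc _ = ∫⁻ _ in Ioo (2 * dist X Y / χ.κ) (4 * dist X Y / χ.κ),
        ‖remJ m f γ X Y‖ₑ ^ P * volume (ball (0 : Rn n) (χ.κ / 2)) := by
        rw [setLIntegral_const, Real.volume_Ioo,
          show 4 * dist X Y / χ.κ - 2 * dist X Y / χ.κ = 2 / χ.κ * dist X Y by ring,
          ofReal_mul (by positivity)]
        ring
    _ ≤ ∫⁻ t in Ioo (2 * dist X Y / χ.κ) (4 * dist X Y / χ.κ), K * (χ.jetG P m f u γ X t +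
      ∑ β ∈ mlt n m, ofReal (dist X Y ^ (P * (∑ i, β i : ℕ))) * χ.jetG P m f u (γ + β) Y t) := by
      refine setLIntegral_mono' measurableSet_Ioo fun t ht => ?_
      have t1 : 2 * dist X Y < t * χ.κ := (div_lt_iff₀ hκ).1 ht.1
      have t0 : 0 < t := pos_of_mul_pos_left (by linarith) hκ.le
      exact χ.enorm_remJ_rpow_le_jetG hP hf hu γ t0 t1 hK hKd
    _ = _ := by
      rw [lintegral_const_mul' _ _ hK, lintegral_add_left (hm1 _ _),
        lintegral_finsetSum _ fun β _ => (hm1 (γ + β) Y).const_mul _]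
      congr 2
      exact sum_congr rfl fun β _ => lintegral_ofReal_mul

/-- The kernel of `exists_lintegral_shadow_le`. -/
def shadowKer (e : ℝ) (G : Rn n → ℝ → ℝ≥0∞) (Z X Y : Rn n) : ℝ≥0∞ :=
  if 0 < dist X Y ∧ dist X Y < χ.κ * χ.r / 4 then
    ofReal (dist X Y ^ e) * ∫⁻ t in Ioo (2 * dist X Y / χ.κ) (4 * dist X Y / χ.κ), G Z t
  else 0

theorem measurable_lintegral_Ioo {X : Type*} [MeasurableSpace X] {a b : X → ℝ} (ha : Measurable a)
    (hb : Measurable b) {G : X → ℝ → ℝ≥0∞} (hG : Measurable fun q : X × ℝ => G q.1 q.2) :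
    Measurable fun x => ∫⁻ t in Ioo (a x) (b x), G x t := by
  have h1 : Measurable ({w : X × ℝ | a w.1 < w.2 ∧ w.2 < b w.1}.indicator
    (fun w => G w.1 w.2)) := by
    refine hG.indicator ?_
    exact (measurableSet_lt (ha.comp measurable_fst) measurable_snd).inter
      (measurableSet_lt measurable_snd (hb.comp measurable_fst))
  have h2 := h1.lintegral_prod_right' (ν := volume)
  convert! h2 using 2 with x
  rw [← lintegral_indicator measurableSet_Ioo]; rfl

theorem measurable_shadowKer (e : ℝ) {G : Rn n → ℝ → ℝ≥0∞}
    (hG : Measurable fun q : Rn n × ℝ => G q.1 q.2) :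
    Measurable fun q : Rn n × Rn n × Rn n => χ.shadowKer e G q.1 q.2.1 q.2.2 := by
  have hd : Measurable fun q : Rn n × Rn n × Rn n => dist q.2.1 q.2.2 := by fun_prop
  have h1 : Measurable fun w : (Rn n × Rn n × Rn n) × ℝ => (w.1.1, w.2) := by fun_prop
  have h2 : Measurable fun w : (Rn n × Rn n × Rn n) × ℝ => G w.1.1 w.2 := hG.comp h1
  have h3 : Measurable fun q : Rn n × Rn n × Rn n => ofReal (dist q.2.1 q.2.2 ^ e) := by fun_prop
  unfold shadowKer
  refine Measurable.ite ((measurableSet_lt measurable_const hd).inter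
    (measurableSet_lt hd measurable_const)) ?_ measurable_const
  exact h3.mul (measurable_lintegral_Ioo ((hd.const_mul 2).div_const _)
    ((hd.const_mul 4).div_const _) h2)

/-- The part near the diagonal of the Besov seminorms is controlled by the jet differences. -/
theorem exists_near_diagonal_le {P : ℝ} (hP : 1 ≤ P) (a : ℝ) (m : ℕ) : ∃ C : ℝ≥0∞, C ≠ ⊤ ∧
    ∀ f u : Jet n l, (∀ γ, Measurable (f γ)) → (∀ γ, Measurable (u γ)) →
      ∀ γ, ∑ i, γ i < m → ∫⁻ X in ball χ.c χ.r, (∫⁻ Y in ball χ.c χ.r,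
        (if 0 < dist X Y ∧ dist X Y < χ.κ * χ.r / 4 then
          ofReal (dist X Y ^ (jetExp P a m γ + 2 - n)) * ‖remJ m f γ X Y‖ₑ ^ P else 0)
          ∂Ω.surf) ∂Ω.surf ≤
      C * ∑ δ ∈ mlt n m, ∫⁻ q, ofReal (q.2.1 ^ jetExp P a m δ) *
        ‖jetDiff m f u δ q.1 (χ.map q)‖ₑ ^ P ∂χ.coneM := by
  have hκ := χ.cone.κ_pos
  obtain ⟨K, hK, hKd⟩ : ∃ K : ℝ≥0∞, K ≠ ⊤ ∧
    K = 2 ^ (P - 1) * (((mlt n m).card : ℝ≥0∞) ^ (P - 1) + 1) :=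
    ⟨_, two_rpow_mul_ne_top (by linarith) _, rfl⟩
  choose C hC hC' using χ.exists_lintegral_shadow_le
  obtain ⟨V, hVd⟩ : ∃ V, V = volume (ball (0 : Rn n) (χ.κ / 2)) * ofReal (2 / χ.κ) := ⟨_, rfl⟩
  have hV0 : V ≠ 0 := by
    rw [hVd]
    refine mul_ne_zero (measure_ball_pos _ _ (by linarith)).ne' ?_
    simp only [ne_eq, ENNReal.ofReal_eq_zero, not_le]; positivity
  have hV : V ≠ ⊤ := by
    rw [hVd]
    exact mul_ne_top measure_ball_lt_top.ne ofReal_ne_top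
  refine ⟨V⁻¹ * K * ∑ γ ∈ mlt n m, (C (jetExp P a m γ + 1 - n) + ∑ β ∈ mlt n m,
    C (jetExp P a m γ + 1 - n + P * (∑ i, β i : ℕ))), ?_, fun f u hf hu γ hγ => ?_⟩
  · refine mul_ne_top (mul_ne_top (by simpa using hV0) hK) ?_
    refine sum_ne_top.2 fun γ _ => add_ne_top.2 ⟨hC _, ?_⟩
    exact sum_ne_top.2 fun β _ => hC _
  set B := ball χ.c χ.r
  set e := jetExp P a m γ + 1 - n with he
  set S := ∑ δ ∈ mlt n m, ∫⁻ q, ofReal (q.2.1 ^ jetExp P a m δ) *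
    ‖jetDiff m f u δ q.1 (χ.map q)‖ₑ ^ P ∂χ.coneM with hS
  have hG : ∀ δ, Measurable fun q : Rn n × ℝ => χ.jetG P m f u δ q.1 q.2 :=
    fun δ => χ.measurable_jetG hf hu δ
  obtain ⟨H, hH⟩ : ∃ H : ℝ → (Rn n → ℝ → ℝ≥0∞) → Rn n → Rn n → Rn n → ℝ≥0∞,
    H = χ.shadowKer := ⟨_, rfl⟩
  have hHm : ∀ e δ, Measurable fun q : Rn n × Rn n × Rn n =>
    H e (χ.jetG P m f u δ) q.1 q.2.1 q.2.2 := by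
    intro e δ; rw [hH]
    exact χ.measurable_shadowKer e (hG δ)
  replace hH : H = fun e G Z X Y => if 0 < dist X Y ∧ dist X Y < χ.κ * χ.r / 4 then
    ofReal (dist X Y ^ e) * ∫⁻ t in Ioo (2 * dist X Y / χ.κ) (4 * dist X Y / χ.κ), G Z t
    else 0 := hH
  have hSδ : ∀ δ, ∑ i, δ i < m → ∫⁻ X in B, (∫⁻ t in Ioo 0 χ.r,
    ofReal (t ^ jetExp P a m δ) * χ.jetG P m f u δ X t) ∂Ω.surf ≤ S := by
    intro δ hδ; rw [χ.lintegral_jetG hf hu]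
    exact single_le_sum (f := fun δ => ∫⁻ q, ofReal (q.2.1 ^ jetExp P a m δ) *
      ‖jetDiff m f u δ q.1 (χ.map q)‖ₑ ^ P ∂χ.coneM) (fun _ _ => bot_le) (mem_mlt.2 hδ)
  have hH1 : ∀ e δ, ∑ i, δ i < m → e + n - 1 = jetExp P a m δ → ∫⁻ X in B, (∫⁻ Y in B,
    H e (χ.jetG P m f u δ) X X Y ∂Ω.surf) ∂Ω.surf ≤ C e * S := by
    intro e δ hδ hed
    refine le_trans ?_ (mul_le_mul_right (hSδ δ hδ) _)
    rw [← lintegral_const_mul' _ _ (hC e)]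
    refine lintegral_mono fun X => ?_
    rw [hH, ← hed]
    exact hC' e X _ (χ.measurable_jetG_right hf hu δ X)
  have hH2 : ∀ e δ, ∑ i, δ i < m → e + n - 1 = jetExp P a m δ → ∫⁻ X in B, (∫⁻ Y in B,
    H e (χ.jetG P m f u δ) Y X Y ∂Ω.surf) ∂Ω.surf ≤ C e * S := by
    intro e δ hδ hed; rw [lintegral_lintegral_swap (f := fun X Y => H e (χ.jetG P m f u δ) Y X Y)]
    · refine (le_of_eq ?_).trans (hH1 e δ hδ hed)
      refine lintegral_congr fun X => lintegral_congr fun Y => ?_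
      simp only [hH, dist_comm Y X]
    · have h1 : Measurable fun q : Rn n × Rn n => (q.2, q.1, q.2) := by fun_prop
      exact ((hHm e δ).comp h1).aemeasurable
  have hp : ∀ X Y, V * (if 0 < dist X Y ∧ dist X Y < χ.κ * χ.r / 4 then
    ofReal (dist X Y ^ (jetExp P a m γ + 2 - n)) * ‖remJ m f γ X Y‖ₑ ^ P else 0) ≤
    K * (H e (χ.jetG P m f u γ) X X Y + ∑ β ∈ mlt n m, H (e + P * (∑ i, β i : ℕ))
      (χ.jetG P m f u (γ + β)) Y X Y) := by
    intro X Y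
    by_cases h : 0 < dist X Y ∧ dist X Y < χ.κ * χ.r / 4
    · simp only [hH, if_pos h]
      have h1 := χ.enorm_remJ_rpow_le hP hf hu γ h.1 hK hKd
      rw [← hVd] at h1
      have e1 : jetExp P a m γ + 2 - n = e + 1 := by rw [he]; ring
      rw [e1, rpow_add h.1, Real.rpow_one, ofReal_mul (by positivity)]
      calc _ = ofReal (dist X Y ^ e) *
            (V * (ofReal (dist X Y) * ‖remJ m f γ X Y‖ₑ ^ P)) := by ring
        _ ≤ _ := mul_le_mul_right h1 _
        _ = _ := by
          rw [mul_left_comm, mul_add, mul_sum]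
          congr 2
          refine sum_congr rfl fun β _ => ?_
          rw [rpow_add h.1, ofReal_mul (by positivity), mul_assoc]
    · rw [if_neg h, mul_zero]; exact bot_le
  have hH1m : ∀ e δ, Measurable fun q : Rn n × Rn n => H e (χ.jetG P m f u δ) q.1 q.1 q.2 := by
    intro e δ
    have h1 : Measurable fun q : Rn n × Rn n => (q.1, q.1, q.2) := by fun_prop
    exact (hHm e δ).comp h1
  have hH2m : ∀ e δ, Measurable fun q : Rn n × Rn n => H e (χ.jetG P m f u δ) q.2 q.1 q.2 := by
    intro e δ
    have h1 : Measurable fun q : Rn n × Rn n => (q.2, q.1, q.2) := by fun_prop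
    exact (hHm e δ).comp h1
  have main : V * ∫⁻ X in B, (∫⁻ Y in B, (if 0 < dist X Y ∧ dist X Y < χ.κ * χ.r / 4 then
    ofReal (dist X Y ^ (jetExp P a m γ + 2 - n)) * ‖remJ m f γ X Y‖ₑ ^ P else 0) ∂Ω.surf) ∂Ω.surf ≤
    K * ((C e + ∑ β ∈ mlt n m, C (e + P * (∑ i, β i : ℕ))) * S) := by
    rw [← lintegral_const_mul' _ _ hV]
    calc _ ≤ ∫⁻ X in B, K * (∫⁻ Y in B, (H e (χ.jetG P m f u γ) X X Y +
            ∑ β ∈ mlt n m, H (e + P * (∑ i, β i : ℕ)) (χ.jetG P m f u (γ + β)) Y X Y) ∂Ω.surf)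
            ∂Ω.surf := by
          refine lintegral_mono fun X => ?_
          dsimp only
          rw [← lintegral_const_mul' _ _ hV, ← lintegral_const_mul' _ _ hK]
          exact lintegral_mono fun Y => hp X Y
      _ = K * ((∫⁻ X in B, (∫⁻ Y in B, H e (χ.jetG P m f u γ) X X Y ∂Ω.surf) ∂Ω.surf) +
        ∑ β ∈ mlt n m, ∫⁻ X in B, (∫⁻ Y in B, H (e + P * (∑ i, β i : ℕ))
          (χ.jetG P m f u (γ + β)) Y X Y ∂Ω.surf) ∂Ω.surf) := by
        rw [lintegral_const_mul' _ _ hK, ← lintegral_finsetSum, ← lintegral_add_left]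
        · congr 1
          refine lintegral_congr fun X => ?_
          have h1 : Measurable fun Y : Rn n => (X, Y) := measurable_prodMk_left
          have h2 : Measurable fun Y => H e (χ.jetG P m f u γ) X X Y := (hH1m _ _).comp h1
          have h3 : ∀ β : Fin n → ℕ, Measurable fun Y => H (e + P * (∑ i, β i : ℕ))
            (χ.jetG P m f u (γ + β)) Y X Y := fun β => (hH2m _ _).comp h1
          rw [lintegral_add_left h2, lintegral_finsetSum _ fun β _ => h3 β]
        · exact (hH1m _ _).lintegral_prod_right'
        · exact fun β _ => (hH2m _ _).lintegral_prod_right'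
      _ ≤ _ := by
        refine mul_le_mul_right ?_ _
        rw [add_mul, sum_mul]
        refine add_le_add (hH1 e γ hγ (by rw [he]; ring)) (sum_le_sum fun β _ => ?_)
        by_cases hb : ∑ i, (γ + β) i < m
        · refine hH2 _ (γ + β) hb ?_
          simp only [Pi.add_apply, sum_add_distrib] at hb
          simp only [he, jetExp, Pi.add_apply, sum_add_distrib]
          rw [show m - 1 - ∑ i, γ i = (m - 1 - (∑ i, γ i + ∑ i, β i)) + ∑ i, β i by omega]
          push_cast; ring
        · have h0 : ∀ Y t, χ.jetG P m f u (γ + β) Y t = 0 := fun Y t => by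
            simp [jetG, jetDiff_eq_zero (not_lt.1 hb), zero_rpow_of_pos (zero_lt_one.trans_le hP)]
          simp [hH, h0]
  calc _ = V⁻¹ * (V * _) := by rw [← mul_assoc, ENNReal.inv_mul_cancel hV0 hV, one_mul]
    _ ≤ V⁻¹ * _ := mul_le_mul_right main _
    _ ≤ _ := by
      rw [mul_assoc, mul_assoc]; gcongr
      exact single_le_sum (f := fun γ => C (jetExp P a m γ + 1 - n) + ∑ β ∈ mlt n m,
        C (jetExp P a m γ + 1 - n + P * (∑ i, β i : ℕ))) (fun _ _ => bot_le) (mem_mlt.2 hγ)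

end LipDomain.Chart

/-- The jet `u` of a function in the weighted Sobolev space of order `m`, together with the jet `f`
of its traces. -/
structure IsJetTrace {n l : ℕ} (Ω : LipDomain n) (m : ℕ) (p : ℝ≥0∞) (a : ℝ)
    (u f : Jet n l) : Prop where
  meas : ∀ γ, StronglyMeasurable (u γ)
  meas_f : ∀ γ, StronglyMeasurable (f γ)
  locInt : ∀ γ, ∑ i, γ i ≤ m → LocallyIntegrableOn (u γ) Ω.carrier volume
  memLp : ∀ γ, ∑ i, γ i ≤ m → MemLp (u γ) p (Ω.wMeas (p.toReal * a))
  hasWeakD : ∀ γ, ∑ i, γ i < m → ∀ j, HasWeakD Ω.carrier (Pi.single j 1) (u γ)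
    ((-Complex.I) • u (γ + Pi.single j 1))
  trace : ∀ γ, ∑ i, γ i < m → IsTrace Ω p a (u γ) (f γ)

/-- The `p`-th power of the norm of the weighted Sobolev space, in terms of the jet. -/
def sobN {n l : ℕ} (Ω : LipDomain n) (m : ℕ) (p : ℝ≥0∞) (a : ℝ) (u : Jet n l) :
    ℝ≥0∞ := ∑ δ ∈ mlt n (m + 1), eLpNorm (u δ) p (Ω.wMeas (p.toReal * a)) ^ p.toReal

theorem le_sobN {n l : ℕ} (Ω : LipDomain n) {m : ℕ} (p : ℝ≥0∞) (a : ℝ)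
    (u : Jet n l) {δ : Fin n → ℕ} (hδ : ∑ i, δ i ≤ m) :
    eLpNorm (u δ) p (Ω.wMeas (p.toReal * a)) ^ p.toReal ≤ sobN Ω m p a u :=
  single_le_sum (f := fun δ => eLpNorm (u δ) p (Ω.wMeas (p.toReal * a)) ^ p.toReal)
    (fun _ _ => bot_le) (mem_mlt.2 (Nat.lt_succ_of_le hδ))

theorem sum_add_single {n : ℕ} (γ : Fin n → ℕ) (j : Fin n) :
    ∑ i, (γ + Pi.single j 1 : Fin n → ℕ) i = ∑ i, γ i + 1 := by
  simp [sum_add_distrib]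

namespace IsJetTrace

variable {n l m : ℕ} {Ω : LipDomain n} {p : ℝ≥0∞} {a : ℝ} {u f : Jet n l}

theorem isW1 (h : IsJetTrace Ω m p a u f) {γ : Fin n → ℕ} (hγ : ∑ i, γ i < m) :
    IsW1 Ω p a (u γ) fun j => (-Complex.I) • u (γ + Pi.single j 1) where
  meas := h.meas γ
  memLp := h.memLp γ hγ.le
  meas_d j := (h.meas _).const_smul _
  memLp_d j := (h.memLp _ (by rw [sum_add_single]; omega)).const_smul _
  hasWeakD := h.hasWeakD γ hγ

theorem sobN_lt_top (h : IsJetTrace Ω m p a u f) : sobN Ω m p a u < ⊤ :=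
  sum_lt_top.2 fun δ hδ => rpow_lt_top_of_nonneg toReal_nonneg
    (h.memLp δ (Nat.le_of_lt_succ (mem_mlt.1 hδ))).2.ne

end IsJetTrace

namespace LipDomain

variable {n l : ℕ} {Ω : LipDomain n}

theorem Chart.exists_jetDiff_le (χ : Ω.Chart) {p : ℝ≥0∞} (hp : 1 < p) (hp' : p < ⊤) {a : ℝ}
    (ha : -1 / p.toReal < a) (ha' : a < 1 - 1 / p.toReal) (m : ℕ) :
    ∃ C : ℝ, 0 ≤ C ∧ ∀ u f : Jet n l, IsJetTrace Ω m p a u f →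
      ∀ γ, ∑ i, γ i < m → ∫⁻ q, ofReal (q.2.1 ^ jetExp p.toReal a m γ) *
        ‖jetDiff m f u γ q.1 (χ.map q)‖ₑ ^ p.toReal ∂χ.coneM ≤
      ofReal C * sobN Ω m p a u := by
  have hP : 0 < p.toReal := by linarith [one_lt_toReal hp hp']
  have hPa : -1 < p.toReal * a := neg_one_lt_mul hP ha
  obtain ⟨C, hC0, hC⟩ := χ.exists_jet_bound (l := l) hp hp' ha' m
  have hr := χ.cone.r_pos
  refine ⟨C, hC0, fun u f h γ hγ => ?_⟩
  have hε : Tendsto (fun k : ℕ => χ.r / ((k : ℝ) + 2)) atTop (𝓝[>] 0) := by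
    refine tendsto_nhdsWithin_iff.2 ⟨?_, .of_forall fun k => ?_⟩
    · exact Tendsto.div_atTop tendsto_const_nhds
        (tendsto_atTop_add_const_right _ _ tendsto_natCast_atTop_atTop)
    · exact mem_Ioi.2 (by positivity)
  have hε0 : ∀ k : ℕ, 0 < χ.r / ((k : ℝ) + 2) := fun k => by positivity
  have hεr : ∀ k : ℕ, χ.r / ((k : ℝ) + 2) < χ.r := fun k => by
    rw [div_lt_iff₀ (by positivity)]
    nlinarith [(Nat.cast_nonneg k : (0 : ℝ) ≤ k)]
  obtain ⟨H, hH⟩ : ∃ H : ℕ → Jet n l, H = fun (k : ℕ) α =>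
    if ∑ i, α i ≤ m then χ.cone.moll (χ.r / ((k : ℝ) + 2)) (u α) else 0 := ⟨_, rfl⟩
  have hH1 : ∀ k α, ∑ i, α i ≤ m → H k α = χ.cone.moll (χ.r / ((k : ℝ) + 2)) (u α) :=
    fun k α hα => by rw [hH]; exact if_pos hα
  have key := hC H u f (fun k α => ?_) (fun k α hα j X hX hXc => ?_)
    (fun α _ => (h.meas α).aestronglyMeasurable) (fun α _ => (h.meas_f α).aestronglyMeasurable)
    (fun α hα => ?_) (fun α hα => ?_) γ hγ
  · simp only [jetDiff, truncJet_eq _ hγ]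
    refine key.trans ?_
    refine mul_le_mul_right ?_ _
    calc _ ≤ ∑ δ ∈ topIdx n m, eLpNorm (u δ) p (Ω.wMeas (p.toReal * a)) ^ p.toReal := by
          refine sum_le_sum fun δ _ => ?_
          exact rpow_le_rpow (eLpNorm_restrict_le _ _ _ _) hP.le
      _ ≤ _ := Finset.sum_le_sum_of_subset (Finset.filter_subset _ _)
  · by_cases hα : ∑ i, α i ≤ m
    · rw [hH1 k α hα]
      exact χ.cone.contDiff_moll (hε0 k) (h.locInt α hα)
    · rw [hH]
      simp only [if_neg hα]
      exact contDiff_const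
  · rw [hH1 k α hα.le, hH1 k _ (by rw [sum_add_single]; omega),
      χ.cone.pd_moll (hε0 k) (hεr k) (h.hasWeakD α hα j) hX hXc, smul_smul]
    simp
  · simp only [hH1 _ α hα]
    exact (χ.cone.tendsto_moll hp hp' hPa (h.meas α) (h.locInt α hα) (h.memLp α hα)).comp hε
  · simp only [hH1 _ α hα.le]
    exact χ.tendsto_moll_trace hp hp' ha ha' (h.isW1 hα) (h.meas_f α).aestronglyMeasurable
      (h.trace α hα) hε0 hε

theorem exists_trace_Lp_le {p : ℝ≥0∞} (hp : 1 < p) (hp' : p < ⊤) {a : ℝ}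
    (ha : -1 / p.toReal < a) (ha' : a < 1 - 1 / p.toReal) (Ω : LipDomain n) (l m : ℕ) :
    ∃ C : ℝ, 0 ≤ C ∧ ∀ u f : Jet n l, IsJetTrace Ω m p a u f →
      ∀ γ, ∑ i, γ i < m → eLpNorm (f γ) p Ω.surf ^ p.toReal ≤ ofReal C * sobN Ω m p a u := by
  have hp0 : p ≠ 0 := hp.ne_bot
  have hP : 1 < p.toReal := one_lt_toReal hp hp'
  obtain ⟨T, hT⟩ := Ω.exists_atlas
  choose C₁ hC₁ h1 using fun χ : Ω.Chart => χ.exists_isTrace_bound (l := l) hp hp' ha'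
  choose C₂ hC₂ h2 using fun χ : Ω.Chart => χ.exists_lintegral_bdry_le (l := l) hP ha
  refine ⟨∑ χ ∈ T, C₂ χ * (C₁ χ * n + 1), sum_nonneg fun χ _ => ?_, fun u f h γ hγ => ?_⟩
  · have := hC₁ χ
    have := hC₂ χ
    positivity
  have hb : ∀ χ : Ω.Chart, ∫⁻ Y in ball χ.c χ.r, ‖f γ Y‖ₑ ^ p.toReal ∂Ω.surf ≤
    ofReal (C₂ χ * (C₁ χ * n + 1)) * sobN Ω m p a u := by
    intro χ
    refine (h2 χ (f γ) (u γ) (h.meas_f γ).aestronglyMeasurable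
      (h.meas γ).aestronglyMeasurable).trans ?_
    have i1 := hC₁ χ
    have i2 := hC₂ χ
    rw [ofReal_mul (hC₂ χ), mul_assoc, ENNReal.ofReal_add (by positivity) zero_le_one,
      ofReal_mul (hC₁ χ), ofReal_one, add_mul, one_mul]
    refine mul_le_mul_right (add_le_add ?_ ?_) _
    · refine (h1 χ (u γ) (f γ) _ (h.hasWeakD γ hγ) (h.meas_f γ).aestronglyMeasurable
        (h.trace γ hγ)).trans ?_
      rw [mul_assoc]
      refine mul_le_mul_right ?_ _
      refine (sum_le_card_nsmul _ _ (sobN Ω m p a u) fun j _ => ?_).trans ?_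
      · rw [eLpNorm_const_smul]
        simp only [enorm_neg]
        rw [show ‖Complex.I‖ₑ = 1 by simp [enorm_eq_nnnorm], one_mul]
        exact le_sobN Ω p a u (by rw [sum_add_single]; omega)
      · simp
    · rw [lintegral_enorm_rpow hp0 hp'.ne]
      refine le_trans ?_ (le_sobN Ω p a u hγ.le)
      exact rpow_le_rpow (eLpNorm_restrict_le _ _ _ _) (by linarith)
  rw [ofReal_sum_of_nonneg fun χ _ => mul_nonneg (hC₂ χ) (by have := hC₁ χ; positivity),
    sum_mul, ← lintegral_enorm_rpow hp0 hp'.ne]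
  exact (Ω.lintegral_surf_le_sum hT _).trans (sum_le_sum fun χ _ => hb χ)

theorem lintegral_truncJet_le {Ω : LipDomain n} {P : ℝ} (hP : 0 < P) {m : ℕ} (f : Jet n l)
    (δ : Fin n → ℕ) :
    ∫⁻ Y, ‖truncJet m f δ Y‖ₑ ^ P ∂Ω.surf ≤ ∑ δ ∈ mlt n m, ∫⁻ Y, ‖f δ Y‖ₑ ^ P ∂Ω.surf := by
  by_cases h : ∑ i, δ i < m
  · rw [truncJet_eq _ h]
    exact single_le_sum (f := fun δ => ∫⁻ Y, ‖f δ Y‖ₑ ^ P ∂Ω.surf) (fun _ _ => bot_le) (mem_mlt.2 h)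
  · rw [truncJet_eq_zero _ _ _ (not_lt.1 h)]; simp [zero_rpow_of_pos hP]

theorem exists_far_le (Ω : LipDomain n) (l m : ℕ) {P : ℝ} (hP : 1 ≤ P) {δ : ℝ} (hδ : 0 < δ) {e : ℝ}
    (he : e < 0) : ∃ C : ℝ≥0∞, C ≠ ⊤ ∧ ∀ f : Jet n l, (∀ γ, Measurable (f γ)) →
      ∀ γ, ∫⁻ X, (∫⁻ Y, (if δ ≤ dist X Y then ofReal (dist X Y ^ e) *
        ‖remJ m f γ X Y‖ₑ ^ P else 0) ∂Ω.surf) ∂Ω.surf ≤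
      C * ∑ δ ∈ mlt n m, ∫⁻ Y, ‖f δ Y‖ₑ ^ P ∂Ω.surf := by
  obtain ⟨K, hK, hKd⟩ : ∃ K : ℝ≥0∞, K ≠ ⊤ ∧
    K = 2 ^ (P - 1) * (((mlt n m).card : ℝ≥0∞) ^ (P - 1) + 1) :=
    ⟨_, two_rpow_mul_ne_top (by linarith) _, rfl⟩
  obtain ⟨D, hD0, hD⟩ : ∃ D, 0 ≤ D ∧ ∀ X ∈ Ω.bdry, ∀ Y ∈ Ω.bdry, ‖X - Y‖ ≤ D := by
    refine ⟨Metric.diam Ω.bdry, Metric.diam_nonneg, fun X hX Y hY => ?_⟩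
    rw [← dist_eq_norm]
    exact Metric.dist_le_diam_of_mem Ω.bdry_compact.isBounded hX hY
  obtain ⟨M, hMd⟩ : ∃ M : ℝ≥0∞, M = 1 + ∑ β ∈ mlt n m, ofReal (D ^ (P * (∑ i, β i : ℕ))) := ⟨_, rfl⟩
  have hM : M ≠ ⊤ := by
    rw [hMd]
    exact add_ne_top.2 ⟨by simp, sum_ne_top.2 fun β _ => ofReal_ne_top⟩
  obtain ⟨A, hAd⟩ : ∃ A : ℝ≥0∞, A = ofReal (δ ^ e) * K * M := ⟨_, rfl⟩
  have hA : A ≠ ⊤ := by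
    rw [hAd]
    exact mul_ne_top (mul_ne_top ofReal_ne_top hK) hM
  have hσ : Ω.surf univ ≠ ⊤ := measure_ne_top _ _
  refine ⟨A * (Ω.surf univ * (1 + (mlt n m).card)), mul_ne_top hA
    (mul_ne_top hσ (by simp)), fun f hf γ => ?_⟩
  have hP0 : 0 < P := by linarith
  set S := ∑ δ ∈ mlt n m, ∫⁻ Y, ‖f δ Y‖ₑ ^ P ∂Ω.surf with hS
  have hm : ∀ δ, Measurable fun Y => ‖truncJet m f δ Y‖ₑ ^ P :=
    fun δ => (measurable_truncJet hf δ).enorm.pow_const P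
  have hSδ : ∀ δ, ∫⁻ Y, ‖truncJet m f δ Y‖ₑ ^ P ∂Ω.surf ≤ S := lintegral_truncJet_le hP0 f
  calc _ ≤ ∫⁻ X, (∫⁻ Y, A * (‖truncJet m f γ X‖ₑ ^ P + ∑ β ∈ mlt n m,
          ‖truncJet m f (γ + β) Y‖ₑ ^ P) ∂Ω.surf) ∂Ω.surf := by
        refine lintegral_mono_ae ?_
        filter_upwards [Ω.ae_surf_mem] with X hX
        refine lintegral_mono_ae ?_
        filter_upwards [Ω.ae_surf_mem] with Y hY
        split_ifs with h
        · rw [hAd, mul_assoc, mul_assoc]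
          refine mul_le_mul' (ofReal_le_ofReal (Real.rpow_le_rpow_of_nonpos hδ h he.le)) ?_
          refine (enorm_sub_sum_rpow_le hP (truncJet m f γ X)
            (fun β => truncJet m f (γ + β) Y) (X - Y)).trans ?_
          rw [← hKd]
          refine mul_le_mul_right ?_ _
          rw [mul_add, mul_sum]
          refine add_le_add ?_ (sum_le_sum fun β hβ => mul_le_mul_left ?_ _)
          · calc _ = 1 * ‖truncJet m f γ X‖ₑ ^ P := (one_mul _).symm
              _ ≤ _ := by rw [hMd]; gcongr; exact le_self_add
          · rw [hMd]
            refine le_trans ?_ le_add_self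
            refine le_trans (ofReal_le_ofReal ?_) (single_le_sum
              (f := fun β : Fin n → ℕ => ofReal (D ^ (P * (∑ i, β i : ℕ))))
              (fun _ _ => bot_le) hβ)
            exact Real.rpow_le_rpow (norm_nonneg _) (hD X hX Y hY) (by positivity)
        · exact bot_le
    _ = A * (Ω.surf univ * (∫⁻ Y, ‖truncJet m f γ Y‖ₑ ^ P ∂Ω.surf) + Ω.surf univ * ∑ β ∈ mlt n m,
      ∫⁻ Y, ‖truncJet m f (γ + β) Y‖ₑ ^ P ∂Ω.surf) := by
      simp_rw [lintegral_const_mul' _ _ hA]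
      congr 1; rw [← lintegral_finsetSum _ fun β _ => hm (γ + β)]
      simp_rw [lintegral_add_left measurable_const, lintegral_const]
      rw [lintegral_add_right _ measurable_const, lintegral_mul_const' _ _ hσ, lintegral_const]
      ring
    _ ≤ A * (Ω.surf univ * S + Ω.surf univ * ∑ β ∈ mlt n m, S) := by
      gcongr
      · exact hSδ γ
      · exact hSδ _
    _ = _ := by rw [Finset.sum_const, nsmul_eq_mul]; ring

theorem jetExp_lt {P a : ℝ} (hP : 1 < P) (ha : a < 1 - 1 / P) (m : ℕ) (γ : Fin n → ℕ) :
    jetExp P a m γ < -1 := by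
  have h1 : P * a < P * (1 - 1 / P) := by gcongr
  have h2 : P * (1 - 1 / P) = P - 1 := by field_simp
  have h3 : 0 ≤ P * ((m - 1 - ∑ i, γ i : ℕ) : ℝ) := by positivity
  rw [jetExp]; linarith

/-- The traces of a function in the weighted Sobolev space have finite Besov seminorms. -/
theorem exists_besov_le {p : ℝ≥0∞} (hp : 1 < p) (hp' : p < ⊤) {a : ℝ}
    (ha : -1 / p.toReal < a) (ha' : a < 1 - 1 / p.toReal) (Ω : LipDomain n) (l m : ℕ) :
    ∃ C : ℝ≥0∞, C ≠ ⊤ ∧ ∀ u f : Jet n l, IsJetTrace Ω m p a u f →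
      ∀ γ, ∑ i, γ i < m → ∫⁻ X, (∫⁻ Y, ofReal (dist X Y ^ (jetExp p.toReal a m γ + 2 - n)) *
        ‖remJ m f γ X Y‖ₑ ^ p.toReal ∂Ω.surf) ∂Ω.surf ≤ C * sobN Ω m p a u := by
  have hp0 : p ≠ 0 := hp.ne_bot
  have hP : 1 < p.toReal := one_lt_toReal hp hp'
  have hn : (2 : ℝ) ≤ n := by exact_mod_cast Ω.two_le
  obtain ⟨T, hT⟩ := Ω.exists_atlas
  have hκr : ∀ χ : Ω.Chart, 0 < min (χ.κ * χ.r / 4) (χ.r / 4) := fun χ => by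
    have := χ.cone.r_pos
    have := χ.cone.κ_pos
    positivity
  obtain ⟨δ, hδ0, hδ⟩ := exists_pos_forall_le T hκr
  choose C₁ hC₁ h1 using fun χ : Ω.Chart => χ.exists_jetDiff_le (l := l) hp hp' ha ha' m
  choose C₂ hC₂ h2 using fun χ : Ω.Chart => χ.exists_near_diagonal_le (l := l) hP.le a m
  obtain ⟨C₃, hC₃, h3⟩ := exists_trace_Lp_le hp hp' ha ha' Ω l m
  have he : ∀ γ : Fin n → ℕ, jetExp p.toReal a m γ + 2 - n < 0 := fun γ => by
    linarith [jetExp_lt hP ha' m γ]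
  choose C₄ hC₄ h4 using fun γ => exists_far_le Ω l m hP.le hδ0 (he γ)
  obtain ⟨N, hN⟩ : ∃ N : ℝ≥0∞, N = (mlt n m).card := ⟨_, rfl⟩
  refine ⟨∑ χ ∈ T, C₂ χ * (N * ofReal (C₁ χ)) + (∑ γ ∈ mlt n m, C₄ γ) *
    (N * ofReal C₃), ?_, fun u f h γ hγ => ?_⟩
  · have hN' : N ≠ ⊤ := by simp [hN]
    refine add_ne_top.2 ⟨sum_ne_top.2 fun χ _ => mul_ne_top (hC₂ χ)
      (mul_ne_top hN' ofReal_ne_top), mul_ne_top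
      (sum_ne_top.2 fun γ _ => hC₄ γ) (mul_ne_top hN' ofReal_ne_top)⟩
  have hfm : ∀ γ, Measurable (f γ) := fun γ => (h.meas_f γ).measurable
  set e := jetExp p.toReal a m γ + 2 - n with hed
  obtain ⟨G, hG⟩ : ∃ G : Rn n → Rn n → ℝ≥0∞, G = fun X Y => ofReal (dist X Y ^ e) *
    ‖remJ m f γ X Y‖ₑ ^ p.toReal := ⟨_, rfl⟩
  have hGm : Measurable fun q : Rn n × Rn n => G q.1 q.2 := by
    rw [hG]
    exact Measurable.mul (by fun_prop) ((measurable_remJ hfm γ).enorm.pow_const _)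
  obtain ⟨B, hB⟩ : ∃ B : Ω.Chart → Rn n × Rn n → ℝ≥0∞, B = fun χ q =>
    if (dist q.1 χ.c < χ.r ∧ dist q.2 χ.c < χ.r) ∧ 0 < dist q.1 q.2 ∧
      dist q.1 q.2 < χ.κ * χ.r / 4 then G q.1 q.2 else 0 := ⟨_, rfl⟩
  obtain ⟨F, hF⟩ : ∃ F : Rn n × Rn n → ℝ≥0∞, F = fun q => if δ ≤ dist q.1 q.2 then G q.1 q.2 else 0 :=
    ⟨_, rfl⟩
  have hd : Measurable fun q : Rn n × Rn n => dist q.1 q.2 := by fun_prop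
  have hBm : ∀ χ, Measurable (B χ) := by
    intro χ; rw [hB]
    exact Measurable.ite (((measurableSet_lt (measurable_fst.dist measurable_const) measurable_const).inter
      (measurableSet_lt (measurable_snd.dist measurable_const) measurable_const)).inter ((measurableSet_lt measurable_const hd).inter
        (measurableSet_lt hd measurable_const))) hGm measurable_const
  have hFm : Measurable F := by
    rw [hF]
    exact Measurable.ite (measurableSet_le measurable_const hd) hGm measurable_const
  have hpt : ∀ X ∈ Ω.bdry, ∀ Y ∈ Ω.bdry, G X Y ≤ ∑ χ ∈ T, B χ (X, Y) + F (X, Y) := by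
    intro X hX Y _
    rcases le_or_gt δ (dist X Y) with h0 | h0
    · refine le_trans (le_of_eq ?_) le_add_self
      rw [hF]
      exact (if_pos h0).symm
    · rcases eq_or_lt_of_le (dist_nonneg (x := X) (y := Y)) with h5 | h5
      · rw [hG]
        simp only [← h5]; rw [Real.zero_rpow (he γ).ne, ENNReal.ofReal_zero, zero_mul]; exact bot_le
      · obtain ⟨χ, hχ, h6⟩ := mem_iUnion₂.1 (hT hX)
        have h7 := hδ χ hχ
        have h8 := min_le_left (χ.κ * χ.r / 4) (χ.r / 4)
        have h9 := min_le_right (χ.κ * χ.r / 4) (χ.r / 4)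
        have hr := χ.cone.r_pos
        rw [mem_ball] at h6
        refine le_trans ?_ le_self_add
        refine le_trans (le_of_eq ?_) (single_le_sum (f := fun χ => B χ (X, Y))
          (fun _ _ => bot_le) hχ)
        simp only [hB]; rw [if_pos]
        refine ⟨⟨by linarith, ?_⟩, h5, by linarith⟩
        have := dist_triangle_left Y χ.c X
        linarith
  have near : ∀ χ, ∫⁻ X, (∫⁻ Y, B χ (X, Y) ∂Ω.surf) ∂Ω.surf ≤
    C₂ χ * (N * ofReal (C₁ χ)) * sobN Ω m p a u := by
    intro χ
    have h5 := h2 χ f u hfm (fun γ => (h.meas γ).measurable) γ hγ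
    have h6 : ∑ δ ∈ mlt n m, ∫⁻ q, ofReal (q.2.1 ^ jetExp p.toReal a m δ) *
      ‖jetDiff m f u δ q.1 (χ.map q)‖ₑ ^ p.toReal ∂χ.coneM ≤
      N * (ofReal (C₁ χ) * sobN Ω m p a u) := by
      refine (sum_le_card_nsmul _ _ _ fun δ hδ => h1 χ u f h δ (mem_mlt.1 hδ)).trans ?_
      rw [nsmul_eq_mul, hN]
    refine le_trans ?_ ((h5.trans (mul_le_mul_right h6 _)).trans (le_of_eq (by ring)))
    rw [← lintegral_indicator measurableSet_ball]
    refine lintegral_mono fun X => ?_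
    by_cases hX : X ∈ ball χ.c χ.r
    · rw [indicator_of_mem hX, ← lintegral_indicator measurableSet_ball]
      refine lintegral_mono fun Y => ?_
      by_cases hY : Y ∈ ball χ.c χ.r
      · rw [indicator_of_mem hY]
        simp only [hB, hG]
        split_ifs with g1 g2
        · exact le_rfl
        · exact absurd g1.2 g2
        · exact bot_le
        · exact bot_le
      · simp only [hB]; rw [if_neg fun g => hY (mem_ball.2 g.1.2)]; exact bot_le
    · refine (le_of_eq (lintegral_eq_zero_of_ae_eq_zero (.of_forall fun Y => ?_))).trans bot_le
      simp only [hB]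
      exact if_neg fun g => hX (mem_ball.2 g.1.1)
  have far : ∫⁻ X, (∫⁻ Y, F (X, Y) ∂Ω.surf) ∂Ω.surf ≤
    (∑ γ ∈ mlt n m, C₄ γ) * (N * ofReal C₃) * sobN Ω m p a u := by
    have h6 : ∑ δ ∈ mlt n m, ∫⁻ Y, ‖f δ Y‖ₑ ^ p.toReal ∂Ω.surf ≤
      N * (ofReal C₃ * sobN Ω m p a u) := by
      refine (sum_le_card_nsmul _ _ (ofReal C₃ * sobN Ω m p a u) fun δ hδ => ?_).trans ?_
      · rw [lintegral_enorm_rpow hp0 hp'.ne]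
        exact h3 u f h δ (mem_mlt.1 hδ)
      · rw [nsmul_eq_mul, hN]
    rw [hF, hG]
    refine (h4 γ f hfm γ).trans ?_
    rw [mul_assoc, mul_assoc]
    exact mul_le_mul' (single_le_sum (f := C₄) (fun _ _ => bot_le) (mem_mlt.2 hγ)) h6
  rw [add_mul, sum_mul]
  refine le_trans ?_ (add_le_add (sum_le_sum fun χ _ => near χ) far)
  have hm1 : ∀ χ X, Measurable fun Y => B χ (X, Y) := fun χ X =>
    (hBm χ).comp (measurable_prodMk_left (x := X))
  have hm2 : ∀ X, Measurable fun Y => F (X, Y) := fun X =>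
    hFm.comp (measurable_prodMk_left (x := X))
  rw [← lintegral_finsetSum _ fun χ _ => (hBm χ).lintegral_prod_right',
    ← lintegral_add_right _ hFm.lintegral_prod_right']
  refine lintegral_mono_ae ?_
  filter_upwards [Ω.ae_surf_mem] with X hX
  rw [← lintegral_finsetSum _ fun χ _ => hm1 χ X, ← lintegral_add_right _ (hm2 X)]
  refine lintegral_mono_ae ?_
  filter_upwards [Ω.ae_surf_mem] with Y hY
  have h5 := hpt X hX Y hY
  rw [hG] at h5
  exact h5

end LipDomain

/-- The multi-index of an iterated derivative. -/
def idxOf {n : ℕ} (J : List (Fin n)) : Fin n → ℕ := fun i => J.count i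

section

variable {n l m : ℕ}

theorem idxOf_nil : idxOf ([] : List (Fin n)) = 0 := by
  funext i; simp [idxOf]

theorem idxOf_cons (j : Fin n) (J : List (Fin n)) : idxOf (j :: J) = idxOf J + Pi.single j 1 := by
  funext i; rw [idxOf, List.count_cons, Pi.add_apply, idxOf]
  by_cases h : j = i
  · subst h; simp
  · rw [Pi.single_eq_of_ne (Ne.symm h)]; simp [h]

theorem sum_idxOf (J : List (Fin n)) : ∑ i, idxOf J i = J.length := by
  induction J with
  | nil => simp [idxOf_nil]
  | cons j J ih => rw [idxOf_cons, sum_add_single, ih, List.length_cons]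

theorem perm_wordOf_idxOf (J : List (Fin n)) : J.Perm (wordOf (idxOf J)) :=
  List.perm_iff_count.2 fun i => by rw [count_wordOf]; rfl

theorem idxOf_wordOf (α : Fin n → ℕ) : idxOf (wordOf α) = α := funext fun i => count_wordOf α i

theorem pdW_taylor {g : Jet n l} (hg : ∀ α, m ≤ ∑ i, α i → g α = 0) (J : List (Fin n)) (W : Rn n) :
    pdW J (fun A => taylor m g 0 A W) = fun A => taylor m g (idxOf J) A W := by
  induction J with
  | nil => rw [idxOf_nil]; rfl
  | cons j J ih => rw [pdW, ih, pd_taylor hg, idxOf_cons]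

theorem norm_taylor_le (g : Jet n l) (γ : Fin n → ℕ) (A W : Rn n) :
    ‖taylor m g γ A W‖ ≤ ∑ β ∈ mlt n m, ‖A - W‖ ^ (∑ i, β i) * ‖g (γ + β) W‖ := by
  refine (norm_sum_le _ _).trans (sum_le_sum fun β _ => ?_)
  rw [norm_smul, Real.norm_eq_abs]; gcongr
  exact abs_dpow_le _ _

end

namespace IsWhitneyKernel

variable {n l : ℕ} {Ω : LipDomain n} {K : Rn n → Rn n → ℂ}

theorem exists_pdW_le (hK : IsWhitneyKernel Ω K) (N : ℕ) : ∃ c : ℝ, 0 ≤ c ∧ ∀ X ∈ Ω.carrier, ∀ Y ∈ Ω.bdry,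
    ∀ J : List (Fin n), J.length ≤ N → ‖pdW J (fun X' => K X' Y) X‖ ≤
      c * Ω.rho X ^ (1 - (n : ℝ)) * ((Ω.rho X)⁻¹) ^ J.length := by
  choose c hc using hK.bound
  refine ⟨∑ α ∈ mlt n (N + 1), |c α|, sum_nonneg fun _ _ => abs_nonneg _, fun X hX Y hY J hJ => ?_⟩
  have hρ := Ω.rho_pos hX
  have h1 := hc (idxOf J) X hX Y hY
  rw [classD_eq, Pi.smul_apply, norm_smul, norm_pow, norm_neg, Complex.norm_I, one_pow, one_mul,
    ← pdW_perm Ω.isOpen (hK.smooth Y hY) (perm_wordOf_idxOf J) hX] at h1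
  refine h1.trans ?_
  have e1 : Ω.rho X ^ (1 - (n : ℝ) - ∑ i, (idxOf J i : ℝ)) =
    Ω.rho X ^ (1 - (n : ℝ)) * ((Ω.rho X)⁻¹) ^ J.length := by
    rw [← Nat.cast_sum, sum_idxOf, rpow_sub hρ, rpow_natCast, inv_pow]; rfl
  rw [e1, mul_assoc]
  refine mul_le_mul_of_nonneg_right ((le_abs_self _).trans ?_) (by positivity)
  exact single_le_sum (f := fun α => |c α|) (fun _ _ => abs_nonneg _)
    (mem_mlt.2 (by rw [sum_idxOf]; omega))

theorem exists_pdW_smul_taylor_le (hK : IsWhitneyKernel Ω K) (N m : ℕ) : ∃ c : ℝ, 0 ≤ c ∧ ∀ Λ : ℝ, 1 ≤ Λ → ∀ X ∈ Ω.carrier,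
    ∀ Y ∈ Ω.bdry, ∀ (A : Rn n) (h : (Fin n → ℕ) → Cl l), (∀ γ, m ≤ ∑ i, γ i → h γ = 0) →
      ‖X - A‖ ≤ Λ * Ω.rho X → ∀ J : List (Fin n), J.length ≤ N →
      ‖pdW J (fun X' => K X' Y • taylor m (fun γ _ => h γ) 0 X' A) X‖ ≤ c * Λ ^ m *
        (Ω.rho X ^ (1 - (n : ℝ)) * ((Ω.rho X)⁻¹) ^ J.length *
        ∑ δ ∈ mlt n m, Ω.rho X ^ (∑ i, δ i) * ‖h δ‖) := by
  obtain ⟨c, hc0, hc⟩ := hK.exists_pdW_le N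
  refine ⟨2 ^ N * c * (mlt n m).card, by positivity, fun Λ hΛ X hX Y hY A h hh hA J hJ => ?_⟩
  have hρ := Ω.rho_pos hX
  set ρ := Ω.rho X
  set S := ∑ δ ∈ mlt n m, ρ ^ (∑ i, δ i) * ‖h δ‖ with hS
  have hS0 : 0 ≤ S := sum_nonneg fun _ _ => by positivity
  have hg : ∀ α : Fin n → ℕ, m ≤ ∑ i, α i → (fun γ (_ : Rn n) => h γ) α = 0 :=
    fun α hα => by funext; exact hh α hα
  have h1 : ∀ J : List (Fin n), J.length ≤ N →
    ‖pdW J (fun X' => taylor m (fun γ _ => h γ) 0 X' A) X‖ ≤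
    Λ ^ m * ((mlt n m).card * S) * ρ⁻¹ ^ J.length := by
    intro J _; rw [pdW_taylor hg]
    refine (norm_taylor_le _ _ _ _).trans ?_
    rw [mul_assoc, ← nsmul_eq_mul, smul_mul_assoc, nsmul_eq_mul, mul_left_comm, ← nsmul_eq_mul]
    refine sum_le_card_nsmul _ _ _ fun β hβ => ?_
    by_cases hb : ∑ i, (idxOf J + β) i < m
    · have e1 : ∑ i, (idxOf J + β) i = J.length + ∑ i, β i := by
        simp only [Pi.add_apply, sum_add_distrib, sum_idxOf]
      have e2 : ρ ^ (∑ i, (idxOf J + β) i) * ‖h (idxOf J + β)‖ ≤ S :=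
        single_le_sum (f := fun δ => ρ ^ (∑ i, δ i) * ‖h δ‖) (fun _ _ => by positivity)
          (mem_mlt.2 hb)
      calc ‖X - A‖ ^ (∑ i, β i) * ‖h (idxOf J + β)‖
          ≤ (Λ * ρ) ^ (∑ i, β i) * ‖h (idxOf J + β)‖ := by gcongr
        _ = Λ ^ (∑ i, β i) * (ρ ^ (∑ i, (idxOf J + β) i) * ‖h (idxOf J + β)‖ * ρ⁻¹ ^ J.length) := by
          rw [e1, pow_add, mul_pow, inv_pow]; field_simp
        _ ≤ Λ ^ m * (S * ρ⁻¹ ^ J.length) := by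
          gcongr
          exact (mem_mlt.1 hβ).le
    · simp only [hh _ (not_lt.1 hb), norm_zero, mul_zero]; positivity
  have h2 := norm_pdW_smul_le Ω.isOpen hX N (r := ρ⁻¹) (by positivity) (hK.smooth Y hY)
    ((contDiff_taylor (m := m) (g := fun γ _ => h γ) 0 A).contDiffOn) (fun J hJ => hc X hX Y hY J hJ)
    h1 J hJ
  refine h2.trans ?_
  calc _ ≤ 2 ^ N * (c * ρ ^ (1 - (n : ℝ)) * (Λ ^ m * ((mlt n m).card * S))) * ρ⁻¹ ^ J.length := by
        gcongr
        exact one_le_two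
    _ = _ := by ring

theorem pdW_eq_zero (hK : IsWhitneyKernel Ω K) {X Y : Rn n} (hX : X ∈ Ω.carrier) (hY : Y ∈ Ω.bdry)
    (hXY : 2 * Ω.rho X < ‖X - Y‖) (g : Rn n → Cl l) (J : List (Fin n)) :
    pdW J (fun X' => K X' Y • g X') X = 0 := by
  have hO : IsOpen (Ω.carrier ∩ {X' | 2 * Ω.rho X' < ‖X' - Y‖}) :=
    Ω.isOpen.inter (isOpen_lt (by have := Ω.continuous_rho; fun_prop) (by fun_prop))
  have h1 : EqOn (fun X' => K X' Y • g X') (0 : Rn n → Cl l)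
    (Ω.carrier ∩ {X' | 2 * Ω.rho X' < ‖X' - Y‖}) := fun X' hX' => by
    simp [hK.support X' hX'.1 Y hY (le_of_lt hX'.2)]
  rw [pdW_congr hO h1 J ⟨hX, hXY⟩]
  clear h1
  induction J with
  | nil => rfl
  | cons j J ih =>
    have : ∀ J : List (Fin n), pdW J (0 : Rn n → Cl l) = 0 := by
      intro J
      induction J with
      | nil => rfl
      | cons j J ih => rw [pdW, ih]; funext X; simp [pd]
    rw [this]; rfl

/-- Derivatives of the integral of a kernel against polynomials, with the expansion point `A(Y)`. -/
theorem exists_integral_taylor (hK : IsWhitneyKernel Ω K) (N m : ℕ) : ∃ c : ℝ, 0 ≤ c ∧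
    ∀ (A : Rn n → Rn n) (h : Jet n l), Measurable A → (∀ Y ∈ Ω.bdry, A Y ∈ Ω.bdry) →
      (∀ γ, Integrable (h γ) Ω.surf) → (∀ γ, m ≤ ∑ i, γ i → h γ = 0) →
      ContDiffOn ℝ ∞ (fun X => ∫ Y, K X Y • taylor m (fun γ _ => h γ Y) 0 X (A Y) ∂Ω.surf)
        Ω.carrier ∧
      ∀ Λ : ℝ, 1 ≤ Λ → ∀ X ∈ Ω.carrier,
        (∀ Y ∈ Ω.bdry, ‖X - Y‖ ≤ 2 * Ω.rho X → ‖X - A Y‖ ≤ Λ * Ω.rho X) →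
        ∀ J : List (Fin n), J.length ≤ N →
        ‖pdW J (fun X => ∫ Y, K X Y • taylor m (fun γ _ => h γ Y) 0 X (A Y) ∂Ω.surf) X‖ₑ ≤
          ofReal (c * Λ ^ m * (Ω.rho X ^ (1 - (n : ℝ)) * ((Ω.rho X)⁻¹) ^ J.length)) *
          ∑ δ ∈ mlt n m, ofReal (Ω.rho X ^ (∑ i, δ i)) *
            ∫⁻ Y in closedBall X (2 * Ω.rho X), ‖h δ Y‖ₑ ∂Ω.surf := by
  choose c hc0 hc using fun N => hK.exists_pdW_smul_taylor_le (l := l) N m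
  refine ⟨c N, hc0 N, fun A h hA hAb hh hh0 => ?_⟩
  obtain ⟨D, hD0, hD⟩ : ∃ D, 0 ≤ D ∧ ∀ X ∈ Ω.carrier, ∀ Y ∈ Ω.bdry, ‖X - Y‖ ≤ D := by
    have hb : Bornology.IsBounded (Ω.carrier ∪ Ω.bdry) := Ω.isBounded.union Ω.bdry_compact.isBounded
    refine ⟨Metric.diam (Ω.carrier ∪ Ω.bdry), Metric.diam_nonneg, fun X hX Y hY => ?_⟩
    rw [← dist_eq_norm]
    exact Metric.dist_le_diam_of_mem hb (Or.inl hX) (Or.inr hY)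
  have hh0' : ∀ Y γ, m ≤ ∑ i, γ i → h γ Y = 0 := fun Y γ hγ => by rw [hh0 γ hγ]; rfl
  have hloc : ∀ J : List (Fin n), ∀ X₀ ∈ Ω.carrier, ∃ δ > 0, ∃ b : Rn n → ℝ, Integrable b Ω.surf ∧
    ∀ᵐ Y ∂Ω.surf, ∀ X ∈ ball X₀ δ, X ∈ Ω.carrier →
      ‖pdW J (fun X => K X Y • taylor m (fun γ _ => h γ Y) 0 X (A Y)) X‖ ≤ b Y := by
    intro J X₀ hX₀
    have hρ₀ := Ω.rho_pos hX₀
    set ρ₀ := Ω.rho X₀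
    refine ⟨ρ₀ / 2, by positivity, fun Y => c J.length * (D / (ρ₀ / 2) + 1) ^ m *
      ((2 ^ |1 - (n : ℝ)| * ρ₀ ^ (1 - (n : ℝ))) * ((ρ₀ / 2)⁻¹) ^ J.length *
        ∑ δ ∈ mlt n m, (2 * ρ₀) ^ (∑ i, δ i) * ‖h δ Y‖), ?_, ?_⟩
    · refine Integrable.const_mul (Integrable.const_mul ?_ _) _
      exact integrable_finsetSum _ fun δ _ => (hh δ).norm.const_mul _
    · filter_upwards [Ω.ae_surf_mem] with Y hY X hXb hX
      have hρ := Ω.rho_pos hX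
      have h1 : Ω.rho X ≤ ρ₀ + dist X X₀ := Ω.rho_le_add X X₀
      have h2 : ρ₀ ≤ Ω.rho X + dist X₀ X := Ω.rho_le_add X₀ X
      rw [dist_comm] at h2
      rw [mem_ball] at hXb
      have h3 : ρ₀ / 2 ≤ Ω.rho X := by linarith
      have hΛ : ‖X - A Y‖ ≤ (D / (ρ₀ / 2) + 1) * Ω.rho X := by
        calc ‖X - A Y‖ ≤ D := hD X hX _ (hAb Y hY)
          _ = D / (ρ₀ / 2) * (ρ₀ / 2) := by field_simp
          _ ≤ D / (ρ₀ / 2) * Ω.rho X := by gcongr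
          _ ≤ _ := by nlinarith
      refine (hc J.length (D / (ρ₀ / 2) + 1) (le_add_of_nonneg_left (by positivity)) X hX Y hY (A Y)
        (fun γ => h γ Y) (hh0' Y) hΛ J le_rfl).trans ?_
      have := hc0 J.length
      gcongr
      · exact rpow_le_of_comparable _ hρ₀ hρ (by linarith) (by linarith)
      · linarith
  have hs : ∀ᵐ Y ∂Ω.surf, ContDiffOn ℝ ∞
    (fun X => K X Y • taylor m (fun γ _ => h γ Y) 0 X (A Y)) Ω.carrier := by
    filter_upwards [Ω.ae_surf_mem] with Y hY
    exact (hK.smooth Y hY).smul (contDiff_taylor (g := fun γ _ => h γ Y) 0 (A Y)).contDiffOn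
  have hm : ∀ X ∈ Ω.carrier, AEStronglyMeasurable
    (fun Y => K X Y • taylor m (fun γ _ => h γ Y) 0 X (A Y)) Ω.surf := by
    intro X hX
    refine (hK.measurable X hX).smul ?_
    simp only [taylor]
    refine Finset.aestronglyMeasurable_fun_sum _ fun β _ => ?_
    exact ((contDiff_dpow β).continuous.measurable.comp
      (measurable_const.sub hA)).aestronglyMeasurable.smul (hh _).aestronglyMeasurable
  obtain ⟨e1, -, e2⟩ := pdW_integral Ω.isOpen hs hm hloc
  refine ⟨e1, fun Λ hΛ X hX hXA J hJ => ?_⟩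
  have hρ := Ω.rho_pos hX
  rw [e2 J X hX]
  refine (enorm_integral_le_lintegral_enorm _).trans ?_
  have hmc : MeasurableSet (closedBall X (2 * Ω.rho X)) := measurableSet_closedBall
  obtain ⟨B, hB⟩ : ∃ B, B = c N * Λ ^ m * (Ω.rho X ^ (1 - (n : ℝ)) * ((Ω.rho X)⁻¹) ^ J.length) :=
    ⟨_, rfl⟩
  have hB0 : 0 ≤ B := by
    have := hc0 N
    rw [hB]; positivity
  rw [← hB]
  calc _ ≤ ∫⁻ Y, (closedBall X (2 * Ω.rho X)).indicator (fun Y => ofReal B *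
        ∑ δ ∈ mlt n m, ofReal (Ω.rho X ^ (∑ i, δ i)) * ‖h δ Y‖ₑ) Y ∂Ω.surf := by
        refine lintegral_mono_ae ?_
        filter_upwards [Ω.ae_surf_mem] with Y hY
        by_cases hYX : Y ∈ closedBall X (2 * Ω.rho X)
        · have h1 : ‖X - Y‖ ≤ 2 * Ω.rho X := by rwa [mem_closedBall, dist_comm, dist_eq_norm] at hYX
          rw [indicator_of_mem hYX, ← ofReal_norm]
          refine (ofReal_le_ofReal (hc N Λ hΛ X hX Y hY (A Y) (fun γ => h γ Y) (hh0' Y)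
            (hXA Y hY h1) J hJ)).trans (le_of_eq ?_)
          rw [← mul_assoc, ← hB, ofReal_mul hB0, ofReal_sum_of_nonneg fun δ _ => by positivity]
          congr 1
          refine sum_congr rfl fun δ _ => ?_
          rw [ofReal_mul (by positivity), ofReal_norm]
        · rw [indicator_of_notMem hYX, hK.pdW_eq_zero hX hY]
          · simp
          · rwa [mem_closedBall, dist_comm, dist_eq_norm, not_le] at hYX
    _ = _ := by
      rw [lintegral_indicator hmc, lintegral_ofReal_mul, lintegral_finsetSum']
      · simp_rw [lintegral_ofReal_mul]
      · exact fun δ _ => ((hh δ).aestronglyMeasurable.restrict.enorm).const_mul _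

end IsWhitneyKernel

/-- The Whitney-type extension of a family, as a function of a jet. -/
def whit {n l : ℕ} (Ω : LipDomain n) (K : Rn n → Rn n → ℂ) (m : ℕ)
    (f : Jet n l) (X : Rn n) : Cl l :=
  ∫ Y, K X Y • taylor m (truncJet m f) 0 X Y ∂Ω.surf

namespace LipDomain

variable {n l m : ℕ} {Ω : LipDomain n} {K : Rn n → Rn n → ℂ} {f : Jet n l}

theorem remJ_eq_zero {γ : Fin n → ℕ} (hγ : m ≤ ∑ i, γ i) (X Y : Rn n) : remJ m f γ X Y = 0 :=
  jetDiff_eq_zero (u := f) hγ X Y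

theorem integrable_remJ (hf : ∀ γ, Measurable (f γ))
    (hfi : ∀ γ, Integrable (truncJet m f γ) Ω.surf) (γ : Fin n → ℕ) {Z : Rn n} (hZ : Z ∈ Ω.bdry) :
    Integrable (fun Y => remJ m f γ Z Y) Ω.surf := by
  have he : (fun Y => remJ m f γ Z Y) = fun Y => truncJet m f γ Z -
    ∑ β ∈ mlt n m, dpow β (Z - Y) • truncJet m f (γ + β) Y := rfl
  rw [he]
  refine (integrable_const _).sub ?_
  refine integrable_finsetSum _ fun β _ => ?_
  have hd : Measurable fun Y => dpow β (Z - Y) :=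
    (contDiff_dpow β).continuous.measurable.comp (measurable_const.sub measurable_id)
  refine ((hfi (γ + β)).norm.const_mul (Metric.diam Ω.bdry ^ (∑ i, β i))).mono'
    (hd.smul (measurable_truncJet hf _)).aestronglyMeasurable ?_
  filter_upwards [Ω.ae_surf_mem] with Y hY
  rw [norm_smul, Real.norm_eq_abs]
  refine mul_le_mul_of_nonneg_right ((abs_dpow_le _ _).trans ?_) (norm_nonneg _)
  gcongr; rw [← dist_eq_norm]
  exact Metric.dist_le_diam_of_mem Ω.bdry_compact.isBounded hZ hY

theorem taylor_eq_sub_remJ (X Y Z : Rn n) : taylor m (truncJet m f) 0 X Y =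
    taylor m (truncJet m f) 0 X Z - taylor m (fun γ _ => remJ m f γ Z Y) 0 X Z := by
  rw [taylor_eq_sum (truncJet_eq_zero m f) 0 X Z Y, taylor, taylor, ← sum_sub_distrib]
  refine sum_congr rfl fun β _ => ?_
  rw [← smul_sub, remJ]; congr 1; abel

theorem whit_eq (hK : IsWhitneyKernel Ω K) (hf : ∀ γ, Measurable (f γ))
    (hfi : ∀ γ, Integrable (truncJet m f γ) Ω.surf) {Z : Rn n} (hZ : Z ∈ Ω.bdry) {X : Rn n}
    (hX : X ∈ Ω.carrier) : whit Ω K m f X = taylor m (truncJet m f) 0 X Z -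
      ∫ Y, K X Y • taylor m (fun γ _ => remJ m f γ Z Y) 0 X Z ∂Ω.surf := by
  obtain ⟨c, hc0, hc⟩ := hK.exists_pdW_le 0
  have h1 : Integrable (K X) Ω.surf := by
    by_contra h
    have := hK.integral_eq_one X hX
    rw [integral_undef h] at this
    exact zero_ne_one this
  have h2 : Integrable (fun Y => taylor m (fun γ _ => remJ m f γ Z Y) 0 X Z) Ω.surf := by
    simp only [taylor]
    exact integrable_finsetSum _ fun β _ => (integrable_remJ hf hfi (0 + β) hZ).smul (dpow β (X - Z))
  have h3 : Integrable (fun Y => K X Y • taylor m (fun γ _ => remJ m f γ Z Y) 0 X Z) Ω.surf := by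
    refine (h2.norm.const_mul (c * Ω.rho X ^ (1 - (n : ℝ)))).mono'
      ((hK.measurable X hX).smul h2.aestronglyMeasurable) ?_
    filter_upwards [Ω.ae_surf_mem] with Y hY
    rw [norm_smul]
    refine mul_le_mul_of_nonneg_right ?_ (norm_nonneg _)
    simpa [pdW] using hc X hX Y hY [] le_rfl
  have h4 : Integrable (fun Y => K X Y • taylor m (truncJet m f) 0 X Z) Ω.surf := h1.smul_const _
  have h5 : (fun Y => K X Y • taylor m (truncJet m f) 0 X Y) = fun Y =>
    K X Y • taylor m (truncJet m f) 0 X Z - K X Y • taylor m (fun γ _ => remJ m f γ Z Y) 0 X Z := by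
    funext Y; rw [taylor_eq_sub_remJ X Y Z, smul_sub]
  rw [whit, h5, integral_sub h4 h3, integral_smul_const, hK.integral_eq_one X hX, one_smul]

theorem exists_whit_bound (hK : IsWhitneyKernel Ω K) (l m N : ℕ) : ∃ c : ℝ, 0 ≤ c ∧
    ∀ f : Jet n l, (∀ γ, Measurable (f γ)) →
      (∀ γ, Integrable (truncJet m f γ) Ω.surf) → ContDiffOn ℝ ∞ (whit Ω K m f) Ω.carrier ∧
      (∀ X ∈ Ω.carrier, ∀ J : List (Fin n), J.length ≤ N → ‖pdW J (whit Ω K m f) X‖ₑ ≤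
        ofReal (c * 2 ^ m * (Ω.rho X ^ (1 - (n : ℝ)) * ((Ω.rho X)⁻¹) ^ J.length)) *
          ∑ δ ∈ mlt n m, ofReal (Ω.rho X ^ (∑ i, δ i)) *
            ∫⁻ Y in closedBall X (2 * Ω.rho X), ‖truncJet m f δ Y‖ₑ ∂Ω.surf) ∧
      ∀ Λ : ℝ, 1 ≤ Λ → ∀ X ∈ Ω.carrier, ∀ Z ∈ Ω.bdry, ‖X - Z‖ ≤ Λ * Ω.rho X →
        ∀ J : List (Fin n), J.length ≤ N →
        ‖pdW J (whit Ω K m f) X - taylor m (truncJet m f) (idxOf J) X Z‖ₑ ≤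
        ofReal (c * Λ ^ m * (Ω.rho X ^ (1 - (n : ℝ)) * ((Ω.rho X)⁻¹) ^ J.length)) *
          ∑ δ ∈ mlt n m, ofReal (Ω.rho X ^ (∑ i, δ i)) *
            ∫⁻ Y in closedBall X (2 * Ω.rho X), ‖remJ m f δ Z Y‖ₑ ∂Ω.surf := by
  obtain ⟨c, hc0, hc⟩ := hK.exists_integral_taylor (l := l) N m
  refine ⟨c, hc0, fun f hf hfi => ?_⟩
  obtain ⟨e1, e2⟩ := hc id (truncJet m f) measurable_id (fun Y hY => hY) hfi (truncJet_eq_zero m f)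
  refine ⟨e1, fun X hX J hJ => e2 2 one_le_two X hX (fun _ _ h => h) J hJ,
    fun Λ hΛ X hX Z hZ hXZ J hJ => ?_⟩
  obtain ⟨e3, e4⟩ := hc (fun _ => Z) (fun γ Y => remJ m f γ Z Y) measurable_const (fun _ _ => hZ)
    (fun γ => integrable_remJ hf hfi γ hZ) (fun γ hγ => by funext Y; exact remJ_eq_zero hγ Z Y)
  have ht : ContDiff ℝ ∞ fun X => taylor m (truncJet m f) 0 X Z := contDiff_taylor 0 Z
  have h1 := pdW_congr Ω.isOpen (f := whit Ω K m f) (g := (fun X => taylor m (truncJet m f) 0 X Z) -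
    fun X => ∫ Y, K X Y • taylor m (fun γ _ => remJ m f γ Z Y) 0 X Z ∂Ω.surf)
    (fun X hX => whit_eq hK hf hfi hZ hX) J hX
  rw [h1, pdW_sub Ω.isOpen ht.contDiffOn e3 J hX, Pi.sub_apply,
    pdW_taylor (truncJet_eq_zero m f), sub_sub_cancel_left, enorm_neg]
  exact e4 Λ hΛ X hX (fun _ _ _ => hXZ) J hJ

theorem Chart.exists_whit_rpow_le (χ : Ω.Chart) (hK : IsWhitneyKernel Ω K) (l m N : ℕ) {P : ℝ}
    (hP : 1 < P) : ∃ C : ℝ, 0 ≤ C ∧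
    ∀ f : Jet n l, (∀ γ, Measurable (f γ)) →
      (∀ γ, Integrable (truncJet m f γ) Ω.surf) → ∀ J : List (Fin n), J.length ≤ N →
      ∀ Z t z, Z ∈ Ω.bdry → dist Z χ.c < χ.r → 0 < t → t < χ.r → ‖z‖ < χ.κ →
      ‖pdW J (whit Ω K m f) (χ.map (Z, t, z)) -
        taylor m (truncJet m f) (idxOf J) (χ.map (Z, t, z)) Z‖ₑ ^ P ≤ ofReal C *
        ∑ δ ∈ mlt n m, ofReal (t ^ (P * ((∑ i, δ i : ℕ) - J.length) + 1 - n)) *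
          ∫⁻ Y in ball Z (7 * t), ‖remJ m f δ Z Y‖ₑ ^ P ∂Ω.surf := by
  obtain ⟨c, hc0, hc⟩ := exists_whit_bound hK l m N
  obtain ⟨A, hA0, hA⟩ := Ω.exists_surf_ball_le
  have hκ := χ.cone.κ_pos
  have hκ1 := χ.cone.κ_le
  have hn := Ω.two_le
  have hP0 : 0 < P := by linarith
  obtain ⟨Λ, hΛd⟩ : ∃ Λ, Λ = 2 / χ.κ := ⟨_, rfl⟩
  have hΛ : 1 ≤ Λ := by rw [hΛd, le_div_iff₀ hκ]; linarith
  have hΛ0 : 0 < Λ := by linarith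
  obtain ⟨B, hB⟩ : ∃ B, B = c * Λ ^ m * Λ ^ ((n + N + m : ℕ) : ℝ) := ⟨_, rfl⟩
  have hB0 : 0 ≤ B := by rw [hB]; positivity
  refine ⟨(mlt n m).card ^ (P - 1) * (B ^ P * (A * 7 ^ (n - 1)) ^ (P - 1)), by positivity,
    fun f hf hfi J hJ Z t z hZ hZc ht htr hz => ?_⟩
  obtain ⟨h1, -, h3, h4, h5⟩ := χ.mem_ball_map hZ hZc ht htr hz.le
  obtain ⟨X, hXd⟩ : ∃ X, X = χ.map (Z, t, z) := ⟨_, rfl⟩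
  rw [← hXd]
  change X = Z + t • (χ.v + z) at hXd
  rw [← hXd] at h1 h3 h4 h5
  have hρ := Ω.rho_pos h1
  set ρ := Ω.rho X with hρd
  have hXZ : ‖X - Z‖ ≤ Λ * ρ := by
    rw [← dist_eq_norm, hΛd, div_mul_eq_mul_div, le_div_iff₀ hκ]; nlinarith
  have hmain := (hc f hf hfi).2.2 Λ hΛ X h1 Z hZ hXZ J hJ
  have hterm : ∀ δ ∈ mlt n m, (ofReal (c * Λ ^ m * (ρ ^ (1 - (n : ℝ)) * ρ⁻¹ ^ J.length)) *
    (ofReal (ρ ^ (∑ i, δ i)) * ∫⁻ Y in closedBall X (2 * ρ), ‖remJ m f δ Z Y‖ₑ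
      ∂Ω.surf)) ^ P ≤ ofReal (B ^ P * (A * 7 ^ (n - 1)) ^ (P - 1)) *
    (ofReal (t ^ (P * ((∑ i, δ i : ℕ) - J.length) + 1 - n)) *
      ∫⁻ Y in ball Z (7 * t), ‖remJ m f δ Z Y‖ₑ ^ P ∂Ω.surf) := by
    intro δ hδ
    have hδm := mem_mlt.1 hδ
    set d := ∑ i, δ i
    obtain ⟨e, he⟩ : ∃ e : ℝ, e = 1 - n - J.length + d := ⟨_, rfl⟩
    have e1 : c * Λ ^ m * (ρ ^ (1 - (n : ℝ)) * ρ⁻¹ ^ J.length) * ρ ^ d = c * Λ ^ m * ρ ^ e := by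
      rw [he, rpow_add hρ, rpow_sub hρ (1 - n) J.length, rpow_natCast, rpow_natCast, inv_pow]; ring
    have e2 : ρ ^ e ≤ Λ ^ ((n + N + m : ℕ) : ℝ) * t ^ e := by
      refine (rpow_le_of_comparable (K := Λ) e ht hρ ?_ ?_).trans ?_
      · refine h5.trans ?_
        rw [hΛd, div_mul_eq_mul_div, le_div_iff₀ hκ]; nlinarith
      · rw [hΛd, div_mul_eq_mul_div, le_div_iff₀ hκ]; linarith
      · refine mul_le_mul_of_nonneg_right (Real.rpow_le_rpow_of_exponent_le hΛ ?_) (by positivity)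
        have hJ' : (J.length : ℝ) ≤ N := by exact_mod_cast hJ
        have hd' : (d : ℝ) ≤ m := by exact_mod_cast hδm.le
        have hn' : (2 : ℝ) ≤ n := by exact_mod_cast hn
        have : (0 : ℝ) ≤ J.length := by positivity
        have : (0 : ℝ) ≤ d := by positivity
        have : (0 : ℝ) ≤ N := by positivity
        have : (0 : ℝ) ≤ m := by positivity
        push_cast; rw [abs_le]
        constructor <;> linarith
    have e3 : (∫⁻ Y in closedBall X (2 * ρ), ‖remJ m f δ Z Y‖ₑ ∂Ω.surf) ^ P ≤
      ofReal ((A * (7 * t) ^ (n - 1)) ^ (P - 1)) *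
        ∫⁻ Y in ball Z (7 * t), ‖remJ m f δ Z Y‖ₑ ^ P ∂Ω.surf := by
      have i1 : closedBall X (2 * ρ) ⊆ ball Z (7 * t) := by
        intro Y hY
        rw [mem_closedBall] at hY; rw [mem_ball]; linarith [dist_triangle Y X Z]
      have i2 : Measurable fun Y => ‖remJ m f δ Z Y‖ₑ :=
        ((measurable_remJ hf δ).comp (measurable_prodMk_left (x := Z))).enorm
      refine (rpow_le_rpow (lintegral_mono_set i1) hP0.le).trans
        ((lintegral_rpow_le hP i2.aemeasurable).trans ?_)
      rw [Measure.restrict_apply_univ, ← ofReal_rpow_of_nonneg (by positivity) (by linarith)]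
      exact mul_le_mul_left (rpow_le_rpow (hA Z _ (by positivity)) (by linarith)) _
    rw [← mul_assoc, ← ofReal_mul (by positivity), e1, mul_rpow_of_nonneg _ _ hP0.le]
    have e4 : ofReal (c * Λ ^ m * ρ ^ e) ^ P ≤ ofReal (B ^ P * t ^ (e * P)) := by
      rw [ofReal_rpow_of_nonneg (by positivity) hP0.le]
      refine ofReal_le_ofReal ?_
      rw [rpow_mul ht.le, ← mul_rpow hB0 (by positivity)]
      refine Real.rpow_le_rpow (by positivity) ?_ hP0.le
      rw [hB, mul_assoc (c * Λ ^ m)]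
      exact mul_le_mul_of_nonneg_left e2 (by positivity)
    refine (mul_le_mul' e4 e3).trans (le_of_eq ?_)
    rw [← mul_assoc, ← mul_assoc, ← ofReal_mul (by positivity), ← ofReal_mul (by positivity)]
    congr 2
    have e5 : t ^ (P * ((d : ℝ) - J.length) + 1 - n) = t ^ (e * P) * (t ^ (n - 1)) ^ (P - 1) := by
      rw [← rpow_natCast t (n - 1), ← rpow_mul ht.le, ← rpow_add ht, Nat.cast_sub (by omega), he]
      congr 1; push_cast; ring
    rw [e5, mul_pow, ← mul_assoc A, mul_rpow (x := A * 7 ^ (n - 1)) (by positivity) (by positivity)]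
    ring
  refine (rpow_le_rpow hmain hP0.le).trans ?_
  rw [mul_sum]
  refine (rpow_sum_le_const_mul_sum_rpow _ _ hP.le).trans ?_
  refine (mul_le_mul_right (sum_le_sum hterm) _).trans (le_of_eq ?_)
  rw [← mul_sum, ofReal_mul (p := ((mlt n m).card : ℝ) ^ (P - 1)) (by positivity),
    ← ofReal_rpow_of_nonneg (Nat.cast_nonneg _) (by linarith), ENNReal.ofReal_natCast,
    mul_assoc]

theorem measurable_indicator_ball {G : Rn n → Rn n → ℝ≥0∞}
    (hG : Measurable fun q : Rn n × Rn n => G q.1 q.2) (c : ℝ) :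
    Measurable fun q : (Rn n × ℝ) × Rn n => (ball q.1.1 (c * q.1.2)).indicator (G q.1.1) q.2 := by
  have h0 : Measurable fun q : (Rn n × ℝ) × Rn n => (q.1.1, q.2) := by fun_prop
  have h1 : Measurable fun q : (Rn n × ℝ) × Rn n => G q.1.1 q.2 := hG.comp h0
  have h2 : Measurable fun q : (Rn n × ℝ) × Rn n => dist q.2 q.1.1 := by fun_prop
  have h3 : Measurable fun q : (Rn n × ℝ) × Rn n => c * q.1.2 := by fun_prop
  exact h1.indicator (measurableSet_lt h2 h3)

theorem Chart.lintegral_coneM_ball_le (χ : Ω.Chart) {G : Rn n → Rn n → ℝ≥0∞}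
    (hG : Measurable fun q : Rn n × Rn n => G q.1 q.2) (hG0 : ∀ Z, G Z Z = 0) {e : ℝ} (he : e < -1) :
    ∫⁻ q, ofReal (q.2.1 ^ e) * (∫⁻ Y in ball q.1 (7 * q.2.1), G q.1 Y ∂Ω.surf)
      ∂χ.coneM ≤ ofReal (7⁻¹ ^ (e + 1) / (-(e + 1))) * volume (ball (0 : Rn n) χ.κ) *
        ∫⁻ Z, (∫⁻ Y, ofReal (dist Z Y ^ (e + 1)) * G Z Y ∂Ω.surf) ∂Ω.surf := by
  have hV : volume (ball (0 : Rn n) χ.κ) ≠ ⊤ := measure_ball_lt_top.ne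
  have hm := measurable_indicator_ball hG 7
  have hm1 : Measurable fun q : Rn n × ℝ => ∫⁻ Y in ball q.1 (7 * q.2), G q.1 Y ∂Ω.surf := by
    have h1 := hm.lintegral_prod_right' (ν := Ω.surf)
    convert! h1 using 2 with q
    rw [← lintegral_indicator measurableSet_ball]
  have hm2 : Measurable fun q : Rn n × ℝ × Rn n => ofReal (q.2.1 ^ e) *
    (∫⁻ Y in ball q.1 (7 * q.2.1), G q.1 Y ∂Ω.surf) := by
    have h0 : Measurable fun q : Rn n × ℝ × Rn n => (q.1, q.2.1) := by fun_prop
    have h3 := hm1.comp h0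
    exact Measurable.mul (by fun_prop) h3
  rw [χ.lintegral_coneM hm2, mul_assoc, mul_left_comm, ← mul_assoc (volume _)]
  have h7 : ∀ Z, (∫⁻ t in Ioo 0 χ.r, ofReal (t ^ e) *
    (∫⁻ Y in ball Z (7 * t), G Z Y ∂Ω.surf)) ≤ ofReal (7⁻¹ ^ (e + 1) / (-(e + 1))) *
      ∫⁻ Y, ofReal (dist Z Y ^ (e + 1)) * G Z Y ∂Ω.surf := by
    intro Z
    have hmZ : Measurable fun q : ℝ × Rn n => ofReal (q.1 ^ e) *
      (ball Z (7 * q.1)).indicator (G Z) q.2 := by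
      have h0 : Measurable fun q : ℝ × Rn n => ((Z, q.1), q.2) := by fun_prop
      have h1 := hm.comp h0
      exact Measurable.mul (by fun_prop) h1
    calc _ = ∫⁻ t in Ioo 0 χ.r, (∫⁻ Y, ofReal (t ^ e) *
          (ball Z (7 * t)).indicator (G Z) Y ∂Ω.surf) := by
          refine lintegral_congr fun t => ?_
          rw [lintegral_ofReal_mul, lintegral_indicator measurableSet_ball]
      _ = ∫⁻ Y, (∫⁻ t in Ioo 0 χ.r, ofReal (t ^ e) * (ball Z (7 * t)).indicator (G Z) Y) ∂Ω.surf :=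
        lintegral_lintegral_swap hmZ.aemeasurable
      _ ≤ ∫⁻ Y, ofReal (7⁻¹ ^ (e + 1) / (-(e + 1))) *
        (ofReal (dist Z Y ^ (e + 1)) * G Z Y) ∂Ω.surf := by
        refine lintegral_mono fun Y => ?_
        dsimp only
        rcases eq_or_lt_of_le (dist_nonneg (x := Z) (y := Y)) with h0 | h0
        · have hZY : Z = Y := dist_eq_zero.1 h0.symm
          subst hZY
          refine (le_of_eq (lintegral_eq_zero_of_ae_eq_zero (.of_forall fun t => ?_))).trans bot_le
          simp [indicator, hG0]
        · calc _ ≤ ∫⁻ t in Ioo (dist Z Y * 7⁻¹) χ.r, ofReal (t ^ e) * G Z Y := by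
                rw [← lintegral_indicator measurableSet_Ioo, ← lintegral_indicator measurableSet_Ioo]
                refine lintegral_mono fun t => ?_
                by_cases ht : t ∈ Ioo 0 χ.r ∧ Y ∈ ball Z (7 * t)
                · rw [indicator_of_mem ht.1, indicator_of_mem ht.2, indicator_of_mem]
                  have := mem_ball.1 ht.2
                  rw [dist_comm] at this
                  exact ⟨by linarith, ht.1.2⟩
                · refine le_trans (le_of_eq ?_) bot_le
                  by_cases h1 : t ∈ Ioo 0 χ.r
                  · rw [indicator_of_mem h1, indicator_of_notMem fun h2 => ht ⟨h1, h2⟩, mul_zero]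
                    rfl
                  · rw [indicator_of_notMem h1]; rfl
            _ ≤ ofReal ((dist Z Y * 7⁻¹) ^ (e + 1) / (-(e + 1))) * G Z Y := by
              rw [lintegral_mul_const _ (measurable_ofReal_rpow e)]
              exact mul_le_mul_left (lintegral_rpow_Ioo_le he (by positivity)) _
            _ = _ := by
              rw [← mul_assoc, ← ofReal_mul
                (div_nonneg (by positivity) (by linarith)), mul_rpow h0.le (by positivity)]
              congr 2
              ring
      _ = _ := lintegral_ofReal_mul
  calc _ ≤ ∫⁻ Z, volume (ball (0 : Rn n) χ.κ) * (ofReal (7⁻¹ ^ (e + 1) / (-(e + 1))) *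
        ∫⁻ Y, ofReal (dist Z Y ^ (e + 1)) * G Z Y ∂Ω.surf) ∂Ω.surf := by
        refine (setLIntegral_le_lintegral _ _).trans (lintegral_mono fun Z => ?_)
        dsimp only
        simp_rw [setLIntegral_const]
        rw [lintegral_mul_const' _ _ hV, mul_comm]
        exact mul_le_mul_right (h7 Z) _
    _ = _ := by rw [lintegral_const_mul' _ _ hV, lintegral_ofReal_mul]; ring

end LipDomain

/-- The `P`-th powers of the Besov seminorms of a family. -/
def besN {n l : ℕ} (Ω : LipDomain n) (P a : ℝ) (m : ℕ) (f : Jet n l) : ℝ≥0∞ :=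
  ∑ δ ∈ mlt n m, ∫⁻ Z, (∫⁻ Y, ofReal (dist Z Y ^ (jetExp P a m δ + 2 - n)) *
    ‖remJ m f δ Z Y‖ₑ ^ P ∂Ω.surf) ∂Ω.surf

/-- The `P`-th powers of the `L_P`-norms of a family. -/
def lpN {n l : ℕ} (Ω : LipDomain n) (P : ℝ) (m : ℕ) (f : Jet n l) : ℝ≥0∞ :=
  ∑ δ ∈ mlt n m, ∫⁻ Z, ‖f δ Z‖ₑ ^ P ∂Ω.surf

namespace LipDomain

variable {n l : ℕ} {Ω : LipDomain n} {K : Rn n → Rn n → ℂ}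

theorem Chart.exists_whit_cone_le (χ : Ω.Chart) (hK : IsWhitneyKernel Ω K) (l m N : ℕ) {P a : ℝ}
    (hP : 1 < P) (ha : a < 1 - 1 / P) : ∃ C : ℝ, 0 ≤ C ∧
    ∀ f : Jet n l, (∀ γ, Measurable (f γ)) →
      (∀ γ, Integrable (truncJet m f γ) Ω.surf) → ∀ J : List (Fin n), J.length ≤ N →
      ∫⁻ q, ofReal (q.2.1 ^ (P * a - P + P * (J.length - (m - 1)))) *
        ‖pdW J (whit Ω K m f) (χ.map q) - taylor m (truncJet m f) (idxOf J) (χ.map q) q.1‖ₑ ^ P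
          ∂χ.coneM ≤ ofReal C * besN Ω P a m f := by
  obtain ⟨C, hC0, hC⟩ := χ.exists_whit_rpow_le hK l m N hP
  have hn : (2 : ℝ) ≤ n := by exact_mod_cast Ω.two_le
  have hP0 : 0 < P := by linarith
  have he : ∀ δ : Fin n → ℕ, jetExp P a m δ + 1 - n < -1 := fun δ => by
    linarith [jetExp_lt hP ha m δ]
  obtain ⟨V, hV⟩ : ∃ V, V = (volume (ball (0 : Rn n) χ.κ)).toReal := ⟨_, rfl⟩
  have hV' : volume (ball (0 : Rn n) χ.κ) = ofReal V := by
    rw [hV, ofReal_toReal measure_ball_lt_top.ne]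
  have hV0 : 0 ≤ V := by rw [hV]; positivity
  obtain ⟨D, hD⟩ : ∃ D : (Fin n → ℕ) → ℝ, D = fun δ =>
    7⁻¹ ^ (jetExp P a m δ + 1 - n + 1) / (-(jetExp P a m δ + 1 - n + 1)) * V := ⟨_, rfl⟩
  have hD0 : ∀ δ, 0 ≤ D δ := fun δ => by
    rw [hD]
    exact mul_nonneg (div_nonneg (by positivity) (by linarith [he δ])) hV0
  refine ⟨C * ∑ δ ∈ mlt n m, D δ, mul_nonneg hC0 (sum_nonneg fun δ _ => hD0 δ),
    fun f hf hfi J hJ => ?_⟩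
  have hG : ∀ δ, Measurable fun q : Rn n × Rn n => ‖remJ m f δ q.1 q.2‖ₑ ^ P := fun δ =>
    (measurable_remJ hf δ).enorm.pow_const P
  have hG0 : ∀ δ ∈ mlt n m, ∀ Z, ‖remJ m f δ Z Z‖ₑ ^ P = 0 := fun δ hδ Z => by
    rw [remJ, taylor_self (by have := mem_mlt.1 hδ; omega), sub_self, enorm_zero,
      zero_rpow_of_pos hP0]
  have h1 := fun δ (hδ : δ ∈ mlt n m) => χ.lintegral_coneM_ball_le
    (G := fun Z Y => ‖remJ m f δ Z Y‖ₑ ^ P) (hG δ) (hG0 δ hδ) (he δ)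
  have hmt : ∀ δ, AEMeasurable (fun q : Rn n × ℝ × Rn n =>
    ofReal (q.2.1 ^ (jetExp P a m δ + 1 - n)) *
      (∫⁻ Y in ball q.1 (7 * q.2.1), ‖remJ m f δ q.1 Y‖ₑ ^ P ∂Ω.surf)) χ.coneM := by
    intro δ
    have h3 := (measurable_indicator_ball (G := fun Z Y => ‖remJ m f δ Z Y‖ₑ ^ P) (hG δ) 7).lintegral_prod_right' (ν := Ω.surf)
    have h0 : Measurable fun q : Rn n × ℝ × Rn n => (q.1, q.2.1) := by fun_prop
    have h4 := h3.comp h0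
    have h5 : Measurable fun q : Rn n × ℝ × Rn n => q.2.1 := by fun_prop
    have h6 := (measurable_ofReal_rpow (jetExp P a m δ + 1 - n)).comp h5
    refine Measurable.aemeasurable ?_
    convert! h6.mul h4 using 2 with q
    rw [Pi.mul_apply, Function.comp_apply, Function.comp_apply,
      ← lintegral_indicator measurableSet_ball]
  calc _ ≤ ∫⁻ q, ofReal C * ∑ δ ∈ mlt n m,
        ofReal (q.2.1 ^ (jetExp P a m δ + 1 - n)) *
          (∫⁻ Y in ball q.1 (7 * q.2.1), ‖remJ m f δ q.1 Y‖ₑ ^ P ∂Ω.surf) ∂χ.coneM := by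
        refine lintegral_mono_ae ?_
        filter_upwards [χ.ae_coneM] with q ⟨hZ, hZc, ht, htr, hz⟩
        obtain ⟨Z, t, z⟩ := q
        refine (mul_le_mul_right (hC f hf hfi J hJ Z t z hZ hZc ht htr hz) _).trans (le_of_eq ?_)
        rw [mul_left_comm, mul_sum]; congr 1
        refine sum_congr rfl fun δ hδ => ?_
        rw [← mul_assoc, ← ofReal_mul (rpow_nonneg ht.le _), ← rpow_add ht]
        congr 3
        have := mem_mlt.1 hδ
        rw [jetExp, Nat.cast_sub (by omega), Nat.cast_sub (by omega)]; push_cast; ring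
    _ = ofReal C * ∑ δ ∈ mlt n m, ∫⁻ q, ofReal (q.2.1 ^ (jetExp P a m δ + 1 - n)) *
      (∫⁻ Y in ball q.1 (7 * q.2.1), ‖remJ m f δ q.1 Y‖ₑ ^ P ∂Ω.surf) ∂χ.coneM := by
      rw [lintegral_ofReal_mul, lintegral_finsetSum' _ fun δ _ => hmt δ]
    _ ≤ ofReal C * ∑ δ ∈ mlt n m, ofReal (∑ δ ∈ mlt n m, D δ) *
      ∫⁻ Z, (∫⁻ Y, ofReal (dist Z Y ^ (jetExp P a m δ + 2 - n)) *
        ‖remJ m f δ Z Y‖ₑ ^ P ∂Ω.surf) ∂Ω.surf := by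
      refine mul_le_mul_right (sum_le_sum fun δ hδ => (h1 δ hδ).trans ?_) _
      have e1 : jetExp P a m δ + 1 - n + 1 = jetExp P a m δ + 2 - n := by ring
      rw [hV', ← ofReal_mul (div_nonneg (by positivity) (by linarith [he δ]))]
      simp only [e1]
      refine mul_le_mul_left (ofReal_le_ofReal ?_) _
      refine le_trans (le_of_eq ?_) (single_le_sum (f := D) (fun δ _ => hD0 δ) hδ)
      simp only [hD, e1]
    _ = _ := by rw [← mul_sum, ofReal_mul hC0, mul_assoc, besN]

/-- `∑_β |f_{γ + β}(Z)|`. -/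
def jetSum (m : ℕ) (f : Jet n l) (γ : Fin n → ℕ) (Z : Rn n) : ℝ≥0∞ :=
  ∑ β ∈ mlt n m, ‖truncJet m f (γ + β) Z‖ₑ

theorem lintegral_jetSum_le {P : ℝ} (hP : 1 ≤ P) {m : ℕ} {f : Jet n l}
    (hf : ∀ γ, Measurable (f γ)) (γ : Fin n → ℕ) :
    ∫⁻ Z, jetSum m f γ Z ^ P ∂Ω.surf ≤ ((mlt n m).card : ℝ≥0∞) ^ P * lpN Ω P m f := by
  have hP0 : 0 < P := by linarith
  calc _ ≤ ∫⁻ Z, ((mlt n m).card : ℝ≥0∞) ^ (P - 1) *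
        ∑ β ∈ mlt n m, ‖truncJet m f (γ + β) Z‖ₑ ^ P ∂Ω.surf :=
        lintegral_mono fun Z => rpow_sum_le_const_mul_sum_rpow _ _ hP
    _ ≤ ((mlt n m).card : ℝ≥0∞) ^ (P - 1) * ((mlt n m).card * lpN Ω P m f) := by
      rw [lintegral_const_mul' _ _ (rpow_ne_top_of_nonneg (by linarith) (by simp)),
        lintegral_finsetSum _ fun β _ => (measurable_truncJet hf _).enorm.pow_const P, ← nsmul_eq_mul]
      exact mul_le_mul_right (sum_le_card_nsmul _ _ _ fun β _ => lintegral_truncJet_le hP0 f (γ + β)) _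
    _ = _ := by
      rw [← mul_assoc]; congr 1
      rcases Nat.eq_zero_or_pos (mlt n m).card with h | h
      · rw [h]; simp [hP0]
      · rw [show P = P - 1 + 1 by ring, ENNReal.rpow_add _ _ (by exact_mod_cast h.ne') (by simp)]
        simp

theorem enorm_taylor_le {m : ℕ} {f : Jet n l} (γ : Fin n → ℕ) {X Z : Rn n} {R : ℝ}
    (hR : 1 ≤ R) (hXZ : ‖X - Z‖ ≤ R) :
    ‖taylor m (truncJet m f) γ X Z‖ₑ ≤ ofReal (R ^ m) * jetSum m f γ Z := by
  rw [jetSum, mul_sum]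
  refine (enorm_sum_le _ _).trans (sum_le_sum fun β hβ => ?_)
  rw [enorm_smul, enorm_eq_ofReal_abs]
  refine mul_le_mul_left (ofReal_le_ofReal ((abs_dpow_le _ _).trans ?_)) _
  exact (pow_le_pow_left₀ (norm_nonneg _) hXZ _).trans (pow_le_pow_right₀ hR (mem_mlt.1 hβ).le)

theorem enorm_taylor_sub_self_le {m : ℕ} (hm : 0 < m) {f : Jet n l}
    (γ : Fin n → ℕ) {X Z : Rn n} {R t : ℝ} (hR : 1 ≤ R) (ht : t ≤ R) (hXZ : ‖X - Z‖ ≤ t) :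
    ‖truncJet m f γ Z - taylor m (truncJet m f) γ X Z‖ₑ ≤ ofReal (t * R ^ m) * jetSum m f γ Z := by
  have h0 : (0 : Fin n → ℕ) ∈ mlt n m := mem_mlt.2 (by simpa using hm)
  have ht0 : 0 ≤ t := (norm_nonneg _).trans hXZ
  rw [taylor, ← Finset.add_sum_erase _ _ h0, dpow_zero, one_smul, add_zero, sub_add_cancel_left,
    enorm_neg]
  refine (enorm_sum_le _ _).trans ?_
  rw [jetSum, mul_sum]
  refine (sum_le_sum fun β hβ => ?_).trans (Finset.sum_le_sum_of_subset (Finset.erase_subset 0 _))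
  obtain ⟨hβ0, hβ⟩ := Finset.mem_erase.1 hβ
  obtain ⟨b, hb⟩ : ∃ b, ∑ i, β i = b + 1 := by
    refine Nat.exists_eq_succ_of_ne_zero fun h => hβ0 ?_
    funext i
    exact Finset.sum_eq_zero_iff.1 h i (Finset.mem_univ i)
  rw [enorm_smul, enorm_eq_ofReal_abs]
  refine mul_le_mul_left (ofReal_le_ofReal ((abs_dpow_le _ _).trans ?_)) _
  rw [hb, pow_succ']
  have := mem_mlt.1 hβ
  refine mul_le_mul hXZ ?_ (by positivity) ht0
  exact (pow_le_pow_left₀ (norm_nonneg _) (hXZ.trans ht) _).trans (pow_le_pow_right₀ hR (by omega))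

theorem Chart.exists_jetSum_cone_le (χ : Ω.Chart) (l m : ℕ) {P b : ℝ} (hP : 1 ≤ P) (hb : -1 < b) :
    ∃ C : ℝ, 0 ≤ C ∧ ∀ f : Jet n l, (∀ γ, Measurable (f γ)) → ∀ γ,
      ∫⁻ q, ofReal (q.2.1 ^ b) * jetSum m f γ q.1 ^ P ∂χ.coneM ≤ ofReal C * lpN Ω P m f := by
  have hr := χ.cone.r_pos
  have hb1 : 0 < b + 1 := by linarith
  refine ⟨χ.r ^ (b + 1) / (b + 1) * (volume (ball (0 : Rn n) χ.κ)).toReal *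
    (mlt n m).card ^ P, by positivity, fun f hf γ => ?_⟩
  have hm : Measurable fun Z => jetSum m f γ Z ^ P :=
    (Finset.measurable_fun_sum _ fun β _ => (measurable_truncJet hf (γ + β)).enorm).pow_const P
  rw [χ.lintegral_fst_mul (G := fun t => ofReal (t ^ b)) hm.aemeasurable
    (measurable_ofReal_rpow b), lintegral_rpow_Ioo hb hr.le,
    ofReal_mul (by positivity), ofReal_mul (by positivity),
    ofReal_toReal measure_ball_lt_top.ne,
    ← ofReal_rpow_of_nonneg (Nat.cast_nonneg _) (by linarith), ENNReal.ofReal_natCast,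
    mul_assoc (_ * volume _)]
  exact mul_le_mul_right ((setLIntegral_le_lintegral _ _).trans (lintegral_jetSum_le hP hf γ)) _

theorem Chart.exists_whit_near_le (χ : Ω.Chart) (hK : IsWhitneyKernel Ω K) (l : ℕ) {m : ℕ}
    (hm : 0 < m) {P a : ℝ} (hP : 1 < P) (ha' : -1 / P < a) (ha : a < 1 - 1 / P) :
    ∃ C : ℝ, 0 ≤ C ∧
    ∀ f : Jet n l, (∀ γ, Measurable (f γ)) →
      (∀ γ, Integrable (truncJet m f γ) Ω.surf) → ∀ J : List (Fin n), J.length ≤ m →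
      ∫⁻ q, ofReal (q.2.1 ^ (P * a)) * ‖pdW J (whit Ω K m f) (χ.map q)‖ₑ ^ P ∂χ.coneM ≤
        ofReal C * (besN Ω P a m f + lpN Ω P m f) ∧
      (J.length < m → ∫⁻ q, ofReal (q.2.1 ^ (P * a - P)) *
        ‖truncJet m f (idxOf J) q.1 - pdW J (whit Ω K m f) (χ.map q)‖ₑ ^ P ∂χ.coneM ≤
        ofReal C * (besN Ω P a m f + lpN Ω P m f)) := by
  have hP0 : 0 < P := by linarith
  have hPa : -1 < P * a := neg_one_lt_mul (by positivity) ha'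
  obtain ⟨C₁, hC₁, h1⟩ := χ.exists_whit_cone_le hK l m m hP ha
  obtain ⟨C₂, hC₂, h2⟩ := χ.exists_jetSum_cone_le l m hP.le hPa
  have hr := χ.cone.r_pos
  obtain ⟨R, hR⟩ : ∃ R, R = 2 * χ.r + 1 := ⟨_, rfl⟩
  have hR1 : 1 ≤ R := by linarith
  obtain ⟨M, hM⟩ : ∃ M, M = R ^ (P * m) + (R ^ m) ^ P + (2 * R ^ m) ^ P := ⟨_, rfl⟩
  have hM1 : R ^ (P * m) ≤ M := by
    rw [hM, add_assoc]
    exact le_add_of_nonneg_right (by positivity)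
  have hM2 : (R ^ m) ^ P ≤ M := by
    rw [hM, add_right_comm]
    exact le_add_of_nonneg_left (by positivity)
  have hM3 : (2 * R ^ m) ^ P ≤ M := by
    rw [hM]
    exact le_add_of_nonneg_left (by positivity)
  have hM0 : 0 ≤ M := by rw [hM]; positivity
  refine ⟨2 ^ (P - 1) * M * (C₁ + C₂), by positivity, fun f hf hfi J hJ => ?_⟩
  have hJm : (J.length : ℝ) ≤ m := by exact_mod_cast hJ
  obtain ⟨D, hD⟩ : ∃ D : Rn n × ℝ × Rn n → Cl l, D = fun q => pdW J (whit Ω K m f) (χ.map q) -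
    taylor m (truncJet m f) (idxOf J) (χ.map q) q.1 := ⟨_, rfl⟩
  obtain ⟨E, hE⟩ : ∃ E, E = P * a - P + P * (J.length - (m - 1)) := ⟨_, rfl⟩
  have hDE : ∫⁻ q, ofReal (q.2.1 ^ E) * ‖D q‖ₑ ^ P ∂χ.coneM ≤ ofReal C₁ * besN Ω P a m f := by
    rw [hD, hE]; exact h1 f hf hfi J hJ
  have key : ∀ H T : Rn n × ℝ × Rn n → Cl l, ∀ w : ℝ, E ≤ w → w ≤ E + P * m →
    (∀ᵐ q ∂χ.coneM, ofReal (q.2.1 ^ w) * ‖T q‖ₑ ^ P ≤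
      ofReal M * (ofReal (q.2.1 ^ (P * a)) * jetSum m f (idxOf J) q.1 ^ P)) →
    (∀ q, H q = D q + T q ∨ H q = - D q + T q) →
    ∫⁻ q, ofReal (q.2.1 ^ w) * ‖H q‖ₑ ^ P ∂χ.coneM ≤
      ofReal (2 ^ (P - 1) * M * (C₁ + C₂)) * (besN Ω P a m f + lpN Ω P m f) := by
    intro H T w hw0 hw1 hT hH
    have hjm : AEMeasurable (fun q : Rn n × ℝ × Rn n => ofReal M *
      (ofReal (q.2.1 ^ (P * a)) * jetSum m f (idxOf J) q.1 ^ P)) χ.coneM := by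
      have h7 : Measurable fun Z => jetSum m f (idxOf J) Z ^ P :=
        (Finset.measurable_fun_sum _ fun β _ =>
          (measurable_truncJet hf (idxOf J + β)).enorm).pow_const P
      exact ((Measurable.mul (by fun_prop) (h7.comp measurable_fst)).const_mul _).aemeasurable
    calc _ ≤ ∫⁻ q, ofReal (2 ^ (P - 1)) * (ofReal M * (ofReal (q.2.1 ^ E) * ‖D q‖ₑ ^ P) +
          ofReal M * (ofReal (q.2.1 ^ (P * a)) * jetSum m f (idxOf J) q.1 ^ P)) ∂χ.coneM := by
          refine lintegral_mono_ae ?_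
          filter_upwards [χ.ae_coneM, hT] with q ⟨hZ, hZc, ht, htr, hz⟩ hT
          have e1 : ‖H q‖ₑ ≤ ‖D q‖ₑ + ‖T q‖ₑ := by
            rcases hH q with h | h
            · rw [h]; exact enorm_add_le _ _
            · rw [h, ← enorm_neg (D q)]; exact enorm_add_le _ _
          have e2 := (rpow_le_rpow e1 hP0.le).trans (rpow_add_le_mul_rpow_add_rpow _ _ hP.le)
          refine (mul_le_mul_right e2 _).trans ?_
          rw [← ofReal_rpow_of_pos two_pos, ENNReal.ofReal_ofNat, mul_left_comm, mul_add]
          refine mul_le_mul_right (add_le_add ?_ hT) _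
          rw [← mul_assoc, ← ofReal_mul hM0]
          refine mul_le_mul_left (ofReal_le_ofReal ?_) _
          rw [← sub_add_cancel w E, rpow_add ht]
          refine mul_le_mul_of_nonneg_right (le_trans ?_ hM1) (by positivity)
          exact (Real.rpow_le_rpow ht.le (by linarith) (by linarith)).trans
            (Real.rpow_le_rpow_of_exponent_le hR1 (by linarith))
      _ = ofReal (2 ^ (P - 1)) * (ofReal M * (∫⁻ q, ofReal (q.2.1 ^ E) * ‖D q‖ₑ ^ P ∂χ.coneM) +
        ofReal M * ∫⁻ q, ofReal (q.2.1 ^ (P * a)) * jetSum m f (idxOf J) q.1 ^ P ∂χ.coneM) := by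
        rw [lintegral_ofReal_mul, lintegral_add_right' _ hjm, lintegral_ofReal_mul,
          lintegral_ofReal_mul]
      _ ≤ ofReal (2 ^ (P - 1)) * (ofReal M * (ofReal C₁ * besN Ω P a m f) +
        ofReal M * (ofReal C₂ * lpN Ω P m f)) := by
        gcongr
        exact h2 f hf _
      _ ≤ ofReal (2 ^ (P - 1)) * (ofReal M * (ofReal (C₁ + C₂) *
        besN Ω P a m f) + ofReal M * (ofReal (C₁ + C₂) * lpN Ω P m f)) := by
        gcongr <;> linarith
      _ = _ := by
        rw [ofReal_mul (p := 2 ^ (P - 1) * M) (by positivity),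
          ofReal_mul (p := 2 ^ (P - 1)) (by positivity)]
        ring
  have hJ0 : 0 ≤ P * J.length := by positivity
  have hJP : P * J.length ≤ P * m := by gcongr
  refine ⟨key _ (fun q => taylor m (truncJet m f) (idxOf J) (χ.map q) q.1) (P * a) (by linarith)
    (by linarith) ?_ (fun q => Or.inl (by simp [hD])), fun hJ' => key _ (fun q =>
      truncJet m f (idxOf J) q.1 - taylor m (truncJet m f) (idxOf J) (χ.map q) q.1) (P * a - P) ?_
    (by linarith) ?_ (fun q => Or.inr (by simp only [hD]; abel))⟩
  · filter_upwards [χ.ae_coneM] with q ⟨hZ, hZc, ht, htr, hz⟩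
    have e1 := (χ.mem_ball_map hZ hZc ht htr hz.le).2.2.1
    have e2 := enorm_taylor_le (m := m) (f := f) (idxOf J) (X := χ.map q) (Z := q.1) hR1 (by
      rw [← dist_eq_norm]
      exact e1.trans (by linarith))
    rw [mul_left_comm]
    refine mul_le_mul_right ((rpow_le_rpow e2 hP0.le).trans ?_) _
    rw [mul_rpow_of_nonneg _ _ hP0.le, ofReal_rpow_of_nonneg (by positivity) hP0.le]
    exact mul_le_mul_left (ofReal_le_ofReal hM2) _
  · have hJ'' : (J.length : ℝ) + 1 ≤ m := by exact_mod_cast hJ'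
    nlinarith
  · filter_upwards [χ.ae_coneM] with q ⟨hZ, hZc, ht, htr, hz⟩
    have e1 := (χ.mem_ball_map hZ hZc ht htr hz.le).2.2.1
    have e2 := enorm_taylor_sub_self_le hm (f := f) (idxOf J) (X := χ.map q) (Z := q.1) hR1
      (t := 2 * q.2.1) (by linarith) (by
      rw [← dist_eq_norm]
      exact e1)
    refine (mul_le_mul_right (rpow_le_rpow e2 hP0.le) _).trans ?_
    rw [mul_rpow_of_nonneg _ _ hP0.le, ofReal_rpow_of_nonneg (by positivity) hP0.le,
      ← mul_assoc, ← mul_assoc, ← ofReal_mul (by positivity), ← ofReal_mul hM0]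
    refine mul_le_mul_left (ofReal_le_ofReal ?_) _
    rw [show 2 * q.2.1 * R ^ m = (2 * R ^ m) * q.2.1 by ring, mul_rpow (by positivity) ht.le,
      mul_left_comm, ← rpow_add ht, sub_add_cancel]
    exact mul_le_mul_of_nonneg_right hM3 (by positivity)

theorem exists_whit_far_le (hK : IsWhitneyKernel Ω K) (l m : ℕ) {P : ℝ} (hP : 1 < P) {δ : ℝ}
    (hδ : 0 < δ) : ∃ C : ℝ≥0∞, C ≠ ⊤ ∧
    ∀ f : Jet n l, (∀ γ, Measurable (f γ)) →
      (∀ γ, Integrable (truncJet m f γ) Ω.surf) → ∀ J : List (Fin n), J.length ≤ m →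
      ∀ X ∈ Ω.carrier, δ ≤ Ω.rho X → ‖pdW J (whit Ω K m f) X‖ₑ ^ P ≤ C * lpN Ω P m f := by
  obtain ⟨c, hc0, hc⟩ := exists_whit_bound hK l m m
  obtain ⟨D, hD0, hD⟩ := Ω.exists_rho_le
  have hP0 : 0 < P := by linarith
  obtain ⟨B, hB⟩ : ∃ B : ℝ, B = c * 2 ^ m * (δ ^ (1 - (n : ℝ)) * (δ⁻¹ + 1) ^ m) * (D + 1) ^ m :=
    ⟨_, rfl⟩
  have hσ : Ω.surf univ ^ (P - 1) ≠ ⊤ := rpow_ne_top_of_nonneg (by linarith) (measure_ne_top _ _)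
  refine ⟨ofReal B ^ P * (((mlt n m).card : ℝ≥0∞) ^ (P - 1) *
    ((mlt n m).card * Ω.surf univ ^ (P - 1))), ?_, fun f hf hfi J hJ X hX hXδ => ?_⟩
  · refine mul_ne_top (rpow_ne_top_of_nonneg hP0.le ofReal_ne_top)
      (mul_ne_top (rpow_ne_top_of_nonneg (by linarith) (by simp)) (mul_ne_top (by simp) hσ))
  have hρ := Ω.rho_pos hX
  have hρD := hD X (subset_closure hX)
  have hn : (2 : ℝ) ≤ n := by exact_mod_cast Ω.two_le
  have h1 : ‖pdW J (whit Ω K m f) X‖ₑ ≤ ofReal B *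
    ∑ δ ∈ mlt n m, ∫⁻ Y, ‖truncJet m f δ Y‖ₑ ∂Ω.surf := by
    refine ((hc f hf hfi).2.1 X hX J hJ).trans ?_
    rw [mul_sum, mul_sum]
    refine sum_le_sum fun γ hγ => ?_
    rw [← mul_assoc, ← ofReal_mul (by positivity)]
    refine mul_le_mul' (ofReal_le_ofReal ?_) (setLIntegral_le_lintegral _ _)
    have i1 : (Ω.rho X)⁻¹ ^ J.length ≤ (δ⁻¹ + 1) ^ m := by
      refine (pow_le_pow_left₀ (by positivity) (?_ : _ ≤ δ⁻¹ + 1) _).trans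
        (pow_le_pow_right₀ (by simp [hδ.le]) hJ)
      have := inv_anti₀ hδ hXδ
      linarith
    have i2 : Ω.rho X ^ (∑ i, γ i) ≤ (D + 1) ^ m :=
      (pow_le_pow_left₀ hρ.le (by linarith) _).trans
        (pow_le_pow_right₀ (by linarith) (mem_mlt.1 hγ).le)
    have i3 := Real.rpow_le_rpow_of_nonpos hδ hXδ (by linarith : 1 - (n : ℝ) ≤ 0)
    rw [hB]; gcongr
  refine (rpow_le_rpow h1 hP0.le).trans ?_
  rw [mul_rpow_of_nonneg _ _ hP0.le, mul_assoc, mul_assoc]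
  refine mul_le_mul_right ((rpow_sum_le_const_mul_sum_rpow _ _ hP.le).trans
    (mul_le_mul_right ?_ _)) _
  rw [mul_assoc, ← nsmul_eq_mul]
  refine sum_le_card_nsmul _ _ _ fun γ _ => ?_
  exact (lintegral_rpow_le hP (measurable_truncJet hf γ).enorm.aemeasurable).trans
    (mul_le_mul_right (lintegral_truncJet_le hP0 f γ) _)

/-- The extension operator is bounded. -/
theorem exists_whit_wMeas_le (hK : IsWhitneyKernel Ω K) (l : ℕ) {m : ℕ}
    (hm : 0 < m) {P a : ℝ} (hP : 1 < P) (ha' : -1 / P < a) (ha : a < 1 - 1 / P) :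
    ∃ C : ℝ≥0∞, C ≠ ⊤ ∧
    ∀ f : Jet n l, (∀ γ, Measurable (f γ)) →
      (∀ γ, Integrable (truncJet m f γ) Ω.surf) → ∀ J : List (Fin n), J.length ≤ m →
      ∫⁻ X, ‖pdW J (whit Ω K m f) X‖ₑ ^ P ∂Ω.wMeas (P * a) ≤
        C * (besN Ω P a m f + lpN Ω P m f) := by
  have hP0 : 0 < P := by linarith
  have hPa : -1 < P * a := neg_one_lt_mul (by positivity) ha'
  have := Ω.isFiniteMeasure_wMeas hPa
  obtain ⟨T, δ, hδ, hT⟩ := Ω.exists_lintegral_wMeas_le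
  choose C₁ hC₁ h1 using fun χ : Ω.Chart => χ.exists_whit_near_le hK l hm hP ha' ha
  choose C₂ hC₂ h2 using fun χ : Ω.Chart => χ.exists_le_lintegral_map (P * a)
  obtain ⟨C₃, hC₃, h3⟩ := exists_whit_far_le hK l m hP hδ
  refine ⟨∑ χ ∈ T, ofReal (C₂ χ) * ofReal (C₁ χ) + C₃ * Ω.wMeas (P * a) univ, ?_,
    fun f hf hfi J hJ => ?_⟩
  · exact add_ne_top.2 ⟨sum_ne_top.2 fun χ _ => mul_ne_top
      ofReal_ne_top ofReal_ne_top, mul_ne_top hC₃ (measure_ne_top _ _)⟩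
  set S := besN Ω P a m f + lpN Ω P m f
  classical
  obtain ⟨c₀, hc₀, hsm⟩ := exists_whit_bound hK l m m
  obtain ⟨F, hF⟩ : ∃ F : Rn n → ℝ≥0∞, F = Ω.carrier.indicator
    fun X => ‖pdW J (whit Ω K m f) X‖ₑ ^ P := ⟨_, rfl⟩
  have hFm : Measurable F := by
    have h4 : ContinuousOn (pdW J (whit Ω K m f)) Ω.carrier :=
      (contDiffOn_pdW Ω.isOpen (hsm f hf hfi).1 J).continuousOn
    have h5 := (h4.measurable_piecewise (continuousOn_const (c := (0 : Cl l)))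
      Ω.isOpen.measurableSet).enorm.pow_const P
    convert! h5 using 1
    funext X; rw [hF]
    by_cases hX : X ∈ Ω.carrier
    · simp [hX]
    · simp [hX, zero_rpow_of_pos hP0]
  have hFc : ∀ X ∈ Ω.carrier, F X = ‖pdW J (whit Ω K m f) X‖ₑ ^ P := fun X hX => by
    rw [hF, indicator_of_mem hX]
  calc _ = ∫⁻ X, F X ∂Ω.wMeas (P * a) := by
        refine lintegral_congr_ae ?_
        filter_upwards [Ω.ae_wMeas_mem (P * a)] with X hX
        rw [hFc X hX]
    _ ≤ ∑ χ ∈ T, (∫⁻ X in χ.inner, F X ∂Ω.wMeas (P * a)) +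
      ∫⁻ X in {X | δ ≤ Ω.rho X}, F X ∂Ω.wMeas (P * a) := hT _ F
    _ ≤ ∑ χ ∈ T, ofReal (C₂ χ) * ofReal (C₁ χ) * S + C₃ * S * Ω.wMeas (P * a) univ := by
      refine add_le_add (sum_le_sum fun χ _ => ?_) ?_
      · refine (h2 χ F hFm).trans ?_
        rw [mul_assoc]
        refine mul_le_mul_right (le_trans (le_of_eq ?_) (h1 χ f hf hfi J hJ).1) _
        refine lintegral_congr_ae ?_
        filter_upwards [χ.ae_coneM] with q ⟨hZ, hZc, ht, htr, hz⟩
        rw [hFc (χ.map q) (χ.mem_ball_map hZ hZc ht htr hz.le).1]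
      · rw [← lintegral_const]
        refine (lintegral_mono_ae ?_).trans (setLIntegral_le_lintegral _ _)
        filter_upwards [ae_restrict_of_ae (Ω.ae_wMeas_mem (P * a)), ae_restrict_mem
          (measurableSet_le measurable_const Ω.continuous_rho.measurable)] with X hX hXδ
        rw [hFc X hX]
        exact (h3 f hf hfi J hJ X hX hXδ).trans (mul_le_mul_right le_add_self _)
    _ = _ := by rw [← sum_mul]; ring

end LipDomain

section Affine

variable {n : ℕ}

theorem pdW_comp_affine {G : Rn n → ℂ} (hG : ContDiff ℝ ∞ G) (c : ℂ) (t : ℝ) (W : Rn n)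
    (J : List (Fin n)) : pdW J (fun X => c • G (t • (X - W))) =
      fun X => (c * (t : ℂ) ^ J.length) • pdW J G (t • (X - W)) := by
  induction J with
  | nil => simp [pdW]
  | cons j J ih =>
    funext X
    have h1 : HasFDerivAt (fun X : Rn n => t • (X - W)) (t • ContinuousLinearMap.id ℝ (Rn n)) X :=
      ((hasFDerivAt_id X).sub_const W).const_smul t
    have h2 := ((((contDiff_pdW hG J).differentiable (by simp)) (t • (X - W))).hasFDerivAt.comp X
      h1).const_smul (c * (t : ℂ) ^ J.length)
    change HasFDerivAt (fun X => (c * (t : ℂ) ^ J.length) • pdW J G (t • (X - W))) _ X at h2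
    simp only [pdW]; rw [ih, pd, h2.fderiv]; simp [pd, pow_succ]
    ring

theorem exists_norm_pdW_le {G : Rn n → ℂ} (hG : ContDiff ℝ ∞ G) {R : ℝ}
    (h : tsupport G ⊆ closedBall 0 R) (J : List (Fin n)) : ∃ C : ℝ, 0 ≤ C ∧
      ∀ Z, ‖pdW J G Z‖ ≤ C ∧ (pdW J G Z ≠ 0 → ‖Z‖ ≤ R) := by
  have h1 : tsupport (pdW J G) ⊆ closedBall 0 R := by
    induction J with
    | nil => exact h
    | cons j J ih => exact (tsupport_fderiv_apply_subset ℝ _).trans ih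
  have h2 : HasCompactSupport (pdW J G) :=
    (isCompact_closedBall _ _).of_isClosed_subset (isClosed_tsupport _) h1
  obtain ⟨C, hC⟩ := h2.exists_bound_of_continuous (contDiff_pdW hG J).continuous
  exact ⟨C, (norm_nonneg _).trans (hC 0), fun Z => ⟨hC Z, fun h0 =>
    mem_closedBall_zero_iff.1 (h1 (subset_tsupport _ h0))⟩⟩

end Affine

namespace LipDomain

variable {n : ℕ} (Ω : LipDomain n)

theorem ball_rho_subset {X : Rn n} (hX : X ∈ Ω.carrier) : ball X (Ω.rho X) ⊆ Ω.carrier := by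
  refine (convex_ball X _).isPreconnected.subset_of_closure_inter_subset Ω.isOpen
    ⟨X, mem_ball_self (Ω.rho_pos hX), hX⟩ fun W hW => ?_
  by_contra h0
  have h1 : W ∈ Ω.bdry := by
    rw [bdry, Ω.isOpen.frontier_eq]
    exact ⟨hW.1, h0⟩
  have := Ω.rho_le_dist X h1
  rw [dist_comm] at this
  exact absurd (mem_ball.1 hW.2) (not_lt.2 this)

theorem exists_le_surf_ball : ∃ c : ℝ, 0 < c ∧ ∀ W ∈ Ω.carrier,
    c ≤ Ω.rho W ^ (1 - (n : ℝ)) * Ω.surf.real (ball W (3 / 2 * Ω.rho W)) := by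
  obtain ⟨T, hT⟩ := Ω.exists_atlas
  choose C hC0 hC using fun χ : Ω.Chart => χ.lower
  obtain ⟨c, hc0, hc⟩ := exists_pos_forall_le T hC0
  obtain ⟨r, hr0, hr⟩ := exists_pos_forall_le T fun χ => χ.cone.r_pos
  obtain ⟨D, hD0, hD⟩ := Ω.exists_rho_le
  have hn := Ω.two_le
  set k := min (1 / 2) (r / (2 * D)) with hk
  have hk0 : 0 < k := by positivity
  refine ⟨c * k ^ (n - 1), by positivity, fun W hW => ?_⟩
  have hρ := Ω.rho_pos hW
  have hρD := hD W (subset_closure hW)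
  obtain ⟨Y, hY, hYW⟩ := Ω.bdry_compact.exists_infDist_eq_dist (Ω.bdry_nonempty_of_mem hW) W
  obtain ⟨χ, hχ, h⟩ := mem_iUnion₂.1 (hT hY)
  have hχr := hr χ hχ
  have hlt : k * Ω.rho W < χ.r := by
    have h1 : k * Ω.rho W ≤ r / (2 * D) * D := by
      gcongr
      exact min_le_right _ _
    have h2 : r / (2 * D) * D = r / 2 := by field_simp
    linarith
  have h1 := hC χ Y hY (by have := mem_ball.1 h; linarith) (k * Ω.rho W) (by positivity) hlt
  have h2 : ball Y (k * Ω.rho W) ⊆ ball W (3 / 2 * Ω.rho W) := by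
    refine Metric.ball_subset_ball' ?_
    rw [dist_comm, ← hYW]
    have : k * Ω.rho W ≤ 1 / 2 * Ω.rho W := by gcongr; exact min_le_left _ _
    change _ + Ω.rho W ≤ _
    linarith
  have h3 : c * (k * Ω.rho W) ^ (n - 1) ≤ Ω.surf.real (ball W (3 / 2 * Ω.rho W)) := by
    refine (ENNReal.ofReal_le_iff_le_toReal (measure_ne_top _ _)).1 (le_trans ?_ (h1.trans (measure_mono h2)))
    gcongr
    exact hc χ hχ
  have e : Ω.rho W ^ (1 - (n : ℝ)) = (Ω.rho W ^ (n - 1))⁻¹ := by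
    rw [← rpow_natCast, ← rpow_neg hρ.le]; congr 1
    push_cast [show 1 ≤ n by omega]
    ring
  rw [e]
  calc c * k ^ (n - 1) = (Ω.rho W ^ (n - 1))⁻¹ * (c * (k * Ω.rho W) ^ (n - 1)) := by
        rw [mul_pow]; field_simp
    _ ≤ _ := by gcongr

/-- A smooth cut-off function, equal to `1` on the unit ball. -/
def cutoff (n : ℕ) : ContDiffBump (0 : Rn n) := ⟨1, 2, one_pos, one_lt_two⟩

/-- The contribution of the Whitney ball at `W` to the average at `X` of the weight `w`. -/
def avgFun (w : Rn n → ℝ) (X W : Rn n) : ℝ :=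
  Ω.rho W ^ (-(n : ℝ)) * w W * cutoff n ((16 / Ω.rho W) • (X - W))

/-- The average of the weight `w` over the Whitney balls. -/
def avg (w : Rn n → ℝ) (X : Rn n) : ℂ := ∫ W in Ω.carrier, (Ω.avgFun w X W : ℂ)

theorem measurable_avgFun {w : Rn n → ℝ} (hw : Measurable w) (X : Rn n) :
    Measurable (Ω.avgFun w X) := by
  have := Ω.continuous_rho.measurable
  exact ((this.pow_const _).mul hw).mul ((cutoff n).continuous.measurable.comp (by fun_prop))

theorem exists_pdW_avgFun_le (e : ℝ) (J : List (Fin n)) : ∃ C : ℝ, 0 ≤ C ∧ ∀ (w : Rn n → ℝ) (b : ℝ),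
    0 ≤ b → (∀ W ∈ Ω.carrier, |w W| ≤ b * Ω.rho W ^ e) → ∀ X ∈ Ω.carrier, ∀ W ∈ Ω.carrier,
      ‖pdW J (fun X => (Ω.avgFun w X W : ℂ)) X‖ ≤ (closedBall X (Ω.rho X)).indicator
        (fun _ => C * b * Ω.rho X ^ (e - n - J.length)) W := by
  have hG : ContDiff ℝ ∞ fun Z => ((cutoff n Z : ℝ) : ℂ) :=
    Complex.ofRealCLM.contDiff.comp (cutoff n).contDiff
  obtain ⟨C, hC0, hC⟩ := exists_norm_pdW_le hG (R := 2) (by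
    refine closure_minimal (fun Z hZ => ?_) Metric.isClosed_closedBall
    refine Metric.ball_subset_closedBall ((cutoff n).support_eq ▸ ?_ : Z ∈ ball 0 2)
    exact fun h => hZ (by simp [h])) J
  refine ⟨C * 16 ^ J.length * 2 ^ |e - n - J.length|, by positivity, fun w b hb hw X hX W hW => ?_⟩
  have hρ := Ω.rho_pos hX
  have hρ' := Ω.rho_pos hW
  have h1 : pdW J (fun X => (Ω.avgFun w X W : ℂ)) X = ((Ω.rho W ^ (-(n : ℝ)) * w W : ℝ) *
    ((16 / Ω.rho W : ℝ) : ℂ) ^ J.length : ℂ) •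
    pdW J (fun Z => ((cutoff n Z : ℝ) : ℂ)) ((16 / Ω.rho W) • (X - W)) := by
    refine Eq.trans ?_ (congrFun (pdW_comp_affine hG _ (16 / Ω.rho W) W J) X)
    simp only [avgFun, Complex.ofReal_mul, smul_eq_mul]
  rw [h1]
  obtain ⟨h2, h3⟩ := hC ((16 / Ω.rho W) • (X - W))
  by_cases h0 : pdW J (fun Z => ((cutoff n Z : ℝ) : ℂ)) ((16 / Ω.rho W) • (X - W)) = 0
  · rw [h0, smul_zero, norm_zero]
    exact indicator_nonneg (fun _ _ => by positivity) _
  have h4 := h3 h0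
  rw [norm_smul, norm_of_nonneg (by positivity), div_mul_eq_mul_div, div_le_iff₀ hρ',
    ← dist_eq_norm] at h4
  have h5 := Ω.rho_le_add X W
  have h6 := Ω.rho_le_add W X
  rw [dist_comm] at h6; rw [indicator_of_mem (Metric.mem_closedBall'.2 (by linarith))]
  have h7 := rpow_le_of_comparable (K := 2) (e - n - J.length) hρ hρ' (by linarith) (by linarith)
  rw [norm_smul, norm_mul, norm_pow, Complex.norm_real, Complex.norm_real, norm_mul,
    norm_of_nonneg (by positivity : 0 ≤ 16 / Ω.rho W), norm_of_nonneg (by positivity : 0 ≤ Ω.rho W ^ (-(n : ℝ)))]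
  calc _ ≤ Ω.rho W ^ (-(n : ℝ)) * (b * Ω.rho W ^ e) * (16 / Ω.rho W) ^ J.length * C := by
        gcongr
        exact hw W hW
    _ = C * 16 ^ J.length * b * Ω.rho W ^ (e - n - J.length) := by
      rw [rpow_sub hρ', rpow_sub hρ', rpow_neg hρ'.le, rpow_natCast, rpow_natCast, div_pow]
      field_simp
    _ ≤ C * 16 ^ J.length * b * (2 ^ |e - n - J.length| * Ω.rho X ^ (e - n - J.length)) := by gcongr
    _ = _ := by ring

theorem exists_avg_le (e : ℝ) (N : ℕ) : ∃ C : ℝ, 0 ≤ C ∧ ∀ (w : Rn n → ℝ) (b : ℝ), 0 ≤ b →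
    Measurable w → (∀ W ∈ Ω.carrier, |w W| ≤ b * Ω.rho W ^ e) → ContDiffOn ℝ ∞ (Ω.avg w) Ω.carrier ∧
      ∀ X ∈ Ω.carrier, ∀ J : List (Fin n), J.length ≤ N → ‖pdW J (Ω.avg w) X‖ ≤ C * b * Ω.rho X ^ e * ((Ω.rho X)⁻¹) ^ J.length := by
  choose C hC0 hC using Ω.exists_pdW_avgFun_le e
  set v := volume.real (ball (0 : Rn n) 1) with hv
  have hfin : IsFiniteMeasure (volume.restrict Ω.carrier) :=
    ⟨by simpa using Ω.isBounded.measure_lt_top⟩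
  have hS0 : 0 ≤ ∑ J ∈ (List.finite_length_le (Fin n) N).toFinset, C J :=
    sum_nonneg fun J _ => hC0 J
  refine ⟨(∑ J ∈ (List.finite_length_le (Fin n) N).toFinset, C J) * v,
    mul_nonneg hS0 measureReal_nonneg, fun w b hb hwm hw => ?_⟩
  have hms : ∀ᵐ W ∂(volume.restrict Ω.carrier), W ∈ Ω.carrier := ae_restrict_mem Ω.isOpen.measurableSet
  obtain ⟨h1, h2, h3⟩ := pdW_integral (μ := volume.restrict Ω.carrier) Ω.isOpen
    (H := fun X W => (Ω.avgFun w X W : ℂ))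
    (.of_forall fun W => ContDiff.contDiffOn <| Complex.ofRealCLM.contDiff.comp <|
      contDiff_const.mul ((cutoff n).contDiff.comp (by fun_prop)))
    (fun X _ => (Complex.measurable_ofReal.comp (Ω.measurable_avgFun hwm X)).aestronglyMeasurable)
    (fun J X₀ hX₀ => by
      have hρ := Ω.rho_pos hX₀
      refine ⟨Ω.rho X₀ / 2, by positivity, fun _ => C J * b * (2 ^ |e - n - J.length| *
        Ω.rho X₀ ^ (e - n - J.length)), integrable_const _, ?_⟩
      filter_upwards [hms] with W hW X hX hXΩ
      have a1 := Ω.rho_le_add X X₀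
      have a2 := Ω.rho_le_add X₀ X
      rw [dist_comm] at a2
      have a3 := mem_ball.1 hX
      refine (hC J w b hb hw X hXΩ W hW).trans ((indicator_le_self' (fun _ _ => ?_) W).trans ?_)
      · have := hC0 J; have := Ω.rho_pos hXΩ; positivity
      · have := hC0 J
        gcongr
        exact rpow_le_of_comparable _ hρ (Ω.rho_pos hXΩ) (by linarith) (by linarith))
  refine ⟨h1, fun X hX J hJ => ?_⟩
  have hρ := Ω.rho_pos hX
  have hCJ := hC0 J
  have hCS : C J ≤ ∑ J ∈ (List.finite_length_le (Fin n) N).toFinset, C J :=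
    single_le_sum (fun J _ => hC0 J) ((List.finite_length_le (Fin n) N).mem_toFinset.2 hJ)
  have h4 := h3 J X hX
  change pdW J (Ω.avg w) X = _ at h4
  rw [h4]
  refine (norm_integral_le_of_norm_le (g := (closedBall X (Ω.rho X)).indicator
    (fun _ => C J * b * Ω.rho X ^ (e - n - J.length)))
    ((integrable_const _).indicator measurableSet_closedBall)
    (by filter_upwards [hms] with W hW using hC J w b hb hw X hX W hW)).trans ?_
  rw [integral_indicator_const _ measurableSet_closedBall, smul_eq_mul]
  have h5 : (volume.restrict Ω.carrier).real (closedBall X (Ω.rho X)) ≤ Ω.rho X ^ n * v := by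
    have a1 := Measure.addHaar_real_closedBall (volume : Measure (Rn n)) X hρ.le
    rw [finrank_euclideanSpace_fin] at a1; rw [hv, ← a1]
    exact ENNReal.toReal_mono measure_closedBall_lt_top.ne (Measure.restrict_apply_le _ _)
  calc _ ≤ Ω.rho X ^ n * v * (C J * b * Ω.rho X ^ (e - n - J.length)) := by gcongr
    _ ≤ Ω.rho X ^ n * v * ((∑ J ∈ (List.finite_length_le (Fin n) N).toFinset, C J) * b *
      Ω.rho X ^ (e - n - J.length)) := by gcongr
    _ = _ := by rw [rpow_sub hρ, rpow_sub hρ, rpow_natCast, rpow_natCast, inv_pow]; field_simp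

theorem integrable_avgFun {w : Rn n → ℝ} {b : ℝ} (hb : 0 ≤ b) (hwm : Measurable w)
    (hw : ∀ W ∈ Ω.carrier, |w W| ≤ b) {X : Rn n} (hX : X ∈ Ω.carrier) :
    IntegrableOn (Ω.avgFun w X) Ω.carrier := by
  obtain ⟨C, hC0, hC⟩ := Ω.exists_pdW_avgFun_le 0 []
  have hfin : IsFiniteMeasure (volume.restrict Ω.carrier) :=
    ⟨by simpa using Ω.isBounded.measure_lt_top⟩
  have hρ := Ω.rho_pos hX
  refine (integrable_const (C * b * Ω.rho X ^ ((0 : ℝ) - n - ([] : List (Fin n)).length))).mono'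
    (Ω.measurable_avgFun hwm X).aestronglyMeasurable ?_
  filter_upwards [ae_restrict_mem Ω.isOpen.measurableSet] with W hW
  have h := hC w b hb (by simpa using hw) X hX W hW
  rw [pdW, Complex.norm_real] at h
  exact h.trans (indicator_le_self' (fun _ _ => by positivity) _)

theorem exists_le_avg : ∃ c₁ : ℝ, 0 < c₁ ∧ ∀ (w : Rn n → ℝ) (b c : ℝ), 0 < c → Measurable w →
    (∀ W ∈ Ω.carrier, c ≤ w W) → (∀ W ∈ Ω.carrier, |w W| ≤ b) → ∀ X ∈ Ω.carrier,
      c * c₁ ≤ ‖Ω.avg w X‖ := by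
  set v := volume.real (ball (0 : Rn n) 1) with hv
  have hv0 : 0 < v := toReal_pos (measure_ball_pos _ _ one_pos).ne' measure_ball_lt_top.ne
  refine ⟨v * (64 ^ n)⁻¹, by positivity, fun w b c hc hwm hw hwb X hX => ?_⟩
  have hρ := Ω.rho_pos hX
  have hb : 0 ≤ b := (abs_nonneg _).trans (hwb X hX)
  have hfin : IsFiniteMeasure (volume.restrict Ω.carrier) :=
    ⟨by simpa using Ω.isBounded.measure_lt_top⟩
  rw [avg, integral_complex_ofReal, Complex.norm_real]
  refine le_trans ?_ (le_abs_self _)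
  have h1 : ∫ W in Ω.carrier, (ball X (Ω.rho X / 32)).indicator
    (fun _ => (2 * Ω.rho X) ^ (-(n : ℝ)) * c) W ≤ ∫ W in Ω.carrier, Ω.avgFun w X W := by
    refine integral_mono_ae ((integrable_const _).indicator measurableSet_ball)
      (Ω.integrable_avgFun hb hwm hwb hX) ?_
    filter_upwards [ae_restrict_mem Ω.isOpen.measurableSet] with W hW
    have hρ' := Ω.rho_pos hW
    have hwW : 0 < w W := hc.trans_le (hw W hW)
    by_cases h : W ∈ ball X (Ω.rho X / 32)
    · rw [indicator_of_mem h]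
      have h2 := mem_ball'.1 h
      have h3 := Ω.rho_le_add W X
      have h4 := Ω.rho_le_add X W
      rw [dist_comm] at h3
      have h5 : cutoff n ((16 / Ω.rho W) • (X - W)) = 1 := by
        refine (cutoff n).one_of_mem_closedBall (mem_closedBall_zero_iff.2 ?_)
        rw [norm_smul, norm_of_nonneg (by positivity), div_mul_eq_mul_div, ← dist_eq_norm]
        exact (div_le_one hρ').2 (by linarith)
      rw [avgFun, h5, mul_one]
      refine mul_le_mul (Real.rpow_le_rpow_of_nonpos hρ' (by linarith) (by simp)) (hw W hW) hc.le
        (by positivity)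
    · rw [indicator_of_notMem h]
      exact mul_nonneg (by positivity) (cutoff n).nonneg
  refine le_trans (le_of_eq ?_) h1
  rw [integral_indicator_const _ measurableSet_ball, smul_eq_mul, measureReal_restrict_apply
    measurableSet_ball, inter_eq_left.2 ((ball_subset_ball (by linarith)).trans
    (Ω.ball_rho_subset hX)), Measure.real, Measure.addHaar_ball_of_pos _ _ (by positivity), finrank_euclideanSpace_fin,
    ENNReal.toReal_mul, ENNReal.toReal_ofReal (by positivity), ← Measure.real, rpow_neg (by positivity), rpow_natCast, ← hv, mul_pow, div_pow,
    show (64 : ℝ) ^ n = 2 ^ n * 32 ^ n by rw [← mul_pow]; norm_num]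
  field_simp

/-- The weight at `W` of the boundary points near `W`. -/
def nearWt (Y W : Rn n) : ℝ := (ball W (3 / 2 * Ω.rho W)).indicator
  (fun _ => Ω.rho W ^ (1 - (n : ℝ))) Y

theorem measurable_nearWt : Measurable fun q : Rn n × Rn n => Ω.nearWt q.1 q.2 := by
  have h := Ω.continuous_rho
  have e : (fun q : Rn n × Rn n => Ω.nearWt q.1 q.2) = {q | dist q.1 q.2 < 3 / 2 * Ω.rho q.2}.indicator
    fun q => Ω.rho q.2 ^ (1 - (n : ℝ)) := by
    funext q
    by_cases h : dist q.1 q.2 < 3 / 2 * Ω.rho q.2 <;> simp [nearWt, h]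
  rw [e]
  exact ((h.measurable.comp measurable_snd).pow_const _).indicator
    (measurableSet_lt (by fun_prop) (by have := h.measurable; fun_prop))

theorem integral_nearWt (W : Rn n) : ∫ Y, Ω.nearWt Y W ∂Ω.surf =
    Ω.rho W ^ (1 - (n : ℝ)) * Ω.surf.real (ball W (3 / 2 * Ω.rho W)) := by
  simp only [nearWt]; rw [integral_indicator_const _ measurableSet_ball, smul_eq_mul, mul_comm]

theorem abs_nearWt_le (Y : Rn n) {W : Rn n} (hW : W ∈ Ω.carrier) :
    |Ω.nearWt Y W| ≤ 1 * Ω.rho W ^ (1 - (n : ℝ)) := by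
  have := Ω.rho_pos hW
  rw [one_mul, nearWt, abs_of_nonneg (indicator_nonneg (fun _ _ => by positivity) _)]
  exact indicator_le_self' (fun _ _ => by positivity) _

theorem integral_avg_nearWt {X : Rn n} (hX : X ∈ Ω.carrier) : ∫ Y, Ω.avg (Ω.nearWt Y) X ∂Ω.surf =
    Ω.avg (fun W => ∫ Y, Ω.nearWt Y W ∂Ω.surf) X := by
  have hfin : IsFiniteMeasure (volume.restrict Ω.carrier) :=
    ⟨by simpa using Ω.isBounded.measure_lt_top⟩
  obtain ⟨C, hC0, hC⟩ := Ω.exists_pdW_avgFun_le (1 - (n : ℝ)) []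
  have hρ := Ω.rho_pos hX
  have h1 := Ω.measurable_nearWt
  have h2 := Ω.continuous_rho.measurable
  have hm : Measurable fun q : Rn n × Rn n => (Ω.avgFun (Ω.nearWt q.1) X q.2 : ℂ) :=
    Complex.measurable_ofReal.comp ((((h2.comp measurable_snd).pow_const _).mul h1).mul
      ((cutoff n).continuous.measurable.comp (by fun_prop)))
  have hi : Integrable (Function.uncurry fun Y W => (Ω.avgFun (Ω.nearWt Y) X W : ℂ))
    (Ω.surf.prod (volume.restrict Ω.carrier)) := by
    refine (integrable_const (C * 1 * Ω.rho X ^ (1 - (n : ℝ) - n - 0))).mono' hm.aestronglyMeasurable ?_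
    filter_upwards [Measure.quasiMeasurePreserving_snd.ae (ae_restrict_mem Ω.isOpen.measurableSet)]
      with q hq
    have h := hC (Ω.nearWt q.1) 1 zero_le_one (fun W hW => Ω.abs_nearWt_le q.1 hW) X hX q.2 hq
    rw [pdW, List.length_nil, Nat.cast_zero] at h
    exact h.trans (indicator_le_self' (fun _ _ => by positivity) _)
  simp only [avg]; rw [integral_integral_swap hi]; congr 1
  funext W; rw [integral_complex_ofReal]; congr 1
  simp only [avgFun]; rw [integral_mul_const, integral_const_mul]

theorem measurable_integral_nearWt : Measurable fun W => ∫ Y, Ω.nearWt Y W ∂Ω.surf := by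
  have h0 := Ω.measurable_nearWt.comp (measurable_swap (α := Rn n) (β := Rn n))
  have h := h0.stronglyMeasurable.integral_prod_right' (ν := Ω.surf)
  exact h.measurable

theorem measurable_avg_nearWt (X : Rn n) : Measurable fun Y => Ω.avg (Ω.nearWt Y) X := by
  have h1 := Ω.measurable_nearWt
  have h2 := Ω.continuous_rho.measurable
  have h3 : Measurable fun q : Rn n × Rn n => (Ω.avgFun (Ω.nearWt q.1) X q.2 : ℂ) :=
    Complex.measurable_ofReal.comp ((((h2.comp measurable_snd).pow_const _).mul h1).mul
      ((cutoff n).continuous.measurable.comp (by fun_prop)))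
  have h := h3.stronglyMeasurable.integral_prod_right' (ν := volume.restrict Ω.carrier)
  exact h.measurable

theorem avg_nearWt_eq_zero {X Y : Rn n} (hX : X ∈ Ω.carrier) (h : 2 * Ω.rho X ≤ ‖X - Y‖) :
    Ω.avg (Ω.nearWt Y) X = 0 := by
  have hρ := Ω.rho_pos hX
  refine setIntegral_eq_zero_of_forall_eq_zero fun W hW => ?_
  have hρ' := Ω.rho_pos hW
  rw [Complex.ofReal_eq_zero, avgFun, nearWt]
  by_cases h1 : Y ∈ ball W (3 / 2 * Ω.rho W)
  · refine mul_eq_zero_of_right _ ((cutoff n).zero_of_le_dist ?_)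
    rw [dist_zero_right, norm_smul, norm_of_nonneg (by positivity), div_mul_eq_mul_div,
      le_div_iff₀ hρ', ← dist_eq_norm]
    change 2 * _ ≤ _
    rw [← dist_eq_norm] at h
    have h2 := mem_ball'.1 h1
    have h3 := Ω.rho_le_add W X
    have h4 := dist_triangle X W Y
    rw [dist_comm W X] at h3
    by_contra! h5
    linarith
  · simp [h1]

theorem exists_isWhitneyKernel : ∃ K, IsWhitneyKernel Ω K := by
  obtain ⟨c, hc0, hc⟩ := Ω.exists_le_surf_ball
  obtain ⟨A, hA0, hA⟩ := Ω.exists_surf_ball_le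
  obtain ⟨c₁, hc₁, h₁⟩ := Ω.exists_le_avg
  obtain ⟨w', hw'⟩ : ∃ w' : Rn n → ℝ, w' = fun W => ∫ Y, Ω.nearWt Y W ∂Ω.surf := ⟨_, rfl⟩
  have hm' : Measurable w' := hw' ▸ Ω.measurable_integral_nearWt
  have hm : ∀ Y, Measurable (Ω.nearWt Y) := fun Y => by
    have h := Ω.measurable_nearWt.comp (measurable_prodMk_left (x := Y) (β := Rn n))
    exact h
  have hlow : ∀ W ∈ Ω.carrier, c ≤ w' W := fun W hW => by
    rw [hw']
    simp only [integral_nearWt]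
    exact hc W hW
  obtain ⟨b, hb⟩ : ∃ b, b = A * (3 / 2) ^ (n - 1) := ⟨_, rfl⟩
  have hup : ∀ W ∈ Ω.carrier, |w' W| ≤ b := fun W hW => by
    have hρ := Ω.rho_pos hW
    rw [abs_of_pos (hc0.trans_le (hlow W hW)), hw']
    simp only [integral_nearWt]
    have h1 := ENNReal.toReal_le_of_le_ofReal (by positivity) (hA W (3 / 2 * Ω.rho W) (by positivity))
    have h2 : Ω.rho W ^ (1 - (n : ℝ)) = (Ω.rho W ^ (n - 1))⁻¹ := by
      have := Ω.two_le
      rw [← rpow_natCast, ← rpow_neg hρ.le]; congr 1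
      push_cast [show 1 ≤ n by omega]
      ring
    calc _ ≤ Ω.rho W ^ (1 - (n : ℝ)) * (A * (3 / 2 * Ω.rho W) ^ (n - 1)) := by gcongr; exact h1
      _ = _ := by rw [hb, h2, mul_pow]; field_simp
  have hup' : ∀ W ∈ Ω.carrier, |w' W| ≤ b * Ω.rho W ^ (0 : ℝ) := by simpa using hup
  have hw := fun Y W (hW : W ∈ Ω.carrier) => Ω.abs_nearWt_le Y hW
  have hb0 : 0 ≤ b := by rw [hb]; positivity
  have hN := fun X hX => h₁ w' b c hc0 hm' hlow hup X hX
  have hN0 : ∀ X ∈ Ω.carrier, Ω.avg w' X ≠ 0 := fun X hX =>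
    norm_pos_iff.1 ((mul_pos hc0 hc₁).trans_le (hN X hX))
  obtain ⟨_, _, hs'⟩ := Ω.exists_avg_le 0 0
  obtain ⟨_, _, hs⟩ := Ω.exists_avg_le (1 - (n : ℝ)) 0
  have hs1 := (hs' w' b hb0 hm' hup').1
  have hs2 := fun Y => (hs (Ω.nearWt Y) 1 zero_le_one (hm Y) (hw Y)).1
  have hs3 : ContDiffOn ℝ ∞ (Ω.avg w')⁻¹ Ω.carrier := hs1.inv hN0
  refine ⟨fun X Y => (Ω.avg w' X)⁻¹ • Ω.avg (Ω.nearWt Y) X, fun Y _ => hs3.smul (hs2 Y), fun X hX => ?_,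
    fun X hX => ?_, fun α => ?_, fun X hX Y hY h => ?_⟩
  · exact ((Ω.measurable_avg_nearWt X).const_mul _).aestronglyMeasurable
  · rw [integral_smul, Ω.integral_avg_nearWt hX, ← hw', smul_eq_mul, inv_mul_cancel₀ (hN0 X hX)]
  · obtain ⟨N, hNd⟩ : ∃ N, N = ∑ i, α i := ⟨_, rfl⟩
    obtain ⟨C₁, hC₁, h1⟩ := Ω.exists_avg_le 0 N
    obtain ⟨C₂, hC₂, h2⟩ := Ω.exists_avg_le (1 - (n : ℝ)) N
    obtain ⟨C₃, h3⟩ := exists_norm_pdW_inv_le (C₁ * b) (c * c₁) (by positivity) N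
    refine ⟨2 ^ N * (C₃ * C₂), fun X hX Y hY => ?_⟩
    have hρ := Ω.rho_pos hX
    have hJ : (wordOf α).length ≤ N := by rw [wordOf_length, hNd]
    have h4 := h3 n Ω.carrier Ω.isOpen X hX (Ω.rho X)⁻¹ (Ω.avg w') (by positivity) hs1 hN0 (hN X hX)
      fun J hJ => by simpa using (h1 w' b hb0 hm' hup').2 X hX J hJ
    have h5 := norm_pdW_smul_le Ω.isOpen hX N (by positivity) hs3 (hs2 Y) h4
      ((h2 _ 1 zero_le_one (hm Y) (hw Y)).2 X hX) _ hJ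
    rw [classD_eq, Pi.smul_apply, norm_smul, norm_pow, norm_neg, Complex.norm_I, one_pow, one_mul]
    refine h5.trans (le_of_eq ?_)
    rw [wordOf_length, ← Nat.cast_sum, ← hNd, rpow_sub hρ _ (N : ℝ), rpow_natCast, inv_pow]; ring
  · exact smul_eq_zero_of_right _ (Ω.avg_nearWt_eq_zero hX h)

end LipDomain

theorem exists_clm_of_rel {E F : Type*} [NormedAddCommGroup E] [NormedSpace ℂ E]
    [NormedAddCommGroup F] [NormedSpace ℂ F] {R : E → F → Prop}
    (hu : ∀ x y y', R x y → R x y' → y = y')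
    (hl : ∀ (c : ℂ) x y x' y', R x y → R x' y' → R (c • x + x') (c • y + y'))
    (h : ∃ C : ℝ, ∀ x, ∃ y, R x y ∧ ‖y‖ ≤ C * ‖x‖) : ∃ L : E →L[ℂ] F, ∀ x, R x (L x) := by
  obtain ⟨C, h⟩ := h
  choose g hg hC using h
  have h0 : g 0 = 0 := by simpa using hC 0
  refine ⟨LinearMap.mkContinuous ⟨⟨g, fun x y => ?_⟩, fun c x => ?_⟩ C hC, hg⟩
  · exact hu _ _ _ (hg _) (by simpa using hl 1 _ _ _ _ (hg x) (hg y))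
  · exact hu _ _ _ (hg _) (by simpa [h0] using hl c _ _ _ _ (hg x) (hg 0))

theorem norm_le_of_eLpNorm_rpow_le {X E : Type*} [MeasurableSpace X] [NormedAddCommGroup E]
    {μ : Measure X} {p : ℝ≥0∞} (hp0 : p ≠ 0) (hp' : p ≠ ⊤) (x : Lp E p μ) {C : ℝ≥0∞}
    (hC : C ≠ ⊤) {B : ℝ} (hB : 0 ≤ B)
    (h : eLpNorm x p μ ^ p.toReal ≤ C * ofReal B ^ p.toReal) :
    ‖x‖ ≤ (C ^ (1 / p.toReal)).toReal * B := by
  have hP := toReal_pos hp0 hp'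
  rw [Lp.norm_def]
  refine ENNReal.toReal_le_of_le_ofReal (by positivity) ?_
  have h1 := rpow_le_rpow h (by positivity : 0 ≤ 1 / p.toReal)
  rw [← ENNReal.rpow_mul, mul_one_div_cancel hP.ne', ENNReal.rpow_one,
    mul_rpow_of_nonneg _ _ (by positivity), ← ENNReal.rpow_mul, mul_one_div_cancel hP.ne',
    ENNReal.rpow_one] at h1
  rwa [ofReal_mul toReal_nonneg, ofReal_toReal (rpow_ne_top_of_nonneg (by positivity) hC)]

theorem IsTrace.linear {n l : ℕ} {Ω : LipDomain n} {p : ℝ≥0∞} (hp : 1 ≤ p) {a : ℝ} (c : ℂ)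
    {u u' w g g' h : Rn n → Cl l} (ht : IsTrace Ω p a u g) (ht' : IsTrace Ω p a u' g')
    (hg : AEStronglyMeasurable g Ω.surf) (hg' : AEStronglyMeasurable g' Ω.surf)
    (hw : w =ᵐ[volume.restrict Ω.carrier] c • u + u') (hh : h =ᵐ[Ω.surf] c • g + g') :
    IsTrace Ω p a w h := by
  obtain ⟨v, hv, φ, h1, h2, h3, h4⟩ := ht
  obtain ⟨v', hv', φ', h1', h2', h3', h4'⟩ := ht'
  have key : ∀ {μ : Measure (Rn n)} {f f' F : Rn n → Cl l} {ψ ψ' : ℕ → Rn n → Cl l},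
    (∀ k, Continuous (ψ k)) → (∀ k, Continuous (ψ' k)) → AEStronglyMeasurable f μ →
    AEStronglyMeasurable f' μ → F =ᵐ[μ] c • f + f' →
    Tendsto (fun k => eLpNorm (ψ k - f) p μ) atTop (𝓝 0) →
    Tendsto (fun k => eLpNorm (ψ' k - f') p μ) atTop (𝓝 0) →
    Tendsto (fun k => eLpNorm (c • ψ k + ψ' k - F) p μ) atTop (𝓝 0) := by
    intro μ f f' F ψ ψ' hψ hψ' hf hf' hF t t'
    have e := (ENNReal.Tendsto.const_mul t (Or.inr (enorm_ne_top (x := c)))).add t'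
    rw [mul_zero, add_zero] at e
    refine tendsto_zero_of_le e fun k => ?_
    have e1 : c • ψ k + ψ' k - F =ᵐ[μ] c • (ψ k - f) + (ψ' k - f') := by
      filter_upwards [hF] with X hX
      simp only [Pi.add_apply, Pi.sub_apply, Pi.smul_apply, hX, smul_sub]; abel
    rw [eLpNorm_congr_ae e1]
    refine (eLpNorm_add_le (((hψ k).aestronglyMeasurable.sub hf).const_smul c)
      ((hψ' k).aestronglyMeasurable.sub hf') hp).trans ?_
    rw [eLpNorm_const_smul]
  have hj : 0 < n := by linarith [Ω.two_le]
  have hm : ∀ {f : Rn n → Cl l}, LocallyIntegrableOn f Ω.carrier volume →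
    AEStronglyMeasurable f (Ω.wMeas (p.toReal * a)) := fun hf =>
    hf.aestronglyMeasurable.mono_ac (LipDomain.wMeas_ac _)
  have hd : ∀ j k, classD1 j (c • φ k + φ' k) = c • classD1 j (φ k) + classD1 j (φ' k) := fun j k => by
    funext X
    have d1 := (h1 k).differentiable (by simp) X
    simp only [classD1, Pi.add_apply, Pi.smul_apply]
    rw [fderiv_add (d1.const_smul c) ((h1' k).differentiable (by simp) X), fderiv_const_smul d1,
      smul_comm c, ← smul_add]
    rfl
  have hc : ∀ {ψ : Rn n → Cl l} j, ContDiff ℝ ∞ ψ → Continuous (classD1 j ψ) := fun j hψ => by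
    have h := (contDiff_pd hψ j).continuous.const_smul (-Complex.I)
    exact h
  refine ⟨fun j => c • v j + v' j, fun j => (((hv j).smul c).add (hv' j)).congr hw.symm ae_eq_rfl,
    fun k => c • φ k + φ' k, fun k => ((h1 k).const_smul c).add (h1' k),
    key (fun k => (h1 k).continuous) (fun k => (h1' k).continuous) (hm (hv ⟨0, hj⟩).1)
      (hm (hv' ⟨0, hj⟩).1) ((LipDomain.wMeas_ac _).ae_eq hw) h2 h2', fun j => ?_,
    key (fun k => (h1 k).continuous) (fun k => (h1' k).continuous) hg hg' hh h4 h4'⟩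
  simp only [hd]
  exact key (fun k => hc j (h1 k)) (fun k => hc j (h1' k)) (hm (hv j).2.1) (hm (hv' j).2.1) ae_eq_rfl
    (h3 j) (h3' j)

/-- The extension by zero of a family indexed by the multi-indices of length `≤ k`. -/
def extendIdx {n k : ℕ} {E : Type*} [Zero E] (f : MIdx n k → E) (α : Fin n → ℕ) : E :=
  if h : ∑ i, α i ≤ k then f ⟨α, h⟩ else 0

theorem extendIdx_apply {n k : ℕ} {E : Type*} [Zero E] (f : MIdx n k → E) (α : MIdx n k) :
    extendIdx f α.1 = f α := dif_pos α.2

theorem extendIdx_of {n k : ℕ} {E : Type*} [Zero E] {f : MIdx n k → E} {q : E → Prop} (h0 : q 0)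
    (h : ∀ α, q (f α)) (α : Fin n → ℕ) : q (extendIdx f α) := by
  rw [extendIdx]
  split_ifs
  exacts [h _, h0]

section Besov

variable {n l k : ℕ} {Ω : LipDomain n} {p : ℝ≥0∞} {a s : ℝ}

theorem taylorP_eq (f : MIdx n k → Rn n → Cl l) (α : MIdx n k) (X Y : Rn n) :
    taylorP f α X Y = taylor (k + 1) (truncJet (k + 1) (extendIdx f)) α.1 X Y := by
  have h : k + 1 - ∑ i, α.1 i = k - α.len + 1 := by have := α.2; unfold MIdx.len; omega
  rw [taylor_truncJet, h, ← sum_mIdx]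
  refine sum_congr rfl fun β _ => ?_
  rw [monom_div_fact, ← extendIdx_apply f (α.add β)]; rfl

theorem remR_eq (f : MIdx n k → Rn n → Cl l) (α : MIdx n k) (X Y : Rn n) :
    remR f α X Y = remJ (k + 1) (extendIdx f) α.1 X Y := by
  rw [remR, remJ, taylorP_eq, truncJet_eq _ (Nat.lt_succ_of_le α.2), extendIdx_apply]

theorem whitneyExt_eq (K : Rn n → Rn n → ℂ) (f : MIdx n k → Rn n → Cl l) :
    whitneyExt Ω K f = whit Ω K (k + 1) (extendIdx f) := by
  funext X
  simp only [whitneyExt, whit, taylorP_eq]; rfl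

theorem measurable_remQ {f : MIdx n k → Rn n → Cl l} (hf : ∀ α, Measurable (f α)) (α : MIdx n k) :
    Measurable (remQ p s f α) := by
  have h := measurable_remJ (m := k + 1) (extendIdx_of measurable_zero hf) α.1
  have e : remQ p s f α = fun Z => (‖Z.1 - Z.2‖ ^ ((k : ℝ) + s - α.len + ((n : ℝ) - 1) / p.toReal))⁻¹ •
    remJ (k + 1) (extendIdx f) α.1 Z.1 Z.2 := funext fun Z => by rw [remQ, remR_eq]
  rw [e]
  exact ((measurable_fst.sub measurable_snd).norm.pow_const _).inv.smul h

theorem eLpNorm_remQ (hp0 : p ≠ 0) (hp' : p ≠ ⊤) (hs : s = 1 - a - 1 / p.toReal)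
    {f : MIdx n k → Rn n → Cl l} (hf : ∀ α, Measurable (f α)) (α : MIdx n k) :
    eLpNorm (remQ p s f α) p (Ω.surf.prod Ω.surf) ^ p.toReal =
      ∫⁻ X, (∫⁻ Y, ofReal (dist X Y ^ (jetExp p.toReal a (k + 1) α.1 + 2 - n)) *
        ‖remJ (k + 1) (extendIdx f) α.1 X Y‖ₑ ^ p.toReal ∂Ω.surf) ∂Ω.surf := by
  have hP := toReal_pos hp0 hp'
  rw [← lintegral_enorm_rpow hp0 hp', lintegral_prod _ ((measurable_remQ hf α).enorm.pow_const _).aemeasurable]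
  refine lintegral_congr fun X => lintegral_congr fun Y => ?_
  have e : jetExp p.toReal a (k + 1) α.1 + 2 - n =
    -((k : ℝ) + s - α.len + ((n : ℝ) - 1) / p.toReal) * p.toReal := by
    rw [jetExp, Nat.add_sub_cancel, Nat.cast_sub α.2, hs, MIdx.len]; field_simp; ring
  rw [remQ, enorm_smul, mul_rpow_of_nonneg _ _ hP.le, remR_eq, e, ← rpow_neg (norm_nonneg _),
    Real.enorm_of_nonneg (by positivity), ofReal_rpow_of_nonneg (by positivity) hP.le,
    ← rpow_mul (norm_nonneg _), dist_eq_norm]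

theorem WBesov.measurable_fn (f : WBesov Ω k p s l) (α : MIdx n k) : Measurable (f.fn α) :=
  (Lp.stronglyMeasurable (f.comp α)).measurable

theorem WBesov.besN_add_lpN_le [Fact (1 ≤ p)] (hp0 : p ≠ 0) (hp' : p ≠ ⊤) (hs : s = 1 - a - 1 / p.toReal)
    (f : WBesov Ω k p s l) : besN Ω p.toReal a (k + 1) (extendIdx f.fn) +
      lpN Ω p.toReal (k + 1) (extendIdx f.fn) ≤
      2 * (Finset.univ : Finset (MIdx n k)).card * ofReal ‖f‖ ^ p.toReal := by
  have h1 : 0 ≤ ∑ α, ‖f.comp α‖ := sum_nonneg fun α _ => norm_nonneg _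
  have h2 : 0 ≤ ∑ α, ‖f.rem α‖ := sum_nonneg fun α _ => norm_nonneg _
  have h3 := f.norm_def
  rw [two_mul, add_mul, besN, lpN, ← sum_mIdx, ← sum_mIdx, ← nsmul_eq_mul]
  refine add_le_add (sum_le_card_nsmul _ _ _ fun α _ => ?_) (sum_le_card_nsmul _ _ _ fun α _ => ?_)
  · rw [← eLpNorm_remQ hp0 hp' hs f.measurable_fn]; gcongr
    rw [← eLpNorm_congr_ae (f.memLp_rem α).coeFn_toLp, ← Lp.enorm_def, ← ofReal_norm]
    refine ofReal_le_ofReal ?_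
    have := single_le_sum (fun α _ => norm_nonneg (f.rem α)) (Finset.mem_univ α)
    change ‖f.rem α‖ ≤ _
    linarith
  · simp only [extendIdx_apply]; rw [lintegral_enorm_rpow hp0 hp']; gcongr
    change eLpNorm (f.comp α) p Ω.surf ≤ _
    rw [← Lp.enorm_def, ← ofReal_norm]
    refine ofReal_le_ofReal ?_
    have := single_le_sum (fun α _ => norm_nonneg (f.comp α)) (Finset.mem_univ α)
    linarith

theorem WBesov.ext_ae {f g : WBesov Ω k p s l} (h : ∀ α, f.fn α =ᵐ[Ω.surf] g.fn α) : f = g :=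
  Subtype.ext (funext fun α => Lp.ext (h α))

theorem WBesov.integrable_truncJet [Fact (1 ≤ p)] (f : WBesov Ω k p s l) (γ : Fin n → ℕ) :
    Integrable (truncJet (k + 1) (extendIdx f.fn) γ) Ω.surf := by
  have h := extendIdx_of (q := fun g => Integrable g Ω.surf) (f := f.fn) (integrable_zero _ _ _)
    (fun α => (Lp.memLp (f.comp α)).integrable Fact.out) γ
  rw [truncJet]
  split_ifs
  exacts [h, integrable_zero _ _ _]

end Besov

theorem IsTrace.zero {n l : ℕ} {Ω : LipDomain n} {p : ℝ≥0∞} {a : ℝ} : IsTrace Ω p a (0 : Rn n → Cl l) 0 :=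
  ⟨0, fun _ => HasWeakD.zero _ _, 0, fun _ => contDiff_const, by simp,
    fun j => by simp [show classD1 j (0 : Rn n → Cl l) = 0 by funext X; simp [classD1]], by simp⟩

section Sobolev

variable {n l m k : ℕ} {Ω : LipDomain n} {p : ℝ≥0∞} [Fact (1 ≤ p)] {a s : ℝ}

theorem exists_sobolevW {u : Rn n → Cl l} {v : MIdx n m → Rn n → Cl l}
    (hv : ∀ β, HasWeakD Ω.carrier β.1 u (v β)) (hm : ∀ β, MemLp (v β) p (Ω.wMeas (p.toReal * a))) :
    ∃ U : sobolevW Ω m p a l, (∀ β, sobolevW.D U β =ᵐ[volume.restrict Ω.carrier] v β) ∧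
      sobolevW.toFun U =ᵐ[volume.restrict Ω.carrier] u := by
  have e : ∀ β, (hm β).toLp =ᵐ[volume.restrict Ω.carrier] v β := fun β =>
    (Ω.restrict_ac_wMeas _).ae_eq (hm β).coeFn_toLp
  have e0 : v (MIdx.zero n m) =ᵐ[volume.restrict Ω.carrier] u := by
    refine HasWeakD.unique Ω.isOpen (hv _) ⟨(hv (MIdx.zero n m)).1, (hv (MIdx.zero n m)).1, fun φ _ _ _ => ?_⟩
    have h : classD (MIdx.zero n m).1 φ = φ := by
      change classD (0 : Fin n → ℕ) φ = φ
      rw [classD_eq, wordOf_zero]; simp [pdW]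
    rw [h]; simp [MIdx.zero]
  exact ⟨⟨WithLp.toLp p fun β => (hm β).toLp, fun β => (hv β).congr ((e _).trans e0).symm (e β).symm⟩,
    e, (e _).trans e0⟩

theorem sobolevW.ext_ae {U U' : sobolevW Ω m p a l}
    (h : sobolevW.toFun U =ᵐ[volume.restrict Ω.carrier] sobolevW.toFun U') : U = U' := by
  refine Subtype.ext (PiLp.ext fun α => Lp.ext ((LipDomain.wMeas_ac _).ae_eq ?_))
  exact HasWeakD.unique Ω.isOpen (U.2 α) ((U'.2 α).congr h.symm ae_eq_rfl)

/-- The family `i ^ |α| D ^ α U`. -/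
def sobJet (U : sobolevW Ω m p a l) : Jet n l :=
  extendIdx fun α : MIdx n m => Complex.I ^ α.len • ⇑(sobolevW.D U α)

theorem sobJet_eq (U : sobolevW Ω m p a l) {γ : Fin n → ℕ} (h : ∑ i, γ i ≤ m) :
    sobJet U γ = Complex.I ^ (∑ i, γ i) • ⇑(sobolevW.D U ⟨γ, h⟩) := dif_pos h

theorem isW1_sobJet (U : sobolevW Ω m p a l) {γ : Fin n → ℕ} (h : ∑ i, γ i < m) :
    IsW1 Ω p a (sobJet U γ) fun j => (-Complex.I) • sobJet U (γ + Pi.single j 1) := by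
  have h' : ∀ j, ∑ i, (γ + Pi.single j 1 : Fin n → ℕ) i ≤ m := fun j => by rw [sum_add_single]; omega
  have e : ∀ j, (-Complex.I) • sobJet U (γ + Pi.single j 1) =
    Complex.I ^ (∑ i, γ i) • ⇑(sobolevW.D U ⟨_, h' j⟩) := fun j => by
    rw [sobJet_eq U (h' j), smul_smul, sum_add_single, pow_succ', ← mul_assoc, neg_mul, Complex.I_mul_I]
    simp
  rw [sobJet_eq U h.le]
  exact ⟨(Lp.stronglyMeasurable _).const_smul _, (Lp.memLp _).const_smul _,
    fun j => (e j) ▸ (Lp.stronglyMeasurable _).const_smul _, fun j => (e j) ▸ (Lp.memLp _).const_smul _,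
    fun j => (e j) ▸ ((U.2 ⟨γ, h.le⟩).single (U.2 ⟨_, h' j⟩)).smul _⟩

theorem isJetTrace_sobJet (U : sobolevW Ω (k + 1) p a l) {T : MIdx n k → Rn n → Cl l}
    (hm : ∀ α, StronglyMeasurable (T α)) (hT : ∀ α, IsTrace Ω p a (sobJet U α.1) (T α)) :
    IsJetTrace Ω (k + 1) p a (sobJet U) (extendIdx T) where
  meas := extendIdx_of stronglyMeasurable_zero fun α => (Lp.stronglyMeasurable _).const_smul _
  meas_f := extendIdx_of stronglyMeasurable_zero hm
  locInt γ h := by rw [sobJet_eq U h]; exact (U.2 ⟨γ, h⟩).2.1.smul _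
  memLp γ h := by rw [sobJet_eq U h]; exact (Lp.memLp _).const_smul _
  hasWeakD γ h := (isW1_sobJet U h).hasWeakD
  trace γ h := by
    rw [show extendIdx T γ = T ⟨γ, Nat.le_of_lt_succ h⟩ from dif_pos _]
    exact hT ⟨γ, _⟩

theorem sobN_sobJet_le (U : sobolevW Ω m p a l) :
    sobN Ω m p a (sobJet U) ≤ (Finset.univ : Finset (MIdx n m)).card * ofReal ‖U‖ ^ p.toReal := by
  rw [sobN, ← sum_mIdx, ← nsmul_eq_mul]
  refine sum_le_card_nsmul _ _ _ fun α _ => ?_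
  gcongr
  rw [sobJet, extendIdx_apply, eLpNorm_const_smul, enorm_pow, ← ofReal_norm, Complex.norm_I,
    ofReal_one, one_pow, one_mul, ← Lp.enorm_def, ofReal_norm]
  exact PiLp.enorm_apply_le U.1 α

theorem IsTrace.sobJet_ae_eq (hp : 1 < p) (hp' : p < ⊤) (ha' : a < 1 - 1 / p.toReal)
    {U : sobolevW Ω (k + 1) p a l} {α : MIdx n k} {f g : Rn n → Cl l}
    (hf : AEStronglyMeasurable f Ω.surf) (hg : AEStronglyMeasurable g Ω.surf)
    (h : IsTrace Ω p a (sobJet U α.1) g) (h' : IsTrace Ω p a (sobJet U α.1) f) : f =ᵐ[Ω.surf] g :=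
  have hw := isW1_sobJet U (Nat.lt_succ_of_le α.2)
  IsTrace.unique hp hp' ha' hw.hasWeakD hw.memLp_d hf hg h h'

theorem exists_trace (hp : 1 < p) (hp' : p < ⊤) (ha : -1 / p.toReal < a)
    (ha' : a < 1 - 1 / p.toReal) (hs : s = 1 - a - 1 / p.toReal) :
    ∃ tr : sobolevW Ω (k + 1) p a l →L[ℂ] WBesov Ω k p s l,
      ∀ U α, IsTrace Ω p a (sobJet U α.1) ((tr U).fn α) := by
  have hp0 : p ≠ 0 := hp.ne_bot
  have hP := toReal_pos hp0 hp'.ne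
  refine exists_clm_of_rel (R := fun (U : sobolevW Ω (k + 1) p a l) (F : WBesov Ω k p s l) =>
    ∀ α, IsTrace Ω p a (sobJet U α.1) (F.fn α)) (fun U F F' h h' => WBesov.ext_ae fun α => ?_)
    (fun c U F U' F' h h' α => ?_) ?_
  · exact IsTrace.sobJet_ae_eq hp hp' ha' (F.measurable_fn α).aestronglyMeasurable
      (F'.measurable_fn α).aestronglyMeasurable (h' α) (h α)
  · refine (h α).linear hp.le c (h' α) (F.measurable_fn α).aestronglyMeasurable
      (F'.measurable_fn α).aestronglyMeasurable ?_ ?_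
    · have h1 := (Ω.restrict_ac_wMeas (p.toReal * a)).ae_eq
        (Lp.coeFn_add (c • sobolevW.D U ⟨α.1, Nat.le_succ_of_le α.2⟩) (sobolevW.D U' ⟨α.1, Nat.le_succ_of_le α.2⟩))
      have h2 := (Ω.restrict_ac_wMeas (p.toReal * a)).ae_eq
        (Lp.coeFn_smul c (sobolevW.D U ⟨α.1, Nat.le_succ_of_le α.2⟩))
      simp only [sobJet_eq _ (Nat.le_succ_of_le α.2)]
      filter_upwards [h1, h2] with X e1 e2
      have e3 := e1.trans (congrArg (· + _) e2)
      simp only [Pi.add_apply, Pi.smul_apply] at e3 ⊢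
      rw [smul_comm c, ← smul_add]
      exact congrArg _ e3
    · exact (Lp.coeFn_add (c • F.comp α) (F'.comp α)).trans ((Lp.coeFn_smul c (F.comp α)).add ae_eq_rfl)
  · obtain ⟨C₁, hC₁, h1⟩ := LipDomain.exists_trace_Lp_le hp hp' ha ha' Ω l (k + 1)
    obtain ⟨C₂, hC₂, h2⟩ := LipDomain.exists_besov_le hp hp' ha ha' Ω l (k + 1)
    obtain ⟨N, hN⟩ : ∃ N : ℝ≥0∞, N = (Finset.univ : Finset (MIdx n (k + 1))).card := ⟨_, rfl⟩
    have hN' : N ≠ ⊤ := by rw [hN]; exact ENNReal.natCast_ne_top _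
    refine ⟨∑ _ : MIdx n k, ((ofReal C₁ * N) ^ (1 / p.toReal)).toReal +
      ∑ _ : MIdx n k, ((C₂ * N) ^ (1 / p.toReal)).toReal, fun U => ?_⟩
    have hS := sobN_sobJet_le U
    rw [← hN] at hS
    choose T hT using fun α : MIdx n k =>
      Ω.exists_isTrace hp hp' ha ha' (isW1_sobJet U (Nat.lt_succ_of_le α.2))
    have hm : ∀ α, StronglyMeasurable (T α) := fun α => Lp.stronglyMeasurable (T α)
    have hJ := isJetTrace_sobJet U hm hT
    have hQ : ∀ α, eLpNorm (remQ p s (fun β => ⇑(T β)) α) p (Ω.surf.prod Ω.surf) ^ p.toReal ≤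
      C₂ * N * ofReal ‖U‖ ^ p.toReal := fun α => by
      rw [eLpNorm_remQ hp0 hp'.ne hs (fun α => (hm α).measurable), mul_assoc]
      exact (h2 _ _ hJ α.1 (Nat.lt_succ_of_le α.2)).trans (by gcongr)
    have hQm : ∀ α, MemLp (remQ p s (fun β => ⇑(T β)) α) p (Ω.surf.prod Ω.surf) := fun α =>
      ⟨(measurable_remQ (fun α => (hm α).measurable) α).aestronglyMeasurable,
        (ENNReal.rpow_lt_top_iff_of_pos hP).1 ((hQ α).trans_lt (mul_lt_top
          (mul_ne_top hC₂ hN').lt_top (rpow_lt_top_of_nonneg hP.le ofReal_ne_top)))⟩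
    obtain ⟨F, rfl⟩ : ∃ F : WBesov Ω k p s l, F.comp = T := ⟨⟨T, hQm⟩, rfl⟩
    refine ⟨F, hT, ?_⟩
    rw [WBesov.norm_def, add_mul, sum_mul, sum_mul]
    refine add_le_add (sum_le_sum fun α _ => ?_) (sum_le_sum fun α _ => ?_)
    · refine norm_le_of_eLpNorm_rpow_le hp0 hp'.ne _ (mul_ne_top ofReal_ne_top hN')
        (norm_nonneg _) ?_
      have h3 := h1 _ _ hJ α.1 (Nat.lt_succ_of_le α.2)
      rw [extendIdx_apply] at h3; rw [mul_assoc]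
      exact h3.trans (by gcongr)
    · refine norm_le_of_eLpNorm_rpow_le hp0 hp'.ne _ (mul_ne_top hC₂ hN') (norm_nonneg _) ?_
      rw [eLpNorm_congr_ae (show ⇑(F.rem α) =ᵐ[_] _ from (F.memLp_rem α).coeFn_toLp)]
      exact hQ α

end Sobolev

section Extension

variable {n l k : ℕ} {Ω : LipDomain n} {p : ℝ≥0∞} [Fact (1 ≤ p)] {a s : ℝ} {K : Rn n → Rn n → ℂ}

theorem WBesov.besN_add_lpN_lt_top (hp0 : p ≠ 0) (hp' : p ≠ ⊤) (hs : s = 1 - a - 1 / p.toReal)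
    (f : WBesov Ω k p s l) : besN Ω p.toReal a (k + 1) (extendIdx f.fn) +
      lpN Ω p.toReal (k + 1) (extendIdx f.fn) < ⊤ :=
  (f.besN_add_lpN_le hp0 hp' hs).trans_lt (mul_lt_top (mul_lt_top ENNReal.ofNat_lt_top
    (ENNReal.natCast_lt_top _)) (rpow_lt_top_of_nonneg toReal_nonneg ofReal_ne_top))

theorem IsWhitneyKernel.whitneyExt_linear (hK : IsWhitneyKernel Ω K) (c : ℂ) (f g : WBesov Ω k p s l)
    {X : Rn n} (hX : X ∈ Ω.carrier) : whitneyExt Ω K (c • f + g).fn X =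
      c • whitneyExt Ω K f.fn X + whitneyExt Ω K g.fn X := by
  obtain ⟨C, hC0, hC⟩ := hK.exists_pdW_le 0
  have hi : ∀ f : WBesov Ω k p s l, Integrable (fun Y => K X Y • taylorP f.fn (MIdx.zero n k) X Y) Ω.surf := by
    intro f
    simp only [taylorP_eq, taylor]
    refine (integrable_finsetSum _ fun β _ => ?_).bdd_smul _ (hK.measurable X hX)
      (Ω.ae_surf_mem.mono fun Y hY => hC X hX Y hY [] le_rfl)
    refine (f.integrable_truncJet _).smul_of_top_right (LipDomain.memLp_surf (φ := fun Y => dpow β (X - Y)) ?_ ⊤)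
    exact (contDiff_dpow β).continuous.comp (by fun_prop)
  have hi' : Integrable (fun Y => c • K X Y • taylorP f.fn (MIdx.zero n k) X Y) Ω.surf := (hi f).smul c
  rw [whitneyExt, whitneyExt, whitneyExt, ← integral_smul, ← integral_add hi' (hi g)]
  have h : ∀ᵐ Y ∂Ω.surf, ∀ α, (c • f + g).fn α Y = c • f.fn α Y + g.fn α Y := ae_all_iff.2 fun α =>
    (Lp.coeFn_add (c • f.comp α) (g.comp α)).trans ((Lp.coeFn_smul c (f.comp α)).add ae_eq_rfl)
  refine integral_congr_ae (h.mono fun Y hY => ?_)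
  simp only [taylorP, hY, smul_add, sum_add_distrib, smul_sum]
  simp only [smul_comm c]

theorem IsWhitneyKernel.eq_of_isTrace (hK : IsWhitneyKernel Ω K) (hp : 1 < p) (hp' : p < ⊤)
    (ha : -1 / p.toReal < a) (ha' : a < 1 - 1 / p.toReal) (hs : s = 1 - a - 1 / p.toReal)
    {f F : WBesov Ω k p s l} {U : sobolevW Ω (k + 1) p a l}
    (hU : sobolevW.toFun U =ᵐ[volume.restrict Ω.carrier] whitneyExt Ω K f.fn)
    (hF : ∀ α, IsTrace Ω p a (sobJet U α.1) (F.fn α)) : F = f := by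
  have hp0 : p ≠ 0 := hp.ne_bot
  have hP : 1 < p.toReal := one_lt_toReal hp hp'
  have hfm := extendIdx_of (q := Measurable) measurable_zero f.measurable_fn
  obtain ⟨_, _, hsm⟩ := LipDomain.exists_whit_bound hK l (k + 1) 0
  have hW := (hsm _ hfm f.integrable_truncJet).1
  refine WBesov.ext_ae fun α => Filter.EventuallyEq.symm ?_
  have hw := isW1_sobJet U (Nat.lt_succ_of_le α.2)
  refine IsTrace.ae_eq hp hp' ha' hw.hasWeakD hw.memLp_d (f.measurable_fn α).aestronglyMeasurable
    (F.measurable_fn α).aestronglyMeasurable (hF α) fun χ => ?_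
  have h1 : sobJet U α.1 =ᵐ[volume.restrict Ω.carrier]
    pdW (wordOf α.1) (whit Ω K (k + 1) (extendIdx f.fn)) := by
    rw [whitneyExt_eq] at hU
    have h2 := HasWeakD.unique Ω.isOpen ((U.2 ⟨α.1, Nat.le_succ_of_le α.2⟩).congr hU ae_eq_rfl)
      (hasWeakD_of_contDiffOn Ω.isOpen hW α.1)
    rw [classD_eq] at h2; rw [sobJet_eq U (Nat.le_succ_of_le α.2)]
    filter_upwards [h2] with X hX
    change Complex.I ^ _ • (U.1 ⟨α.1, Nat.le_succ_of_le α.2⟩ : Rn n → Cl l) X = _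
    rw [hX, Pi.smul_apply, smul_smul, ← mul_pow, mul_neg, Complex.I_mul_I, neg_neg, one_pow, one_smul]
  obtain ⟨C, hC0, hC⟩ := χ.exists_whit_near_le hK l k.succ_pos hP ha ha'
  have hα : (wordOf α.1).length < k + 1 := by rw [wordOf_length]; exact Nat.lt_succ_of_le α.2
  have h3 := (hC _ hfm f.integrable_truncJet (wordOf α.1) hα.le).2 hα
  refine (lintegral_congr_ae ?_).trans_lt (h3.trans_lt (mul_lt_top ofReal_lt_top
    (f.besN_add_lpN_lt_top hp0 hp'.ne hs)))
  filter_upwards [χ.ae_map 0 (ae_restrict_of_ae ((LipDomain.wMeas_ac 0).ae_eq h1))] with q hq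
  rw [hq, idxOf_wordOf, truncJet_eq _ (Nat.lt_succ_of_le α.2), extendIdx_apply]

theorem IsWhitneyKernel.exists_extension (hK : IsWhitneyKernel Ω K) (hp : 1 < p) (hp' : p < ⊤)
    (ha : -1 / p.toReal < a) (ha' : a < 1 - 1 / p.toReal) (hs : s = 1 - a - 1 / p.toReal) :
    ∃ E : WBesov Ω k p s l →L[ℂ] sobolevW Ω (k + 1) p a l, ∀ f,
      sobolevW.toFun (E f) =ᵐ[volume.restrict Ω.carrier] whitneyExt Ω K f.fn := by
  have hp0 : p ≠ 0 := hp.ne_bot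
  have hP : 1 < p.toReal := one_lt_toReal hp hp'
  refine exists_clm_of_rel (R := fun (f : WBesov Ω k p s l) (U : sobolevW Ω (k + 1) p a l) =>
    sobolevW.toFun U =ᵐ[volume.restrict Ω.carrier] whitneyExt Ω K f.fn)
    (fun f U U' h h' => sobolevW.ext_ae (h.trans h'.symm)) (fun c f U g U' h h' => ?_) ?_
  · have h1 := (Ω.restrict_ac_wMeas (p.toReal * a)).ae_eq
      (Lp.coeFn_add (c • sobolevW.D U (MIdx.zero _ _)) (sobolevW.D U' (MIdx.zero _ _)))
    have h2 := (Ω.restrict_ac_wMeas (p.toReal * a)).ae_eq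
      (Lp.coeFn_smul c (sobolevW.D U (MIdx.zero _ _)))
    filter_upwards [h1, h2, h, h', ae_restrict_mem Ω.isOpen.measurableSet] with X e1 e2 e3 e4 hX
    rw [hK.whitneyExt_linear c f g hX, ← e3, ← e4]
    exact e1.trans (congrArg (· + _) e2)
  obtain ⟨C, hC, h1⟩ := LipDomain.exists_whit_wMeas_le hK l k.succ_pos hP ha ha'
  obtain ⟨N, hN⟩ : ∃ N : ℝ≥0∞, N = 2 * (Finset.univ : Finset (MIdx n k)).card := ⟨_, rfl⟩
  have hN' : N ≠ ⊤ := by rw [hN]; exact mul_ne_top (by simp) (by simp)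
  obtain ⟨e, he⟩ : ∃ e, e = PiLp.continuousLinearEquiv p ℂ fun _ : MIdx n (k + 1) =>
    Lp (Cl l) p (Ω.wMeas (p.toReal * a)) := ⟨_, rfl⟩
  refine ⟨‖e.symm.toContinuousLinearMap‖ * ((C * N) ^ (1 / p.toReal)).toReal, fun f => ?_⟩
  have hfm := extendIdx_of (q := Measurable) measurable_zero f.measurable_fn
  obtain ⟨_, _, hsm⟩ := LipDomain.exists_whit_bound hK l (k + 1) 0
  have hW := (hsm _ hfm f.integrable_truncJet).1
  have hv := fun β : MIdx n (k + 1) => hasWeakD_of_contDiffOn Ω.isOpen hW β.1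
  have hb : ∀ β : MIdx n (k + 1), eLpNorm (classD β.1 (whit Ω K (k + 1) (extendIdx f.fn))) p
    (Ω.wMeas (p.toReal * a)) ^ p.toReal ≤ C * N * ofReal ‖f‖ ^ p.toReal := fun β => by
    rw [classD_eq, eLpNorm_const_smul, enorm_pow, enorm_neg, ← ofReal_norm, Complex.norm_I,
      ofReal_one, one_pow, one_mul, ← lintegral_enorm_rpow hp0 hp'.ne, mul_assoc, hN]
    exact (h1 _ hfm f.integrable_truncJet _ (by rw [wordOf_length]; exact β.2)).trans
      (mul_le_mul_right (f.besN_add_lpN_le hp0 hp'.ne hs) _)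
  have hP0 : 0 < p.toReal := by linarith
  obtain ⟨U, hU, hU0⟩ := exists_sobolevW hv fun β => ⟨(hv β).aestronglyMeasurable _,
    (ENNReal.rpow_lt_top_iff_of_pos hP0).1 ((hb β).trans_lt (mul_lt_top
      (mul_ne_top hC hN').lt_top (rpow_lt_top_of_nonneg hP0.le ofReal_ne_top)))⟩
  refine ⟨U, hU0.trans (by rw [whitneyExt_eq]), ?_⟩
  calc ‖U‖ = ‖e.symm (e U.1)‖ := by rw [e.symm_apply_apply]; rfl
    _ ≤ ‖e.symm.toContinuousLinearMap‖ * ‖e U.1‖ := e.symm.toContinuousLinearMap.le_opNorm _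
    _ ≤ _ := by
      rw [mul_assoc]; gcongr
      refine (pi_norm_le_iff_of_nonneg (by positivity)).2 fun β => ?_
      refine norm_le_of_eLpNorm_rpow_le hp0 hp'.ne _ (mul_ne_top hC hN') (norm_nonneg _) ?_
      refine le_of_eq_of_le ?_ (hb β)
      rw [← eLpNorm_congr_ae ((LipDomain.wMeas_ac _).ae_eq (hU β)), he]; rfl

end Extension

namespace LipDomain

variable {n l m : ℕ} {Ω : LipDomain n} {p : ℝ≥0∞} {a : ℝ}

theorem lintegral_rho_smul {P : ℝ} (hP : 0 ≤ P) (b e : ℝ) {w : Rn n → Cl l} (hw : Measurable w) :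
    ∫⁻ X, ‖Ω.rho X ^ e • w X‖ₑ ^ P ∂Ω.wMeas b = ∫⁻ X, ‖w X‖ₑ ^ P ∂Ω.wMeas (b + P * e) := by
  have hr : Measurable fun X => Ω.rho X ^ e := Ω.continuous_rho.measurable.pow_const _
  rw [← setLIntegral_univ, ← setLIntegral_univ (μ := Ω.wMeas (b + P * e)), Ω.lintegral_wMeas _
    (F := fun X => ‖Ω.rho X ^ e • w X‖ₑ ^ P) ((hr.smul hw).enorm.pow_const P) MeasurableSet.univ, Ω.lintegral_wMeas _ (hw.enorm.pow_const P)
    MeasurableSet.univ]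
  refine setLIntegral_congr_fun (MeasurableSet.univ.inter Ω.isOpen.measurableSet) fun X hX => ?_
  have hρ := Ω.rho_pos hX.2
  rw [enorm_smul, mul_rpow_of_nonneg _ _ hP, ← mul_assoc, Real.enorm_of_nonneg (by positivity),
    ofReal_rpow_of_nonneg (by positivity) hP, ← ofReal_mul (by positivity),
    ← rpow_mul hρ.le, ← rpow_add hρ, mul_comm e]

theorem memLp_rho_smul_mono {b e e' : ℝ} (h : e ≤ e') {w : Rn n → Cl l}
    (hw : AEStronglyMeasurable w (Ω.wMeas b)) (hm : MemLp (fun X => Ω.rho X ^ e • w X) p (Ω.wMeas b)) :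
    MemLp (fun X => Ω.rho X ^ e' • w X) p (Ω.wMeas b) := by
  obtain ⟨D, hD0, hD⟩ := Ω.exists_rho_le
  have hr : Measurable fun X => Ω.rho X ^ e' := Ω.continuous_rho.measurable.pow_const _
  refine hm.of_le_mul (c := D ^ (e' - e)) (hr.aestronglyMeasurable.smul hw) ?_
  filter_upwards [Ω.ae_wMeas_mem b] with X hX
  have hρ := Ω.rho_pos hX
  have h1 : Ω.rho X ^ e' = Ω.rho X ^ (e' - e) * Ω.rho X ^ e := by rw [← rpow_add hρ, sub_add_cancel]
  rw [norm_smul, norm_smul, h1, norm_mul, mul_assoc, norm_of_nonneg (by positivity : 0 ≤ Ω.rho X ^ (e' - e))]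
  exact mul_le_mul_of_nonneg_right
    (Real.rpow_le_rpow hρ.le (hD X (subset_closure hX)) (sub_nonneg.2 h)) (by positivity)

theorem Chart.lintegral_jet_lt_top (χ : Ω.Chart) (hp : 1 < p) (hp' : p < ⊤)
    (ha : -1 / p.toReal < a) (ha' : a < 1 - 1 / p.toReal) {u : Jet n l}
    (h : IsJetTrace Ω m p a u 0) {γ : Fin n → ℕ} (hγ : ∑ i, γ i < m) :
    ∫⁻ q, ofReal (q.2.1 ^ jetExp p.toReal a m γ) * ‖u γ (χ.map q)‖ₑ ^ p.toReal ∂χ.coneM < ⊤ := by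
  have hP : 1 < p.toReal := one_lt_toReal hp hp'
  have hP0 : 0 < p.toReal := by linarith
  obtain ⟨C, hC0, hC⟩ := χ.exists_jetDiff_le hp hp' ha ha' (l := l) m
  obtain ⟨P, hPd⟩ : ∃ P, P = p.toReal := ⟨_, rfl⟩
  rw [← hPd] at hC hP hP0 ⊢
  obtain ⟨R, hR⟩ : ∃ R, R = ‖χ.v‖ + χ.κ := ⟨_, rfl⟩
  have hR0 : 0 ≤ R := by have := χ.cone.κ_pos; rw [hR]; positivity
  obtain ⟨A, hA⟩ : ∃ A : ℝ≥0∞, A = 2 ^ (P - 1) * (((mlt n m).card : ℝ≥0∞) ^ (P - 1) + 1) := ⟨_, rfl⟩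
  have hA' : A ≠ ⊤ := by
    rw [hA]
    exact mul_ne_top (rpow_ne_top_of_nonneg (by linarith) (by simp))
      (add_ne_top.2 ⟨rpow_ne_top_of_nonneg (by linarith) (by simp), by simp⟩)
  have hum : ∀ γ, Measurable (u γ) := fun γ => (h.meas γ).measurable
  have key : ∀ᵐ q ∂χ.coneM, ofReal (q.2.1 ^ jetExp P a m γ) * ‖u γ (χ.map q)‖ₑ ^ P ≤
    ∑ β ∈ mlt n m, A * ofReal (R ^ (P * (∑ i, β i : ℕ))) *
      (ofReal (q.2.1 ^ jetExp P a m (γ + β)) * ‖jetDiff m 0 u (γ + β) q.1 (χ.map q)‖ₑ ^ P) := by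
    filter_upwards [χ.ae_coneM] with q ⟨_, _, hq, _, hz⟩
    have e1 : u γ (χ.map q) = 0 - ∑ β ∈ mlt n m, dpow β (χ.map q - q.1) •
      jetDiff m 0 u (γ + β) q.1 (χ.map q) := by
      have e0 : ∀ α Y, truncJet m (0 : Jet n l) α Y = 0 := fun α Y => by simp [truncJet]
      rw [← truncJet_eq u hγ, ← taylor_self (g := truncJet m u) (by omega : 0 < m) γ,
        taylor_eq_sum (truncJet_eq_zero m u) γ _ q.1]
      simp [jetDiff, e0]
    rw [e1]
    refine (mul_le_mul_right (enorm_sub_sum_rpow_le hP.le _ _ _) _).trans ?_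
    rw [← hA, enorm_zero, zero_rpow_of_pos hP0, zero_add, mul_left_comm, mul_sum, mul_sum]
    refine sum_le_sum fun β _ => ?_
    rw [mul_assoc]
    refine mul_le_mul_right ?_ _
    rw [← mul_assoc, ← mul_assoc]
    by_cases hβ : ∑ i, (γ + β) i < m
    · refine mul_le_mul_left ?_ _
      rw [← ofReal_mul (by positivity), ← ofReal_mul (by positivity)]
      refine ofReal_le_ofReal ?_
      have h1 : ‖χ.map q - q.1‖ ≤ R * q.2.1 := by
        rw [Chart.map, add_sub_cancel_left, norm_smul, norm_of_nonneg hq.le, mul_comm, hR]; gcongr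
        exact (norm_add_le _ _).trans (by gcongr)
      have h2 : jetExp P a m (γ + β) = jetExp P a m γ + P * (∑ i, β i : ℕ) := by
        have h3 : ∑ i, (γ + β) i = ∑ i, γ i + ∑ i, β i := by simp [sum_add_distrib]
        rw [jetExp, jetExp, show m - 1 - ∑ i, γ i = (m - 1 - ∑ i, (γ + β) i) + ∑ i, β i by omega]
        push_cast; ring
      calc _ ≤ q.2.1 ^ jetExp P a m γ * (R * q.2.1) ^ (P * (∑ i, β i : ℕ)) := by gcongr
        _ = _ := by rw [mul_rpow hR0 hq.le, h2, rpow_add hq]; ring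
    · rw [jetDiff_eq_zero (not_lt.1 hβ), enorm_zero, zero_rpow_of_pos hP0, mul_zero, mul_zero]
  refine (lintegral_mono_ae key).trans_lt ?_
  rw [lintegral_finsetSum]
  · refine sum_lt_top.2 fun β _ => ?_
    rw [lintegral_const_mul' _ _ (mul_ne_top hA' ofReal_ne_top)]
    refine mul_lt_top (mul_ne_top hA' ofReal_ne_top).lt_top ?_
    by_cases hβ : ∑ i, (γ + β) i < m
    · exact (hC u 0 h _ hβ).trans_lt (mul_lt_top ofReal_lt_top h.sobN_lt_top)
    · simp [jetDiff_eq_zero (not_lt.1 hβ), zero_rpow_of_pos hP0]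
  · exact fun β _ => (((measurable_ofReal_rpow _).comp (by fun_prop)).mul
      (measurable_jetDiff_map (fun _ => measurable_zero) hum _)).const_mul _

theorem _root_.IsJetTrace.lintegral_lt_top (hp : 1 < p) (hp' : p < ⊤)
    (ha : -1 / p.toReal < a) (ha' : a < 1 - 1 / p.toReal) {u : Jet n l}
    (h : IsJetTrace Ω m p a u 0) {γ : Fin n → ℕ} (hγ : ∑ i, γ i < m) :
    ∫⁻ X, ‖u γ X‖ₑ ^ p.toReal ∂Ω.wMeas (jetExp p.toReal a m γ) < ⊤ := by
  have hp0 : p ≠ 0 := hp.ne_bot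
  have hum : Measurable fun X => ‖u γ X‖ₑ ^ p.toReal := (h.meas γ).measurable.enorm.pow_const _
  obtain ⟨b, hb⟩ : ∃ b, b = jetExp p.toReal a m γ := ⟨_, rfl⟩
  obtain ⟨T, δ, hδ, hT⟩ := Ω.exists_lintegral_wMeas_le
  have hms : MeasurableSet {X | δ ≤ Ω.rho X} := measurableSet_le measurable_const Ω.continuous_rho.measurable
  have hbP : b ≤ p.toReal * a := by
    have h1 : 0 ≤ p.toReal * ((m - 1 - ∑ i, γ i : ℕ) : ℝ) := by positivity
    have h2 : 0 ≤ p.toReal := toReal_nonneg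
    rw [hb, jetExp]; linarith
  rw [← hb]
  refine (hT b _).trans_lt ?_
  refine ENNReal.add_lt_top.2 ⟨sum_lt_top.2 fun χ _ => ?_, ?_⟩
  · obtain ⟨C, hC0, hC⟩ := χ.exists_le_lintegral_map b
    refine (hC _ hum).trans_lt (mul_lt_top ofReal_lt_top ?_)
    rw [hb]
    exact χ.lintegral_jet_lt_top hp hp' ha ha' h hγ
  · have h1 := (h.memLp γ hγ.le).2
    have h2 : ∫⁻ X in {X | δ ≤ Ω.rho X}, ‖u γ X‖ₑ ^ p.toReal ∂Ω.wMeas (p.toReal * a) < ⊤ := by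
      refine (setLIntegral_le_lintegral _ _).trans_lt ?_
      rw [lintegral_enorm_rpow hp0 hp'.ne]
      exact rpow_lt_top_of_nonneg toReal_nonneg h1.ne
    rw [Ω.lintegral_wMeas _ hum hms] at h2 ⊢
    refine lt_of_le_of_lt ?_ (mul_lt_top (ofReal_lt_top (r := δ ^ (b - p.toReal * a))) h2)
    rw [← lintegral_ofReal_mul]
    refine setLIntegral_mono' (hms.inter Ω.isOpen.measurableSet) fun X hX => ?_
    have hρ := Ω.rho_pos hX.2
    rw [← mul_assoc, ← ofReal_mul (by positivity)]; gcongr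
    calc Ω.rho X ^ b = Ω.rho X ^ (b - p.toReal * a) * Ω.rho X ^ (p.toReal * a) := by
          rw [← rpow_add hρ, sub_add_cancel]
      _ ≤ _ := by
        gcongr ?_ * _
        exact Real.rpow_le_rpow_of_nonpos hδ hX.1 (by linarith)

end LipDomain

theorem memV_iff {n l k : ℕ} {Ω : LipDomain n} {p : ℝ≥0∞} [Fact (1 ≤ p)] {a s : ℝ} (hp : 1 < p)
    (hp' : p < ⊤) (ha : -1 / p.toReal < a) (ha' : a < 1 - 1 / p.toReal)
    {tr : sobolevW Ω (k + 1) p a l →L[ℂ] WBesov Ω k p s l}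
    (htr : ∀ U α, IsTrace Ω p a (sobJet U α.1) ((tr U).fn α)) (u : Rn n → Cl l) :
    MemV Ω (k + 1) p a u ↔ ∃ U : sobolevW Ω (k + 1) p a l, tr U = 0 ∧
      sobolevW.toFun U =ᵐ[volume.restrict Ω.carrier] u := by
  have hp0 : p ≠ 0 := hp.ne_bot
  have hP := toReal_pos hp0 hp'.ne
  constructor
  · rintro ⟨v, hv⟩
    have hvm := fun β => (hv β).1.aestronglyMeasurable (p.toReal * a)
    have hM : ∀ (β : MIdx n (k + 1)) (e : ℝ), (β.len : ℝ) - (k + 1 : ℕ) ≤ e →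
      MemLp (fun X => Ω.rho X ^ e • v β X) p (Ω.wMeas (p.toReal * a)) := fun β e he =>
      LipDomain.memLp_rho_smul_mono he (hvm β) (hv β).2
    obtain ⟨U, hU, hU0⟩ := exists_sobolevW (fun β => (hv β).1) fun β => by
      have hβ : (β.len : ℝ) ≤ (k + 1 : ℕ) := Nat.cast_le.2 β.2
      simpa using hM β 0 (by linarith)
    refine ⟨U, WBesov.ext_ae fun α => ?_, hU0⟩
    have hw := isW1_sobJet U (Nat.lt_succ_of_le α.2)
    refine Filter.EventuallyEq.trans (Filter.EventuallyEq.symm ?_) (Lp.coeFn_zero _ _ _).symm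
    refine IsTrace.ae_eq hp hp' ha' hw.hasWeakD hw.memLp_d aestronglyMeasurable_zero
      ((tr U).measurable_fn α).aestronglyMeasurable (htr U α) fun χ => ?_
    obtain ⟨C, hC0, hC⟩ := χ.exists_lintegral_map_le (p.toReal * a - p.toReal)
    simp only [Pi.zero_apply, zero_sub, enorm_neg]
    refine (hC _ (hw.meas.measurable.enorm.pow_const p.toReal)).trans_lt
      (mul_lt_top ofReal_lt_top ((setLIntegral_le_lintegral _ _).trans_lt ?_))
    have h1 := LipDomain.lintegral_rho_smul hP.le (p.toReal * a) (-1) hw.meas.measurable (Ω := Ω)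
    rw [mul_neg_one, ← sub_eq_add_neg] at h1; rw [← h1, lintegral_enorm_rpow hp0 hp'.ne]
    refine rpow_lt_top_of_nonneg hP.le ?_
    have hα : (α.len : ℝ) ≤ k := Nat.cast_le.2 α.2
    have h2 := (hM ⟨α.1, Nat.le_succ_of_le α.2⟩ (-1) (by
      change (α.len : ℝ) - _ ≤ _
      push_cast
      linarith)).const_smul (Complex.I ^ ∑ i, α.1 i)
    refine (eLpNorm_congr_ae ?_).trans_ne h2.2.ne
    filter_upwards [(LipDomain.wMeas_ac _).ae_eq (hU ⟨α.1, Nat.le_succ_of_le α.2⟩)] with X hX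
    rw [sobJet_eq U (Nat.le_succ_of_le α.2)]
    simp only [Pi.smul_apply, hX]; rw [smul_comm]
  · rintro ⟨U, hU, hU0⟩
    refine ⟨fun β => sobolevW.D U β, fun β => ⟨(U.2 β).congr hU0 ae_eq_rfl, ?_⟩⟩
    have hm : Measurable fun X => Ω.rho X ^ ((β.len : ℝ) - (k + 1 : ℕ)) :=
      Ω.continuous_rho.measurable.pow_const _
    rcases Nat.lt_or_ge (∑ i, β.1 i) (k + 1) with hβ | hβ
    · have hT : ∀ α : MIdx n k, IsTrace Ω p a (sobJet U α.1) (0 : Rn n → Cl l) := fun α => by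
        have h1 := htr U α
        rw [hU] at h1
        refine IsTrace.linear hp.le 0 IsTrace.zero h1 aestronglyMeasurable_zero
          (Lp.stronglyMeasurable _).aestronglyMeasurable (by simp) ?_
        rw [zero_smul, zero_add]
        exact (Lp.coeFn_zero _ _ _).symm
      have hJ := isJetTrace_sobJet U (fun _ => stronglyMeasurable_zero) hT
      rw [show extendIdx (fun _ : MIdx n k => (0 : Rn n → Cl l)) = 0 from
        funext (extendIdx_of (q := (· = 0)) rfl fun _ => rfl)] at hJ
      have h1 := hJ.lintegral_lt_top hp hp' ha ha' hβ
      have e : jetExp p.toReal a (k + 1) β.1 = p.toReal * a + p.toReal * (β.len - (k + 1 : ℕ)) := by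
        rw [jetExp, Nat.add_sub_cancel, Nat.cast_sub (Nat.le_of_lt_succ hβ), MIdx.len]; push_cast
        ring
      rw [e, ← LipDomain.lintegral_rho_smul hP.le _ _ (hJ.meas _).measurable,
        lintegral_enorm_rpow hp0 hp'.ne, ENNReal.rpow_lt_top_iff_of_pos hP] at h1
      have h2 : MemLp (fun X => Ω.rho X ^ ((β.len : ℝ) - (k + 1 : ℕ)) • sobJet U β.1 X) p
        (Ω.wMeas (p.toReal * a)) := ⟨(hm.smul (hJ.meas _).measurable).aestronglyMeasurable, h1⟩
      refine h2.of_le (hm.aestronglyMeasurable.smul (Lp.aestronglyMeasurable _))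
        (.of_forall fun X => le_of_eq ?_)
      rw [sobJet_eq U β.2, Pi.smul_apply, norm_smul, norm_smul, norm_smul, norm_pow, Complex.norm_I, one_pow, one_mul]
      rfl
    · have e : (β.len : ℝ) - (k + 1 : ℕ) = 0 := by
        rw [sub_eq_zero]
        exact congrArg _ (le_antisymm β.2 hβ)
      simp only [e, Real.rpow_zero, one_smul]
      exact Lp.memLp _

theorem mainTheorem6 {n : ℕ} (Ω : LipDomain n) (l m : ℕ) (hm : 1 ≤ m)
    (p : ℝ≥0∞) [Fact (1 ≤ p)] (hp : 1 < p) (hp' : p < ⊤)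
    (a s : ℝ) (ha : -1 / p.toReal < a) (ha' : a < 1 - 1 / p.toReal)
    (hs : s = 1 - a - 1 / p.toReal) :
    ∃ tr : sobolevW Ω m p a l →L[ℂ] WBesov Ω (m - 1) p s l,
      -- the traces `Tr [D ^ α U]` exist, are unique, and `(tr U)_α = i ^ |α| Tr [D ^ α U]`
      (∀ (U : sobolevW Ω m p a l) (α : MIdx n (m - 1)) (g : Lp (Cl l) p Ω.surf),
        IsTrace Ω p a (sobolevW.D U (α.castLE (Nat.sub_le m 1))) g ↔
          (tr U).comp α = Complex.I ^ α.len • g) ∧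
      Function.Surjective tr ∧
      -- the null-space is `V`
      (∀ u : Rn n → Cl l, MemV Ω m p a u ↔ ∃ U : sobolevW Ω m p a l, tr U = 0 ∧
        sobolevW.toFun U =ᵐ[volume.restrict Ω.carrier] u) ∧
      -- the Whitney-type extension operators are bounded linear right inverses
      (∃ K, IsWhitneyKernel Ω K) ∧
      ∀ K, IsWhitneyKernel Ω K → ∃ E : WBesov Ω (m - 1) p s l →L[ℂ] sobolevW Ω m p a l,
        (∀ f, tr (E f) = f) ∧
        ∀ f, sobolevW.toFun (E f) =ᵐ[volume.restrict Ω.carrier] whitneyExt Ω K f.fn := by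
  obtain ⟨k, rfl⟩ : ∃ k, m = k + 1 := ⟨m - 1, by omega⟩
  obtain ⟨tr, htr⟩ := exists_trace (Ω := Ω) (l := l) (k := k) hp hp' ha ha' hs
  obtain ⟨K, hK⟩ := Ω.exists_isWhitneyKernel
  refine ⟨tr, fun U α g => ?_, fun f => ?_, memV_iff hp hp' ha ha' htr, ⟨K, hK⟩, fun K hK => ?_⟩
  · have hα : ∑ i, α.1 i ≤ k + 1 := Nat.le_succ_of_le α.2
    have hI : Complex.I ^ (∑ i, α.1 i) ≠ 0 := pow_ne_zero _ Complex.I_ne_zero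
    have e := sobJet_eq U hα
    have hT := htr U α
    have hg : AEStronglyMeasurable g Ω.surf := Lp.aestronglyMeasurable g
    have hm := ((tr U).measurable_fn α).aestronglyMeasurable (μ := Ω.surf)
    constructor
    · intro h
      have h1 : IsTrace Ω p a (sobJet U α.1) (Complex.I ^ (∑ i, α.1 i) • ⇑g) :=
        h.linear hp.le _ IsTrace.zero hg aestronglyMeasurable_zero (by rw [e, add_zero]; rfl)
          (by rw [add_zero])
      exact Lp.ext ((IsTrace.sobJet_ae_eq hp hp' ha' hm (hg.const_smul _) h1 hT).trans
        (Lp.coeFn_smul _ _).symm)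
    · intro h
      refine hT.linear hp.le (Complex.I ^ (∑ i, α.1 i))⁻¹ IsTrace.zero hm aestronglyMeasurable_zero ?_ ?_
      · rw [e, smul_smul, inv_mul_cancel₀ hI, one_smul, add_zero]; rfl
      · have h1 : (tr U).fn α =ᵐ[Ω.surf] Complex.I ^ (∑ i, α.1 i) • ⇑g := by
          change ⇑((tr U).comp α) =ᵐ[Ω.surf] _
          rw [h]
          exact Lp.coeFn_smul _ _
        filter_upwards [h1] with X hX
        simp [hX, smul_smul]
  · obtain ⟨E, hE⟩ := hK.exists_extension (l := l) (k := k) hp hp' ha ha' hs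
    exact ⟨E f, hK.eq_of_isTrace hp hp' ha ha' hs (hE f) (htr _)⟩
  · obtain ⟨E, hE⟩ := hK.exists_extension (l := l) (k := k) hp hp' ha ha' hs
    exact ⟨E, fun f => hK.eq_of_isTrace hp hp' ha ha' hs (hE f) (htr _), hE⟩
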